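/- Let $d\ge 2$, let $\Omega\subset\mathbb R^d$ be a bounded Lipschitz domain with boundary $\Gamma$ and outer normal $\nu$, let $0<T<\infty$ and $I=(0,T)$. Write $(\cdot,\cdot)$ and $\|\cdot\|$ for the inner product and norm of $L^2(\Omega)$ and $(L^2(\Omega))^d$, and $\langle\psi,r\rangle=\int_\Gamma\psi\, r\,d\sigma$. Let $\phi\in C^1(\Omega)$ with $0<\phi_*<\phi(x)<\phi^*$ for $x\in\Omega$. Let $g(s)=\sum_{j=0}^{n}a_js^{\alpha_j}$ with $n\ge1$, real exponents $0=\alpha_0<\alpha_1<\dots<\alpha_n$, $a_0,a_n>0$ and $a_1,\dots,a_{n-1}\ge0$, and let $K(\xi)=1/g(s(\xi))$, where $s(\xi)$ is the unique $s\ge 0$ with $s\,g(s)=\xi$, for $\xi\ge0$. The data satisfy $f,f_t\in L^2(I;L^2(\Omega))$ and $\psi,\psi_t\in L^\infty(I;L^\infty(\Gamma))$ (with $f$, $\psi$ continuous in time). Let $(\rho,m)$, with $\rho(t)\in H^1(\Omega)$ and $m(t)\in H(\mathrm{div},\Omega)$, be a weak solution of $m+K(|\nabla\rho|)\nabla\rho=0$,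 $\phi\rho_t+\nabla\cdot m=f$, $m\cdot\nu|_\Gamma=\psi$, i.e. for every $t\in(0,T]$ $$(m,z)+(K(|\nabla\rho|)\nabla\rho,z)=0\quad\forall z\in H(\mathrm{div},\Omega),\qquad (\phi\rho_t,r)-(m,\nabla r)=(f,r)-\langle\psi,r\rangle\quad\forall r\in H^1(\Omega).$$ Let $k\ge0$ be an integer and $\kappa>0$. For a finite conforming triangulation $\mathcal T_h$ of $\overline\Omega$ into $d$-simplices with maximal diameter $h$, each simplex of which contains a ball of radius $\kappa h$ (quasi-uniformity), let $\mathcal R_h\subset H^1(\Omega)$ be the space of continuous piecewise polynomials of degree at most $k$ over $\mathcal T_h$, and let $\mathcal M_h$ be the space of discontinuous piecewise polynomial vector fields of degree at most $k$ over $\mathcal T_h$. For an integer $N\ge1$ let $\Delta t=T/N$, $t_i=i\Delta t$ and $\varphi^i=\varphi(\cdot,t_i)$. Let $\rho_h^0$ be the $L^2(\Omega)$-projection of $\rho^0=\rho(\cdot,0)$ onto $\mathcal R_h$ and let $(\rho_h^i,m_h^i)\in\mathcal R_h\times\mathcal M_h$, $i=1,\dots,N$, solve $$(m_h^i,z)+(K(|\nabla\rho_h^i|)\nabla\rho_h^i,z)=0\quad\forall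 z\in\mathcal M_h,\qquad \Big(\phi\,\frac{\rho_h^i-\rho_h^{i-1}}{\Delta t},r\Big)-(m_h^i,\nabla r)=(f^i,r)-\langle\psi^i,r\rangle\quad\forall r\in\mathcal R_h.$$ Suppose that $\rho\in L^\infty(I;H^{k+1}(\Omega))$, $m\in L^\infty(I;(L^2(\Omega))^d)$ and $\rho_{tt}\in L^2(I;L^2(\Omega))$ and, in case $k\ge3$, that also $m\in L^\infty(I;(H^{\lceil k/2\rceil}(\Omega))^d)$. Then there are constants $C>0$ and $\tau>0$, independent of $h$, of $\Delta t$ and of the triangulation (they depend on $\kappa$ and on the fixed data and solution), such that if $\Delta t\le\tau$ then $$\|\rho^i-\rho_h^i\|+\|m^i-m_h^i\|^2\le C\big(h^k+\sqrt{\Delta t}\big)\qquad\text{for all } i=1,\dots,N.$$ -/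

import Mathlib

open Set Filter Topology MeasureTheory
open scoped ContDiff NNReal ENNReal RealInnerProductSpace

noncomputable section

namespace MixedFEM

/-- The generalized Forchheimer polynomials `g(s) = a₀ s^{α₀} + ⋯ + aₙ s^{αₙ}` with `n ≥ 1`, real
exponents `0 = α₀ < α₁ < ⋯ < αₙ` and coefficients `a₀, aₙ > 0`, `a₁, …, aₙ₋₁ ≥ 0`. -/
structure ForchheimerPoly (n : ℕ) where
  one_le : 1 ≤ n
  α : Fin (n + 1) → ℝ
  a : Fin (n + 1) → ℝ
  α_zero : α 0 = 0
  α_strictMono : StrictMono α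
  a_zero_pos : 0 < a 0
  a_last_pos : 0 < a (Fin.last n)
  a_nonneg : ∀ j, 0 ≤ a j

namespace ForchheimerPoly

variable {n : ℕ} (P : ForchheimerPoly n)

/-- The function `g`. (The `j = 0` term is the constant `a₀`, since `s ^ (0 : ℝ) = 1`.) -/
def g (s : ℝ) : ℝ := ∑ j, P.a j * s ^ P.α j

theorem α_nonneg (j : Fin (n + 1)) : 0 ≤ P.α j := by
  rw [← P.α_zero]
  exact P.α_strictMono.monotone (Fin.zero_le j)

theorem a_zero_le_g {s : ℝ} (hs : 0 ≤ s) : P.a 0 ≤ P.g s := by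
  have h : P.a 0 * s ^ P.α 0 ≤ P.g s :=
    Finset.single_le_sum (f := fun j => P.a j * s ^ P.α j)
      (fun j _ => mul_nonneg (P.a_nonneg j) (Real.rpow_nonneg hs _)) (Finset.mem_univ 0)
  simpa [P.α_zero] using h

theorem g_mono {s t : ℝ} (hs : 0 ≤ s) (hst : s ≤ t) : P.g s ≤ P.g t :=
  Finset.sum_le_sum fun j _ =>
    mul_le_mul_of_nonneg_left (Real.rpow_le_rpow hs hst (P.α_nonneg j)) (P.a_nonneg j)

theorem continuous_g : Continuous P.g :=
  continuous_finsetSum _ fun j _ =>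
    continuous_const.mul (Real.continuous_rpow_const (P.α_nonneg j))

/-- For `ξ ≥ 0` the equation `s g(s) = ξ` has exactly one solution `s ≥ 0`. -/
theorem existsUnique_s (ξ : ℝ≥0) : ∃! s : ℝ, 0 ≤ s ∧ s * P.g s = ξ := by
  have ha := P.a_zero_pos
  have hR : 0 ≤ (ξ : ℝ) / P.a 0 := div_nonneg ξ.2 ha.le
  have hcont : ContinuousOn (fun s => s * P.g s) (Icc 0 ((ξ : ℝ) / P.a 0)) :=
    (continuous_id.mul P.continuous_g).continuousOn
  have hmem : (ξ : ℝ) ∈ Icc ((0 : ℝ) * P.g 0) ((ξ : ℝ) / P.a 0 * P.g ((ξ : ℝ) / P.a 0)) := by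
    refine ⟨by simp, ?_⟩
    calc (ξ : ℝ) = (ξ : ℝ) / P.a 0 * P.a 0 := by field_simp
      _ ≤ _ := mul_le_mul_of_nonneg_left (P.a_zero_le_g hR) hR
  obtain ⟨s, hs, hsξ⟩ := intermediate_value_Icc hR hcont hmem
  have key : ∀ x y : ℝ, 0 ≤ x → x < y → x * P.g x < y * P.g y := by
    intro x y hx hxy
    have h1 := P.g_mono hx hxy.le
    have h2 := P.a_zero_le_g hx
    nlinarith
  refine ⟨s, ⟨hs.1, hsξ⟩, fun t ht => ?_⟩
  rcases lt_trichotomy t s with h | h | h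
  · have := key t s ht.1 h
    simp only at hsξ
    linarith [ht.2]
  · exact h
  · have := key s t hs.1 h
    simp only at hsξ
    linarith [ht.2]

/-- `s(ξ)`, the unique non-negative solution of `s g(s) = ξ`. -/
def s (ξ : ℝ≥0) : ℝ := (P.existsUnique_s ξ).choose

/-- The nonlinear conductivity `K(ξ) = 1 / g(s(ξ))`. -/
def K (ξ : ℝ≥0) : ℝ := 1 / P.g (P.s ξ)

end ForchheimerPoly

/-- `ℝᵈ` with its Euclidean norm. -/
abbrev E (d : ℕ) : Type := EuclideanSpace ℝ (Fin d)

variable {d : ℕ}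

/-- `L²(Ω)`. -/
abbrev L2 (Ω : Set (E d)) : Type := Lp ℝ 2 (volume.restrict Ω)

/-- `(L²(Ω))ᵈ`. -/
abbrev L2v (Ω : Set (E d)) : Type := Lp (E d) 2 (volume.restrict Ω)

/-- Test functions: smooth functions with compact support inside `Ω`. -/
def IsTest (Ω : Set (E d)) (η : E d → ℝ) : Prop :=
  ContDiff ℝ ∞ η ∧ HasCompactSupport η ∧ tsupport η ⊆ Ω

/-- `v` is the weak derivative `∂u/∂x_j` in `Ω`. -/
def IsWeakPartial (Ω : Set (E d)) (j : Fin d) (u v : L2 Ω) : Prop :=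
  ∀ η : E d → ℝ, IsTest Ω η →
    ∫ x in Ω, u x * fderiv ℝ η x (EuclideanSpace.single j 1) = -∫ x in Ω, v x * η x

/-- The `j`-th component of a vector field in `(L²(Ω))ᵈ`. -/
def comp (Ω : Set (E d)) (j : Fin d) (z : L2v Ω) : L2 Ω :=
  (EuclideanSpace.proj (𝕜 := ℝ) j : E d →L[ℝ] ℝ).compLp z

/-- `G` is the weak gradient of `u` in `Ω`; thus `u ∈ H¹(Ω)` iff such a `G ∈ (L²(Ω))ᵈ` exists. -/
def IsWeakGradient (Ω : Set (E d)) (u : L2 Ω) (G : L2v Ω) : Prop :=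
  ∀ j, IsWeakPartial Ω j u (comp Ω j G)

/-- `H(div, Ω)`: the fields in `(L²(Ω))ᵈ` whose weak divergence `q` is in `L²(Ω)`. -/
def Hdiv (Ω : Set (E d)) : Set (L2v Ω) :=
  {z | ∃ q : L2 Ω, ∀ η : E d → ℝ, IsTest Ω η →
    ∫ x in Ω, fderiv ℝ η x (z x) = -∫ x in Ω, q x * η x}

/-- `u ∈ H^s(Ω)`, with the `L²(Ω)` norms of `u` and of all its weak partial derivatives of order at
most `s` bounded by `M`. (The sets of such `u` are, up to constant factors in `M` that depend on
`s` and `d` only, the balls of the Sobolev space `H^s(Ω)`.) -/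
def SobolevBound (Ω : Set (E d)) : ℕ → L2 Ω → ℝ → Prop
  | 0, u, M => ‖u‖ ≤ M
  | s + 1, u, M => ‖u‖ ≤ M ∧ ∀ j : Fin d, ∃ v, IsWeakPartial Ω j u v ∧ SobolevBound Ω s v M

/-- A bounded Lipschitz domain: a bounded connected non-empty open set which near each boundary
point is the part of space on one side of the graph of a Lipschitz function, in suitable Cartesian
coordinates (`ν` is the direction of the last coordinate axis). -/
structure IsLipschitzDomain (Ω : Set (E d)) : Prop where
  isOpen : IsOpen Ω
  isConnected : IsConnected Ω
  isBounded : Bornology.IsBounded Ω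
  lipschitz_boundary : ∀ x₀ ∈ frontier Ω, ∃ ν : E d, ‖ν‖ = 1 ∧ ∃ γ : (ℝ ∙ ν)ᗮ → ℝ,
    (∃ L : ℝ≥0, LipschitzWith L γ) ∧ ∃ δ > 0, ∀ x ∈ Metric.ball x₀ δ,
      (x ∈ Ω ↔ γ ((ℝ ∙ ν)ᗮ.orthogonalProjectionOnto x) < ⟪ν, x⟫)

/-- The surface measure on the boundary `Γ` of `Ω`. -/
def surface (Ω : Set (E d)) : Measure (E d) :=
  (Measure.euclideanHausdorffMeasure (d - 1)).restrict (frontier Ω)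

/-- The boundary values of `u`: `(tr u)(x)` is the limit of the means of `u` over `B(x, ε) ∩ Ω` as
`ε → 0`. On a bounded Lipschitz domain and for `u ∈ H¹(Ω)` this limit exists at almost every
boundary point and is the usual trace of `u`. -/
def trace (Ω : Set (E d)) (u : L2 Ω) (x : E d) : ℝ :=
  limUnder (𝓝[>] (0 : ℝ)) fun ε => ⨍ y in Metric.ball x ε ∩ Ω, u y

/-- The boundary pairing `⟨ψ, r⟩ = ∫_Γ ψ r dσ`. -/
def bdryPair (Ω : Set (E d)) (ψ : E d → ℝ) (r : L2 Ω) : ℝ :=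
  ∫ x, ψ x * trace Ω r x ∂(surface Ω)

/-- The form `(K(|G|) G, z)`. -/
def KForm {n : ℕ} (P : ForchheimerPoly n) (Ω : Set (E d)) (G z : L2v Ω) : ℝ :=
  ∫ x in Ω, ⟪P.K ‖G x‖₊ • G x, z x⟫

/-- The weighted form `(φ u, r)`. -/
def wForm (Ω : Set (E d)) (φ : E d → ℝ) (u r : L2 Ω) : ℝ :=
  ∫ x in Ω, φ x * u x * r x

/-- `u' = v` on `(0, T)` in the sense of distributions with values in the Banach space `X`, and `u`
is the continuous representative on `[0, T]`. -/
def HasTimeDeriv {X : Type*} [NormedAddCommGroup X] [NormedSpace ℝ X] (T : ℝ) (u v : ℝ → X) :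
    Prop :=
  IntervalIntegrable v volume 0 T ∧ ∀ t ∈ Icc 0 T, u t = u 0 + ∫ τ in (0 : ℝ)..t, v τ

/-- `(ρ, m)` (with `ρt` the time derivative of `ρ`) solves the mixed weak formulation
`(m, z) + (K(|∇ρ|)∇ρ, z) = 0` for `z ∈ H(div, Ω)`,
`(φ ρ_t, r) - (m, ∇r) = (f, r) - ⟨ψ, r⟩` for `r ∈ H¹(Ω)`, at each time `t ∈ (0, T]`. -/
structure IsWeakSolution {n : ℕ} (P : ForchheimerPoly n) (Ω : Set (E d)) (T : ℝ) (φ : E d → ℝ)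
    (f : ℝ → L2 Ω) (ψ : ℝ → E d → ℝ) (ρ ρt : ℝ → L2 Ω) (m : ℝ → L2v Ω) : Prop where
  time_deriv : HasTimeDeriv T ρ ρt
  m_mem : ∀ t ∈ Ioc 0 T, m t ∈ Hdiv Ω
  momentum : ∀ t ∈ Ioc 0 T, ∃ G : L2v Ω, IsWeakGradient Ω (ρ t) G ∧
    ∀ z ∈ Hdiv Ω, ⟪m t, z⟫ + KForm P Ω G z = 0
  mass : ∀ t ∈ Ioc 0 T, ∀ (r : L2 Ω) (Gr : L2v Ω), IsWeakGradient Ω r Gr →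
    wForm Ω φ (ρt t) r - ⟪m t, Gr⟫ = ⟪f t, r⟫ - bdryPair Ω (ψ t) r

/-- The elements of a triangulation: its `d`-dimensional simplices, given by their vertices. -/
def cells (𝒯 : Geometry.SimplicialComplex ℝ (E d)) : Set (Finset (E d)) :=
  {s | s ∈ 𝒯.faces ∧ s.card = d + 1}

/-- `𝒯` is a (finite, conforming) triangulation of `closure Ω` with maximal element diameter `h`,
which is quasi-uniform with constant `κ`: each element contains a ball of radius `κ h`. -/
structure IsQuasiUniformTriangulation (Ω : Set (E d)) (κ h : ℝ)
    (𝒯 : Geometry.SimplicialComplex ℝ (E d)) : Prop where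
  finite : 𝒯.faces.Finite
  space_eq : 𝒯.space = closure Ω
  mesh_size : IsGreatest ((fun s : Finset (E d) => Metric.diam (convexHull ℝ (s : Set (E d)))) ''
    cells 𝒯) h
  quasi_uniform : ∀ s ∈ cells 𝒯, ∃ c : E d,
    Metric.closedBall c (κ * h) ⊆ convexHull ℝ (s : Set (E d))

/-- The value at `x` of a polynomial in `d` variables. -/
def pEval (p : MvPolynomial (Fin d) ℝ) (x : E d) : ℝ := MvPolynomial.eval (fun j => x j) p

/-- The density space `R_h ⊆ H¹(Ω)`: the continuous functions on `closure Ω` which are polynomials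
of degree at most `k` on each element. -/
def Rh (Ω : Set (E d)) (k : ℕ) (𝒯 : Geometry.SimplicialComplex ℝ (E d)) : Set (L2 Ω) :=
  {u | ∃ v : E d → ℝ, ContinuousOn v (closure Ω) ∧
    (∀ s ∈ cells 𝒯, ∃ p : MvPolynomial (Fin d) ℝ, p.totalDegree ≤ k ∧
      ∀ x ∈ convexHull ℝ (s : Set (E d)), v x = pEval p x) ∧
    ∀ᵐ x ∂(volume.restrict Ω), u x = v x}

/-- The momentum space `M_h`: the (discontinuous) vector fields whose components are polynomials of
degree at most `k` on each element. -/
def Mh (Ω : Set (E d)) (k : ℕ) (𝒯 : Geometry.SimplicialComplex ℝ (E d)) : Set (L2v Ω) :=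
  {z | ∀ s ∈ cells 𝒯, ∃ p : Fin d → MvPolynomial (Fin d) ℝ, (∀ j, (p j).totalDegree ≤ k) ∧
    ∀ᵐ x ∂(volume.restrict Ω), x ∈ convexHull ℝ (s : Set (E d)) → ∀ j, z x j = pEval (p j) x}

/-- `(ρh i, mh i)`, `i = 1, …, N`, solves the backward Euler mixed finite element scheme with time
step `Δt = T / N`, time levels `t_i = i Δt`, and initial value the `L²`-projection of `ρ⁰`. -/
structure IsDiscreteSolution {n : ℕ} (P : ForchheimerPoly n) (Ω : Set (E d)) (T : ℝ)
    (φ : E d → ℝ) (f : ℝ → L2 Ω) (ψ : ℝ → E d → ℝ) (ρ0 : L2 Ω) (k : ℕ)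
    (𝒯 : Geometry.SimplicialComplex ℝ (E d)) (N : ℕ) (ρh : ℕ → L2 Ω) (mh : ℕ → L2v Ω) : Prop where
  init_mem : ρh 0 ∈ Rh Ω k 𝒯
  init_proj : ∀ r ∈ Rh Ω k 𝒯, ⟪ρh 0 - ρ0, r⟫ = 0
  ρh_mem : ∀ i ∈ Finset.Icc 1 N, ρh i ∈ Rh Ω k 𝒯
  mh_mem : ∀ i ∈ Finset.Icc 1 N, mh i ∈ Mh Ω k 𝒯
  momentum : ∀ i ∈ Finset.Icc 1 N, ∃ G : L2v Ω, IsWeakGradient Ω (ρh i) G ∧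
    ∀ z ∈ Mh Ω k 𝒯, ⟪mh i, z⟫ + KForm P Ω G z = 0
  mass : ∀ i ∈ Finset.Icc 1 N, ∀ r ∈ Rh Ω k 𝒯, ∀ Gr : L2v Ω, IsWeakGradient Ω r Gr →
    wForm Ω φ ((T / N)⁻¹ • (ρh i - ρh (i - 1))) r - ⟪mh i, Gr⟫
      = ⟪f (i * (T / N)), r⟫ - bdryPair Ω (ψ (i * (T / N))) r

end MixedFEM

end

open MixedFEM

noncomputable section

namespace MixedFEM

namespace ForchheimerPoly

variable {n : ℕ} (P : ForchheimerPoly n)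

theorem s_nonneg (ξ : ℝ≥0) : 0 ≤ P.s ξ := (P.existsUnique_s ξ).choose_spec.1.1

theorem s_mul_g (ξ : ℝ≥0) : P.s ξ * P.g (P.s ξ) = ξ := (P.existsUnique_s ξ).choose_spec.1.2

theorem g_pos {s : ℝ} (hs : 0 ≤ s) : 0 < P.g s := P.a_zero_pos.trans_le (P.a_zero_le_g hs)

variable {V : Type*} [NormedAddCommGroup V] [InnerProductSpace ℝ V]

/-- The nonlinear flux `a ↦ K(|a|) a`. -/
def flux (a : V) : V := P.K ‖a‖₊ • a

theorem norm_flux (a : V) : ‖P.flux a‖ = P.s ‖a‖₊ := by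
  have hg := P.g_pos (P.s_nonneg ‖a‖₊)
  have h := P.s_mul_g ‖a‖₊
  rw [coe_nnnorm] at h
  rw [flux, norm_smul, K, Real.norm_of_nonneg (by positivity)]
  rw [div_mul_eq_mul_div, one_mul, div_eq_iff hg.ne', h]

theorem g_norm_flux_smul (a : V) : P.g ‖P.flux a‖ • P.flux a = a := by
  rw [norm_flux, flux, smul_smul, K, mul_one_div_cancel (P.g_pos (P.s_nonneg _)).ne', one_smul]

theorem flux_zero : P.flux (0 : V) = 0 := by simp [flux]

/-- The convex dual energy density, whose gradient is `y ↦ g(|y|) y`. -/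
def dualEnergy (y : V) : ℝ := ∑ j, P.a j * (‖y‖ ^ (P.α j + 2) / (P.α j + 2))

theorem rpow_norm_bregman {p : ℝ} (hp : 2 ≤ p) (x y : V) :
    ‖y‖ ^ (p - 2) * ⟪y, x - y⟫ ≤ ‖x‖ ^ p / p - ‖y‖ ^ p / p := by
  have hp0 : 0 < p := by linarith
  have hpq : p.HolderConjugate (p / (p - 1)) := Real.HolderConjugate.conjExponent (by linarith)
  have hY := Real.young_inequality_of_nonneg (norm_nonneg x)
    (Real.rpow_nonneg (norm_nonneg y) (p - 1)) hpq
  rw [← Real.rpow_mul (norm_nonneg y), mul_div_cancel₀ _ (by linarith : p - 1 ≠ 0)] at hY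
  rcases eq_or_ne y 0 with rfl | hy
  · simp only [inner_zero_left, mul_zero, norm_zero, Real.zero_rpow hp0.ne', zero_div, sub_zero]
    positivity
  have hy' : 0 < ‖y‖ := norm_pos_iff.2 hy
  have e1 : ‖y‖ ^ (p - 1) = ‖y‖ ^ (p - 2) * ‖y‖ := by
    rw [← Real.rpow_add_one hy'.ne']; congr 1; ring
  have e2 : ‖y‖ ^ p = ‖y‖ ^ (p - 2) * ‖y‖ ^ 2 := by
    rw [← Real.rpow_natCast, ← Real.rpow_add hy']; congr 1; push_cast; ring
  have h0 : 0 ≤ ‖y‖ ^ (p - 2) := by positivity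
  rw [inner_sub_right, real_inner_self_eq_norm_sq, mul_sub, ← e2]
  have h1 : ‖y‖ ^ (p - 2) * ⟪y, x⟫ ≤ ‖x‖ * ‖y‖ ^ (p - 1) := by
    rw [e1]
    calc ‖y‖ ^ (p - 2) * ⟪y, x⟫ ≤ ‖y‖ ^ (p - 2) * (‖y‖ * ‖x‖) :=
          mul_le_mul_of_nonneg_left (real_inner_le_norm _ _) h0
      _ = _ := by ring
  have e3 : ‖y‖ ^ p / (p / (p - 1)) = ‖y‖ ^ p - ‖y‖ ^ p / p := by field_simp
  linarith

theorem dualEnergy_bregman (x y : V) :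
    P.a 0 / 2 * ‖x - y‖ ^ 2 ≤ P.dualEnergy x - P.dualEnergy y - P.g ‖y‖ * ⟪y, x - y⟫ := by
  have h2 (j : Fin (n + 1)) : 2 ≤ P.α j + 2 := by linarith [P.α_nonneg j]
  have hterm (j : Fin (n + 1)) : 0 ≤ P.a j * (‖x‖ ^ (P.α j + 2) / (P.α j + 2)
      - ‖y‖ ^ (P.α j + 2) / (P.α j + 2) - ‖y‖ ^ P.α j * ⟪y, x - y⟫) := by
    have := rpow_norm_bregman (h2 j) x y
    rw [add_sub_cancel_right] at this
    exact mul_nonneg (P.a_nonneg j) (by linarith)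
  have hsum : P.dualEnergy x - P.dualEnergy y - P.g ‖y‖ * ⟪y, x - y⟫ =
      ∑ j, P.a j * (‖x‖ ^ (P.α j + 2) / (P.α j + 2)
      - ‖y‖ ^ (P.α j + 2) / (P.α j + 2) - ‖y‖ ^ P.α j * ⟪y, x - y⟫) := by
    rw [dualEnergy, dualEnergy, g, Finset.sum_mul, ← Finset.sum_sub_distrib,
      ← Finset.sum_sub_distrib]
    exact Finset.sum_congr rfl fun j _ => by ring
  rw [hsum]
  refine le_trans (le_of_eq ?_) (Finset.single_le_sum (fun j _ => hterm j) (Finset.mem_univ 0))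
  rw [P.α_zero, zero_add, Real.rpow_two, Real.rpow_two, Real.rpow_zero, inner_sub_right,
    real_inner_self_eq_norm_sq, norm_sub_sq_real, real_inner_comm]
  ring

/-- The energy density, a convex function whose gradient is the flux. -/
def energy (a : V) : ℝ := ⟪a, P.flux a⟫ - P.dualEnergy (P.flux a)

theorem energy_bregman (a b : V) :
    P.a 0 / 2 * ‖P.flux a - P.flux b‖ ^ 2 ≤ P.energy a - P.energy b - ⟪P.flux b, a - b⟫ := by
  have h := P.dualEnergy_bregman (P.flux b) (P.flux a)
  rw [← real_inner_smul_left, g_norm_flux_smul, norm_sub_rev] at h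
  refine h.trans (le_of_eq ?_)
  rw [energy, energy, inner_sub_right, inner_sub_right, real_inner_comm a (P.flux b),
    real_inner_comm b (P.flux b)]
  ring

theorem flux_cocoercive (a b : V) :
    P.a 0 * ‖P.flux a - P.flux b‖ ^ 2 ≤ ⟪P.flux a - P.flux b, a - b⟫ := by
  have h1 := P.energy_bregman a b
  have h2 := P.energy_bregman b a
  rw [norm_sub_rev] at h2
  have e : ⟪P.flux a, b - a⟫ = - ⟪P.flux a, a - b⟫ := by rw [← inner_neg_right, neg_sub]
  rw [inner_sub_left]
  linarith

theorem norm_flux_sub_le (a b : V) : ‖P.flux a - P.flux b‖ ≤ (P.a 0)⁻¹ * ‖a - b‖ := by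
  have h := (P.flux_cocoercive a b).trans (real_inner_le_norm _ _)
  rw [le_inv_mul_iff₀ P.a_zero_pos]
  rcases (norm_nonneg (P.flux a - P.flux b)).eq_or_lt with h0 | h0
  · rw [← h0]; simp
  · exact le_of_mul_le_mul_left (by linarith) h0

theorem lipschitzWith_flux :
    LipschitzWith (Real.toNNReal (P.a 0)⁻¹) (P.flux : V → V) :=
  LipschitzWith.of_dist_le_mul fun a b => by
    rw [dist_eq_norm, dist_eq_norm, Real.coe_toNNReal _ (inv_nonneg.2 P.a_zero_pos.le)]
    exact P.norm_flux_sub_le a b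

theorem dualEnergy_nonneg (y : V) : 0 ≤ P.dualEnergy y :=
  Finset.sum_nonneg fun j _ => mul_nonneg (P.a_nonneg j)
    (div_nonneg (Real.rpow_nonneg (norm_nonneg _) _) (by linarith [P.α_nonneg j]))

theorem energy_zero : P.energy (0 : V) = 0 := by
  have h (j : Fin (n + 1)) : P.α j + 2 ≠ 0 := by linarith [P.α_nonneg j]
  simp [energy, flux_zero, dualEnergy, Real.zero_rpow (h _)]

theorem energy_nonneg (a : V) : 0 ≤ P.energy a := by
  have h := P.energy_bregman a 0
  simp only [energy_zero, flux_zero, inner_zero_left, sub_zero] at h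
  exact le_trans (mul_nonneg (half_pos P.a_zero_pos).le (sq_nonneg _)) h

theorem energy_le (a : V) : P.energy a ≤ (P.a 0)⁻¹ * ‖a‖ ^ 2 := by
  have h1 := P.dualEnergy_nonneg (P.flux a)
  have h2 := P.norm_flux_sub_le a 0
  rw [flux_zero, sub_zero, sub_zero] at h2
  calc P.energy a ≤ ⟪a, P.flux a⟫ := by rw [energy]; linarith
    _ ≤ ‖a‖ * ‖P.flux a‖ := real_inner_le_norm _ _
    _ ≤ ‖a‖ * ((P.a 0)⁻¹ * ‖a‖) := by gcongr
    _ = _ := by ring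

theorem continuous_energy : Continuous (P.energy : V → ℝ) := by
  have hF : Continuous (P.flux : V → V) := P.lipschitzWith_flux.continuous
  refine (continuous_id.inner hF).sub (continuous_finsetSum _ fun j _ => ?_)
  refine continuous_const.mul (Continuous.div_const ?_ _)
  exact hF.norm.rpow_const fun _ => Or.inr (by linarith [P.α_nonneg j])

section L2

variable {X : Type*} [MeasurableSpace X] {μ : Measure X}

/-- The flux as a map on square integrable fields. -/
def fluxL (G : Lp V 2 μ) : Lp V 2 μ := P.lipschitzWith_flux.compLp P.flux_zero G

theorem coeFn_fluxL (G : Lp V 2 μ) : P.fluxL G =ᵐ[μ] fun x => P.flux (G x) :=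
  LipschitzWith.coeFn_compLp _ _ _

/-- The energy of a square integrable field. -/
def energyL (G : Lp V 2 μ) : ℝ := ∫ x, P.energy (G x) ∂μ

theorem integrable_energy (G : Lp V 2 μ) : Integrable (fun x => P.energy (G x)) μ := by
  have hG := (Lp.memLp G).integrable_norm_pow (by norm_num)
  refine Integrable.mono' (hG.const_mul (P.a 0)⁻¹)
    (P.continuous_energy.comp_aestronglyMeasurable (Lp.aestronglyMeasurable G)) ?_
  filter_upwards with x
  rw [Real.norm_of_nonneg (P.energy_nonneg _)]
  simpa using P.energy_le (G x)

theorem fluxL_zero : P.fluxL (0 : Lp V 2 μ) = 0 := by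
  apply Lp.ext
  filter_upwards [P.coeFn_fluxL (0 : Lp V 2 μ), Lp.coeFn_zero V 2 μ] with x h1 h2
  rw [h1, h2, Pi.zero_apply, flux_zero]

theorem energyL_bregman (a b : Lp V 2 μ) :
    P.a 0 / 2 * ‖P.fluxL a - P.fluxL b‖ ^ 2 ≤
      P.energyL a - P.energyL b - ⟪P.fluxL b, a - b⟫ := by
  have h1 : ‖P.fluxL a - P.fluxL b‖ ^ 2 = ∫ x, ‖P.flux (a x) - P.flux (b x)‖ ^ 2 ∂μ := by
    rw [← real_inner_self_eq_norm_sq, L2.inner_def]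
    refine integral_congr_ae ?_
    filter_upwards [Lp.coeFn_sub (P.fluxL a) (P.fluxL b), P.coeFn_fluxL a, P.coeFn_fluxL b]
      with x h1 h2 h3
    rw [h1, Pi.sub_apply, h2, h3, real_inner_self_eq_norm_sq]
  have h2 : ⟪P.fluxL b, a - b⟫ = ∫ x, ⟪P.flux (b x), a x - b x⟫ ∂μ := by
    rw [L2.inner_def]
    refine integral_congr_ae ?_
    filter_upwards [Lp.coeFn_sub a b, P.coeFn_fluxL b] with x h1 h2
    rw [h1, Pi.sub_apply, h2]
  have i2 : Integrable (fun x => ⟪P.flux (b x), a x - b x⟫) μ := by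
    refine (L2.integrable_inner (𝕜 := ℝ) (P.fluxL b) (a - b)).congr ?_
    filter_upwards [Lp.coeFn_sub a b, P.coeFn_fluxL b] with x h1 h2
    rw [h1, Pi.sub_apply, h2]
  have i1 : Integrable (fun x => ‖P.flux (a x) - P.flux (b x)‖ ^ 2) μ := by
    refine (L2.integrable_inner (𝕜 := ℝ) (P.fluxL a - P.fluxL b) (P.fluxL a - P.fluxL b)).congr ?_
    filter_upwards [Lp.coeFn_sub (P.fluxL a) (P.fluxL b), P.coeFn_fluxL a, P.coeFn_fluxL b]
      with x h1 h2 h3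
    rw [h1, Pi.sub_apply, h2, h3, real_inner_self_eq_norm_sq]
  rw [h1, h2, energyL, energyL, ← integral_sub (P.integrable_energy a) (P.integrable_energy b),
    ← integral_const_mul]
  rw [← integral_sub (by exact (P.integrable_energy a).sub (P.integrable_energy b)) i2]
  exact integral_mono (i1.const_mul _)
    (((P.integrable_energy a).sub (P.integrable_energy b)).sub i2)
    fun x => P.energy_bregman (a x) (b x)

end L2

end ForchheimerPoly

variable {d : ℕ}

theorem KForm_eq_inner {n : ℕ} (P : ForchheimerPoly n) (Ω : Set (E d)) (G z : L2v Ω) :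
    KForm P Ω G z = ⟪P.fluxL G, z⟫ := by
  rw [KForm, L2.inner_def]
  refine integral_congr_ae ?_
  filter_upwards [P.coeFn_fluxL G] with x hx
  rw [hx, ForchheimerPoly.flux]

section TimeStepping

variable {H V : Type*} [NormedAddCommGroup H] [InnerProductSpace ℝ H]
  [NormedAddCommGroup V] [InnerProductSpace ℝ V]

/-- `En` is a convex energy with gradient `F`, where `F` is Lipschitz with constant `a₀⁻¹`. -/
def IsEnergy (a₀ : ℝ) (F : V → V) (En : V → ℝ) : Prop :=
  ∀ u v, a₀ / 2 * ‖F u - F v‖ ^ 2 ≤ En u - En v - ⟪F v, u - v⟫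

namespace IsEnergy

variable {a₀ : ℝ} {F : V → V} {En : V → ℝ}

theorem cocoercive (h : IsEnergy a₀ F En) (u v : V) :
    a₀ * ‖F u - F v‖ ^ 2 ≤ ⟪F u - F v, u - v⟫ := by
  have h1 := h u v
  have h2 := h v u
  rw [norm_sub_rev] at h2
  have e : ⟪F u, v - u⟫ = - ⟪F u, u - v⟫ := by rw [← inner_neg_right, neg_sub]
  rw [inner_sub_left]
  linarith

theorem sub_le (h : IsEnergy a₀ F En) (ha : 0 < a₀) (u v : V) :
    En u - En v ≤ ⟪F u, u - v⟫ := by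
  have h1 := h v u
  have e : ⟪F u, v - u⟫ = - ⟪F u, u - v⟫ := by rw [← inner_neg_right, neg_sub]
  have : 0 ≤ a₀ / 2 * ‖F v - F u‖ ^ 2 := by positivity
  linarith

theorem norm_sub_le (h : IsEnergy a₀ F En) (ha : 0 < a₀) (u v : V) :
    ‖F u - F v‖ ≤ a₀⁻¹ * ‖u - v‖ := by
  have h := (h.cocoercive u v).trans (real_inner_le_norm _ _)
  rw [le_inv_mul_iff₀ ha]
  rcases (norm_nonneg (F u - F v)).eq_or_lt with h0 | h0
  · rw [← h0]; simp
  · exact le_of_mul_le_mul_left (by linarith) h0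

end IsEnergy

/-- A solution of a nonlinear evolution equation `a(q, r) + (F(G), D r) = ℓ(r)`, and its backward
Euler approximation `x` in the subspace `R`; `π` is an approximate solution in `R`. -/
structure IsEulerScheme (a₀ φlo φhi K T : ℝ) (F : V → V) (En : V → ℝ) (a : H →ₗ[ℝ] H →ₗ[ℝ] ℝ)
    (R : Submodule ℝ H) (D : R →ₗ[ℝ] V) (ε Δt : ℝ) (N : ℕ) (p q : ℝ → H) (G : ℝ → V)
    (π : ℝ → R) (x : ℕ → R) (ℓ : ℝ → R → ℝ) : Prop where
  a₀_pos : 0 < a₀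
  φlo_pos : 0 < φlo
  φhi_pos : 0 < φhi
  K_pos : 0 < K
  isEnergy : IsEnergy a₀ F En
  symm : ∀ u v, a u v = a v u
  coercive : ∀ u, φlo * ‖u‖ ^ 2 ≤ a u u
  bounded : ∀ u v, |a u v| ≤ φhi * ‖u‖ * ‖v‖
  step_pos : 0 < Δt
  final_time : N * Δt = T
  eps_pos : 0 < ε
  continuous_eq : ∀ t ∈ Ioc 0 T, ∀ r : R, a (q t) r + ⟪F (G t), D r⟫ = ℓ t r
  discrete_eq : ∀ i < N, ∀ r : R, a (Δt⁻¹ • ((x (i + 1) : H) - x i)) r + ⟪F (D (x (i + 1))), D r⟫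
    = ℓ ((i + 1 : ℕ) * Δt) r
  proj : ∀ t ∈ Icc 0 T, ∀ r : R, a (p t - π t) r = 0
  grad_err : ∀ t ∈ Ioc 0 T, ‖G t - D (π t)‖ ≤ K * ε
  init_err : ‖(π 0 : H) - x 0‖ ≤ K * ε
  trunc : ∑ i ∈ Finset.range N, Δt * ‖q ((i + 1 : ℕ) * Δt) -
    Δt⁻¹ • (p ((i + 1 : ℕ) * Δt) - p (i * Δt))‖ ≤ K * Δt

variable {a₀ φlo φhi K T : ℝ} {F : V → V} {En : V → ℝ} {a : H →ₗ[ℝ] H →ₗ[ℝ] ℝ}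
  {R : Submodule ℝ H} {D : R →ₗ[ℝ] V} {ε Δt : ℝ} {N : ℕ} {p q : ℝ → H} {G : ℝ → V}
  {π : ℝ → R} {x : ℕ → R} {ℓ : ℝ → R → ℝ}

namespace IsEulerScheme

theorem time_mem (S : IsEulerScheme a₀ φlo φhi K T F En a R D ε Δt N p q G π x ℓ) {i : ℕ}
    (hi : i < N) : ((i + 1 : ℕ) * Δt : ℝ) ∈ Ioc 0 T := by
  have := S.step_pos
  refine ⟨by positivity, ?_⟩
  rw [← S.final_time]
  have : ((i + 1 : ℕ) : ℝ) ≤ N := by exact_mod_cast hi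
  gcongr

theorem time_mem_Icc (S : IsEulerScheme a₀ φlo φhi K T F En a R D ε Δt N p q G π x ℓ) {i : ℕ}
    (hi : i ≤ N) : (i * Δt : ℝ) ∈ Icc 0 T := by
  have := S.step_pos
  refine ⟨by positivity, ?_⟩
  rw [← S.final_time]
  gcongr

theorem step (S : IsEulerScheme a₀ φlo φhi K T F En a R D ε Δt N p q G π x ℓ)
    {i : ℕ} (hi : i < N) :
    a ((π ((i + 1 : ℕ) * Δt) - x (i + 1) : R) : H) (π ((i + 1 : ℕ) * Δt) - x (i + 1) : R)
      - a ((π (i * Δt) - x i : R) : H) (π (i * Δt) - x i : R) +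
      Δt * ⟪F (G ((i + 1 : ℕ) * Δt)) - F (D (x (i + 1))), G ((i + 1 : ℕ) * Δt) - D (x (i + 1))⟫
      ≤ Δt * (K ^ 2 / a₀ * ε ^ 2) + 2 * φhi * (Δt * ‖q ((i + 1 : ℕ) * Δt) -
    Δt⁻¹ • (p ((i + 1 : ℕ) * Δt) - p (i * Δt))‖) *
        ‖(π ((i + 1 : ℕ) * Δt) - x (i + 1) : R)‖ := by
  have hΔ := S.step_pos
  have ha₀ := S.a₀_pos
  have ht := S.time_mem hi
  set t : ℝ := ((i + 1 : ℕ) * Δt : ℝ) with htdef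
  set s : ℝ := (i * Δt : ℝ) with hsdef
  set θ : R := π t - x (i + 1) with hθ
  set θ' : R := π s - x i with hθ'
  set X := ⟪F (G t) - F (D (x (i + 1))), G t - D (x (i + 1))⟫ with hX
  set τ : H := q t - Δt⁻¹ • (p t - p s) with hτ
  have e1 := S.continuous_eq t ht θ
  have e2 := S.discrete_eq i hi θ
  have p1 := S.proj t ⟨ht.1.le, ht.2⟩ θ
  have p2 := S.proj s (S.time_mem_Icc hi.le) θ
  have hXθ : ⟪F (G t) - F (D (x (i + 1))), D θ⟫ =
      X - ⟪F (G t) - F (D (x (i + 1))), G t - D (π t)⟫ := by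
    rw [hX, ← inner_sub_right, hθ, map_sub]
    congr 1; abel
  have hη : ⟪F (G t) - F (D (x (i + 1))), G t - D (π t)⟫ ≤ X / 2 + K ^ 2 / (2 * a₀) * ε ^ 2 := by
    have h1 := S.isEnergy.cocoercive (G t) (D (x (i + 1)))
    have h2 := real_inner_le_norm (F (G t) - F (D (x (i + 1)))) (G t - D (π t))
    have h3 := S.grad_err t ht
    have h4 : ‖F (G t) - F (D (x (i + 1)))‖ * ‖G t - D (π t)‖ ≤
        ‖F (G t) - F (D (x (i + 1)))‖ * (K * ε) := by gcongr
    have h5 : ‖F (G t) - F (D (x (i + 1)))‖ * (K * ε) ≤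
        a₀ / 2 * ‖F (G t) - F (D (x (i + 1)))‖ ^ 2 + K ^ 2 / (2 * a₀) * ε ^ 2 := by
      have : 0 ≤ (a₀ * ‖F (G t) - F (D (x (i + 1)))‖ - K * ε) ^ 2 / (2 * a₀) := by positivity
      have e : (a₀ * ‖F (G t) - F (D (x (i + 1)))‖ - K * ε) ^ 2 / (2 * a₀) =
        a₀ / 2 * ‖F (G t) - F (D (x (i + 1)))‖ ^ 2 + K ^ 2 / (2 * a₀) * ε ^ 2 -
          ‖F (G t) - F (D (x (i + 1)))‖ * (K * ε) := by
        field_simp; ring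
      linarith
    linarith
  have hτθ : -(a τ θ) ≤ φhi * ‖τ‖ * ‖θ‖ := (neg_le_abs _).trans (S.bounded τ θ)
  have hsq : a (θ : H) θ - a (θ' : H) θ' ≤ 2 * a ((θ : H) - θ') θ := by
    have h0 : 0 ≤ a ((θ : H) - θ') ((θ : H) - θ') := by
      have := S.φlo_pos
      exact le_trans (by positivity) (S.coercive _)
    simp only [map_sub, LinearMap.sub_apply] at h0 ⊢
    have := S.symm (θ' : H) θ
    linarith
  have key : Δt⁻¹ * a ((θ : H) - θ') θ + X ≤ X / 2 + K ^ 2 / (2 * a₀) * ε ^ 2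
      + φhi * ‖τ‖ * ‖θ‖ := by
    have : Δt⁻¹ * a ((θ : H) - θ') θ = -(a τ θ) + (a (q t) θ -
        a (Δt⁻¹ • ((x (i + 1) : H) - x i)) θ) := by
      have hθc : (θ : H) = π t - x (i + 1) := rfl
      have hθc' : (θ' : H) = π s - x i := rfl
      rw [hτ]
      simp only [map_sub, map_smul, LinearMap.sub_apply, LinearMap.smul_apply, smul_eq_mul]
        at p1 p2 ⊢
      have g1 : a (θ : H) θ = a (π t : H) θ - a (x (i + 1) : H) θ := by
        nth_rewrite 1 [hθc]; simp
      have g2 : a (θ' : H) θ = a (π s : H) θ - a (x i : H) θ := by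
        nth_rewrite 1 [hθc']; simp
      rw [g1, g2]
      linear_combination (-Δt⁻¹) * p1 + Δt⁻¹ * p2
    rw [inner_sub_left] at hXθ
    linarith
  have key2 := mul_le_mul_of_nonneg_left key hΔ.le
  rw [mul_add, ← mul_assoc, mul_inv_cancel₀ hΔ.ne', one_mul] at key2
  have e3 : K ^ 2 / a₀ = 2 * (K ^ 2 / (2 * a₀)) := by field_simp
  have e4 : ‖(θ : H)‖ = ‖θ‖ := rfl
  rw [e3]
  rw [e4] at *
  linarith

/-- The constant in the error estimate for the Euler scheme. -/
def errConst (a₀ φlo φhi K T : ℝ) : ℝ :=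
  2 / φlo * (φhi * K ^ 2 + T * (K ^ 2 / a₀) + 2 * φhi ^ 2 * K ^ 2 / φlo)

theorem error_le (S : IsEulerScheme a₀ φlo φhi K T F En a R D ε Δt N p q G π x ℓ) :
    (∀ i ≤ N, ‖π (i * Δt) - x i‖ ^ 2 ≤ errConst a₀ φlo φhi K T * (ε ^ 2 + Δt ^ 2)) ∧
    ∑ i ∈ Finset.range N, Δt *
      ⟪F (G ((i + 1 : ℕ) * Δt)) - F (D (x (i + 1))), G ((i + 1 : ℕ) * Δt) - D (x (i + 1))⟫ ≤
      φlo * errConst a₀ φlo φhi K T * (ε ^ 2 + Δt ^ 2) := by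
  have hΔ := S.step_pos
  have ha₀ := S.a₀_pos
  have hφlo := S.φlo_pos
  have hφhi := S.φhi_pos
  have hK := S.K_pos
  have hT : 0 ≤ T := by rw [← S.final_time]; positivity
  set θ : ℕ → R := fun i => π (i * Δt) - x i with hθ
  set X : ℕ → ℝ := fun i => ⟪F (G ((i + 1 : ℕ) * Δt)) - F (D (x (i + 1))),
    G ((i + 1 : ℕ) * Δt) - D (x (i + 1))⟫ with hX
  have hX0 (i : ℕ) : 0 ≤ X i := le_trans (by positivity) (S.isEnergy.cocoercive _ _)
  obtain ⟨i₀, hi₀, hmax⟩ := Finset.exists_max_image (Finset.range (N + 1)) (fun i => ‖θ i‖)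
    ⟨0, by simp⟩
  set M := ‖θ i₀‖ with hM
  have hθM (i : ℕ) (hi : i ≤ N) : ‖θ i‖ ≤ M := hmax i (Finset.mem_range.2 (by omega))
  set τ : ℕ → ℝ := fun i => Δt * ‖q ((i + 1 : ℕ) * Δt) -
    Δt⁻¹ • (p ((i + 1 : ℕ) * Δt) - p (i * Δt))‖ with hτ
  have hτ0 (i : ℕ) : 0 ≤ τ i := by positivity
  have hstep (i : ℕ) (hi : i < N) : a (θ (i + 1) : H) (θ (i + 1)) - a (θ i : H) (θ i) + Δt * X i
      ≤ Δt * (K ^ 2 / a₀ * ε ^ 2) + 2 * φhi * M * τ i := by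
    refine (S.step hi).trans ?_
    have h1 : 2 * φhi * τ i * ‖θ (i + 1)‖ ≤ 2 * φhi * τ i * M := by
      have := hτ0 i
      gcongr
      exact hθM _ hi
    simp only [hθ, hτ] at h1 ⊢
    linarith
  have hsum (j : ℕ) (hj : j ≤ N) : a (θ j : H) (θ j) + ∑ i ∈ Finset.range j, Δt * X i ≤
      a (θ 0 : H) (θ 0) + j * Δt * (K ^ 2 / a₀ * ε ^ 2) +
        2 * φhi * M * ∑ i ∈ Finset.range j, τ i := by
    induction j with
    | zero => simp
    | succ j ih =>
      have h1 := ih (by omega)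
      have h2 := hstep j (by omega)
      rw [Finset.sum_range_succ, Finset.sum_range_succ]
      push_cast
      linarith
  have hA0 : a (θ 0 : H) (θ 0) ≤ φhi * (K ^ 2 * ε ^ 2) := by
    have h1 := (le_abs_self _).trans (S.bounded (θ 0) (θ 0))
    have h2 : ‖(θ 0 : H)‖ ≤ K * ε := by
      have := S.init_err
      simpa [hθ] using this
    have : φhi * ‖(θ 0 : H)‖ * ‖(θ 0 : H)‖ ≤ φhi * (K * ε) * (K * ε) := by
      have := S.eps_pos
      gcongr
    linarith
  have hB (j : ℕ) (hj : j ≤ N) : a (θ j : H) (θ j) + ∑ i ∈ Finset.range j, Δt * X i ≤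
      φhi * (K ^ 2 * ε ^ 2) + T * (K ^ 2 / a₀ * ε ^ 2) + 2 * φhi * M * (K * Δt) := by
    refine (hsum j hj).trans ?_
    have h1 : j * Δt * (K ^ 2 / a₀ * ε ^ 2) ≤ T * (K ^ 2 / a₀ * ε ^ 2) := by
      have := (S.time_mem_Icc hj).2
      gcongr
    have h2 : ∑ i ∈ Finset.range j, τ i ≤ K * Δt :=
      (Finset.sum_le_sum_of_subset_of_nonneg (Finset.range_mono hj) fun i _ _ => hτ0 i).trans
        S.trunc
    have h3 : 2 * φhi * M * ∑ i ∈ Finset.range j, τ i ≤ 2 * φhi * M * (K * Δt) := by gcongr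
    linarith
  have hY : 2 * φhi * M * (K * Δt) ≤ φlo / 2 * M ^ 2 + 2 * φhi ^ 2 * K ^ 2 / φlo * Δt ^ 2 := by
    have : 0 ≤ (φlo * M - 2 * φhi * K * Δt) ^ 2 / (2 * φlo) := by positivity
    have e : (φlo * M - 2 * φhi * K * Δt) ^ 2 / (2 * φlo) = φlo / 2 * M ^ 2 +
      2 * φhi ^ 2 * K ^ 2 / φlo * Δt ^ 2 - 2 * φhi * M * (K * Δt) := by field_simp; ring
    linarith
  have hsums (j : ℕ) : 0 ≤ ∑ i ∈ Finset.range j, Δt * X i :=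
    Finset.sum_nonneg fun i _ => mul_nonneg hΔ.le (hX0 i)
  set C := errConst a₀ φlo φhi K T with hC
  have hCe : φlo / 2 * C = φhi * K ^ 2 + T * (K ^ 2 / a₀) + 2 * φhi ^ 2 * K ^ 2 / φlo := by
    rw [hC, errConst]; field_simp
  have hbd : φhi * (K ^ 2 * ε ^ 2) + T * (K ^ 2 / a₀ * ε ^ 2) + 2 * φhi ^ 2 * K ^ 2 / φlo * Δt ^ 2
      ≤ φlo / 2 * C * (ε ^ 2 + Δt ^ 2) := by
    rw [hCe]
    have h1 : 0 ≤ (φhi * K ^ 2 + T * (K ^ 2 / a₀)) * Δt ^ 2 := by positivity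
    have h2 : 0 ≤ 2 * φhi ^ 2 * K ^ 2 / φlo * ε ^ 2 := by positivity
    linarith
  have hM2 : M ^ 2 ≤ C * (ε ^ 2 + Δt ^ 2) := by
    have hi₀N : i₀ ≤ N := by simpa [Nat.lt_succ_iff] using hi₀
    have h1 := hB i₀ hi₀N
    have h2 := S.coercive (θ i₀)
    have h3 := hsums i₀
    have h4 : ‖(θ i₀ : H)‖ = M := rfl
    rw [h4] at h2
    have : φlo / 2 * M ^ 2 ≤ φlo / 2 * (C * (ε ^ 2 + Δt ^ 2)) := by linarith
    exact le_of_mul_le_mul_left this (by positivity)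
  refine ⟨fun i hi => le_trans (pow_le_pow_left₀ (norm_nonneg _) (hθM i hi) 2) hM2, ?_⟩
  have h1 := hB N le_rfl
  have h2 : 0 ≤ a (θ N : H) (θ N) := le_trans (by positivity) (S.coercive _)
  have h3 : φlo / 2 * M ^ 2 ≤ φlo / 2 * (C * (ε ^ 2 + Δt ^ 2)) := by gcongr
  linarith

theorem errConst_nonneg (S : IsEulerScheme a₀ φlo φhi K T F En a R D ε Δt N p q G π x ℓ) :
    0 ≤ errConst a₀ φlo φhi K T := by
  have hΔ := S.step_pos
  have ha₀ := S.a₀_pos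
  have hφlo := S.φlo_pos
  have hφhi := S.φhi_pos
  have hT : 0 ≤ T := by rw [← S.final_time]; positivity
  rw [errConst]; positivity

/-- The flux error at a single time level, for large time steps. -/
theorem flux_error_of_le_step (S : IsEulerScheme a₀ φlo φhi K T F En a R D ε Δt N p q G π x ℓ)
    {i : ℕ} (hi : i < N) :
    Δt * (a₀ * ‖F (G ((i + 1 : ℕ) * Δt)) - F (D (x (i + 1)))‖ ^ 2) ≤
      φlo * errConst a₀ φlo φhi K T * (ε ^ 2 + Δt ^ 2) := by
  have hΔ := S.step_pos
  have ha₀ := S.a₀_pos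
  refine le_trans ?_ S.error_le.2
  refine le_trans (mul_le_mul_of_nonneg_left (S.isEnergy.cocoercive _ _) hΔ.le) ?_
  exact Finset.single_le_sum (f := fun i : ℕ => Δt *
      ⟪F (G ((i + 1 : ℕ) * Δt)) - F (D (x (i + 1))), G ((i + 1 : ℕ) * Δt) - D (x (i + 1))⟫)
    (fun j _ => mul_nonneg hΔ.le (le_trans (by positivity) (S.isEnergy.cocoercive _ _)))
    (Finset.mem_range.2 hi)

/-- A bound for the time variation of the flux, tested with gradients from `R`. -/
def varConst (φhi K : ℝ) : ℝ := K * (1 + K) + 2 * φhi * K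

theorem flux_var (S : IsEulerScheme a₀ φlo φhi K T F En a R D ε Δt N p q G π x ℓ) {h : ℝ}
    (hq : ∀ t ∈ Icc 0 T, ‖q t‖ ≤ K)
    (hℓ : ∀ t ∈ Ioc 0 T, ∀ s ∈ Ioc 0 T, ∀ r : R, |ℓ t r - ℓ s r| ≤ K * (1 + |t - s| / h) * ‖r‖)
    (hh : 0 < h) (hεh : ε ≤ K * h) {s t : ℝ} (hs : s ∈ Ioc 0 T) (ht : t ∈ Ioc 0 T)
    (hst : |t - s| ≤ ε) (r : R) : |⟪F (G t) - F (G s), D r⟫| ≤ varConst φhi K * ‖r‖ := by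
  have hK := S.K_pos
  have hφ := S.φhi_pos
  have e : ⟪F (G t) - F (G s), D r⟫ = (ℓ t r - ℓ s r) - a (q t) r + a (q s) r := by
    rw [← S.continuous_eq t ht, ← S.continuous_eq s hs, inner_sub_left]; ring
  have b1 : |a (q t) r| ≤ φhi * K * ‖r‖ := (S.bounded _ _).trans (by
    have := hq t ⟨ht.1.le, ht.2⟩
    have e : ‖(r : H)‖ = ‖r‖ := rfl
    rw [e]; gcongr)
  have b2 : |a (q s) r| ≤ φhi * K * ‖r‖ := (S.bounded _ _).trans (by
    have := hq s ⟨hs.1.le, hs.2⟩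
    have e : ‖(r : H)‖ = ‖r‖ := rfl
    rw [e]; gcongr)
  have b3 : |ℓ t r - ℓ s r| ≤ K * (1 + K) * ‖r‖ := (hℓ t ht s hs r).trans (by
    have : |t - s| / h ≤ K := by rw [div_le_iff₀ hh]; linarith
    gcongr)
  rw [e, varConst]
  have c1 := abs_add_le ((ℓ t r - ℓ s r) - a (q t) r) (a (q s) r)
  have c2 := abs_sub (ℓ t r - ℓ s r) (a (q t) r)
  linarith

theorem proj_sub_le (S : IsEulerScheme a₀ φlo φhi K T F En a R D ε Δt N p q G π x ℓ)
    (hp : ∀ t ∈ Icc 0 T, ∀ s ∈ Icc 0 T, ‖p t - p s‖ ≤ K * |t - s|)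
    {s t : ℝ} (hs : s ∈ Icc 0 T) (ht : t ∈ Icc 0 T) :
    ‖π t - π s‖ ≤ φhi / φlo * (K * |t - s|) := by
  have hK := S.K_pos
  have hφ := S.φhi_pos
  have hφlo := S.φlo_pos
  set r := π t - π s with hr
  have e1 : a (r : H) r = a (p t - p s) r := by
    have h1 := S.proj t ht r
    have h2 := S.proj s hs r
    have h3 : (r : H) = π t - π s := rfl
    have h4 : a (r : H) r = a (π t : H) r - a (π s : H) r := by
      nth_rewrite 1 [h3]; simp
    rw [h4]
    simp only [map_sub, LinearMap.sub_apply] at h1 h2 ⊢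
    linarith
  have e2 := S.coercive (r : H)
  have e3 : a (p t - p s) r ≤ φhi * (K * |t - s|) * ‖r‖ :=
    (le_abs_self _).trans ((S.bounded _ _).trans (by
      have := hp t ht s hs
      have e : ‖(r : H)‖ = ‖r‖ := rfl
      rw [e]; gcongr))
  have e4 : ‖(r : H)‖ = ‖r‖ := rfl
  rw [e4, e1] at e2
  rw [div_mul_eq_mul_div, le_div_iff₀ hφlo]
  rcases (norm_nonneg r).eq_or_lt with h0 | h0
  · rw [← h0]; simp; positivity
  · exact le_of_mul_le_mul_right (by linarith) h0

/-- The bound for the time variation of the solution. -/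
def solVarConst (a₀ φlo φhi K : ℝ) : ℝ :=
  varConst φhi K * (φhi / φlo * K) + 4 * K ^ 2 / a₀

theorem norm_flux_sub (S : IsEulerScheme a₀ φlo φhi K T F En a R D ε Δt N p q G π x ℓ)
    (hG : ∀ t ∈ Ioc 0 T, ‖G t‖ ≤ K)
    {s t : ℝ} (hs : s ∈ Ioc 0 T) (ht : t ∈ Ioc 0 T) :
    ‖F (G t) - F (G s)‖ ≤ 2 * K / a₀ := by
  have ha₀ := S.a₀_pos
  refine (S.isEnergy.norm_sub_le S.a₀_pos _ _).trans ?_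
  have h1 := norm_sub_le (G t) (G s)
  have h2 := hG t ht
  have h3 := hG s hs
  rw [inv_mul_eq_div]
  gcongr
  linarith

theorem sol_var (S : IsEulerScheme a₀ φlo φhi K T F En a R D ε Δt N p q G π x ℓ) {h : ℝ}
    (hq : ∀ t ∈ Icc 0 T, ‖q t‖ ≤ K)
    (hp : ∀ t ∈ Icc 0 T, ∀ s ∈ Icc 0 T, ‖p t - p s‖ ≤ K * |t - s|)
    (hG : ∀ t ∈ Ioc 0 T, ‖G t‖ ≤ K)
    (hℓ : ∀ t ∈ Ioc 0 T, ∀ s ∈ Ioc 0 T, ∀ r : R, |ℓ t r - ℓ s r| ≤ K * (1 + |t - s| / h) * ‖r‖)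
    (hh : 0 < h) (hεh : ε ≤ K * h) {s t : ℝ} (hs : s ∈ Ioc 0 T) (ht : t ∈ Ioc 0 T)
    (hst : |t - s| ≤ ε) :
    ⟪F (G t) - F (G s), G t - G s⟫ ≤ solVarConst a₀ φlo φhi K * ε := by
  have hK := S.K_pos
  have hφ := S.φhi_pos
  have hφlo := S.φlo_pos
  have ha₀ := S.a₀_pos
  have e : G t - G s = D (π t - π s) + ((G t - D (π t)) - (G s - D (π s))) := by
    rw [map_sub]; abel
  rw [e, inner_add_right]
  have h1 := (le_abs_self _).trans (S.flux_var hq hℓ hh hεh hs ht hst (π t - π s))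
  have h2 := S.proj_sub_le hp (s := s) (t := t) ⟨hs.1.le, hs.2⟩ ⟨ht.1.le, ht.2⟩
  have h3 := real_inner_le_norm (F (G t) - F (G s)) ((G t - D (π t)) - (G s - D (π s)))
  have h4 : ‖(G t - D (π t)) - (G s - D (π s))‖ ≤ 2 * (K * ε) := by
    have := norm_sub_le (G t - D (π t)) (G s - D (π s))
    have := S.grad_err t ht
    have := S.grad_err s hs
    linarith
  have h5 := S.norm_flux_sub hG hs ht
  have hv : 0 ≤ varConst φhi K := by rw [varConst]; positivity
  have h6 : varConst φhi K * ‖π t - π s‖ ≤ varConst φhi K * (φhi / φlo * (K * ε)) := by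
    refine mul_le_mul_of_nonneg_left (h2.trans ?_) hv
    gcongr
  have h7 : ‖F (G t) - F (G s)‖ * ‖(G t - D (π t)) - (G s - D (π s))‖ ≤
      2 * K / a₀ * (2 * (K * ε)) := by gcongr
  have e2 : solVarConst a₀ φlo φhi K * ε =
      varConst φhi K * (φhi / φlo * (K * ε)) + 2 * K / a₀ * (2 * (K * ε)) := by
    rw [solVarConst]; ring
  rw [e2]
  linarith

/-- The excess energy of the discrete gradient over a fixed gradient grows at a bounded rate. -/
theorem excess_step (S : IsEulerScheme a₀ φlo φhi K T F En a R D ε Δt N p q G π x ℓ) {h : ℝ}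
    (hq : ∀ t ∈ Icc 0 T, ‖q t‖ ≤ K)
    (hℓ : ∀ t ∈ Ioc 0 T, ∀ s ∈ Ioc 0 T, ∀ r : R, |ℓ t r - ℓ s r| ≤ K * (1 + |t - s| / h) * ‖r‖)
    (hh : 0 < h) (hεh : ε ≤ K * h) {s : ℝ} (hs : s ∈ Ioc 0 T) {i : ℕ} (hi : i < N)
    (hst : |(i + 1 : ℕ) * Δt - s| ≤ ε) :
    En (D (x (i + 1))) - ⟪F (G s), D (x (i + 1))⟫ ≤ En (D (x i)) - ⟪F (G s), D (x i)⟫ +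
      Δt * ((varConst φhi K) ^ 2 / (4 * φlo)) := by
  have hK := S.K_pos
  have hφ := S.φhi_pos
  have hφlo := S.φlo_pos
  have hΔ := S.step_pos
  set t : ℝ := (i + 1 : ℕ) * Δt with ht'
  have ht : t ∈ Ioc 0 T := S.time_mem hi
  set δ := x (i + 1) - x i with hδ
  have h1 := S.isEnergy.sub_le S.a₀_pos (D (x (i + 1))) (D (x i))
  rw [← map_sub] at h1
  have h2 := S.discrete_eq i hi δ
  have h3 := S.continuous_eq s hs δ
  have h4 : ⟪F (G s), D δ⟫ = ⟪F (G s), D (x (i + 1))⟫ - ⟪F (G s), D (x i)⟫ := by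
    rw [hδ, map_sub, inner_sub_right]
  have b2 : |a (q s) δ| ≤ φhi * K * ‖δ‖ := (S.bounded _ _).trans (by
    have := hq s ⟨hs.1.le, hs.2⟩
    have e : ‖(δ : H)‖ = ‖δ‖ := rfl
    rw [e]; gcongr)
  have b3 : |ℓ t δ - ℓ s δ| ≤ K * (1 + K) * ‖δ‖ := (hℓ t ht s hs δ).trans (by
    have : |t - s| / h ≤ K := by rw [div_le_iff₀ hh]; linarith
    gcongr)
  have b4 : Δt⁻¹ * (φlo * ‖δ‖ ^ 2) ≤ a (Δt⁻¹ • ((x (i + 1) : H) - x i)) δ := by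
    rw [map_smul, LinearMap.smul_apply, smul_eq_mul]
    exact mul_le_mul_of_nonneg_left (S.coercive (δ : H)) (by positivity)
  have b5 : varConst φhi K * ‖δ‖ ≤ Δt⁻¹ * (φlo * ‖δ‖ ^ 2) +
      Δt * ((varConst φhi K) ^ 2 / (4 * φlo)) := by
    have : 0 ≤ (2 * φlo * ‖δ‖ - Δt * varConst φhi K) ^ 2 / (4 * φlo * Δt) := by positivity
    have e : (2 * φlo * ‖δ‖ - Δt * varConst φhi K) ^ 2 / (4 * φlo * Δt) = Δt⁻¹ * (φlo * ‖δ‖ ^ 2) +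
      Δt * ((varConst φhi K) ^ 2 / (4 * φlo)) - varConst φhi K * ‖δ‖ := by
      field_simp; ring
    linarith
  have b6 : 0 ≤ φhi * K * ‖δ‖ := by positivity
  have b7 := le_abs_self (a (q s) δ)
  have b8 := le_abs_self (ℓ t δ - ℓ s δ)
  have b9 : varConst φhi K * ‖δ‖ = K * (1 + K) * ‖δ‖ + 2 * (φhi * K * ‖δ‖) := by
    rw [varConst]; ring
  linarith

theorem flux_error_of_step_le (S : IsEulerScheme a₀ φlo φhi K T F En a R D ε Δt N p q G π x ℓ)
    {h : ℝ} (hq : ∀ t ∈ Icc 0 T, ‖q t‖ ≤ K)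
    (hp : ∀ t ∈ Icc 0 T, ∀ s ∈ Icc 0 T, ‖p t - p s‖ ≤ K * |t - s|)
    (hG : ∀ t ∈ Ioc 0 T, ‖G t‖ ≤ K)
    (hℓ : ∀ t ∈ Ioc 0 T, ∀ s ∈ Ioc 0 T, ∀ r : R, |ℓ t r - ℓ s r| ≤ K * (1 + |t - s| / h) * ‖r‖)
    (hinv : ∀ r : R, ‖D r‖ ≤ K * h⁻¹ * ‖r‖)
    (herr : ∀ t ∈ Icc 0 T, ‖p t - π t‖ ≤ K * (ε * h)) (hx0 : ‖(x 0 : H) - p 0‖ ≤ K * (ε * h))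
    (hh : 0 < h) (hεh : ε ≤ K * h) (hεK : ε ≤ K) (hΔε : Δt ≤ ε) {i : ℕ} (hi : i < N) :
    a₀ / 2 * ‖F (G ((i + 1 : ℕ) * Δt)) - F (D (x (i + 1)))‖ ^ 2 ≤
      (solVarConst a₀ φlo φhi K + (varConst φhi K) ^ 2 / (4 * φlo)
        + a₀⁻¹ * (((3 * K ^ 2 + K) * K + 2 * K) * (3 * K ^ 2 + K))
        + 4 * φlo * errConst a₀ φlo φhi K T
        + varConst φhi K * √(2 * errConst a₀ φlo φhi K T) + 2 * K ^ 2 / a₀) * ε := by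
  have hK := S.K_pos
  have hφ := S.φhi_pos
  have hφlo := S.φlo_pos
  have ha₀ := S.a₀_pos
  have hΔ := S.step_pos
  have hε := S.eps_pos
  have hC1 := S.errConst_nonneg
  have hv : 0 ≤ varConst φhi K := by rw [varConst]; positivity
  set t : ℝ := (i + 1 : ℕ) * Δt with ht'
  have ht : t ∈ Ioc 0 T := S.time_mem hi
  set b : V → ℝ := fun u => En u - En (G t) - ⟪F (G t), u - G t⟫ with hb
  have hbdiff (u v : V) : b u ≤ b v + ⟪F u - F (G t), u - v⟫ := by
    have h1 := S.isEnergy.sub_le ha₀ u v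
    simp only [hb, inner_sub_left, inner_sub_right] at h1 ⊢
    linarith
  have hbG {s : ℝ} (hs : s ∈ Ioc 0 T) (hst : |s - t| ≤ ε) :
      b (G s) ≤ solVarConst a₀ φlo φhi K * ε := by
    have h1 := S.sol_var hq hp hG hℓ hh hεh ht hs hst
    have h2 := hbdiff (G s) (G t)
    have h3 : b (G t) = 0 := by simp [hb]
    linarith
  have hgrow (j : ℕ) : ∀ m, j + m = i + 1 → (m : ℝ) * Δt ≤ ε + Δt →
      b (D (x (i + 1))) ≤ b (D (x j)) + m * Δt * ((varConst φhi K) ^ 2 / (4 * φlo)) := by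
    have hgen : ∀ m, j + m ≤ i + 1 → (((i + 1 : ℕ) : ℝ) - (j + 1)) * Δt ≤ ε →
        b (D (x (j + m))) ≤ b (D (x j)) + m * Δt * ((varConst φhi K) ^ 2 / (4 * φlo)) := by
      intro m hm hw
      induction m with
      | zero => simp
      | succ m ih =>
        have h1 := ih (by omega)
        have hle : ((j + m + 1 : ℕ) : ℝ) ≤ (i + 1 : ℕ) := by exact_mod_cast hm
        have hab : |(j + m + 1 : ℕ) * Δt - t| ≤ ε := by
          have h0 : 0 ≤ (((i + 1 : ℕ) : ℝ) - (j + m + 1 : ℕ)) * Δt :=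
            mul_nonneg (sub_nonneg.2 hle) hΔ.le
          rw [abs_sub_comm, ht', ← sub_mul, abs_of_nonneg h0]
          refine le_trans (mul_le_mul_of_nonneg_right ?_ hΔ.le) hw
          push_cast
          have : (0 : ℝ) ≤ m := by positivity
          linarith
        have h2 := S.excess_step hq hℓ hh hεh ht (i := j + m) (by omega) hab
        simp only [hb, inner_sub_right] at h1 h2 ⊢
        rw [← add_assoc]
        push_cast
        linarith
    intro m hm hw
    have := hgen m hm.le (by
      have e : ((i + 1 : ℕ) : ℝ) = j + m := by exact_mod_cast hm.symm
      rw [e]; linarith)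
    rwa [hm] at this
  have hfin : a₀ / 2 * ‖F (G t) - F (D (x (i + 1)))‖ ^ 2 ≤ b (D (x (i + 1))) := by
    rw [norm_sub_rev]; exact S.isEnergy _ _
  by_cases hcase : t ≤ ε
  · -- the initial layer
    obtain ⟨s, hs0, hst, hsε⟩ : ∃ s, 0 < s ∧ s ≤ t ∧ s ≤ ε * h :=
      ⟨min t (ε * h), lt_min ht.1 (by positivity), min_le_left _ _, min_le_right _ _⟩
    have hs : s ∈ Ioc 0 T := ⟨hs0, hst.trans ht.2⟩
    have h1 := hgrow 0 (i + 1) (by omega) (by rw [← ht']; linarith)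
    rw [← ht'] at h1
    have h2 := hbG hs (by rw [abs_sub_comm, abs_of_nonneg (by linarith)]; linarith)
    have h3 := hbdiff (D (x 0)) (G s)
    have h0 : (0 : ℝ) ∈ Icc 0 T := ⟨le_rfl, ht.1.le.trans ht.2⟩
    have hs' : s ∈ Icc 0 T := ⟨hs.1.le, hs.2⟩
    have h4 : ‖x 0 - π s‖ ≤ 3 * K * (ε * h) := by
      have e : (x 0 : H) - π s = ((x 0 : H) - p 0) + (p 0 - p s) + (p s - π s) := by abel
      have e' : ‖x 0 - π s‖ = ‖(x 0 : H) - π s‖ := rfl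
      rw [e', e]
      have g1 := norm_add₃_le (a := (x 0 : H) - p 0) (b := p 0 - p s) (c := p s - π s)
      have g2 := hp 0 h0 s hs'
      rw [zero_sub, abs_neg, abs_of_pos hs0] at g2
      have g3 := herr s hs'
      have g4 : K * s ≤ K * (ε * h) := by gcongr
      linarith
    have h5 : ‖D (x 0) - G s‖ ≤ (3 * K ^ 2 + K) * ε := by
      have e : D (x 0) - G s = D (x 0 - π s) - (G s - D (π s)) := by rw [map_sub]; abel
      rw [e]
      have g1 := norm_sub_le (D (x 0 - π s)) (G s - D (π s))
      have g2 := hinv (x 0 - π s)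
      have g3 := S.grad_err s hs
      have g4 : K * h⁻¹ * ‖x 0 - π s‖ ≤ K * h⁻¹ * (3 * K * (ε * h)) := by gcongr
      have g5 : K * h⁻¹ * (3 * K * (ε * h)) = 3 * K ^ 2 * ε := by field_simp
      linarith
    have h6 : ‖F (D (x 0)) - F (G t)‖ ≤ a₀⁻¹ * ((3 * K ^ 2 + K) * K + 2 * K) := by
      refine (S.isEnergy.norm_sub_le ha₀ _ _).trans ?_
      have e : D (x 0) - G t = (D (x 0) - G s) + G s - G t := by abel
      have g1 := norm_sub_le ((D (x 0) - G s) + G s) (G t)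
      have g2 := norm_add_le (D (x 0) - G s) (G s)
      have g3 := hG s hs
      have g4 := hG t ht
      have g5 : (3 * K ^ 2 + K) * ε ≤ (3 * K ^ 2 + K) * K := by gcongr
      have : ‖D (x 0) - G t‖ ≤ (3 * K ^ 2 + K) * K + 2 * K := by rw [e]; linarith
      gcongr
    have h7 : ⟪F (D (x 0)) - F (G t), D (x 0) - G s⟫ ≤
        a₀⁻¹ * ((3 * K ^ 2 + K) * K + 2 * K) * ((3 * K ^ 2 + K) * ε) :=
      (real_inner_le_norm _ _).trans (by gcongr)
    have h8 : t * ((varConst φhi K) ^ 2 / (4 * φlo)) ≤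
        (varConst φhi K) ^ 2 / (4 * φlo) * ε := by rw [mul_comm]; gcongr
    have p1 : 0 ≤ 4 * φlo * errConst a₀ φlo φhi K T * ε := by positivity
    have p2 : 0 ≤ varConst φhi K * √(2 * errConst a₀ φlo φhi K T) * ε := by positivity
    have p3 : 0 ≤ 2 * K ^ 2 / a₀ * ε := by positivity
    linarith
  · -- later times
    push Not at hcase
    set m := ⌊ε / Δt⌋₊ with hm
    have hm1 : (m : ℝ) * Δt ≤ ε := by
      rw [← le_div_iff₀ hΔ]; exact Nat.floor_le (by positivity)
    have hm2 : ε < (m + 1) * Δt := by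
      rw [← div_lt_iff₀ hΔ]; exact Nat.lt_floor_add_one _
    have hm0 : 1 ≤ m := Nat.le_floor (by rw [Nat.cast_one, le_div_iff₀ hΔ, one_mul]; exact hΔε)
    have hmi : m ≤ i := by
      have : (m : ℝ) < (i + 1 : ℕ) := by
        refine lt_of_mul_lt_mul_right ?_ hΔ.le
        linarith
      exact Nat.lt_succ_iff.1 (by exact_mod_cast this)
    set X : ℕ → ℝ := fun i => ⟪F (G ((i + 1 : ℕ) * Δt)) - F (D (x (i + 1))),
      G ((i + 1 : ℕ) * Δt) - D (x (i + 1))⟫ with hX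
    have hX0 (i : ℕ) : 0 ≤ X i := le_trans (by positivity) (S.isEnergy.cocoercive _ _)
    obtain ⟨j, hj, hmin⟩ := Finset.exists_min_image (Finset.Ico (i + 1 - m) (i + 1)) X
      ⟨i, by rw [Finset.mem_Ico]; omega⟩
    rw [Finset.mem_Ico] at hj
    have hjN : j < N := by omega
    have hXj : X j ≤ 4 * φlo * errConst a₀ φlo φhi K T * ε := by
      have g1 : (m : ℝ) * (Δt * X j) ≤ ∑ l ∈ Finset.Ico (i + 1 - m) (i + 1), Δt * X l := by
        have := Finset.card_nsmul_le_sum (Finset.Ico (i + 1 - m) (i + 1)) (fun l => Δt * X l)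
          (Δt * X j) (fun l hl => mul_le_mul_of_nonneg_left (hmin l hl) hΔ.le)
        rwa [Nat.card_Ico, Nat.sub_sub_self (by omega), nsmul_eq_mul] at this
      have g2 : ∑ l ∈ Finset.Ico (i + 1 - m) (i + 1), Δt * X l ≤
          ∑ l ∈ Finset.range N, Δt * X l :=
        Finset.sum_le_sum_of_subset_of_nonneg (fun l hl => by
          rw [Finset.mem_Ico] at hl; rw [Finset.mem_range]; omega)
          fun l _ _ => mul_nonneg hΔ.le (hX0 l)
      have g3 := S.error_le.2
      have g4 : Δt ^ 2 ≤ ε ^ 2 := pow_le_pow_left₀ hΔ.le hΔε 2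
      have g5 : φlo * errConst a₀ φlo φhi K T * (ε ^ 2 + Δt ^ 2) ≤
          φlo * errConst a₀ φlo φhi K T * (2 * ε ^ 2) := by gcongr; linarith
      have g6 : ε / 2 * X j ≤ m * (Δt * X j) := by
        rw [← mul_assoc]
        have : (1 : ℝ) ≤ m := by exact_mod_cast hm0
        have : Δt ≤ m * Δt := le_mul_of_one_le_left hΔ.le this
        exact mul_le_mul_of_nonneg_right (by linarith) (hX0 j)
      have g7 : ε / 2 * X j ≤ ε / 2 * (4 * φlo * errConst a₀ φlo φhi K T * ε) := by
        refine (g6.trans (g1.trans (g2.trans (g3.trans g5)))).trans (le_of_eq ?_)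
        ring
      exact le_of_mul_le_mul_left g7 (by positivity)
    set s : ℝ := (j + 1 : ℕ) * Δt with hs'
    have hs : s ∈ Ioc 0 T := S.time_mem hjN
    obtain ⟨l, hl⟩ : ∃ l, j + 1 + l = i + 1 := ⟨i - j, by omega⟩
    have hlm : (l : ℝ) * Δt ≤ ε := by
      have : (l : ℝ) ≤ m := by exact_mod_cast (by omega : l ≤ m)
      exact (mul_le_mul_of_nonneg_right this hΔ.le).trans hm1
    have hts : t - s = l * Δt := by
      have : ((i + 1 : ℕ) : ℝ) = (j + 1 : ℕ) + l := by exact_mod_cast hl.symm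
      rw [ht', hs', this]; ring
    have hst : |s - t| ≤ ε := by
      rw [abs_sub_comm, hts, abs_of_nonneg (by positivity)]; exact hlm
    have h1 := hgrow (j + 1) l hl (by linarith)
    have h2 := hbG hs hst
    have h3 : b (D (x (j + 1))) ≤ b (G s) + X j + ⟪F (G s) - F (G t), D (x (j + 1)) - G s⟫ := by
      have g1 := S.isEnergy.sub_le ha₀ (D (x (j + 1))) (G s)
      simp only [hb, hX, ← hs', inner_sub_left, inner_sub_right] at g1 ⊢
      linarith
    have h4 : ⟪F (G s) - F (G t), D (x (j + 1)) - G s⟫ ≤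
        varConst φhi K * (√(2 * errConst a₀ φlo φhi K T) * ε) + 2 * K / a₀ * (K * ε) := by
      have e : D (x (j + 1)) - G s = - D (π s - x (j + 1)) - (G s - D (π s)) := by
        rw [map_sub]; abel
      rw [e, inner_sub_right, inner_neg_right]
      have g1 := (neg_le_abs _).trans (S.flux_var hq hℓ hh hεh ht hs hst (π s - x (j + 1)))
      have g2 := (neg_le_abs _).trans (abs_real_inner_le_norm (F (G s) - F (G t)) (G s - D (π s)))
      have g3 := S.norm_flux_sub hG ht hs
      have g4 := S.grad_err s hs
      have g5 : ‖F (G s) - F (G t)‖ * ‖G s - D (π s)‖ ≤ 2 * K / a₀ * (K * ε) := by gcongr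
      have g6 : ‖π s - x (j + 1)‖ ≤ √(2 * errConst a₀ φlo φhi K T) * ε := by
        have g7 := S.error_le.1 (j + 1) (by omega)
        refine (pow_le_pow_iff_left₀ (norm_nonneg _) (by positivity) two_ne_zero).1 ?_
        rw [mul_pow, Real.sq_sqrt (by positivity)]
        refine g7.trans ?_
        have : errConst a₀ φlo φhi K T * (ε ^ 2 + Δt ^ 2) ≤
          errConst a₀ φlo φhi K T * (ε ^ 2 + ε ^ 2) := by gcongr
        linarith
      have g9 : varConst φhi K * ‖π s - x (j + 1)‖ ≤
        varConst φhi K * (√(2 * errConst a₀ φlo φhi K T) * ε) := by gcongr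
      linarith
    have h8 : l * Δt * ((varConst φhi K) ^ 2 / (4 * φlo)) ≤
        (varConst φhi K) ^ 2 / (4 * φlo) * ε := by rw [mul_comm]; gcongr
    have p1 : 0 ≤ a₀⁻¹ * (((3 * K ^ 2 + K) * K + 2 * K) * (3 * K ^ 2 + K)) * ε := by positivity
    have p3 : 2 * K / a₀ * (K * ε) = 2 * K ^ 2 / a₀ * ε := by ring
    linarith

end IsEulerScheme

end TimeStepping

section Geometry

variable {d : ℕ}

/-- The uniform interior cone condition. -/
theorem IsLipschitzDomain.uniform_cone {Ω : Set (E d)} (hΩ : IsLipschitzDomain Ω) :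
    ∃ δ > 0, ∃ a > 0, a ≤ 1 ∧ ∀ z ∈ closure Ω, ∃ ν : E d, ‖ν‖ ≤ 1 ∧
      ∀ x ∈ Ω, dist x z < δ → ∀ t ∈ Icc 0 δ, ∀ v : E d, ‖v - t • ν‖ ≤ a * t → x + v ∈ Ω := by
  have hcpt : IsCompact (closure Ω) := hΩ.isBounded.isCompact_closure
  refine hcpt.induction_on (p := fun S => ∃ δ > 0, ∃ a > 0, a ≤ 1 ∧ ∀ z ∈ S, ∃ ν : E d, ‖ν‖ ≤ 1 ∧
      ∀ x ∈ Ω, dist x z < δ → ∀ t ∈ Icc (0 : ℝ) δ, ∀ v : E d, ‖v - t • ν‖ ≤ a * t → x + v ∈ Ω)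
    ⟨1, one_pos, 1, one_pos, le_rfl, by simp⟩ ?_ ?_ ?_
  · rintro s t hst ⟨δ, hδ, a, ha, ha1, h⟩
    exact ⟨δ, hδ, a, ha, ha1, fun z hz => h z (hst hz)⟩
  · rintro s t ⟨δ, hδ, a, ha, ha1, h⟩ ⟨δ', hδ', a', ha', ha1', h'⟩
    refine ⟨min δ δ', lt_min hδ hδ', min a a', lt_min ha ha', (min_le_left _ _).trans ha1, ?_⟩
    rintro z (hz | hz)
    · obtain ⟨ν, hν, H⟩ := h z hz
      refine ⟨ν, hν, fun x hx hxz t ht v hv => H x hx (hxz.trans_le (min_le_left _ _)) t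
        ⟨ht.1, ht.2.trans (min_le_left _ _)⟩ v (hv.trans ?_)⟩
      exact mul_le_mul_of_nonneg_right (min_le_left _ _) ht.1
    · obtain ⟨ν, hν, H⟩ := h' z hz
      refine ⟨ν, hν, fun x hx hxz t ht v hv => H x hx (hxz.trans_le (min_le_right _ _)) t
        ⟨ht.1, ht.2.trans (min_le_right _ _)⟩ v (hv.trans ?_)⟩
      exact mul_le_mul_of_nonneg_right (min_le_right _ _) ht.1
  · intro y hy
    by_cases hyΩ : y ∈ Ω
    · obtain ⟨r, hr, hball⟩ := Metric.isOpen_iff.1 hΩ.isOpen y hyΩ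
      refine ⟨Metric.ball y (r / 4), mem_nhdsWithin_of_mem_nhds (Metric.ball_mem_nhds _ (by linarith)),
        r / 4, by linarith, 1, one_pos, le_rfl, fun z hz => ⟨0, by simp, ?_⟩⟩
      intro x _ hxz t ht v hv
      apply hball
      rw [smul_zero, sub_zero, one_mul] at hv
      rw [Metric.mem_ball] at hz ⊢
      have h1 : dist (x + v) x ≤ r / 4 := by
        rw [dist_eq_norm, add_sub_cancel_left]; exact hv.trans ht.2
      have := dist_triangle4 (x + v) x z y
      linarith
    · have hyf : y ∈ frontier Ω := by rw [hΩ.isOpen.frontier_eq]; exact ⟨hy, hyΩ⟩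
      obtain ⟨ν, hν, γ, ⟨L, hL⟩, r, hr, hchart⟩ := hΩ.lipschitz_boundary y hyf
      refine ⟨Metric.ball y (r / 8), mem_nhdsWithin_of_mem_nhds (Metric.ball_mem_nhds _ (by linarith)),
        r / 8, by linarith, 1 / (L + 1), by positivity, ?_, fun z hz => ⟨ν, hν.le, ?_⟩⟩
      · rw [div_le_one (by positivity)]; linarith
      intro x hxΩ hxz t ht v hv
      rw [Metric.mem_ball] at hz
      have ha : 1 / ((L : ℝ) + 1) * t ≤ t := by
        refine mul_le_of_le_one_left ht.1 ?_
        rw [div_le_one (by positivity)]; linarith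
      have hvn : ‖v‖ ≤ 2 * t := by
        have h1 := norm_add_le (v - t • ν) (t • ν)
        rw [sub_add_cancel, norm_smul, hν, mul_one, Real.norm_of_nonneg ht.1] at h1
        linarith
      have hxy : x ∈ Metric.ball y r := by
        rw [Metric.mem_ball]
        have := dist_triangle x z y
        linarith
      have hxvy : x + v ∈ Metric.ball y r := by
        rw [Metric.mem_ball]
        have := dist_triangle4 (x + v) x z y
        have h1 : dist (x + v) x ≤ 2 * t := by
          rw [dist_eq_norm, add_sub_cancel_left]; exact hvn
        linarith [ht.2]
      rw [hchart _ hxvy]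
      have hx := (hchart _ hxy).1 hxΩ
      set Q := (ℝ ∙ ν)ᗮ.orthogonalProjectionOnto with hQ
      set w := v - t • ν with hw
      have hQν : Q ν = 0 := Submodule.orthogonalProjectionOnto_orthogonalComplement_singleton_eq_zero ν
      have hv' : v = t • ν + w := by rw [hw]; abel
      have hQv : Q v = Q w := by rw [hv', map_add, map_smul, hQν, smul_zero, zero_add]
      have h1 : γ (Q (x + v)) ≤ γ (Q x) + L * (1 / (L + 1) * t) := by
        have h2 := hL.dist_le_mul (Q (x + v)) (Q x)
        rw [dist_eq_norm (Q (x + v)), map_add, add_sub_cancel_left, hQv, Real.dist_eq] at h2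
        have h3 : ‖Q w‖ ≤ ‖w‖ := Submodule.norm_orthogonalProjectionOnto_apply_le _ _
        have h4 : (L : ℝ) * ‖Q w‖ ≤ L * (1 / (L + 1) * t) := by gcongr; exact h3.trans hv
        rw [map_add]
        rw [hQv]
        linarith [le_abs_self (γ (Q x + Q w) - γ (Q x))]
      have h2 : t - 1 / (L + 1) * t ≤ ⟪ν, v⟫ := by
        rw [hv', inner_add_right, inner_smul_right, real_inner_self_eq_norm_sq, hν]
        have := (neg_le_abs _).trans (abs_real_inner_le_norm ν w)
        rw [hν, one_mul] at this
        linarith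
      have h3 : (L : ℝ) * (1 / (L + 1) * t) = t - 1 / (L + 1) * t := by field_simp; ring
      rw [inner_add_right]
      linarith

theorem frontier_inter_ball_subset {Ω : Set (E d)} (hΩ : IsOpen Ω) {y ν : E d} (hν : ‖ν‖ = 1)
    {γ : (ℝ ∙ ν)ᗮ → ℝ} (hγ : Continuous γ) {r : ℝ} (hchart : ∀ x ∈ Metric.ball y r,
      (x ∈ Ω ↔ γ ((ℝ ∙ ν)ᗮ.orthogonalProjectionOnto x) < ⟪ν, x⟫)) {x : E d}
    (hx : x ∈ frontier Ω) (hxy : x ∈ Metric.ball y r) :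
    x = ((ℝ ∙ ν)ᗮ.orthogonalProjectionOnto x : E d) +
      γ ((ℝ ∙ ν)ᗮ.orthogonalProjectionOnto x) • ν := by
  rw [hΩ.frontier_eq] at hx
  have h1 : ⟪ν, x⟫ ≤ γ ((ℝ ∙ ν)ᗮ.orthogonalProjectionOnto x) := by
    by_contra hlt
    exact hx.2 ((hchart x hxy).2 (not_le.1 hlt))
  have h2 : γ ((ℝ ∙ ν)ᗮ.orthogonalProjectionOnto x) ≤ ⟪ν, x⟫ := by
    by_contra hlt
    push Not at hlt
    have hopen : IsOpen {w : E d | ⟪ν, w⟫ < γ ((ℝ ∙ ν)ᗮ.orthogonalProjectionOnto w)} :=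
      isOpen_lt (continuous_const.inner continuous_id)
        (hγ.comp ((ℝ ∙ ν)ᗮ.orthogonalProjectionOnto.continuous))
    obtain ⟨w, ⟨hw1, hw2⟩, hwΩ⟩ := mem_closure_iff.1 hx.1 _ (hopen.inter Metric.isOpen_ball)
      ⟨hlt, hxy⟩
    exact lt_asymm hw1 ((hchart w hw2).1 hwΩ)
  rw [le_antisymm h2 h1]
  have h3 := (ℝ ∙ ν).starProjection_add_starProjection_orthogonal x
  rw [Submodule.starProjection_unit_singleton ℝ hν] at h3
  rw [add_comm]
  exact h3.symm

theorem surface_local_bound {n : ℕ} {ν : E (n + 1)} (hν : ‖ν‖ = 1)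
    {γ : (ℝ ∙ ν)ᗮ → ℝ} {L : ℝ≥0} (hγ : LipschitzWith L γ) :
    ∃ C : ℝ, 0 ≤ C ∧ ∀ S : Set (E (n + 1)), (∀ x ∈ S, x =
      ((ℝ ∙ ν)ᗮ.orthogonalProjectionOnto x : E (n + 1)) +
      γ ((ℝ ∙ ν)ᗮ.orthogonalProjectionOnto x) • ν) → ∀ c, ∀ r > 0, S ⊆ Metric.closedBall c r →
      Measure.euclideanHausdorffMeasure n S ≤ ENNReal.ofReal (C * r ^ n) := by
  have hν0 : ν ≠ 0 := by rintro rfl; simp at hν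
  have : Fact (Module.finrank ℝ (E (n + 1)) = n + 1) := ⟨by simp⟩
  have hfin : Module.finrank ℝ (ℝ ∙ ν)ᗮ = n := Submodule.finrank_orthogonal_span_singleton hν0
  set Γ : (ℝ ∙ ν)ᗮ → E (n + 1) := fun p => (p : E (n + 1)) + γ p • ν with hΓ
  have hΓL : LipschitzWith (1 + L) Γ := by
    refine LipschitzWith.add (LipschitzWith.of_dist_le_mul fun p q => by simp [Subtype.dist_eq]) ?_
    refine LipschitzWith.of_dist_le_mul fun p q => ?_
    rw [dist_eq_norm, ← sub_smul, norm_smul, hν, mul_one, ← dist_eq_norm]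
    exact hγ.dist_le_mul p q
  set v := (volume : Measure (ℝ ∙ ν)ᗮ) (Metric.closedBall 0 1) with hv
  have hvfin : v ≠ ⊤ := measure_closedBall_lt_top.ne
  refine ⟨((1 + L : ℝ≥0) : ℝ) ^ n * v.toReal, by positivity, fun S hS c r hr hSc => ?_⟩
  set Q := (ℝ ∙ ν)ᗮ.orthogonalProjectionOnto with hQ
  have hsub : S ⊆ Γ '' Metric.closedBall (Q c) r := by
    intro x hx
    refine ⟨Q x, ?_, (hS x hx).symm⟩
    rw [Metric.mem_closedBall, dist_eq_norm, ← map_sub]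
    refine (Submodule.norm_orthogonalProjectionOnto_apply_le _ _).trans ?_
    rw [← dist_eq_norm]
    exact hSc hx
  refine (measure_mono hsub).trans ?_
  have hvol : (Measure.euclideanHausdorffMeasure n : Measure (ℝ ∙ ν)ᗮ) = volume := by
    rw [← InnerProductSpace.euclideanHausdorffMeasure_eq_volume, hfin]
  have h1 : (Measure.euclideanHausdorffMeasure n : Measure (E (n + 1)))
      (Γ '' Metric.closedBall (Q c) r) ≤
      ((1 + L : ℝ≥0) : ℝ≥0∞) ^ n * volume (Metric.closedBall (Q c) r) := by
    rw [← hvol, Measure.euclideanHausdorffMeasure_def, Measure.euclideanHausdorffMeasure_def,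
      Measure.smul_apply, Measure.smul_apply]
    have := hΓL.hausdorffMeasure_image_le (d := n) (by positivity) (Metric.closedBall (Q c) r)
    rw [ENNReal.rpow_natCast] at this
    rw [ENNReal.smul_def, ENNReal.smul_def, smul_eq_mul, smul_eq_mul, mul_left_comm]
    gcongr
  refine h1.trans (le_of_eq ?_)
  rw [Measure.addHaar_closedBall' _ _ hr.le, hfin, ← hv,
    ENNReal.ofReal_mul (by positivity), ENNReal.ofReal_mul (by positivity),
    ENNReal.ofReal_toReal hvfin, ENNReal.ofReal_pow hr.le,
    ENNReal.ofReal_pow (NNReal.coe_nonneg _), ENNReal.ofReal_coe_nnreal]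
  ring

theorem IsLipschitzDomain.surface_closedBall_le {Ω : Set (E d)} (hd : 1 ≤ d)
    (hΩ : IsLipschitzDomain Ω) :
    ∃ C : ℝ, 0 < C ∧ ∀ c, ∀ r > 0, surface Ω (Metric.closedBall c r) ≤
      ENNReal.ofReal (C * r ^ (d - 1)) := by
  obtain ⟨n, rfl⟩ : ∃ n, d = n + 1 := ⟨d - 1, by omega⟩
  rw [add_tsub_cancel_right]
  have hcpt : IsCompact (frontier Ω) :=
    hΩ.isBounded.isCompact_closure.of_isClosed_subset isClosed_frontier frontier_subset_closure
  have key : ∃ C : ℝ, 0 < C ∧ ∀ c, ∀ r > 0,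
      (Measure.euclideanHausdorffMeasure n : Measure (E (n + 1)))
        (frontier Ω ∩ frontier Ω ∩ Metric.closedBall c r) ≤ ENNReal.ofReal (C * r ^ n) := by
    refine hcpt.induction_on (p := fun S => ∃ C : ℝ, 0 < C ∧ ∀ c, ∀ r > 0,
      (Measure.euclideanHausdorffMeasure n : Measure (E (n + 1)))
        (frontier Ω ∩ S ∩ Metric.closedBall c r) ≤ ENNReal.ofReal (C * r ^ n))
      ⟨1, one_pos, by simp⟩ ?_ ?_ ?_
    · rintro s t hst ⟨C, hC, h⟩
      exact ⟨C, hC, fun c r hr => (measure_mono (by gcongr)).trans (h c r hr)⟩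
    · rintro s t ⟨C, hC, h⟩ ⟨C', hC', h'⟩
      refine ⟨C + C', by positivity, fun c r hr => ?_⟩
      rw [inter_union_distrib_left, union_inter_distrib_right, add_mul,
        ENNReal.ofReal_add (by positivity) (by positivity)]
      exact (measure_union_le _ _).trans (add_le_add (h c r hr) (h' c r hr))
    · intro y hy
      obtain ⟨ν, hν, γ, ⟨L, hL⟩, δ, hδ, hchart⟩ := hΩ.lipschitz_boundary y hy
      obtain ⟨C, hC, H⟩ := surface_local_bound hν hL
      refine ⟨Metric.ball y δ, mem_nhdsWithin_of_mem_nhds (Metric.ball_mem_nhds _ hδ), C + 1,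
        by positivity, fun c r hr => ?_⟩
      refine (H _ (fun x hx => frontier_inter_ball_subset hΩ.isOpen hν hL.continuous hchart
        hx.1.1 hx.1.2) c r hr inter_subset_right).trans ?_
      gcongr
      linarith
  obtain ⟨C, hC, h⟩ := key
  refine ⟨C, hC, fun c r hr => ?_⟩
  rw [surface, Measure.restrict_apply Metric.isClosed_closedBall.measurableSet,
    add_tsub_cancel_right, inter_comm, ← inter_self (frontier Ω)]
  exact h c r hr

theorem IsLipschitzDomain.surface_lt_top {Ω : Set (E d)} (hd : 1 ≤ d)
    (hΩ : IsLipschitzDomain Ω) : surface Ω univ < ⊤ := by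
  obtain ⟨C, hC, h⟩ := hΩ.surface_closedBall_le hd
  obtain ⟨r, hr, hsub⟩ := hΩ.isBounded.closure.subset_closedBall_lt 0 0
  have h1 : surface Ω univ = surface Ω (Metric.closedBall 0 r) := by
    rw [surface, Measure.restrict_apply MeasurableSet.univ,
      Measure.restrict_apply Metric.isClosed_closedBall.measurableSet, univ_inter,
      inter_eq_self_of_subset_right (frontier_subset_closure.trans hsub)]
  rw [h1]
  exact (h 0 r hr).trans_lt ENNReal.ofReal_lt_top

theorem IsLipschitzDomain.volume_frontier {Ω : Set (E d)} (hd : 1 ≤ d)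
    (hΩ : IsLipschitzDomain Ω) : volume (frontier Ω) = 0 := by
  have h1 := hΩ.surface_lt_top hd
  rw [surface, Measure.restrict_apply MeasurableSet.univ, univ_inter] at h1
  have h2 := Measure.euclideanHausdorffMeasure_zero_or_top (show d - 1 < d by omega) (frontier Ω)
  rw [EuclideanSpace.euclideanHausdorffMeasure_eq_volume] at h2
  exact h2.resolve_right h1.ne

end Geometry

section Polynomials

variable {d : ℕ}

/-- The polynomial functions of degree at most `k`, as the span of the products of `k` affine
functions. -/
def polyLE (d k : ℕ) : Submodule ℝ (E d → ℝ) :=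
  Submodule.span ℝ (range fun (L : Fin k → (E d →ᵃ[ℝ] ℝ)) (x : E d) => ∏ j, L j x)

theorem prod_mem_polyLE {k : ℕ} (L : Fin k → (E d →ᵃ[ℝ] ℝ)) :
    (fun x => ∏ j, L j x) ∈ polyLE d k := Submodule.subset_span ⟨L, rfl⟩

theorem polyLE_induction {k : ℕ} {p : (E d → ℝ) → Prop}
    (hprod : ∀ L : Fin k → (E d →ᵃ[ℝ] ℝ), p fun x => ∏ j, L j x) (hzero : p 0)
    (hadd : ∀ f g, f ∈ polyLE d k → g ∈ polyLE d k → p f → p g → p (f + g))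
    (hsmul : ∀ (c : ℝ) f, f ∈ polyLE d k → p f → p (c • f)) {f : E d → ℝ}
    (hf : f ∈ polyLE d k) : p f := by
  induction hf using Submodule.span_induction with
  | mem x hx => obtain ⟨L, rfl⟩ := hx; exact hprod L
  | zero => exact hzero
  | add x y hx hy h1 h2 => exact hadd x y hx hy h1 h2
  | smul c x hx h => exact hsmul c x hx h

theorem affine_mem_polyLE (L : E d →ᵃ[ℝ] ℝ) : (fun x => L x) ∈ polyLE d 1 := by
  simpa using prod_mem_polyLE (fun _ : Fin 1 => L)

theorem mul_mem_polyLE {k l : ℕ} {f g : E d → ℝ} (hf : f ∈ polyLE d k) (hg : g ∈ polyLE d l) :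
    f * g ∈ polyLE d (k + l) := by
  refine polyLE_induction (p := fun f => f * g ∈ polyLE d (k + l)) ?_ ?_ ?_ ?_ hf
  · intro L
    refine polyLE_induction (p := fun g => (fun x => ∏ j, L j x) * g ∈ polyLE d (k + l))
      ?_ ?_ ?_ ?_ hg
    · intro M
      have := prod_mem_polyLE (Fin.append L M)
      convert! this using 1
      ext x
      simp [Fin.prod_univ_add]
    · simp
    · intro f g _ _ h1 h2; rw [mul_add]; exact add_mem h1 h2
    · intro c f _ h; rw [mul_smul_comm]; exact Submodule.smul_mem _ _ h
  · simp
  · intro f g _ _ h1 h2; rw [add_mul]; exact add_mem h1 h2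
  · intro c f _ h; rw [smul_mul_assoc]; exact Submodule.smul_mem _ _ h

theorem const_mem_polyLE (c : ℝ) (k : ℕ) : (fun _ => c) ∈ polyLE d k := by
  have := Submodule.smul_mem _ c (prod_mem_polyLE (d := d) (fun _ : Fin k => AffineMap.const ℝ _ 1))
  convert! this using 1
  ext x; simp

theorem polyLE_mono {k l : ℕ} (h : k ≤ l) : polyLE d k ≤ polyLE d l := by
  intro f hf
  obtain ⟨m, rfl⟩ := Nat.exists_eq_add_of_le h
  have := mul_mem_polyLE hf (const_mem_polyLE 1 m)
  convert! this using 1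
  ext x; simp

theorem coord_mem_polyLE (i : Fin d) : (fun x : E d => x i) ∈ polyLE d 1 :=
  affine_mem_polyLE (EuclideanSpace.proj (𝕜 := ℝ) i : E d →L[ℝ] ℝ).toLinearMap.toAffineMap

theorem prod_mem_polyLE_sum {ι : Type*} (s : Finset ι) (f : ι → E d → ℝ) (k : ι → ℕ)
    (h : ∀ i ∈ s, f i ∈ polyLE d (k i)) : ∏ i ∈ s, f i ∈ polyLE d (∑ i ∈ s, k i) := by
  classical
  induction s using Finset.induction_on with
  | empty => exact const_mem_polyLE 1 0
  | insert i s hi ih =>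
    rw [Finset.prod_insert hi, Finset.sum_insert hi]
    exact mul_mem_polyLE (h i (Finset.mem_insert_self i s))
      (ih fun j hj => h j (Finset.mem_insert_of_mem hj))

theorem monomial_mem_polyLE (β : Fin d →₀ ℕ) :
    (fun x : E d => ∏ i, x i ^ β i) ∈ polyLE d (∑ i, β i) := by
  have := prod_mem_polyLE_sum Finset.univ (fun (i : Fin d) (x : E d) => x i ^ β i) β
    fun i _ => by
      have := prod_mem_polyLE_sum (Finset.range (β i)) (fun _ (x : E d) => x i) (fun _ => 1)
        fun _ _ => coord_mem_polyLE i
      simp only [Finset.prod_const, Finset.card_range, Finset.sum_const, smul_eq_mul, mul_one]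
        at this
      exact this
  convert! this using 1
  ext x; simp

theorem pEval_eq_sum (p : MvPolynomial (Fin d) ℝ) (x : E d) :
    pEval p x = ∑ β ∈ p.support, p.coeff β * ∏ i, x i ^ β i := by
  rw [pEval, MvPolynomial.eval_eq']

theorem pEval_mem_polyLE {k : ℕ} {p : MvPolynomial (Fin d) ℝ} (hp : p.totalDegree ≤ k) :
    pEval p ∈ polyLE d k := by
  have e : pEval p = ∑ β ∈ p.support, p.coeff β • fun x : E d => ∏ i, x i ^ β i := by
    ext x; simp [pEval_eq_sum]
  rw [e]
  refine Submodule.sum_mem _ fun β hβ => Submodule.smul_mem _ _ ?_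
  refine polyLE_mono ?_ (monomial_mem_polyLE β)
  have := (MvPolynomial.le_totalDegree hβ).trans hp
  rwa [Finsupp.sum_fintype _ _ (fun _ => rfl)] at this

theorem exists_pEval_of_affine (L : E d →ᵃ[ℝ] ℝ) :
    ∃ p : MvPolynomial (Fin d) ℝ, p.totalDegree ≤ 1 ∧ ∀ x, L x = pEval p x := by
  refine ⟨MvPolynomial.C (L 0) + ∑ i, MvPolynomial.C (L.linear (EuclideanSpace.single i 1)) *
    MvPolynomial.X i, ?_, fun x => ?_⟩
  · refine (MvPolynomial.totalDegree_add _ _).trans (max_le (by simp) ?_)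
    refine (MvPolynomial.totalDegree_finsetSum _ _).trans (Finset.sup_le fun i _ => ?_)
    exact (MvPolynomial.totalDegree_mul _ _).trans (by simp)
  · have h1 : L x = L.linear x + L 0 := by
      have := L.map_vadd 0 x
      simpa using this
    have h2 : x = ∑ i, x i • EuclideanSpace.single i (1 : ℝ) := by
      have := (EuclideanSpace.basisFun (Fin d) ℝ).sum_repr x
      simpa using this.symm
    rw [h1]
    nth_rewrite 1 [h2]
    simp only [map_sum, map_smul, smul_eq_mul, pEval, map_add, MvPolynomial.eval_C, map_mul,
      MvPolynomial.eval_X]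
    rw [add_comm]
    congr 1
    exact Finset.sum_congr rfl fun i _ => mul_comm _ _

theorem exists_pEval_of_mem_polyLE {k : ℕ} {f : E d → ℝ} (hf : f ∈ polyLE d k) :
    ∃ p : MvPolynomial (Fin d) ℝ, p.totalDegree ≤ k ∧ f = pEval p := by
  refine polyLE_induction (p := fun f => ∃ p : MvPolynomial (Fin d) ℝ, p.totalDegree ≤ k ∧
    f = pEval p) ?_ ?_ ?_ ?_ hf
  · intro L
    choose p hp hpe using fun j => exists_pEval_of_affine (L j)
    refine ⟨∏ j, p j, ?_, ?_⟩
    · refine (MvPolynomial.totalDegree_finsetProd _ _).trans ?_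
      exact (Finset.sum_le_sum fun j _ => hp j).trans (by simp)
    · ext x; simp only [pEval, map_prod]; exact Finset.prod_congr rfl fun j _ => hpe j x
  · exact ⟨0, by simp, by ext x; simp [pEval]⟩
  · rintro _ _ _ _ ⟨p, hp, rfl⟩ ⟨q, hq, rfl⟩
    exact ⟨p + q, (MvPolynomial.totalDegree_add _ _).trans (max_le hp hq),
      by ext x; simp [pEval]⟩
  · rintro c _ _ ⟨p, hp, rfl⟩
    exact ⟨c • p, (MvPolynomial.totalDegree_smul_le _ _).trans hp,
      by ext x; simp [pEval, MvPolynomial.smul_eval]⟩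

instance finiteDimensional_polyLE (k : ℕ) : FiniteDimensional ℝ (polyLE d k) := by
  set m : (Fin d → Fin (k + 1)) → (E d → ℝ) := fun β x => ∏ i, x i ^ (β i : ℕ) with hm
  have hfin : FiniteDimensional ℝ (Submodule.span ℝ (range m)) :=
    FiniteDimensional.span_of_finite ℝ (finite_range m)
  refine Submodule.finiteDimensional_of_le (S₂ := Submodule.span ℝ (range m)) ?_
  intro f hf
  obtain ⟨p, hp, rfl⟩ := exists_pEval_of_mem_polyLE hf
  have e : pEval p = ∑ β ∈ p.support, p.coeff β • fun x : E d => ∏ i, x i ^ β i := by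
    ext x; simp [pEval_eq_sum]
  rw [e]
  refine Submodule.sum_mem _ fun β hβ => Submodule.smul_mem _ _ (Submodule.subset_span ?_)
  have h1 := (MvPolynomial.le_totalDegree hβ).trans hp
  rw [Finsupp.sum_fintype _ _ (fun _ => rfl)] at h1
  refine ⟨fun i => ⟨β i, Nat.lt_succ_of_le ((Finset.single_le_sum (f := fun i => β i)
    (fun _ _ => Nat.zero_le _) (Finset.mem_univ i)).trans h1)⟩, ?_⟩
  ext x; simp [hm]

theorem comp_mem_polyLE {k : ℕ} {f : E d → ℝ} (hf : f ∈ polyLE d k) (φ : E d →ᵃ[ℝ] E d) :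
    (fun x => f (φ x)) ∈ polyLE d k := by
  refine polyLE_induction (p := fun f => (fun x => f (φ x)) ∈ polyLE d k) ?_ ?_ ?_ ?_ hf
  · intro L; exact prod_mem_polyLE fun j => (L j).comp φ
  · exact zero_mem _
  · intro f g _ _ h1 h2; exact add_mem h1 h2
  · intro c f _ h; exact Submodule.smul_mem _ c h

theorem analyticAt_affine (L : E d →ᵃ[ℝ] ℝ) (x : E d) : AnalyticAt ℝ (fun x => L x) x := by
  have e : (fun x => L x) = fun x => (LinearMap.toContinuousLinearMap L.linear) x + L 0 := by
    ext y
    have := L.map_vadd 0 y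
    simpa using this
  rw [e]
  exact (ContinuousLinearMap.analyticAt _ _).add analyticAt_const

theorem analyticAt_of_mem_polyLE {k : ℕ} {f : E d → ℝ} (hf : f ∈ polyLE d k) (x : E d) :
    AnalyticAt ℝ f x := by
  refine polyLE_induction (p := fun f => AnalyticAt ℝ f x) ?_ ?_ ?_ ?_ hf
  · intro L; exact Finset.analyticAt_fun_prod _ fun j _ => analyticAt_affine (L j) x
  · exact analyticAt_const
  · intro f g _ _ h1 h2; exact h1.add h2
  · intro c f _ h; exact h.const_smul

theorem contDiff_of_mem_polyLE {k : ℕ} {f : E d → ℝ} (hf : f ∈ polyLE d k) : ContDiff ℝ ∞ f :=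
  contDiff_iff_contDiffAt.2 fun x => (analyticAt_of_mem_polyLE hf x).contDiffAt

theorem continuous_of_mem_polyLE {k : ℕ} {f : E d → ℝ} (hf : f ∈ polyLE d k) : Continuous f :=
  (contDiff_of_mem_polyLE hf).continuous

theorem differentiable_of_mem_polyLE {k : ℕ} {f : E d → ℝ} (hf : f ∈ polyLE d k) :
    Differentiable ℝ f :=
  (contDiff_of_mem_polyLE hf).differentiable (by simp)

theorem hasFDerivAt_affine (L : E d →ᵃ[ℝ] ℝ) (x : E d) :
    HasFDerivAt (fun x => L x) (LinearMap.toContinuousLinearMap L.linear) x := by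
  have e : (fun x => L x) = fun x => (LinearMap.toContinuousLinearMap L.linear) x + L 0 := by
    ext y
    have := L.map_vadd 0 y
    simpa using this
  rw [e]
  exact (ContinuousLinearMap.hasFDerivAt _).add_const _

theorem fderiv_mem_polyLE {k : ℕ} {f : E d → ℝ} (hf : f ∈ polyLE d k) (w : E d) :
    (fun x => fderiv ℝ f x w) ∈ polyLE d k := by
  classical
  refine polyLE_induction (p := fun f => (fun x => fderiv ℝ f x w) ∈ polyLE d k) ?_ ?_ ?_ ?_ hf
  · intro L
    have e : (fun x => fderiv ℝ (fun x => ∏ j, L j x) x w) = ∑ i, fun x =>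
        ∏ j, (Function.update L i (AffineMap.const ℝ _ ((L i).linear w))) j x := by
      ext x
      rw [(HasFDerivAt.finsetProd (g := fun j x => L j x) fun j (_ : j ∈ Finset.univ) =>
        hasFDerivAt_affine (L j) x).fderiv, Finset.sum_apply, _root_.sum_apply]
      refine Finset.sum_congr rfl fun i _ => ?_
      rw [← Finset.mul_prod_erase _ _ (Finset.mem_univ i), Function.update_self,
        AffineMap.const_apply, _root_.smul_apply, smul_eq_mul, mul_comm]
      congr 1
      refine Finset.prod_congr rfl fun j hj => ?_
      rw [Function.update_of_ne (Finset.ne_of_mem_erase hj)]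
    rw [e]
    exact Submodule.sum_mem _ fun i _ => prod_mem_polyLE _
  · have := (polyLE d k).zero_mem
    convert! this using 1
    ext x; simp
  · intro f g hf hg h1 h2
    have e : (fun x => fderiv ℝ (f + g) x w) =
        (fun x => fderiv ℝ f x w) + fun x => fderiv ℝ g x w := by
      ext x
      rw [fderiv_add (differentiable_of_mem_polyLE hf x) (differentiable_of_mem_polyLE hg x)]
      rfl
    rw [e]; exact add_mem h1 h2
  · intro c f hf h
    have e : (fun x => fderiv ℝ (c • f) x w) = c • (fun x => fderiv ℝ f x w) := by
      ext x
      rw [fderiv_const_smul (differentiable_of_mem_polyLE hf x)]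
      rfl
    rw [e]; exact Submodule.smul_mem _ c h

theorem exists_const_fderiv_of_mem_polyLE_one {f : E d → ℝ} (hf : f ∈ polyLE d 1) :
    ∃ A : E d →L[ℝ] ℝ, ∀ x, fderiv ℝ f x = A := by
  refine polyLE_induction (p := fun f => ∃ A : E d →L[ℝ] ℝ, ∀ x, fderiv ℝ f x = A)
    ?_ ?_ ?_ ?_ hf
  · intro L
    exact ⟨_, fun x => by simpa using (hasFDerivAt_affine (L 0) x).fderiv⟩
  · exact ⟨0, fun x => by simp⟩
  · rintro f g hf hg ⟨A, hA⟩ ⟨B, hB⟩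
    exact ⟨A + B, fun x => by rw [fderiv_add (differentiable_of_mem_polyLE hf x)
      (differentiable_of_mem_polyLE hg x), hA, hB]⟩
  · rintro c f hf ⟨A, hA⟩
    exact ⟨c • A, fun x => by rw [fderiv_const_smul (differentiable_of_mem_polyLE hf x), hA]⟩

theorem eq_zero_of_mem_polyLE {k : ℕ} {f : E d → ℝ} (hf : f ∈ polyLE d k) {c : E d} {r : ℝ}
    (hr : 0 < r) (h : ∫ x in Metric.closedBall c r, f x ^ 2 = 0) : f = 0 := by
  have hc := continuous_of_mem_polyLE hf
  have hint : IntegrableOn (fun x => f x ^ 2) (Metric.closedBall c r) :=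
    (hc.pow 2).continuousOn.integrableOn_compact (isCompact_closedBall _ _)
  rw [setIntegral_eq_zero_iff_of_nonneg_ae (by filter_upwards with x; positivity) hint] at h
  have h2 : (fun x => f x ^ 2) =ᵐ[volume.restrict (Metric.ball c r)] 0 :=
    ae_restrict_of_ae_restrict_of_subset Metric.ball_subset_closedBall h
  have h3 : EqOn (fun x => f x ^ 2) 0 (Metric.ball c r) :=
    Measure.eqOn_open_of_ae_eq h2 Metric.isOpen_ball (hc.pow 2).continuousOn continuousOn_const
  have h4 : f =ᶠ[𝓝 c] 0 := by
    filter_upwards [Metric.ball_mem_nhds c hr] with x hx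
    exact pow_eq_zero_iff two_ne_zero |>.1 (h3 hx)
  exact AnalyticOnNhd.eq_of_eventuallyEq (fun x _ => analyticAt_of_mem_polyLE hf x)
    (fun x _ => analyticAt_const) h4

theorem LinearMap.exists_norm_le_of_injective {W X Y : Type*} [AddCommGroup W] [Module ℝ W]
    [FiniteDimensional ℝ W] [NormedAddCommGroup X] [NormedSpace ℝ X] [NormedAddCommGroup Y]
    [NormedSpace ℝ Y] (A : W →ₗ[ℝ] X) (hA : Function.Injective A) (B : W →ₗ[ℝ] Y) :
    ∃ C > 0, ∀ w, ‖B w‖ ≤ C * ‖A w‖ := by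
  set e := LinearEquiv.ofInjective A hA
  set g := LinearMap.toContinuousLinearMap (B ∘ₗ e.symm.toLinearMap)
  refine ⟨‖g‖ + 1, by positivity, fun w => ?_⟩
  have h := g.le_opNorm (e w)
  have h1 : g (e w) = B w := by simp [g]
  have h2 : ‖e w‖ = ‖A w‖ := rfl
  rw [h1, h2] at h
  exact h.trans (mul_le_mul_of_nonneg_right (by linarith) (norm_nonneg _))

theorem integral_comp_affine_closedBall (f : E d → ℝ) (c : E d) {h : ℝ} (hh : 0 < h) (κ : ℝ) :
    ∫ y in Metric.closedBall (0 : E d) κ, f (c + h • y) =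
      (h ^ d)⁻¹ * ∫ x in Metric.closedBall c (κ * h), f x := by
  rw [← integral_indicator Metric.isClosed_closedBall.measurableSet,
    ← integral_indicator Metric.isClosed_closedBall.measurableSet,
    ← integral_add_left_eq_self ((Metric.closedBall c (κ * h)).indicator f) c]
  have h1 := Measure.integral_comp_smul (volume : Measure (E d))
    (fun x => (Metric.closedBall c (κ * h)).indicator f (c + x)) h
  rw [finrank_euclideanSpace_fin, abs_of_pos (by positivity), smul_eq_mul] at h1
  rw [← h1]
  refine integral_congr_ae (Eventually.of_forall fun y => ?_)
  simp only [indicator, Metric.mem_closedBall, dist_eq_norm, sub_zero, add_sub_cancel_left,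
    norm_smul, Real.norm_of_nonneg hh.le]
  congr 1
  rw [mul_comm κ h, mul_le_mul_iff_right₀ hh]

theorem exists_poly_bounds_unit (d k : ℕ) {κ : ℝ} (hκ : 0 < κ) (R : ℝ) :
    ∃ C > 0, ∀ f ∈ polyLE d k, ∀ x ∈ Metric.closedBall (0 : E d) R,
      f x ^ 2 ≤ C * ∫ y in Metric.closedBall (0 : E d) κ, f y ^ 2 ∧
      ∀ j, (fderiv ℝ f x (EuclideanSpace.single j 1)) ^ 2 ≤
        C * ∫ y in Metric.closedBall (0 : E d) κ, f y ^ 2 := by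
  set μ := (volume : Measure (E d)).restrict (Metric.closedBall 0 κ) with hμ
  have hfin : IsFiniteMeasure μ := ⟨by
    rw [hμ, Measure.restrict_apply_univ]; exact measure_closedBall_lt_top⟩
  have hmem (f : polyLE d k) : MemLp f.1 2 μ := by
    have hc := continuous_of_mem_polyLE f.2
    obtain ⟨B, hB⟩ := (isCompact_closedBall (0 : E d) κ).exists_bound_of_continuousOn
      hc.continuousOn
    refine MemLp.of_bound hc.aestronglyMeasurable B ?_
    exact (ae_restrict_iff' Metric.isClosed_closedBall.measurableSet).2 (Eventually.of_forall hB)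
  let A : polyLE d k →ₗ[ℝ] Lp ℝ 2 μ :=
    { toFun := fun f => (hmem f).toLp f.1
      map_add' := fun f g => rfl
      map_smul' := fun c f => rfl }
  have hAn (f : polyLE d k) : ‖A f‖ ^ 2 = ∫ y in Metric.closedBall (0 : E d) κ, f.1 y ^ 2 := by
    rw [← real_inner_self_eq_norm_sq, L2.inner_def]
    refine integral_congr_ae ?_
    filter_upwards [(hmem f).coeFn_toLp] with x hx
    have : (A f) x = f.1 x := hx
    rw [real_inner_self_eq_norm_sq, this, Real.norm_eq_abs, sq_abs]
  have hA : Function.Injective A := by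
    rw [← LinearMap.ker_eq_bot, LinearMap.ker_eq_bot']
    intro f hf
    apply Subtype.ext
    refine eq_zero_of_mem_polyLE f.2 (c := 0) hκ ?_
    rw [← hAn, hf]; simp
  have : CompactSpace (Metric.closedBall (0 : E d) R) :=
    isCompact_iff_compactSpace.1 (isCompact_closedBall _ _)
  let B0 : polyLE d k →ₗ[ℝ] C(Metric.closedBall (0 : E d) R, ℝ) :=
    { toFun := fun f => ⟨fun x => f.1 x, (continuous_of_mem_polyLE f.2).comp continuous_subtype_val⟩
      map_add' := fun f g => rfl
      map_smul' := fun c f => rfl }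
  let Dj (j : Fin d) : polyLE d k →ₗ[ℝ] polyLE d k :=
    { toFun := fun f => ⟨fun x => fderiv ℝ f.1 x (EuclideanSpace.single j 1),
        fderiv_mem_polyLE f.2 _⟩
      map_add' := fun f g => by
        ext x
        change fderiv ℝ (f.1 + g.1) x _ = _
        rw [fderiv_add (differentiable_of_mem_polyLE f.2 x) (differentiable_of_mem_polyLE g.2 x)]
        rfl
      map_smul' := fun c f => by
        ext x
        change fderiv ℝ (c • f.1) x _ = _
        rw [fderiv_const_smul (differentiable_of_mem_polyLE f.2 x)]
        rfl }
  obtain ⟨C0, hC0, h0⟩ := LinearMap.exists_norm_le_of_injective A hA B0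
  choose C1 hC1 h1 using fun j => LinearMap.exists_norm_le_of_injective A hA (B0 ∘ₗ Dj j)
  have hsum (j : Fin d) : C1 j ^ 2 ≤ ∑ j, C1 j ^ 2 :=
    Finset.single_le_sum (f := fun j => C1 j ^ 2) (fun j _ => sq_nonneg _) (Finset.mem_univ j)
  refine ⟨C0 ^ 2 + ∑ j, C1 j ^ 2, by
    have : 0 ≤ ∑ j, C1 j ^ 2 := Finset.sum_nonneg fun j _ => sq_nonneg _
    positivity, fun f hf x hx => ⟨?_, fun j => ?_⟩⟩
  · have e : f x = B0 ⟨f, hf⟩ ⟨x, hx⟩ := rfl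
    have b := ((B0 ⟨f, hf⟩).norm_coe_le_norm ⟨x, hx⟩).trans (h0 ⟨f, hf⟩)
    rw [← hAn ⟨f, hf⟩, e, ← sq_abs, ← Real.norm_eq_abs]
    refine (pow_le_pow_left₀ (norm_nonneg _) b 2).trans ?_
    rw [mul_pow]
    have : 0 ≤ ∑ j, C1 j ^ 2 := Finset.sum_nonneg fun j _ => sq_nonneg _
    gcongr; linarith
  · have e : fderiv ℝ f x (EuclideanSpace.single j 1) = (B0 ∘ₗ Dj j) ⟨f, hf⟩ ⟨x, hx⟩ := rfl
    have b := (((B0 ∘ₗ Dj j) ⟨f, hf⟩).norm_coe_le_norm ⟨x, hx⟩).trans (h1 j ⟨f, hf⟩)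
    rw [← hAn ⟨f, hf⟩, e, ← sq_abs, ← Real.norm_eq_abs]
    refine (pow_le_pow_left₀ (norm_nonneg _) b 2).trans ?_
    rw [mul_pow]
    gcongr; have := hsum j; nlinarith

/-- Inverse estimates: a polynomial and its derivatives on a ball are bounded by its `L²` norm on
a comparable concentric ball. -/
theorem exists_poly_bounds (d k : ℕ) {κ : ℝ} (hκ : 0 < κ) (R : ℝ) :
    ∃ C > 0, ∀ f ∈ polyLE d k, ∀ (c : E d) (h : ℝ), 0 < h → ∀ x ∈ Metric.closedBall c (R * h),
      f x ^ 2 ≤ C * (h ^ d)⁻¹ * ∫ y in Metric.closedBall c (κ * h), f y ^ 2 ∧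
      ∀ j, (fderiv ℝ f x (EuclideanSpace.single j 1)) ^ 2 ≤
        C * (h ^ d)⁻¹ * (h ^ 2)⁻¹ * ∫ y in Metric.closedBall c (κ * h), f y ^ 2 := by
  obtain ⟨C, hC, H⟩ := exists_poly_bounds_unit d k hκ R
  refine ⟨C, hC, fun f hf c h hh x hx => ?_⟩
  set φ : E d →ᵃ[ℝ] E d := (h • LinearMap.id : E d →ₗ[ℝ] E d).toAffineMap + AffineMap.const ℝ _ c
    with hφ
  have hφe (y : E d) : φ y = c + h • y := by simp [hφ, add_comm]
  set y := h⁻¹ • (x - c) with hy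
  have hxy : x = φ y := by rw [hφe, hy, smul_inv_smul₀ hh.ne']; abel
  have hyR : y ∈ Metric.closedBall (0 : E d) R := by
    rw [Metric.mem_closedBall, dist_eq_norm] at hx
    rw [mem_closedBall_zero_iff, hy, norm_smul, norm_inv, Real.norm_of_nonneg hh.le,
      inv_mul_le_iff₀ hh, mul_comm]
    exact hx
  have hg := comp_mem_polyLE hf φ
  have hint : ∫ y in Metric.closedBall (0 : E d) κ, f (φ y) ^ 2 =
      (h ^ d)⁻¹ * ∫ y in Metric.closedBall c (κ * h), f y ^ 2 := by
    rw [← integral_comp_affine_closedBall (fun x => f x ^ 2) c hh κ]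
    simp only [hφe]
  obtain ⟨h1, h2⟩ := H _ hg y hyR
  rw [hint] at h1 h2
  refine ⟨by rw [hxy]; linarith, fun j => ?_⟩
  have h3 := h2 j
  have hder : fderiv ℝ (fun x => f (φ x)) y (EuclideanSpace.single j 1) =
      h * fderiv ℝ f x (EuclideanSpace.single j 1) := by
    have e : (fun x => f (φ x)) = fun x => f (c + h • x) := by ext z; rw [hφe]
    have hd1 : HasFDerivAt (fun x : E d => c + h • x) (h • ContinuousLinearMap.id ℝ (E d)) y :=
      ((hasFDerivAt_id y).const_smul h).const_add c
    have hd2 : HasFDerivAt f (fderiv ℝ f x) (c + h • y) := by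
      rw [← hφe, ← hxy]; exact (differentiable_of_mem_polyLE hf x).hasFDerivAt
    have hd3 : HasFDerivAt (fun x : E d => f (c + h • x)) _ y := hd2.comp y hd1
    rw [e, hd3.fderiv]
    simp
  rw [hder, mul_pow] at h3
  have : (fderiv ℝ f x (EuclideanSpace.single j 1)) ^ 2 = (h ^ 2)⁻¹ *
      (h ^ 2 * (fderiv ℝ f x (EuclideanSpace.single j 1)) ^ 2) := by
    field_simp
  rw [this]
  calc _ ≤ (h ^ 2)⁻¹ * (C * ((h ^ d)⁻¹ * ∫ y in Metric.closedBall c (κ * h), f y ^ 2)) := by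
        gcongr
    _ = _ := by ring

/-- The polar form (blossom) of `q`, by the polarization identity. -/
def polar (k : ℕ) (q : E d → ℝ) (y : Fin k → E d) : ℝ :=
  (k.factorial : ℝ)⁻¹ * ∑ U ∈ (Finset.univ : Finset (Fin k)).powerset,
    (-1) ^ U.card * ((Uᶜ.card : ℝ) ^ k * q ((Uᶜ.card : ℝ)⁻¹ • ∑ i ∈ Uᶜ, y i))

theorem polar_add (k : ℕ) (f g : E d → ℝ) (y : Fin k → E d) :
    polar k (f + g) y = polar k f y + polar k g y := by
  simp only [polar, Pi.add_apply, mul_add, Finset.sum_add_distrib]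

theorem polar_smul (k : ℕ) (c : ℝ) (f : E d → ℝ) (y : Fin k → E d) :
    polar k (c • f) y = c * polar k f y := by
  simp only [polar, Pi.smul_apply, smul_eq_mul, Finset.mul_sum]
  exact Finset.sum_congr rfl fun U _ => by ring

theorem abs_polar_le {k : ℕ} (hk : k ≠ 0) {q : E d → ℝ} {y : Fin k → E d} {S : Set (E d)}
    (hS : Convex ℝ S) (hy : ∀ i, y i ∈ S) {M : ℝ} (hM : 0 ≤ M) (hq : ∀ x ∈ S, |q x| ≤ M) :
    |polar k q y| ≤ 2 ^ k * k ^ k * M := by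
  have h1 (U : Finset (Fin k)) :
      |(-1) ^ U.card * ((Uᶜ.card : ℝ) ^ k * q ((Uᶜ.card : ℝ)⁻¹ • ∑ i ∈ Uᶜ, y i))| ≤ k ^ k * M := by
    rw [abs_mul, abs_pow, abs_neg, abs_one, one_pow, one_mul, abs_mul, abs_pow, Nat.abs_cast]
    rcases Uᶜ.eq_empty_or_nonempty with h | h
    · rw [h]; simp [hk]; positivity
    · have hc : (Uᶜ.card : ℝ) ≤ k := by
        exact_mod_cast (Finset.card_le_univ _).trans (by simp)
      have hcp : (0 : ℝ) < Uᶜ.card := by exact_mod_cast h.card_pos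
      refine mul_le_mul (by gcongr) (hq _ ?_) (abs_nonneg _) (by positivity)
      rw [Finset.smul_sum]
      refine hS.sum_mem (fun _ _ => by positivity) ?_ fun i _ => hy i
      rw [Finset.sum_const, nsmul_eq_mul, mul_inv_cancel₀ hcp.ne']
  have hf : (1 : ℝ) ≤ k.factorial := by exact_mod_cast Nat.one_le_iff_ne_zero.2 k.factorial_ne_zero
  rw [polar, abs_mul, abs_inv, Nat.abs_cast]
  calc (k.factorial : ℝ)⁻¹ * _ ≤ 1 * _ :=
        mul_le_mul_of_nonneg_right (inv_le_one_of_one_le₀ hf) (abs_nonneg _)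
    _ ≤ ∑ U ∈ (Finset.univ : Finset (Fin k)).powerset, (k : ℝ) ^ k * M := by
        rw [one_mul]
        exact (Finset.abs_sum_le_sum_abs _ _).trans (Finset.sum_le_sum fun U _ => h1 U)
    _ = _ := by simp; ring

theorem polar_prod {k : ℕ} (hk : k ≠ 0) (L : Fin k → (E d →ᵃ[ℝ] ℝ)) (y : Fin k → E d) :
    polar k (fun x => ∏ j, L j x) y = (k.factorial : ℝ)⁻¹ *
      ∑ g : Equiv.Perm (Fin k), ∏ j, L j (y (g j)) := by
  rw [polar]
  congr 1
  have h1 (U : Finset (Fin k)) : (Uᶜ.card : ℝ) ^ k * ∏ j, L j ((Uᶜ.card : ℝ)⁻¹ • ∑ i ∈ Uᶜ, y i) =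
      ∑ g : Fin k → Fin k, if (∀ j, g j ∈ Uᶜ) then ∏ j, L j (y (g j)) else 0 := by
    have h2 (j : Fin k) (hU : Uᶜ.Nonempty) :
        (Uᶜ.card : ℝ) * L j ((Uᶜ.card : ℝ)⁻¹ • ∑ i ∈ Uᶜ, y i) = ∑ i ∈ Uᶜ, L j (y i) := by
      have hcp : (0 : ℝ) < Uᶜ.card := by exact_mod_cast hU.card_pos
      have e (x : E d) : L j x = (L j).linear x + L j 0 := by
        have := (L j).map_vadd 0 x
        simpa using this
      rw [e, map_smul, map_sum, smul_eq_mul, mul_add, mul_inv_cancel_left₀ hcp.ne',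
        Finset.sum_congr rfl fun i _ => e (y i), Finset.sum_add_distrib, Finset.sum_const,
        nsmul_eq_mul]
    have h3 : (Uᶜ.card : ℝ) ^ k * ∏ j, L j ((Uᶜ.card : ℝ)⁻¹ • ∑ i ∈ Uᶜ, y i) =
        ∏ j : Fin k, ∑ i ∈ Uᶜ, L j (y i) := by
      rcases Uᶜ.eq_empty_or_nonempty with h | h
      · rw [h]; simp [hk]
      · rw [← Finset.prod_congr rfl fun j _ => h2 j h, Finset.prod_mul_distrib]
        simp
    rw [h3, Finset.prod_univ_sum, ← Finset.sum_filter]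
    refine Finset.sum_congr ?_ fun _ _ => rfl
    ext g; simp
  simp only [h1, Finset.mul_sum]
  rw [Finset.sum_comm]
  have h4 (g : Fin k → Fin k) : ∑ U ∈ (Finset.univ : Finset (Fin k)).powerset,
      (-1 : ℝ) ^ U.card * (if (∀ j, g j ∈ Uᶜ) then ∏ j, L j (y (g j)) else 0) =
      if Function.Surjective g then ∏ j, L j (y (g j)) else 0 := by
    have h5 : ∑ U ∈ (Finset.univ : Finset (Fin k)).powerset,
      (-1 : ℝ) ^ U.card * (if (∀ j, g j ∈ Uᶜ) then ∏ j, L j (y (g j)) else 0) =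
      (∑ U ∈ ((Finset.univ.image g)ᶜ).powerset, (-1 : ℝ) ^ U.card) * ∏ j, L j (y (g j)) := by
      rw [Finset.sum_mul]
      simp only [mul_ite, mul_zero]
      rw [← Finset.sum_filter]
      refine Finset.sum_congr ?_ fun _ _ => rfl
      ext U
      simp only [Finset.mem_filter, Finset.mem_powerset, Finset.subset_univ, true_and,
        Finset.mem_compl]
      constructor
      · intro h i hi
        rw [Finset.mem_compl, Finset.mem_image]
        rintro ⟨j, _, rfl⟩
        exact h j hi
      · intro h j hj
        have := h hj
        rw [Finset.mem_compl] at this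
        exact this (Finset.mem_image_of_mem g (Finset.mem_univ j))
    rw [h5]
    have h6 := Finset.sum_powerset_neg_one_pow_card (x := (Finset.univ.image g)ᶜ)
    have h7 : (∑ U ∈ ((Finset.univ.image g)ᶜ).powerset, (-1 : ℝ) ^ U.card) =
        if (Finset.univ.image g)ᶜ = ∅ then 1 else 0 := by
      exact_mod_cast congrArg (Int.cast (R := ℝ)) h6
    have h8 : (Finset.univ.image g)ᶜ = ∅ ↔ Function.Surjective g := by
      rw [Finset.compl_eq_empty_iff, ← Finset.coe_eq_univ, Finset.coe_image, Finset.coe_univ,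
        image_univ, range_eq_univ]
    simp only [h7, h8, ite_mul, one_mul, zero_mul]
  rw [Finset.sum_congr rfl fun g _ => h4 g, ← Finset.sum_filter]
  symm
  refine Finset.sum_bij (fun g _ => (g : Fin k → Fin k)) (fun g _ => by
    simpa using g.surjective) (fun g _ g' _ h => Equiv.coe_fn_injective h) (fun g hg => ?_)
    fun g _ => rfl
  have hs : Function.Surjective g := by simpa using hg
  exact ⟨Equiv.ofBijective g (Finite.surjective_iff_bijective.1 hs), Finset.mem_univ _, rfl⟩

/-- The Bernstein representation of a polynomial in barycentric coordinates. -/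
theorem sum_prod_mul_polar {k : ℕ} (hk : k ≠ 0) {q : E d → ℝ} (hq : q ∈ polyLE d k) {ι : Type*}
    [Fintype ι] (w : ι → ℝ) (hw : ∑ i, w i = 1) (v : ι → E d) :
    ∑ τ : Fin k → ι, (∏ j, w (τ j)) * polar k q (fun j => v (τ j)) = q (∑ i, w i • v i) := by
  classical
  refine polyLE_induction (p := fun q => ∑ τ : Fin k → ι, (∏ j, w (τ j)) *
    polar k q (fun j => v (τ j)) = q (∑ i, w i • v i)) ?_ ?_ ?_ ?_ hq
  · intro L
    have hL (j : Fin k) : L j (∑ i, w i • v i) = ∑ i, w i * L j (v i) := by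
      have e (x : E d) : L j x = (L j).linear x + L j 0 := by
        have := (L j).map_vadd 0 x
        simpa using this
      have e2 (i : ι) : w i * L j (v i) = (L j).linear (w i • v i) + w i * L j 0 := by
        rw [e (v i), map_smul, smul_eq_mul, mul_add]
      rw [e, map_sum, Finset.sum_congr rfl fun i _ => e2 i,
        Finset.sum_add_distrib, ← Finset.sum_mul, hw, one_mul]
    have h1 (g : Equiv.Perm (Fin k)) :
        ∑ τ : Fin k → ι, (∏ j, w (τ j)) * ∏ j, L j (v (τ (g j))) =
          ∏ j, L j (∑ i, w i • v i) := by
      rw [Finset.prod_congr rfl fun j _ => hL j, Finset.prod_univ_sum, Fintype.piFinset_univ]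
      refine Fintype.sum_equiv (Equiv.arrowCongr g.symm (Equiv.refl ι)) _ _ fun τ => ?_
      rw [Finset.prod_mul_distrib]
      congr 1
      exact (Equiv.prod_comp g fun j => w (τ j)).symm
    rw [Finset.sum_congr rfl fun τ _ => by rw [polar_prod hk L fun j => v (τ j)]]
    have h2 : ∑ τ : Fin k → ι, (∏ j, w (τ j)) * ((k.factorial : ℝ)⁻¹ *
        ∑ g : Equiv.Perm (Fin k), ∏ j, L j (v (τ (g j)))) =
        (k.factorial : ℝ)⁻¹ * ∑ g : Equiv.Perm (Fin k), ∑ τ : Fin k → ι,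
          (∏ j, w (τ j)) * ∏ j, L j (v (τ (g j))) := by
      rw [Finset.sum_comm, Finset.mul_sum]
      refine Finset.sum_congr rfl fun τ _ => ?_
      rw [← Finset.mul_sum]; ring
    rw [h2, Finset.sum_congr rfl fun g _ => h1 g, Finset.sum_const, Finset.card_univ,
      Fintype.card_perm, Fintype.card_fin, nsmul_eq_mul, inv_mul_cancel_left₀]
    exact_mod_cast k.factorial_ne_zero
  · simp [polar]
  · intro f g _ _ h1 h2
    simp only [polar_add, mul_add, Finset.sum_add_distrib, h1, h2, Pi.add_apply]
  · intro c f _ h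
    simp only [polar_smul, Pi.smul_apply, smul_eq_mul, ← h, Finset.mul_sum]
    exact Finset.sum_congr rfl fun τ _ => by ring

end Polynomials

section WeakGradient

variable {d : ℕ} {Ω : Set (E d)}

theorem comp_ae_eq (j : Fin d) (z : L2v Ω) :
    comp Ω j z =ᵐ[volume.restrict Ω] fun x => z x j :=
  ContinuousLinearMap.coeFn_compLp _ z

/-- The `j`-th component as a continuous linear map. -/
def compL (Ω : Set (E d)) (j : Fin d) : L2v Ω →L[ℝ] L2 Ω :=
  (EuclideanSpace.proj (𝕜 := ℝ) j : E d →L[ℝ] ℝ).compLpL 2 (volume.restrict Ω)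

theorem compL_apply (j : Fin d) (z : L2v Ω) : compL Ω j z = comp Ω j z := rfl

theorem IsTest.memLp {η : E d → ℝ} (hη : IsTest Ω η) : MemLp η 2 (volume.restrict Ω) :=
  hη.1.continuous.memLp_of_hasCompactSupport hη.2.1

theorem IsTest.continuous_fderiv_apply {η : E d → ℝ} (hη : IsTest Ω η) (v : E d) :
    Continuous fun x => fderiv ℝ η x v :=
  (hη.1.continuous_fderiv (by simp)).clm_apply continuous_const

theorem IsTest.memLp_fderiv {η : E d → ℝ} (hη : IsTest Ω η) (v : E d) :
    MemLp (fun x => fderiv ℝ η x v) 2 (volume.restrict Ω) :=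
  (hη.continuous_fderiv_apply v).memLp_of_hasCompactSupport (hη.2.1.fderiv_apply ℝ v)

theorem inner_toLp_eq (u : L2 Ω) {g : E d → ℝ} (hg : MemLp g 2 (volume.restrict Ω)) :
    ⟪u, hg.toLp g⟫ = ∫ x in Ω, u x * g x := by
  rw [L2.inner_def]
  refine integral_congr_ae ?_
  filter_upwards [hg.coeFn_toLp] with x hx
  rw [hx, real_inner_eq_re_inner, RCLike.inner_apply]
  simp [mul_comm]

theorem isWeakPartial_iff {j : Fin d} {u v : L2 Ω} :
    IsWeakPartial Ω j u v ↔ ∀ (η : E d → ℝ) (hη : IsTest Ω η),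
      ⟪u, (hη.memLp_fderiv (EuclideanSpace.single j 1)).toLp _⟫ = -⟪v, hη.memLp.toLp _⟫ := by
  simp only [inner_toLp_eq]
  exact Iff.rfl

theorem IsWeakPartial.add {j : Fin d} {u v u' v' : L2 Ω} (h : IsWeakPartial Ω j u v)
    (h' : IsWeakPartial Ω j u' v') : IsWeakPartial Ω j (u + u') (v + v') := by
  rw [isWeakPartial_iff] at *
  intro η hη
  rw [inner_add_left, inner_add_left, h η hη, h' η hη]
  ring

theorem IsWeakPartial.smul {j : Fin d} {u v : L2 Ω} (h : IsWeakPartial Ω j u v) (c : ℝ) :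
    IsWeakPartial Ω j (c • u) (c • v) := by
  rw [isWeakPartial_iff] at *
  intro η hη
  rw [real_inner_smul_left, real_inner_smul_left, h η hη]
  ring

theorem IsWeakGradient.add {u u' : L2 Ω} {G G' : L2v Ω} (h : IsWeakGradient Ω u G)
    (h' : IsWeakGradient Ω u' G') : IsWeakGradient Ω (u + u') (G + G') := fun j => by
  rw [← compL_apply, map_add]
  exact (h j).add (h' j)

theorem IsWeakGradient.smul {u : L2 Ω} {G : L2v Ω} (h : IsWeakGradient Ω u G) (c : ℝ) :
    IsWeakGradient Ω (c • u) (c • G) := fun j => by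
  rw [← compL_apply, map_smul]
  exact (h j).smul c

theorem IsWeakGradient.sub {u u' : L2 Ω} {G G' : L2v Ω} (h : IsWeakGradient Ω u G)
    (h' : IsWeakGradient Ω u' G') : IsWeakGradient Ω (u - u') (G - G') := by
  have := h.add (h'.smul (-1))
  simpa [sub_eq_add_neg] using this

theorem IsWeakPartial.unique (hΩ : IsOpen Ω) {j : Fin d} {u v v' : L2 Ω}
    (h : IsWeakPartial Ω j u v) (h' : IsWeakPartial Ω j u v') : v = v' := by
  have h0 : ∀ᵐ x ∂volume, x ∈ Ω → (v - v' : L2 Ω) x = 0 := by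
    refine hΩ.ae_eq_zero_of_integral_contDiff_smul_eq_zero ?_ fun g hg hgc hgs => ?_
    · have : LocallyIntegrable (v - v' : L2 Ω) (volume.restrict Ω) :=
        (Lp.memLp (v - v')).locallyIntegrable (by norm_num)
      intro x hx
      obtain ⟨s, hs, hi⟩ := this x
      refine ⟨s ∩ Ω, ?_, ?_⟩
      · exact inter_mem (mem_nhdsWithin_of_mem_nhds hs) self_mem_nhdsWithin
      · rw [IntegrableOn, Measure.restrict_restrict' hΩ.measurableSet] at hi
        exact hi
    · have hη : IsTest Ω g := ⟨hg, hgc, hgs⟩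
      have e : ⟪v - v', hη.memLp.toLp _⟫ = 0 := by
        rw [inner_sub_left]
        linarith [isWeakPartial_iff.1 h g hη, isWeakPartial_iff.1 h' g hη]
      rw [inner_toLp_eq] at e
      rw [← e, ← setIntegral_eq_integral_of_forall_compl_eq_zero (s := Ω)]
      · exact integral_congr_ae (.of_forall fun x => by simp [mul_comm])
      · intro x hx
        rw [image_eq_zero_of_notMem_tsupport fun hx' => hx (hgs hx'), zero_smul]
  rw [← sub_eq_zero]
  refine (Lp.eq_zero_iff_ae_eq_zero).2 ?_
  exact (ae_restrict_iff' hΩ.measurableSet).2 h0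

theorem ext_comp {z z' : L2v Ω} (h : ∀ j, comp Ω j z = comp Ω j z') : z = z' := by
  refine Lp.ext ?_
  have h1 : ∀ᵐ x ∂(volume.restrict Ω), ∀ j, z x j = z' x j := by
    rw [ae_all_iff]
    intro j
    filter_upwards [comp_ae_eq j z, comp_ae_eq j z', EventuallyEq.of_eq (congrArg (fun f : L2 Ω => (f : E d → ℝ)) (h j))]
      with x h1 h2 h3
    rw [← h1, ← h2]
    exact h3
  filter_upwards [h1] with x hx
  ext j
  exact hx j

theorem IsWeakGradient.unique (hΩ : IsOpen Ω) {u : L2 Ω} {G G' : L2v Ω}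
    (h : IsWeakGradient Ω u G) (h' : IsWeakGradient Ω u G') : G = G' :=
  ext_comp fun j => (h j).unique hΩ (h' j)

theorem IsTest.memLp_single {η : E d → ℝ} (hη : IsTest Ω η) (j : Fin d) :
    MemLp (fun x => η x • (EuclideanSpace.single j 1 : E d)) 2 (volume.restrict Ω) :=
  (hη.1.continuous.smul continuous_const).memLp_of_hasCompactSupport hη.2.1.smul_right

/-- The fields `η e_j` with test functions `η`. -/
def testFields (Ω : Set (E d)) : Set (L2v Ω) :=
  {z | ∃ (η : E d → ℝ) (hη : IsTest Ω η) (j : Fin d), z = (hη.memLp_single j).toLp _}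

theorem inner_testField (z : L2v Ω) {η : E d → ℝ} (hη : IsTest Ω η) (j : Fin d) :
    ⟪z, (hη.memLp_single j).toLp _⟫ = ⟪comp Ω j z, hη.memLp.toLp _⟫ := by
  rw [inner_toLp_eq, L2.inner_def]
  refine integral_congr_ae ?_
  filter_upwards [(hη.memLp_single j).coeFn_toLp, comp_ae_eq j z] with x h1 h2
  rw [h1, h2, real_inner_smul_right]
  simp [EuclideanSpace.inner_single_right, mul_comm]

theorem eq_zero_of_inner_test_eq_zero (hΩ : IsOpen Ω) (v : L2 Ω)
    (h : ∀ (η : E d → ℝ) (hη : IsTest Ω η), ⟪v, hη.memLp.toLp _⟫ = 0) (hd : Nonempty (Fin d)) :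
    v = 0 := by
  refine IsWeakPartial.unique hΩ (j := hd.some) (u := 0) ?_ ?_ <;> rw [isWeakPartial_iff] <;>
    intro η hη
  · rw [h η hη]; simp
  · simp

theorem span_testFields_dense (hΩ : IsOpen Ω) :
    (Submodule.span ℝ (testFields Ω)).topologicalClosure = ⊤ := by
  rw [Submodule.topologicalClosure_eq_top_iff, Submodule.eq_bot_iff]
  intro z hz
  refine ext_comp fun j => ?_
  rw [← compL_apply j 0, map_zero]
  refine eq_zero_of_inner_test_eq_zero hΩ _ (fun η hη => ?_) ⟨j⟩
  rw [← inner_testField _ hη]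
  exact Submodule.mem_orthogonal' _ _ |>.1 hz _ (Submodule.subset_span ⟨η, hη, j, rfl⟩)

theorem testField_mem_Hdiv {z : L2v Ω} (hz : z ∈ testFields Ω) : z ∈ Hdiv Ω := by
  obtain ⟨η, hη, j, rfl⟩ := hz
  refine ⟨(hη.memLp_fderiv (EuclideanSpace.single j 1)).toLp _, fun χ hχ => ?_⟩
  have e1 : ∫ x in Ω, fderiv ℝ χ x ((hη.memLp_single j).toLp _ x)
      = ∫ x, η x * fderiv ℝ χ x (EuclideanSpace.single j 1) := by
    rw [← setIntegral_eq_integral_of_forall_compl_eq_zero (s := Ω)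
      (f := fun x => η x * fderiv ℝ χ x (EuclideanSpace.single j 1))]
    · refine integral_congr_ae ?_
      filter_upwards [(hη.memLp_single j).coeFn_toLp] with x hx
      rw [hx, map_smul, smul_eq_mul]
    · intro x hx
      rw [image_eq_zero_of_notMem_tsupport fun hx' => hx (hη.2.2 hx'), zero_mul]
  have e2 : ∫ x in Ω, ((hη.memLp_fderiv (EuclideanSpace.single j 1)).toLp _ : L2 Ω) x * χ x
      = ∫ x, fderiv ℝ η x (EuclideanSpace.single j 1) * χ x := by
    rw [← setIntegral_eq_integral_of_forall_compl_eq_zero (s := Ω)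
      (f := fun x => fderiv ℝ η x (EuclideanSpace.single j 1) * χ x)]
    · refine integral_congr_ae ?_
      filter_upwards [(hη.memLp_fderiv (EuclideanSpace.single j 1)).coeFn_toLp] with x hx
      rw [hx]
    · intro x hx
      rw [image_eq_zero_of_notMem_tsupport (f := χ) fun hx' => hx (hχ.2.2 hx'), mul_zero]
  rw [e1, e2]
  refine integral_mul_fderiv_eq_neg_fderiv_mul_of_integrable ?_ ?_ ?_
    (fun x _ => hη.1.differentiable (by simp) x) (fun x _ => hχ.1.differentiable (by simp) x)
  · exact ((hη.continuous_fderiv_apply _).mul hχ.1.continuous).integrable_of_hasCompactSupport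
      (hχ.2.1.mul_left)
  · exact (hη.1.continuous.mul (hχ.continuous_fderiv_apply _)).integrable_of_hasCompactSupport
      (hη.2.1.mul_right)
  · exact (hη.1.continuous.mul hχ.1.continuous).integrable_of_hasCompactSupport
      (hη.2.1.mul_right)

theorem eq_of_inner_Hdiv_eq (hΩ : IsOpen Ω) {z z' : L2v Ω}
    (h : ∀ w ∈ Hdiv Ω, ⟪z, w⟫ = ⟪z', w⟫) : z = z' := by
  rw [← sub_eq_zero]
  have h0 : z - z' ∈ (Submodule.span ℝ (testFields Ω))ᗮ := by
    rw [Submodule.mem_orthogonal']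
    intro w hw
    induction hw using Submodule.span_induction with
    | mem w hw => rw [inner_sub_left, h w (testField_mem_Hdiv hw), sub_self]
    | zero => simp
    | add a b _ _ ha hb => rw [inner_add_right, ha, hb, add_zero]
    | smul c a _ ha => rw [real_inner_smul_right, ha, mul_zero]
  rw [(Submodule.topologicalClosure_eq_top_iff).1 (span_testFields_dense hΩ)] at h0
  exact h0

/-- Lower semicontinuity of the norm of the weak gradient. -/
theorem IsWeakGradient.norm_le_of_tendsto (hΩ : IsOpen Ω) {ι : Type*} {l : Filter ι} [l.NeBot]
    {u : ι → L2 Ω} {G : ι → L2v Ω} {u₀ : L2 Ω} {G₀ : L2v Ω} {M : ℝ}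
    (hu : Tendsto u l (𝓝 u₀)) (hG : ∀ᶠ i in l, IsWeakGradient Ω (u i) (G i))
    (hM : ∀ᶠ i in l, ‖G i‖ ≤ M) (h₀ : IsWeakGradient Ω u₀ G₀) : ‖G₀‖ ≤ M := by
  have h1 : ∀ z ∈ Submodule.span ℝ (testFields Ω),
      Tendsto (fun i => ⟪G i, z⟫) l (𝓝 ⟪G₀, z⟫) := by
    intro z hz
    induction hz using Submodule.span_induction with
    | mem z hz =>
      obtain ⟨η, hη, j, rfl⟩ := hz
      have e0 := isWeakPartial_iff.1 (h₀ j) η hη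
      rw [inner_testField _ hη, ← neg_neg ⟪comp Ω j G₀, _⟫, ← e0]
      have : Tendsto (fun i => -⟪u i, (hη.memLp_fderiv (EuclideanSpace.single j 1)).toLp _⟫) l
        (𝓝 (-⟪u₀, (hη.memLp_fderiv (EuclideanSpace.single j 1)).toLp _⟫)) :=
        (hu.inner tendsto_const_nhds).neg
      refine this.congr' ?_
      filter_upwards [hG] with i hi
      rw [inner_testField _ hη, isWeakPartial_iff.1 (hi j) η hη, neg_neg]
    | zero => simp
    | add a b _ _ ha hb => simpa only [inner_add_right] using ha.add hb
    | smul c a _ ha => simpa only [real_inner_smul_right] using ha.const_mul c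
  have h2 : ∀ z ∈ Submodule.span ℝ (testFields Ω), ⟪G₀, z⟫ ≤ M * ‖z‖ := fun z hz =>
    le_of_tendsto (h1 z hz) (hM.mono fun i hi => (real_inner_le_norm _ _).trans
      (mul_le_mul_of_nonneg_right hi (norm_nonneg _)))
  have h3 : G₀ ∈ closure (Submodule.span ℝ (testFields Ω) : Set (L2v Ω)) := by
    rw [← Submodule.topologicalClosure_coe, span_testFields_dense hΩ]
    trivial
  have h4 : ⟪G₀, G₀⟫ ≤ M * ‖G₀‖ := by
    have hc : IsClosed {z : L2v Ω | ⟪G₀, z⟫ ≤ M * ‖z‖} :=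
      isClosed_le (continuous_const.inner continuous_id) (continuous_const.mul continuous_norm)
    exact closure_minimal h2 hc h3
  obtain ⟨i, hi⟩ := hM.exists
  have hM0 : 0 ≤ M := (norm_nonneg _).trans hi
  rw [real_inner_self_eq_norm_sq, sq] at h4
  rcases (norm_nonneg G₀).eq_or_lt with h5 | h5
  · rw [← h5]; exact hM0
  · exact le_of_mul_le_mul_right h4 h5

end WeakGradient

section Mollification

theorem sq_lintegral_le {α : Type*} [MeasurableSpace α] {μ : Measure α} {f : α → ℝ≥0∞}
    (hf : AEMeasurable f μ) : (∫⁻ x, f x ∂μ) ^ 2 ≤ μ univ * ∫⁻ x, f x ^ 2 ∂μ := by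
  have h := ENNReal.lintegral_mul_le_Lp_mul_Lq μ Real.HolderConjugate.two_two hf
    (aemeasurable_const (b := (1 : ℝ≥0∞)))
  have h2 := pow_le_pow_left' h 2
  rw [mul_pow, ← ENNReal.rpow_natCast, ← ENNReal.rpow_natCast, ← ENNReal.rpow_natCast,
    ← ENNReal.rpow_mul, ← ENNReal.rpow_mul] at h2
  simp only [Pi.mul_apply, mul_one, ENNReal.one_rpow, lintegral_const, one_mul] at h2
  norm_num at h2
  rw [mul_comm]
  simpa using h2

theorem enorm_add_sq_le (a b : ℝ) : ‖a + b‖ₑ ^ 2 ≤ 2 * ‖a‖ₑ ^ 2 + 2 * ‖b‖ₑ ^ 2 := by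
  have e (c : ℝ) : ‖c‖ₑ ^ 2 = ENNReal.ofReal (c ^ 2) := by
    rw [← ofReal_norm, ← ENNReal.ofReal_pow (norm_nonneg _), Real.norm_eq_abs, sq_abs]
  rw [e, e, e, show (2 : ℝ≥0∞) = ENNReal.ofReal 2 by simp, ← ENNReal.ofReal_mul zero_le_two,
    ← ENNReal.ofReal_mul zero_le_two, ← ENNReal.ofReal_add (by positivity) (by positivity)]
  exact ENNReal.ofReal_le_ofReal (by nlinarith [sq_nonneg (a - b)])

variable {d : ℕ}

/-- A sequence of mollifiers supported in the balls of radius `1 / (n + 1)`. -/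
def mollifier (d n : ℕ) : ContDiffBump (0 : E d) where
  rIn := 1 / (2 * (n + 1))
  rOut := 1 / (n + 1)
  rIn_pos := by positivity
  rIn_lt_rOut := by gcongr; linarith

/-- The convolution of `U` with the `n`-th mollifier. -/
def mollify (n : ℕ) (U : E d → ℝ) : E d → ℝ :=
  convolution ((mollifier d n).normed volume) U (ContinuousLinearMap.lsmul ℝ ℝ) volume

theorem contDiff_mollify (n : ℕ) {U : E d → ℝ} (hU : LocallyIntegrable U) :
    ContDiff ℝ ∞ (mollify n U) :=
  (mollifier d n).hasCompactSupport_normed.contDiff_convolution_left _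
    (mollifier d n).contDiff_normed hU

theorem enorm_mollify_sub_sq_le (n : ℕ) {U : E d → ℝ} (hU : LocallyIntegrable U) (x : E d) :
    ‖mollify n U x - U x‖ₑ ^ 2
      ≤ ∫⁻ y, ‖(mollifier d n).normed volume y‖ₑ * ‖U (x - y) - U x‖ₑ ^ 2 := by
  set η := (mollifier d n).normed (volume : Measure (E d)) with hη
  have hηc : Continuous η := (mollifier d n).continuous_normed
  have h1 : Integrable η := (mollifier d n).integrable_normed
  have hi : Integrable fun y => η y * U (x - y) :=
    (mollifier d n).hasCompactSupport_normed.convolutionExists_left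
      (ContinuousLinearMap.lsmul ℝ ℝ) hηc hU x
  have h2 : mollify n U x - U x = ∫ y, η y * (U (x - y) - U x) := by
    simp only [mul_sub]
    rw [integral_sub hi (h1.mul_const _), integral_mul_const, (mollifier d n).integral_normed,
      one_mul]
    rfl
  have hm : AEMeasurable (fun y => ‖U (x - y) - U x‖ₑ) (volume.withDensity fun y => ‖η y‖ₑ) := by
    have : AEStronglyMeasurable (fun y => U (x - y)) volume :=
      hU.aestronglyMeasurable.comp_quasiMeasurePreserving
        (quasiMeasurePreserving_sub_left volume x)
    exact ((this.sub aestronglyMeasurable_const).enorm).mono_ac (withDensity_absolutelyContinuous _ _)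
  have hw (F : E d → ℝ≥0∞) : ∫⁻ y, F y ∂(volume.withDensity fun y => ‖η y‖ₑ)
      = ∫⁻ y, ‖η y‖ₑ * F y :=
    lintegral_withDensity_eq_lintegral_mul_non_measurable _ hηc.measurable.enorm
      (.of_forall fun _ => enorm_lt_top) F
  have hone : (volume.withDensity fun y => ‖η y‖ₑ) univ = 1 := by
    rw [withDensity_apply _ MeasurableSet.univ, Measure.restrict_univ]
    have : ∫⁻ y, ‖η y‖ₑ = ENNReal.ofReal (∫ y, η y) := by
      rw [ofReal_integral_eq_lintegral_ofReal h1
        (.of_forall fun y => (mollifier d n).nonneg_normed y)]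
      exact lintegral_congr fun y => Real.enorm_of_nonneg ((mollifier d n).nonneg_normed y)
    rw [this, (mollifier d n).integral_normed, ENNReal.ofReal_one]
  calc ‖mollify n U x - U x‖ₑ ^ 2
      ≤ (∫⁻ y, ‖U (x - y) - U x‖ₑ ∂(volume.withDensity fun y => ‖η y‖ₑ)) ^ 2 := by
        gcongr
        rw [h2, hw]
        refine (enorm_integral_le_lintegral_enorm _).trans_eq ?_
        exact lintegral_congr fun y => enorm_mul _ _
    _ ≤ _ := sq_lintegral_le hm
    _ = _ := by rw [hone, one_mul, hw]

theorem tendsto_mollify {U : E d → ℝ} (hU : MemLp U 2 volume) :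
    Tendsto (fun n => ∫⁻ x, ‖mollify n U x - U x‖ₑ ^ 2) atTop (𝓝 0) := by
  have hloc : LocallyIntegrable U := hU.locallyIntegrable (by norm_num)
  set W : Lp ℝ 2 (volume : Measure (E d)) := hU.toLp U with hW
  have : Fact ((2 : ℝ≥0∞) ≠ ⊤) := ⟨by norm_num⟩
  have hnorm (y : E d) : ∫⁻ x, ‖U (x - y) - U x‖ₑ ^ 2
      = ‖(DomAddAct.mk (-y) +ᵥ W) - W‖ₑ ^ 2 := by
    rw [Lp.enorm_def, eLpNorm_eq_lintegral_rpow_enorm_toReal (by norm_num) (by norm_num),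
      ← ENNReal.rpow_natCast, ← ENNReal.rpow_mul]
    rw [show (1 / (2 : ℝ≥0∞).toReal * ((2 : ℕ) : ℝ)) = 1 by norm_num, ENNReal.rpow_one]
    refine lintegral_congr_ae ?_
    have h1 : ∀ᵐ x : E d, W (-y +ᵥ x) = U (-y +ᵥ x) :=
      (measurePreserving_vadd (-y) (volume : Measure (E d))).quasiMeasurePreserving.ae
        hU.coeFn_toLp
    filter_upwards [Lp.coeFn_sub (DomAddAct.mk (-y) +ᵥ W) W, hU.coeFn_toLp,
      DomAddAct.vadd_Lp_ae_eq (DomAddAct.mk (-y)) W, h1] with x h1 h2 h3 h4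
    rw [h1, Pi.sub_apply, h2, h3, Equiv.symm_apply_apply, h4, vadd_eq_add, neg_add_eq_sub]
    norm_num
  have hcont : Tendsto (fun y : E d => ‖(DomAddAct.mk (-y) +ᵥ W) - W‖ₑ ^ 2) (𝓝 0) (𝓝 0) := by
    have : Continuous fun y : E d => ‖(DomAddAct.mk (-y) +ᵥ W) - W‖ₑ ^ 2 := by
      have h1 : Continuous fun y : E d => DomAddAct.mk (-y) +ᵥ W :=
        (DomAddAct.continuous_mk.comp continuous_neg).vadd continuous_const
      exact (ENNReal.continuous_pow 2).comp (h1.sub continuous_const).enorm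
    simpa using this.tendsto 0
  refine ENNReal.tendsto_nhds_zero.2 fun ε hε => ?_
  obtain ⟨δ, hδ, hball⟩ := Metric.eventually_nhds_iff.1 (ENNReal.tendsto_nhds_zero.1 hcont ε hε)
  obtain ⟨n₀, hn₀⟩ := exists_nat_one_div_lt hδ
  filter_upwards [eventually_ge_atTop n₀] with n hn
  set η := (mollifier d n).normed (volume : Measure (E d)) with hη
  have hηc : Continuous η := (mollifier d n).continuous_normed
  have h1 : Integrable η := (mollifier d n).integrable_normed
  have hone : ∫⁻ y, ‖η y‖ₑ = 1 := by
    have : ∫⁻ y, ‖η y‖ₑ = ENNReal.ofReal (∫ y, η y) := by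
      rw [ofReal_integral_eq_lintegral_ofReal h1
        (.of_forall fun y => (mollifier d n).nonneg_normed y)]
      exact lintegral_congr fun y => Real.enorm_of_nonneg ((mollifier d n).nonneg_normed y)
    rw [this, (mollifier d n).integral_normed, ENNReal.ofReal_one]
  have hmeas : AEMeasurable (fun p : E d × E d => ‖η p.2‖ₑ * ‖U (p.1 - p.2) - U p.1‖ₑ ^ 2)
      (volume.prod volume) := by
    refine (hηc.comp continuous_snd).measurable.enorm.aemeasurable.mul
      (AEMeasurable.pow_const ?_ 2)
    have a1 : AEStronglyMeasurable (fun p : E d × E d => U (p.1 - p.2)) (volume.prod volume) :=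
      hU.1.comp_quasiMeasurePreserving
        (quasiMeasurePreserving_sub volume volume)
    have a2 : AEStronglyMeasurable (fun p : E d × E d => U p.1) (volume.prod volume) :=
      hU.1.comp_fst
    exact (a1.sub a2).enorm
  calc ∫⁻ x, ‖mollify n U x - U x‖ₑ ^ 2
      ≤ ∫⁻ x, ∫⁻ y, ‖η y‖ₑ * ‖U (x - y) - U x‖ₑ ^ 2 :=
        lintegral_mono fun x => enorm_mollify_sub_sq_le n hloc x
    _ = ∫⁻ y, ∫⁻ x, ‖η y‖ₑ * ‖U (x - y) - U x‖ₑ ^ 2 := lintegral_lintegral_swap hmeas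
    _ = ∫⁻ y, ‖η y‖ₑ * ‖(DomAddAct.mk (-y) +ᵥ W) - W‖ₑ ^ 2 := by
        refine lintegral_congr fun y => ?_
        rw [lintegral_const_mul' _ _ enorm_ne_top, hnorm]
    _ ≤ ∫⁻ y, ‖η y‖ₑ * ε := by
        refine lintegral_mono fun y => ?_
        rcases eq_or_ne (η y) 0 with h0 | h0
        · simp [h0]
        · have : y ∈ Function.support η := h0
          rw [hη, (mollifier d n).support_normed_eq, Metric.mem_ball] at this
          refine mul_le_mul_right (hball (this.trans_le (le_trans ?_ hn₀.le))) _
          change 1 / ((n : ℝ) + 1) ≤ _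
          gcongr
    _ = ε := by rw [lintegral_mul_const _ hηc.measurable.enorm, hone, one_mul]

theorem fderiv_mollify {Ω : Set (E d)} (hΩ : MeasurableSet Ω) (n : ℕ) (u v : L2 Ω) {j : Fin d}
    (huv : IsWeakPartial Ω j u v) {x : E d} (hx : Metric.closedBall x (1 / (n + 1)) ⊆ Ω)
    (hu : LocallyIntegrable (Ω.indicator u)) :
    fderiv ℝ (mollify n (Ω.indicator u)) x (EuclideanSpace.single j 1)
      = mollify n (Ω.indicator v) x := by
  set η := (mollifier d n).normed (volume : Measure (E d)) with hη
  have hsm : ContDiff ℝ ∞ η := (mollifier d n).contDiff_normed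
  have hcs : HasCompactSupport η := (mollifier d n).hasCompactSupport_normed
  have hts : tsupport η = Metric.closedBall 0 (1 / (n + 1)) := (mollifier d n).tsupport_normed_eq
  have htest : IsTest Ω fun s => η (x - s) := by
    have hh : tsupport (fun s => η (x - s)) ⊆ Metric.closedBall x (1 / (n + 1)) := by
      refine closure_minimal (fun s hs => ?_) Metric.isClosed_closedBall
      have : x - s ∈ tsupport η := subset_tsupport _ hs
      rw [hts, mem_closedBall_zero_iff] at this
      rwa [Metric.mem_closedBall, dist_eq_norm, norm_sub_rev]
    refine ⟨hsm.comp (contDiff_const.sub contDiff_id), ?_, hh.trans hx⟩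
    exact HasCompactSupport.of_support_subset_isCompact (isCompact_closedBall x (1 / (n + 1)))
      ((subset_tsupport _).trans hh)
  have hd := (hcs.hasFDerivAt_convolution_left (ContinuousLinearMap.lsmul ℝ ℝ)
    (hsm.of_le (by simp)) hu x).fderiv
  have hce := (hcs.fderiv ℝ).convolutionExists_left
    (ContinuousLinearMap.precompL (E d) (ContinuousLinearMap.lsmul ℝ ℝ))
    (hsm.continuous_fderiv (by simp)) hu x
  have h1 : fderiv ℝ (mollify n (Ω.indicator u)) x (EuclideanSpace.single j 1)
      = ∫ s, fderiv ℝ η (x - s) (EuclideanSpace.single j 1) * Ω.indicator u s := by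
    rw [mollify, hd, convolution_def, ContinuousLinearMap.integral_apply hce]
    rw [← integral_sub_left_eq_self _ volume x]
    refine integral_congr_ae (.of_forall fun s => ?_)
    simp [ContinuousLinearMap.precompL_apply]
  have h2 : mollify n (Ω.indicator v) x = ∫ s, η (x - s) * Ω.indicator v s := by
    rw [mollify, convolution_eq_swap]
    rfl
  have h3 : ∀ s, fderiv ℝ (fun s => η (x - s)) s (EuclideanSpace.single j 1)
      = - fderiv ℝ η (x - s) (EuclideanSpace.single j 1) := by
    intro s
    have := (hsm.differentiable (by simp) (x - s)).hasFDerivAt.comp s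
      ((hasFDerivAt_const x s).sub (hasFDerivAt_id s))
    rw [show (fun s => η (x - s)) = η ∘ HSub.hSub x from rfl, this.fderiv]
    simp
  have h4 := huv _ htest
  rw [h1, h2]
  have e1 (g : E d → ℝ) (w : L2 Ω) : ∫ s, g s * Ω.indicator w s = ∫ s in Ω, w s * g s := by
    rw [← integral_indicator hΩ]
    refine integral_congr_ae (.of_forall fun s => ?_)
    by_cases hs : s ∈ Ω <;> simp [hs, mul_comm]
  rw [e1, e1]
  simp only [h3, mul_neg, integral_neg] at h4
  linarith

/-- Functions with weak derivatives in `L²(Ω)` are approximated by smooth functions, locally with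
their derivatives. -/
theorem exists_smooth_approx {Ω : Set (E d)} (hΩ : IsOpen Ω) (u : L2 Ω) (v : Fin d → L2 Ω)
    (huv : ∀ j, IsWeakPartial Ω j u (v j)) :
    ∃ w : ℕ → E d → ℝ, (∀ n, ContDiff ℝ ∞ (w n)) ∧
      Tendsto (fun n => ∫⁻ x in Ω, ‖w n x - u x‖ₑ ^ 2) atTop (𝓝 0) ∧
      ∀ K, IsCompact K → K ⊆ Ω → ∀ j, Tendsto (fun n => ∫⁻ x in K,
        ‖fderiv ℝ (w n) x (EuclideanSpace.single j 1) - v j x‖ₑ ^ 2) atTop (𝓝 0) := by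
  have hmem (g : L2 Ω) : MemLp (Ω.indicator g) 2 volume :=
    (memLp_indicator_iff_restrict hΩ.measurableSet).2 (Lp.memLp g)
  have hloc (g : L2 Ω) : LocallyIntegrable (Ω.indicator g) :=
    (hmem g).locallyIntegrable (by norm_num)
  refine ⟨fun n => mollify n (Ω.indicator u), fun n => contDiff_mollify n (hloc u), ?_, ?_⟩
  · refine tendsto_of_tendsto_of_tendsto_of_le_of_le tendsto_const_nhds
      (tendsto_mollify (hmem u)) (fun n => zero_le) fun n => ?_
    refine le_trans (le_of_eq ?_) (setLIntegral_le_lintegral Ω _)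
    refine setLIntegral_congr_fun hΩ.measurableSet fun x hx => ?_
    simp [hx]
  · intro K hK hKΩ j
    obtain ⟨δ, hδ, hKδ⟩ := hK.exists_cthickening_subset_open hΩ hKΩ
    obtain ⟨n₀, hn₀⟩ := exists_nat_one_div_lt hδ
    refine tendsto_of_tendsto_of_tendsto_of_le_of_le' tendsto_const_nhds
      (tendsto_mollify (hmem (v j))) (.of_forall fun n => zero_le) ?_
    filter_upwards [eventually_ge_atTop n₀] with n hn
    refine le_trans (le_of_eq ?_) (setLIntegral_le_lintegral K _)
    refine setLIntegral_congr_fun hK.measurableSet fun x hx => ?_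
    have hb : Metric.closedBall x (1 / ((n : ℝ) + 1)) ⊆ Ω := by
      refine Subset.trans (fun y hy => ?_) hKδ
      refine Metric.mem_cthickening_of_dist_le y x δ K hx ((Metric.mem_closedBall.1 hy).trans ?_)
      refine le_trans ?_ hn₀.le
      gcongr
    simp only [fderiv_mollify hΩ.measurableSet n u (v j) (huv j) hb (hloc u)]
    simp [hKΩ hx]

end Mollification

section IntegralPoly

variable {d : ℕ}

theorem exists_eval_combination (W : Submodule ℝ (E d → ℝ)) [FiniteDimensional ℝ W]
    (L : Module.Dual ℝ W) :
    ∃ (ι : Type) (_ : Fintype ι) (c : ι → ℝ) (y : ι → E d),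
      ∀ f : W, L f = ∑ i, c i * (f : E d → ℝ) (y i) := by
  let ev (x : E d) : Module.Dual ℝ W := (LinearMap.proj x).comp W.subtype
  have htop : Submodule.span ℝ (range ev) = ⊤ := by
    rw [← Subspace.dualCoannihilator_dualAnnihilator_eq (W := Submodule.span ℝ (range ev))]
    have : (Submodule.span ℝ (range ev)).dualCoannihilator = ⊥ := by
      rw [Submodule.eq_bot_iff]
      intro f hf
      rw [Submodule.mem_dualCoannihilator] at hf
      ext x
      exact hf (ev x) (Submodule.subset_span ⟨x, rfl⟩)
    rw [this, Submodule.dualAnnihilator_bot]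
  have hL : L ∈ Submodule.span ℝ (range ev) := htop ▸ Submodule.mem_top
  obtain ⟨c, rfl⟩ := Finsupp.mem_span_range_iff_exists_finsupp.1 hL
  refine ⟨Fin c.support.card, inferInstance, fun i => c (c.support.equivFin.symm i),
    fun i => c.support.equivFin.symm i, fun f => ?_⟩
  rw [Equiv.sum_comp c.support.equivFin.symm (fun x => c x * (f : E d → ℝ) x),
    Finset.sum_coe_sort c.support (fun x => c x * (f : E d → ℝ) x), Finsupp.sum,
    LinearMap.sum_apply]
  rfl

/-- Integrals of polynomials of degree at most `k` that depend on a parameter are polynomials of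
degree at most `k`. -/
theorem integral_mem_polyLE {k : ℕ} {α : Type*} [MeasurableSpace α] {μ : Measure α}
    {F : α → E d → ℝ} (hF : ∀ a, F a ∈ polyLE d k) (hi : ∀ x, Integrable (fun a => F a x) μ) :
    (fun x => ∫ a, F a x ∂μ) ∈ polyLE d k := by
  have : FiniteDimensional ℝ (polyLE d k) := finiteDimensional_polyLE k
  let b := Module.finBasis ℝ (polyLE d k)
  choose ι hι c y hc using fun i => exists_eval_combination (polyLE d k) (b.coord i)
  have h1 (a : α) (x : E d) :
      F a x = ∑ i, (∑ l, c i l * F a (y i l)) * (b i : E d → ℝ) x := by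
    have h := b.sum_repr ⟨F a, hF a⟩
    have h2 := congrFun (congrArg (Subtype.val) h) x
    simp only at h2
    rw [← h2]
    simp only [Submodule.coe_sum, Submodule.coe_smul, Finset.sum_apply, Pi.smul_apply, smul_eq_mul]
    refine Finset.sum_congr rfl fun i _ => ?_
    rw [← hc i ⟨F a, hF a⟩]
    rfl
  have h2 : (fun x => ∫ a, F a x ∂μ)
      = ∑ i, (∑ l, c i l * ∫ a, F a (y i l) ∂μ) • (b i : E d → ℝ) := by
    ext x
    simp only [Finset.sum_apply, Pi.smul_apply, smul_eq_mul]
    simp_rw [h1 _ x]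
    rw [integral_finsetSum _ fun i _ =>
      (integrable_finsetSum _ fun l _ => (hi _).const_mul _).mul_const _]
    refine Finset.sum_congr rfl fun i _ => ?_
    rw [integral_mul_const, integral_finsetSum _ fun l _ => (hi _).const_mul _]
    simp only [integral_const_mul]
  rw [h2]
  exact Submodule.sum_mem _ fun i _ => Submodule.smul_mem _ _ (b i).2

end IntegralPoly

section Poincare

variable {d : ℕ}

theorem lintegral_comp_add_smul {H : E d → ℝ≥0∞} (hH : Measurable H) (b : E d) {t : ℝ}
    (ht : t ≠ 0) : ∫⁻ x, H (b + t • x) = ENNReal.ofReal |(t ^ d)⁻¹| * ∫⁻ x, H x := by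
  have h1 : Measurable fun x => H (b + x) := hH.comp (measurable_const_add b)
  have h2 := lintegral_map (μ := (volume : Measure (E d))) h1 (measurable_const_smul t)
  rw [Measure.map_addHaar_smul _ ht, lintegral_smul_measure, finrank_euclideanSpace_fin,
    lintegral_add_left_eq_self, smul_eq_mul] at h2
  exact h2.symm

theorem lintegral_comp_add_smul_le {H : E d → ℝ≥0∞} (hH : Measurable H) (b : E d) {t : ℝ}
    (ht : 1 / 2 ≤ t) : ∫⁻ x, H (b + t • x) ≤ 2 ^ d * ∫⁻ x, H x := by
  rw [lintegral_comp_add_smul hH b (by linarith)]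
  gcongr
  rw [show (2 : ℝ≥0∞) ^ d = ENNReal.ofReal (2 ^ d) by
    rw [ENNReal.ofReal_pow zero_le_two]; simp, abs_inv, abs_pow, ← inv_pow]
  refine ENNReal.ofReal_le_ofReal (pow_le_pow_left₀ (by positivity) ?_ d)
  rw [abs_of_nonneg (by linarith)]
  exact inv_le_of_inv_le₀ two_pos (by linarith)

theorem lintegral_segment_le {H : E d → ℝ≥0∞} (hH : Measurable H) (B K : Set (E d))
    (t : ℝ) : ∫⁻ y in B, ∫⁻ x in K, H (y + t • (x - y))
      ≤ (volume B + volume K) * (2 ^ d * ∫⁻ x, H x) := by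
  have e (x y : E d) : y + t • (x - y) = (1 - t) • y + t • x := by module
  rcases le_total (1 / 2) t with ht | ht
  · calc ∫⁻ y in B, ∫⁻ x in K, H (y + t • (x - y))
        ≤ ∫⁻ y in B, 2 ^ d * ∫⁻ x, H x := by
          refine lintegral_mono fun y => ?_
          refine (setLIntegral_le_lintegral K _).trans ?_
          simp only [e]
          exact lintegral_comp_add_smul_le hH _ ht
      _ = volume B * (2 ^ d * ∫⁻ x, H x) := by rw [setLIntegral_const, mul_comm]
      _ ≤ _ := by gcongr; exact le_self_add
  · have hm : AEMeasurable (fun p : E d × E d => H (p.1 + t • (p.2 - p.1)))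
        ((volume.restrict B).prod (volume.restrict K)) := by
      refine (hH.comp ?_).aemeasurable
      fun_prop
    rw [lintegral_lintegral_swap hm]
    calc ∫⁻ x in K, ∫⁻ y in B, H (y + t • (x - y))
        ≤ ∫⁻ x in K, 2 ^ d * ∫⁻ x, H x := by
          refine lintegral_mono fun x => ?_
          refine (setLIntegral_le_lintegral B _).trans ?_
          simp only [e, add_comm ((1 - t) • _) _]
          exact lintegral_comp_add_smul_le hH _ (by linarith)
      _ = volume K * (2 ^ d * ∫⁻ x, H x) := by rw [setLIntegral_const, mul_comm]
      _ ≤ _ := by gcongr; exact le_add_self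

/-- The points of `V` from which one sees the whole ball `B(c, r)` inside `V`. -/
def starKernel (V : Set (E d)) (c : E d) (r : ℝ) : Set (E d) :=
  {x | ∀ y ∈ Metric.closedBall c r, segment ℝ x y ⊆ V}

theorem starKernel_subset (V : Set (E d)) (c : E d) {r : ℝ} (hr : 0 ≤ r) :
    starKernel V c r ⊆ V := fun x hx =>
  hx c (Metric.mem_closedBall_self hr) (left_mem_segment ℝ x c)

theorem segment_subset_starKernel {V : Set (E d)} {c : E d} {r : ℝ} {x y : E d}
    (hx : x ∈ starKernel V c r) (hy : y ∈ Metric.closedBall c r) :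
    segment ℝ x y ⊆ starKernel V c r := by
  rintro p ⟨a, b, ha, hb, hab, rfl⟩ y' hy' q ⟨a', b', ha', hb', hab', rfl⟩
  have hs : 0 ≤ a' * b + b' := by positivity
  have hsum : a' * a + (a' * b + b') = 1 := by
    rw [← add_assoc, ← mul_add, hab, mul_one, hab']
  rcases hs.eq_or_lt with h0 | h0
  · have h1 : a' * b = 0 := by nlinarith [mul_nonneg ha' hb]
    have h2 : b' = 0 := by linarith
    have h3 : a' * a = 1 := by linarith
    have : a' • (a • x + b • y) + b' • y' = x := by
      rw [smul_add, smul_smul, smul_smul, h1, h2, h3]; simp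
    rw [this]
    exact hx y hy (left_mem_segment ℝ x y)
  · have hy2 : ((a' * b + b')⁻¹ * (a' * b)) • y + ((a' * b + b')⁻¹ * b') • y'
        ∈ Metric.closedBall c r :=
      (convex_closedBall c r) hy hy' (by positivity) (by positivity) (by field_simp)
    refine hx _ hy2 ⟨a' * a, a' * b + b', by positivity, hs, hsum, ?_⟩
    rw [smul_add, smul_add, smul_smul, smul_smul, smul_smul, smul_smul,
      mul_inv_cancel_left₀ h0.ne', mul_inv_cancel_left₀ h0.ne', add_assoc]

theorem isOpen_starKernel {V : Set (E d)} (hV : IsOpen V) (c : E d) (r : ℝ) :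
    IsOpen (starKernel V c r) := by
  rw [isOpen_iff_mem_nhds]
  intro x hx
  have hK : IsCompact (Metric.closedBall c r ×ˢ Icc (0 : ℝ) 1) :=
    (isCompact_closedBall c r).prod isCompact_Icc
  have h := hK.eventually_forall_of_forall_eventually (x₀ := x)
    (P := fun x p => (1 - p.2) • x + p.2 • p.1 ∈ V) fun p hp => by
      have hc : ContinuousAt (fun z : E d × (E d × ℝ) => (1 - z.2.2) • z.1 + z.2.2 • z.2.1)
        (x, p) := by fun_prop
      refine hc (hV.mem_nhds ?_)
      exact hx p.1 hp.1 ⟨1 - p.2, p.2, by linarith [hp.2.2], hp.2.1, by ring, rfl⟩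
  filter_upwards [h] with z hz y hy q hq
  obtain ⟨a, b, ha, hb, hab, rfl⟩ := hq
  have := hz (y, b) ⟨hy, hb, by linarith⟩
  rwa [show 1 - b = a by linarith] at this

theorem ball_subset_starKernel {V : Set (E d)} {c : E d} {r : ℝ}
    (h : Metric.closedBall c r ⊆ V) : Metric.closedBall c r ⊆ starKernel V c r :=
  fun _ hx _ hy => ((convex_closedBall c r).segment_subset hx hy).trans h

/-- The measure for averages over the segments from the points of `B(c, r)`. -/
def segMeasure (c : E d) (r : ℝ) : Measure (E d × ℝ) :=
  (volume.restrict (Metric.closedBall c r)).prod (volume.restrict (Icc 0 1))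

/-- The field `q` integrated along the segments from the points of `B(c, r)` to `x`. -/
def segIntegral (c : E d) (r : ℝ) (q : Fin d → E d → ℝ) (x : E d) : ℝ :=
  ∫ p, ∑ j, q j (p.1 + p.2 • (x - p.1)) * (x j - p.1 j) ∂(segMeasure c r)

theorem segMeasure_eq (c : E d) (r : ℝ) :
    segMeasure c r = (volume.prod volume).restrict (Metric.closedBall c r ×ˢ Icc 0 1) :=
  Measure.prod_restrict _ _

theorem Continuous.integrable_segMeasure (c : E d) (r : ℝ) {F : E d × ℝ → ℝ} (hF : Continuous F) :
    Integrable F (segMeasure c r) := by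
  rw [segMeasure_eq]
  exact hF.continuousOn.integrableOn_compact ((isCompact_closedBall c r).prod isCompact_Icc)

theorem segIntegral_mem_polyLE {k : ℕ} (c : E d) (r : ℝ) {q : Fin d → E d → ℝ}
    (hq : ∀ j, q j ∈ polyLE d k) : segIntegral c r q ∈ polyLE d (k + 1) := by
  refine integral_mem_polyLE (fun p => ?_) fun x => ?_
  · have : (fun x => ∑ j, q j (p.1 + p.2 • (x - p.1)) * (x j - p.1 j))
        = ∑ j, (fun x => q j (p.1 + p.2 • (x - p.1))) * fun x => x j - p.1 j := by
      ext x; simp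
    rw [this]
    refine Submodule.sum_mem _ fun j _ => mul_mem_polyLE ?_ ?_
    · have := comp_mem_polyLE (hq j) 
        (AffineMap.const ℝ (E d) p.1 + p.2 • (AffineMap.id ℝ (E d) - AffineMap.const ℝ (E d) p.1))
      exact this
    · exact Submodule.sub_mem _ (coord_mem_polyLE j) (const_mem_polyLE _ 1)
  · refine Continuous.integrable_segMeasure c r ?_
    refine continuous_finsetSum _ fun j _ => ?_
    have := continuous_of_mem_polyLE (hq j)
    fun_prop

theorem segIntegral_fderiv {w : E d → ℝ} (hw : ContDiff ℝ ∞ w) (c : E d) (r : ℝ) (x : E d) :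
    segIntegral c r (fun j z => fderiv ℝ w z (EuclideanSpace.single j 1)) x
      = ∫ y in Metric.closedBall c r, (w x - w y) := by
  have hcont : Continuous fun z => fderiv ℝ w z := hw.continuous_fderiv (by simp)
  have e (y z : E d) : ∑ j, fderiv ℝ w z (EuclideanSpace.single j 1) * (x j - y j)
      = fderiv ℝ w z (x - y) := by
    have h := (EuclideanSpace.basisFun (Fin d) ℝ).sum_repr (x - y)
    conv_rhs => rw [← h]
    rw [map_sum]
    refine Finset.sum_congr rfl fun j _ => ?_
    rw [map_smul]
    simp [mul_comm]
  simp only [segIntegral, e]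
  rw [segMeasure, integral_prod]
  · refine integral_congr_ae (.of_forall fun y => ?_)
    simp only
    rw [integral_Icc_eq_integral_Ioc, ← intervalIntegral.integral_of_le zero_le_one]
    rw [intervalIntegral.integral_eq_sub_of_hasDerivAt (f := fun t : ℝ => w (y + t • (x - y)))]
    · simp
    · intro t _
      have h1 : HasDerivAt (fun t : ℝ => y + t • (x - y)) (x - y) t := by
        simpa using ((hasDerivAt_id t).smul_const (x - y)).const_add y
      exact (hw.differentiable (by simp) _).hasFDerivAt.comp_hasDerivAt t h1
    · refine Continuous.intervalIntegrable ?_ _ _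
      exact (hcont.comp (by fun_prop)).clm_apply continuous_const
  · refine Continuous.integrable_segMeasure c r ?_
    exact (hcont.comp (by fun_prop)).clm_apply (by fun_prop)

theorem enorm_sum_mul_sq_le (a b : Fin d → ℝ) {R : ℝ} (hR : ∑ j, b j ^ 2 ≤ R ^ 2) :
    ‖∑ j, a j * b j‖ₑ ^ 2 ≤ ENNReal.ofReal (R ^ 2) * ∑ j, ‖a j‖ₑ ^ 2 := by
  have e (c : ℝ) : ‖c‖ₑ ^ 2 = ENNReal.ofReal (c ^ 2) := by
    rw [← ofReal_norm, ← ENNReal.ofReal_pow (norm_nonneg _), Real.norm_eq_abs, sq_abs]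
  simp only [e]
  rw [← ENNReal.ofReal_sum_of_nonneg fun _ _ => sq_nonneg _, ← ENNReal.ofReal_mul (sq_nonneg _)]
  refine ENNReal.ofReal_le_ofReal ?_
  calc (∑ j, a j * b j) ^ 2 ≤ (∑ j, a j ^ 2) * ∑ j, b j ^ 2 := Finset.sum_mul_sq_le_sq_mul_sq _ _ _
    _ ≤ (∑ j, a j ^ 2) * R ^ 2 := by gcongr
    _ = _ := mul_comm _ _

theorem lintegral_segIntegral_le {g : Fin d → E d → ℝ} (hg : ∀ j, Continuous (g j)) (c : E d)
    {r R : ℝ} {K K' : Set (E d)} (hK : MeasurableSet K) (hK' : MeasurableSet K')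
    (hKK : ∀ x ∈ K, ∀ y ∈ Metric.closedBall c r, segment ℝ x y ⊆ K')
    (hR : ∀ x ∈ K, ∀ y ∈ Metric.closedBall c r, dist x y ≤ R) :
    ∫⁻ x in K, ‖segIntegral c r g x‖ₑ ^ 2
      ≤ volume (Metric.closedBall c r) * (ENNReal.ofReal (R ^ 2) *
        ((volume (Metric.closedBall c r) + volume K)
          * (2 ^ d * ∫⁻ z in K', ∑ j, ‖g j z‖ₑ ^ 2))) := by
  set B := Metric.closedBall c r with hB
  set H : E d → ℝ≥0∞ := K'.indicator fun z => ∑ j, ‖g j z‖ₑ ^ 2 with hH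
  have hHm : Measurable H :=
    (Finset.measurable_fun_sum _ fun j _ => (hg j).measurable.enorm.pow_const 2).indicator hK'
  have huniv : segMeasure c r univ = volume B := by
    rw [segMeasure, Measure.prod_apply MeasurableSet.univ]
    simp [hB]
  have hmem : ∀ᵐ p ∂(segMeasure c r), p.1 ∈ B ∧ p.2 ∈ Icc (0 : ℝ) 1 := by
    rw [segMeasure_eq]
    exact ae_restrict_mem (measurableSet_closedBall.prod measurableSet_Icc)
  have h1 : ∀ x ∈ K, ‖segIntegral c r g x‖ₑ ^ 2
      ≤ volume B * (ENNReal.ofReal (R ^ 2)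
        * ∫⁻ p, H (p.1 + p.2 • (x - p.1)) ∂(segMeasure c r)) := by
    intro x hx
    have hcont : Continuous fun p : E d × ℝ =>
        ∑ j, g j (p.1 + p.2 • (x - p.1)) * (x j - p.1 j) := by
      refine continuous_finsetSum _ fun j _ => ?_
      have := hg j
      fun_prop
    calc ‖segIntegral c r g x‖ₑ ^ 2
        ≤ (∫⁻ p, ‖∑ j, g j (p.1 + p.2 • (x - p.1)) * (x j - p.1 j)‖ₑ ∂(segMeasure c r)) ^ 2 := by
          gcongr
          exact enorm_integral_le_lintegral_enorm _
      _ ≤ volume B * ∫⁻ p, ‖∑ j, g j (p.1 + p.2 • (x - p.1)) * (x j - p.1 j)‖ₑ ^ 2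
            ∂(segMeasure c r) := by
          rw [← huniv]
          exact sq_lintegral_le hcont.measurable.enorm.aemeasurable
      _ ≤ volume B * ∫⁻ p, ENNReal.ofReal (R ^ 2) * H (p.1 + p.2 • (x - p.1))
            ∂(segMeasure c r) := by
          gcongr 1
          refine lintegral_mono_ae ?_
          filter_upwards [hmem] with p hp
          have hz : p.1 + p.2 • (x - p.1) ∈ K' := by
            refine hKK x hx p.1 hp.1 ⟨p.2, 1 - p.2, hp.2.1, by linarith [hp.2.2], by ring, ?_⟩
            module
          rw [hH, indicator_of_mem hz]
          refine enorm_sum_mul_sq_le _ _ ?_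
          have h2 := hR x hx p.1 hp.1
          rw [EuclideanSpace.dist_eq] at h2
          have h3 : ∑ j, (x j - p.1 j) ^ 2 = √(∑ j, dist (x j) (p.1 j) ^ 2) ^ 2 := by
            rw [Real.sq_sqrt (Finset.sum_nonneg fun _ _ => sq_nonneg _)]
            exact Finset.sum_congr rfl fun j _ => by rw [Real.dist_eq, sq_abs]
          rw [h3]
          exact pow_le_pow_left₀ (Real.sqrt_nonneg _) h2 2
      _ = _ := by rw [lintegral_const_mul' _ _ ENNReal.ofReal_ne_top]
  have hm2 : Measurable fun z : E d × (E d × ℝ) => H (z.2.1 + z.2.2 • (z.1 - z.2.1)) :=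
    hHm.comp (by fun_prop)
  have hsf : SFinite (segMeasure c r) := by rw [segMeasure]; infer_instance
  calc ∫⁻ x in K, ‖segIntegral c r g x‖ₑ ^ 2
      ≤ ∫⁻ x in K, volume B * (ENNReal.ofReal (R ^ 2)
        * ∫⁻ p, H (p.1 + p.2 • (x - p.1)) ∂(segMeasure c r)) := setLIntegral_mono' hK h1
    _ = volume B * (ENNReal.ofReal (R ^ 2)
        * ∫⁻ x in K, ∫⁻ p, H (p.1 + p.2 • (x - p.1)) ∂(segMeasure c r)) := by
        rw [lintegral_const_mul' _ _ measure_closedBall_lt_top.ne,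
          lintegral_const_mul' _ _ ENNReal.ofReal_ne_top]
    _ = volume B * (ENNReal.ofReal (R ^ 2)
        * ∫⁻ p, (∫⁻ x in K, H (p.1 + p.2 • (x - p.1))) ∂(segMeasure c r)) := by
        rw [lintegral_lintegral_swap hm2.aemeasurable]
    _ = volume B * (ENNReal.ofReal (R ^ 2)
        * ∫⁻ t in Icc (0 : ℝ) 1, ∫⁻ y in B, ∫⁻ x in K, H (y + t • (x - y))) := by
        rw [segMeasure, lintegral_prod_symm]
        refine Measurable.aemeasurable ?_
        refine Measurable.lintegral_prod_right' (f := fun z : (E d × ℝ) × E d =>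
          H (z.1.1 + z.1.2 • (z.2 - z.1.1))) (hHm.comp (by fun_prop))
    _ ≤ volume B * (ENNReal.ofReal (R ^ 2)
        * ∫⁻ t in Icc (0 : ℝ) 1, (volume B + volume K) * (2 ^ d * ∫⁻ x, H x)) := by
        gcongr with t
        exact lintegral_segment_le hHm B K t
    _ = _ := by
        rw [setLIntegral_const, hH, lintegral_indicator hK']
        simp


theorem segIntegral_sub {q q' : Fin d → E d → ℝ} (hq : ∀ j, Continuous (q j))
    (hq' : ∀ j, Continuous (q' j)) (c : E d) (r : ℝ) (x : E d) :
    segIntegral c r (fun j z => q j z - q' j z) x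
      = segIntegral c r q x - segIntegral c r q' x := by
  have hc {q : Fin d → E d → ℝ} (hq : ∀ j, Continuous (q j)) :
      Integrable (fun p : E d × ℝ => ∑ j, q j (p.1 + p.2 • (x - p.1)) * (x j - p.1 j))
        (segMeasure c r) := by
    refine Continuous.integrable_segMeasure c r ?_
    refine continuous_finsetSum _ fun j _ => ?_
    have := hq j
    fun_prop
  rw [segIntegral, segIntegral, segIntegral, ← integral_sub (hc hq) (hc hq')]
  simp only [sub_mul, Finset.sum_sub_distrib]

/-- The volume of the ball in the averages. -/
theorem volume_real_closedBall_pos (c : E d) {r : ℝ} (hr : 0 < r) :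
    0 < volume.real (Metric.closedBall c r) :=
  ENNReal.toReal_pos (Metric.measure_closedBall_pos volume c hr).ne' measure_closedBall_lt_top.ne

theorem smooth_poincare {A : ℝ} (hA : 0 < A) {w : E d → ℝ} (hw : ContDiff ℝ ∞ w)
    {q : Fin d → E d → ℝ} (hq : ∀ j, Continuous (q j)) (c : E d) {r : ℝ} (hr : 0 < r)
    {K K' : Set (E d)} (hK : MeasurableSet K) (hK' : MeasurableSet K')
    (hKK : ∀ x ∈ K, ∀ y ∈ Metric.closedBall c r, segment ℝ x y ⊆ K')
    (hKA : K ⊆ Metric.closedBall c (A * r)) :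
    ∫⁻ x in K, ‖w x - (volume.real (Metric.closedBall c r))⁻¹ *
        (∫ y in Metric.closedBall c r, w y) -
        (volume.real (Metric.closedBall c r))⁻¹ * segIntegral c r q x‖ₑ ^ 2
      ≤ ENNReal.ofReal ((A + 1) ^ 2 * (1 + A ^ d) * 2 ^ d * r ^ 2) *
        ∫⁻ z in K', ∑ j, ‖fderiv ℝ w z (EuclideanSpace.single j 1) - q j z‖ₑ ^ 2 := by
  set B := Metric.closedBall c r with hB
  have hβ : 0 < volume.real B := volume_real_closedBall_pos c hr
  have hcont (j : Fin d) : Continuous fun z => fderiv ℝ w z (EuclideanSpace.single j 1) :=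
    (hw.continuous_fderiv (by simp)).clm_apply continuous_const
  have hwi : IntegrableOn w B := hw.continuous.continuousOn.integrableOn_compact
    (isCompact_closedBall c r)
  have hid (x : E d) : w x - (volume.real B)⁻¹ * (∫ y in B, w y)
      - (volume.real B)⁻¹ * segIntegral c r q x
      = (volume.real B)⁻¹ * segIntegral c r
        (fun j z => fderiv ℝ w z (EuclideanSpace.single j 1) - q j z) x := by
    rw [segIntegral_sub hcont hq, segIntegral_fderiv hw, integral_sub _ hwi]
    · rw [setIntegral_const, smul_eq_mul]
      field_simp
    · exact integrableOn_const measure_closedBall_lt_top.ne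
  have hvol : volume B = ENNReal.ofReal (volume.real B) :=
    (ENNReal.ofReal_toReal measure_closedBall_lt_top.ne).symm
  have hvolK : volume K ≤ ENNReal.ofReal (A ^ d) * volume B := by
    refine (measure_mono hKA).trans_eq ?_
    rw [Measure.addHaar_closedBall_mul _ _ hA.le hr.le, finrank_euclideanSpace_fin,
      hB, Measure.addHaar_closedBall_center volume c]
  have h := lintegral_segIntegral_le (R := (A + 1) * r) (fun j => (hcont j).sub (hq j)) c hK hK' hKK
    (fun x hx y hy => by
      have h1 := Metric.mem_closedBall.1 (hKA hx)
      have h2 := Metric.mem_closedBall'.1 hy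
      linarith [dist_triangle x c y])
  set I := ∫⁻ z in K', ∑ j, ‖fderiv ℝ w z (EuclideanSpace.single j 1) - q j z‖ₑ ^ 2 with hI
  simp only [hid, enorm_mul, mul_pow]
  rw [lintegral_const_mul' _ _ (ENNReal.pow_ne_top enorm_ne_top)]
  have e1 : ‖(volume.real B)⁻¹‖ₑ ^ 2 = ENNReal.ofReal ((volume.real B)⁻¹ ^ 2) := by
    rw [Real.enorm_of_nonneg (inv_nonneg.2 hβ.le), ENNReal.ofReal_pow (inv_nonneg.2 hβ.le)]
  have e2 : (2 : ℝ≥0∞) ^ d = ENNReal.ofReal (2 ^ d) := by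
    rw [ENNReal.ofReal_pow zero_le_two]; simp
  calc ‖(volume.real B)⁻¹‖ₑ ^ 2 * ∫⁻ x in K, ‖segIntegral c r
        (fun j z => fderiv ℝ w z (EuclideanSpace.single j 1) - q j z) x‖ₑ ^ 2
      ≤ ‖(volume.real B)⁻¹‖ₑ ^ 2 * (volume B * (ENNReal.ofReal (((A + 1) * r) ^ 2) *
        ((volume B + ENNReal.ofReal (A ^ d) * volume B) * (2 ^ d * I)))) := by
        gcongr
        refine h.trans ?_
        gcongr
        exact le_rfl
    _ = _ := by
        rw [e1, hvol, e2, ← ENNReal.ofReal_mul (by positivity), ← ENNReal.ofReal_add hβ.le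
          (by positivity), ← mul_assoc (ENNReal.ofReal (volume.real B + _)),
          ← ENNReal.ofReal_mul (by positivity), ← mul_assoc (ENNReal.ofReal (((A + 1) * r) ^ 2)),
          ← ENNReal.ofReal_mul (by positivity), ← mul_assoc (ENNReal.ofReal (volume.real B)),
          ← ENNReal.ofReal_mul (by positivity), ← mul_assoc, ← ENNReal.ofReal_mul (by positivity)]
        congr 2
        field_simp

theorem exists_lintegral_poincare {A : ℝ} (hA : 0 < A) {Ω : Set (E d)} (hΩ : IsOpen Ω) {u : L2 Ω}
    {v : Fin d → L2 Ω} (huv : ∀ j, IsWeakPartial Ω j u (v j)) {V : Set (E d)} (hV : IsOpen V)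
    (hVΩ : V ⊆ Ω) {c : E d} {r : ℝ} (hr : 0 < r) (hVA : V ⊆ Metric.closedBall c (A * r))
    {q : Fin d → E d → ℝ} (hq : ∀ j, Continuous (q j)) :
    ∃ a : ℝ, ∫⁻ x in starKernel V c r,
        ‖u x - (a + (volume.real (Metric.closedBall c r))⁻¹ * segIntegral c r q x)‖ₑ ^ 2
      ≤ ENNReal.ofReal (4 * ((A + 1) ^ 2 * (1 + A ^ d) * 2 ^ d * r ^ 2)) *
        ∑ j, ∫⁻ z in starKernel V c r, ‖v j z - q j z‖ₑ ^ 2 := by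
  classical
  set B := Metric.closedBall c r with hB
  set D := starKernel V c r with hD
  by_cases hBV : B ⊆ V
  swap
  · have : D = ∅ := by
      refine eq_empty_of_forall_notMem fun x hx => hBV fun y hy => hx y hy (right_mem_segment ℝ x y)
    exact ⟨0, by simp [this]⟩
  have hDV : D ⊆ V := starKernel_subset V c hr.le
  have hDo : IsOpen D := isOpen_starKernel hV c r
  obtain ⟨w, hws, hwu, hwv⟩ := exists_smooth_approx hΩ u v huv
  set β := (volume.real B)⁻¹ with hβ
  set S := segIntegral c r q with hS
  have huB : IntegrableOn u B := by
    have h2 : MemLp u 2 (volume.restrict B) :=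
      (Lp.memLp u).mono_measure (Measure.restrict_mono (hBV.trans hVΩ) le_rfl)
    have : IsFiniteMeasure (volume.restrict B) := ⟨by simp [hB, measure_closedBall_lt_top]⟩
    exact h2.integrable (by norm_num)
  set C0 := ENNReal.ofReal ((A + 1) ^ 2 * (1 + A ^ d) * 2 ^ d * r ^ 2) with hC0
  have hC : ENNReal.ofReal (4 * ((A + 1) ^ 2 * (1 + A ^ d) * 2 ^ d * r ^ 2)) = 4 * C0 := by
    rw [ENNReal.ofReal_mul (by norm_num), hC0]
    norm_num
  refine ⟨β * ∫ y in B, u y, ?_⟩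
  have hcomp : ∀ K, IsCompact K → K ⊆ D →
      ∫⁻ x in K, ‖u x - (β * (∫ y in B, u y) + β * S x)‖ₑ ^ 2
        ≤ 4 * C0 * ∑ j, ∫⁻ z in D, ‖v j z - q j z‖ₑ ^ 2 := by
    intro K hK hKD
    set K' : Set (E d) := (fun z : E d × (E d × ℝ) => (1 - z.2.2) • z.1 + z.2.2 • z.2.1) ''
      (K ×ˢ (B ×ˢ Icc (0 : ℝ) 1)) with hK'
    have hK'c : IsCompact K' := (hK.prod ((isCompact_closedBall c r).prod isCompact_Icc)).image
      (by fun_prop)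
    have hKK : ∀ x ∈ K, ∀ y ∈ B, segment ℝ x y ⊆ K' := by
      rintro x hx y hy p ⟨a, b, ha, hb, hab, rfl⟩
      exact ⟨(x, y, b), ⟨hx, hy, hb, by linarith⟩, by simp [← hab]⟩
    have hK'D : K' ⊆ D := by
      rintro _ ⟨z, ⟨hz1, hz2, hz3⟩, rfl⟩
      exact segment_subset_starKernel (hKD hz1) hz2
        ⟨1 - z.2.2, z.2.2, by linarith [hz3.2], hz3.1, by ring, rfl⟩
    have hK'Ω : K' ⊆ Ω := hK'D.trans (hDV.trans hVΩ)
    have hKΩ : K ⊆ Ω := hKD.trans (hDV.trans hVΩ)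
    have hvK (j : Fin d) : AEStronglyMeasurable (v j) (volume.restrict K') :=
      (Lp.aestronglyMeasurable (v j)).mono_measure (Measure.restrict_mono hK'Ω le_rfl)
    have huK : AEStronglyMeasurable u (volume.restrict K) :=
      (Lp.aestronglyMeasurable u).mono_measure (Measure.restrict_mono hKΩ le_rfl)
    have hpart (n : ℕ) (j : Fin d) :
        Continuous fun z => fderiv ℝ (w n) z (EuclideanSpace.single j 1) :=
      ((hws n).continuous_fderiv (by simp)).clm_apply continuous_const
    have hvB : volume B ≠ ⊤ := measure_closedBall_lt_top.ne
    set cst : ℝ≥0∞ := 4 + 4 * (volume K * (‖β‖ₑ ^ 2 * volume B)) with hcst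
    have hcst' : cst ≠ ⊤ := by
      rw [hcst]
      refine ENNReal.add_ne_top.2 ⟨by norm_num, ENNReal.mul_ne_top (by norm_num)
        (ENNReal.mul_ne_top hK.measure_lt_top.ne (ENNReal.mul_ne_top
          (ENNReal.pow_ne_top enorm_ne_top) hvB))⟩
    have hbound : ∀ n, ∫⁻ x in K, ‖u x - (β * (∫ y in B, u y) + β * S x)‖ₑ ^ 2
        ≤ 4 * C0 * (∑ j, ∫⁻ z in D, ‖v j z - q j z‖ₑ ^ 2)
          + (4 * C0 * (∑ j, ∫⁻ z in K', ‖fderiv ℝ (w n) z (EuclideanSpace.single j 1) - v j z‖ₑ ^ 2)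
            + cst * ∫⁻ x in Ω, ‖w n x - u x‖ₑ ^ 2) := by
      intro n
      set a := β * ∫ y in B, u y
      set b := β * ∫ y in B, w n y with hb
      have hwi : IntegrableOn (w n) B := (hws n).continuous.continuousOn.integrableOn_compact
        (isCompact_closedBall c r)
      have hab : ‖b - a‖ₑ ^ 2 ≤ ‖β‖ₑ ^ 2 * volume B * ∫⁻ x in Ω, ‖w n x - u x‖ₑ ^ 2 := by
        rw [← mul_sub, ← integral_sub hwi huB, enorm_mul, mul_pow, mul_assoc]
        gcongr
        calc ‖∫ y in B, (w n y - u y)‖ₑ ^ 2 ≤ (∫⁻ y in B, ‖w n y - u y‖ₑ) ^ 2 := by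
              gcongr; exact enorm_integral_le_lintegral_enorm _
          _ ≤ volume B * ∫⁻ y in B, ‖w n y - u y‖ₑ ^ 2 := by
              have h := sq_lintegral_le (μ := volume.restrict B)
                (f := fun y => ‖w n y - u y‖ₑ) (hwi.1.sub huB.1).enorm
              rwa [Measure.restrict_apply_univ] at h
          _ ≤ _ := by
              gcongr
              exact hBV.trans hVΩ
      have hmain := smooth_poincare hA (hws n) hq c hr hK.measurableSet hK'c.measurableSet hKK
        (hKD.trans (hDV.trans hVA))
      have hm1 : AEMeasurable (fun x => ‖w n x - u x‖ₑ ^ 2) (volume.restrict K) :=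
        ((hws n).continuous.aestronglyMeasurable.sub huK).enorm.pow_const 2
      have hp : ∀ x, ‖u x - (a + β * S x)‖ₑ ^ 2
          ≤ 4 * ‖w n x - u x‖ₑ ^ 2 + (2 * ‖w n x - b - β * S x‖ₑ ^ 2 + 4 * ‖b - a‖ₑ ^ 2) := by
        intro x
        have e1 : u x - (a + β * S x)
          = (w n x - b - β * S x) + (-(w n x - u x) + (b - a)) := by ring
        have h2 := enorm_add_sq_le (-(w n x - u x)) (b - a)
        rw [enorm_neg] at h2
        rw [e1]
        refine (enorm_add_sq_le _ _).trans ?_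
        refine (add_le_add_right (mul_le_mul_right h2 2) _).trans_eq ?_
        ring
      have hI1 : ∫⁻ z in K', ∑ j, ‖fderiv ℝ (w n) z (EuclideanSpace.single j 1) - q j z‖ₑ ^ 2
          ≤ 2 * (∑ j, ∫⁻ z in K', ‖fderiv ℝ (w n) z (EuclideanSpace.single j 1) - v j z‖ₑ ^ 2)
            + 2 * (∑ j, ∫⁻ z in D, ‖v j z - q j z‖ₑ ^ 2) := by
        have hmeas (j : Fin d) :
            Continuous fun z => fderiv ℝ (w n) z (EuclideanSpace.single j 1) - q j z :=
          (hpart n j).sub (hq j)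
        rw [lintegral_finsetSum' _ fun j _ => ((hmeas j).measurable.enorm.pow_const 2).aemeasurable,
          Finset.mul_sum, Finset.mul_sum, ← Finset.sum_add_distrib]
        refine Finset.sum_le_sum fun j _ => ?_
        calc _ ≤ ∫⁻ z in K', (2 * ‖fderiv ℝ (w n) z (EuclideanSpace.single j 1) - v j z‖ₑ ^ 2
              + 2 * ‖v j z - q j z‖ₑ ^ 2) := by
              refine lintegral_mono fun z => ?_
              have := enorm_add_sq_le (fderiv ℝ (w n) z (EuclideanSpace.single j 1) - v j z)
                (v j z - q j z)
              rwa [sub_add_sub_cancel] at this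
          _ = 2 * (∫⁻ z in K', ‖fderiv ℝ (w n) z (EuclideanSpace.single j 1) - v j z‖ₑ ^ 2)
              + 2 * ∫⁻ z in K', ‖v j z - q j z‖ₑ ^ 2 := by
              have hm2 : AEStronglyMeasurable (fun z => fderiv ℝ (w n) z (EuclideanSpace.single j 1)
                  - v j z) (volume.restrict K') := (hpart n j).aestronglyMeasurable.sub (hvK j)
              rw [lintegral_add_left' ((hm2.enorm.pow_const 2).const_mul 2),
                lintegral_const_mul' _ _ (by norm_num),
                lintegral_const_mul' _ _ (by norm_num)]
          _ ≤ _ := by gcongr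
      calc ∫⁻ x in K, ‖u x - (a + β * S x)‖ₑ ^ 2
          ≤ ∫⁻ x in K, (4 * ‖w n x - u x‖ₑ ^ 2
            + (2 * ‖w n x - b - β * S x‖ₑ ^ 2 + 4 * ‖b - a‖ₑ ^ 2)) := lintegral_mono hp
        _ = 4 * (∫⁻ x in K, ‖w n x - u x‖ₑ ^ 2)
            + (2 * (∫⁻ x in K, ‖w n x - b - β * S x‖ₑ ^ 2) + 4 * ‖b - a‖ₑ ^ 2 * volume K) := by
            rw [lintegral_add_left' (hm1.const_mul 4), lintegral_add_right _ measurable_const,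
              lintegral_const_mul' _ _ (by norm_num), lintegral_const_mul' _ _ (by norm_num),
              setLIntegral_const]
        _ ≤ 4 * (∫⁻ x in Ω, ‖w n x - u x‖ₑ ^ 2)
            + (2 * (C0 * (2 * (∑ j, ∫⁻ z in K',
                ‖fderiv ℝ (w n) z (EuclideanSpace.single j 1) - v j z‖ₑ ^ 2)
              + 2 * (∑ j, ∫⁻ z in D, ‖v j z - q j z‖ₑ ^ 2)))
              + 4 * (‖β‖ₑ ^ 2 * volume B * ∫⁻ x in Ω, ‖w n x - u x‖ₑ ^ 2) * volume K) := by
            gcongr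
            exact hmain.trans (by gcongr)
        _ = _ := by rw [hcst]; ring
    have hlim : Tendsto (fun n => 4 * C0 * (∑ j, ∫⁻ z in D, ‖v j z - q j z‖ₑ ^ 2)
          + (4 * C0 * (∑ j, ∫⁻ z in K', ‖fderiv ℝ (w n) z (EuclideanSpace.single j 1) - v j z‖ₑ ^ 2)
            + cst * ∫⁻ x in Ω, ‖w n x - u x‖ₑ ^ 2)) atTop
        (𝓝 (4 * C0 * (∑ j, ∫⁻ z in D, ‖v j z - q j z‖ₑ ^ 2)
          + (4 * C0 * (∑ j : Fin d, 0) + cst * 0))) := by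
      refine tendsto_const_nhds.add (Tendsto.add ?_ ?_)
      · refine ENNReal.Tendsto.const_mul (tendsto_finsetSum _ fun j _ => hwv K' hK'c hK'Ω j)
          (Or.inr (ENNReal.mul_ne_top (by norm_num) ENNReal.ofReal_ne_top))
      · exact ENNReal.Tendsto.const_mul hwu (Or.inr hcst')
    have := ge_of_tendsto' hlim hbound
    simpa using this
  obtain ⟨F, hFc, hFD, hFU, hFm⟩ := hDo.exists_iUnion_isClosed
  rw [hC]
  rw [← hFU, setLIntegral_iUnion_of_directed _ hFm.directed_le, hFU]
  refine iSup_le fun n => hcomp _ ?_ (hFD n)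
  exact (isCompact_closedBall c (A * r)).of_isClosed_subset (hFc n)
    ((hFD n).trans (hDV.trans hVA))

end Poincare

section BrambleHilbert

variable {d : ℕ}

theorem lintegral_enorm_sq_eq {α : Type*} [MeasurableSpace α] {μ : Measure α} {f : α → ℝ}
    (hf : MemLp f 2 μ) : ∫⁻ x, ‖f x‖ₑ ^ 2 ∂μ = ENNReal.ofReal (∫ x, f x ^ 2 ∂μ) := by
  rw [ofReal_integral_eq_lintegral_ofReal hf.integrable_sq (.of_forall fun x => sq_nonneg _)]
  refine lintegral_congr fun x => ?_
  rw [← ofReal_norm, ← ENNReal.ofReal_pow (norm_nonneg _), Real.norm_eq_abs, sq_abs]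

theorem _root_.Continuous.memLp_restrict_of_subset_closedBall {f : E d → ℝ} (hf : Continuous f)
    {D : Set (E d)} {c : E d} {r : ℝ} (hD : D ⊆ Metric.closedBall c r) :
    MemLp f 2 (volume.restrict D) := by
  have : MemLp f 2 (volume.restrict (Metric.closedBall c r)) := by
    obtain ⟨M, hM⟩ := (isCompact_closedBall c r).exists_bound_of_continuousOn hf.continuousOn
    have : IsFiniteMeasure (volume.restrict (Metric.closedBall c r)) :=
      ⟨by simp [measure_closedBall_lt_top]⟩
    exact MemLp.of_bound hf.aestronglyMeasurable M
      ((ae_restrict_mem measurableSet_closedBall).mono hM)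
  exact this.mono_measure (Measure.restrict_mono hD le_rfl)

theorem memLp_restrict_subset {Ω D : Set (E d)} (u : L2 Ω) (hD : D ⊆ Ω) :
    MemLp u 2 (volume.restrict D) :=
  (Lp.memLp u).mono_measure (Measure.restrict_mono hD le_rfl)

/-- The polynomials of degree less than `s`. -/
def polyLT (d : ℕ) : ℕ → Submodule ℝ (E d → ℝ)
  | 0 => ⊥
  | s + 1 => polyLE d s

theorem polyLT_le (d s : ℕ) : polyLT d s ≤ polyLE d s := by
  cases s with
  | zero => exact bot_le
  | succ s => exact polyLE_mono (Nat.le_succ s)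

theorem segIntegral_zero (c : E d) (r : ℝ) : segIntegral c r (fun _ => 0) = 0 := by
  ext x; simp [segIntegral]

/-- A polynomial approximation of a function, from approximations of its derivatives. -/
theorem exists_poly_approx_step (d : ℕ) {A : ℝ} (hA : 0 < A) :
    ∃ C : ℝ, 0 < C ∧ ∀ (s : ℕ) {Ω : Set (E d)} (_ : IsOpen Ω) {u : L2 Ω}
      {v : Fin d → L2 Ω} (_ : ∀ j, IsWeakPartial Ω j u (v j)) {V : Set (E d)} (_ : IsOpen V)
      (_ : V ⊆ Ω) {c : E d} {r : ℝ} (_ : 0 < r) (_ : V ⊆ Metric.closedBall c (A * r))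
      {q : Fin d → E d → ℝ} (_ : ∀ j, q j ∈ polyLT d s),
      ∃ p ∈ polyLT d (s + 1), ∫ x in starKernel V c r, (u x - p x) ^ 2
        ≤ C * r ^ 2 * ∑ j, ∫ x in starKernel V c r, (v j x - q j x) ^ 2 := by
  refine ⟨4 * ((A + 1) ^ 2 * (1 + A ^ d) * 2 ^ d), by positivity, ?_⟩
  intro s Ω hΩ u v huv V hV hVΩ c r hr hVA q hq
  have hqc (j : Fin d) : Continuous (q j) := continuous_of_mem_polyLE (polyLT_le d s (hq j))
  obtain ⟨a, ha⟩ := exists_lintegral_poincare hA hΩ huv hV hVΩ hr hVA hqc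
  set p : E d → ℝ := fun x =>
    a + (volume.real (Metric.closedBall c r))⁻¹ * segIntegral c r q x with hp
  have hpm : p ∈ polyLT d (s + 1) := by
    change p ∈ polyLE d s
    refine Submodule.add_mem _ (const_mem_polyLE a s) ?_
    refine Submodule.smul_mem _ ((volume.real (Metric.closedBall c r))⁻¹)
      (x := fun x => segIntegral c r q x) ?_
    cases s with
    | zero =>
      have : q = fun _ => 0 := by
        ext j : 1
        exact hq j
      rw [this, segIntegral_zero]
      exact Submodule.zero_mem _
    | succ s => exact segIntegral_mem_polyLE c r hq
  refine ⟨p, hpm, ?_⟩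
  have hDV := starKernel_subset V c hr.le
  have hpc : Continuous p := continuous_of_mem_polyLE (polyLT_le d _ hpm)
  have hu : MemLp (fun x => u x - p x) 2 (volume.restrict (starKernel V c r)) :=
    (memLp_restrict_subset u (hDV.trans hVΩ)).sub
      (hpc.memLp_restrict_of_subset_closedBall (hDV.trans hVA))
  have hv (j : Fin d) : MemLp (fun x => v j x - q j x) 2 (volume.restrict (starKernel V c r)) :=
    (memLp_restrict_subset (v j) (hDV.trans hVΩ)).sub
      ((hqc j).memLp_restrict_of_subset_closedBall (hDV.trans hVA))
  change ∫⁻ x in starKernel V c r, ‖u x - p x‖ₑ ^ 2 ≤ _ at ha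
  rw [lintegral_enorm_sq_eq hu] at ha
  simp only [fun j => lintegral_enorm_sq_eq (hv j)] at ha
  rw [← ENNReal.ofReal_sum_of_nonneg fun j _ => integral_nonneg fun x => sq_nonneg _,
    ← ENNReal.ofReal_mul (by positivity), ENNReal.ofReal_le_ofReal_iff (by positivity)] at ha
  calc _ ≤ _ := ha
    _ = _ := by ring

/-- Local polynomial approximation of functions in `H^s(Ω)`. -/
theorem exists_poly_approx (d s : ℕ) {A : ℝ} (hA : 0 < A) :
    ∃ C : ℝ, 0 < C ∧ ∀ {Ω : Set (E d)} (_ : IsOpen Ω) {u : L2 Ω} {M : ℝ}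
      (_ : SobolevBound Ω s u M), ∃ F : E d → ℝ, (∀ x, 0 ≤ F x) ∧ IntegrableOn F Ω ∧
      ∫ x in Ω, F x ≤ C * M ^ 2 ∧ ∀ {V : Set (E d)} (_ : IsOpen V) (_ : V ⊆ Ω) {c : E d} {r : ℝ}
      (_ : 0 < r) (_ : V ⊆ Metric.closedBall c (A * r)), ∃ p ∈ polyLT d s,
        ∫ x in starKernel V c r, (u x - p x) ^ 2
          ≤ r ^ (2 * s) * ∫ x in starKernel V c r, F x := by
  induction s with
  | zero =>
    refine ⟨1, one_pos, fun {Ω} hΩ {u M} hu => ⟨fun x => u x ^ 2, fun x => sq_nonneg _,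
      (Lp.memLp u).integrable_sq, ?_, ?_⟩⟩
    · have h1 : ∫ x in Ω, u x ^ 2 = ‖u‖ ^ 2 := by
        rw [← real_inner_self_eq_norm_sq, L2.inner_def]
        refine integral_congr_ae (.of_forall fun x => ?_)
        simp [sq]
      rw [h1, one_mul]
      exact pow_le_pow_left₀ (norm_nonneg _) hu 2
    · intro V _ _ c r _ _
      exact ⟨0, Submodule.zero_mem _, by simp⟩
  | succ s ih =>
    obtain ⟨C, hC, h⟩ := ih
    obtain ⟨C', hC', h'⟩ := exists_poly_approx_step d hA
    refine ⟨C' * (d * C) + 1, by positivity, fun {Ω} hΩ {u M} hu => ?_⟩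
    choose v hv hvM using hu.2
    choose F hF0 hFi hFM hFp using fun j => h hΩ (hvM j)
    refine ⟨fun x => C' * ∑ j, F j x, fun x => mul_nonneg hC'.le
      (Finset.sum_nonneg fun j _ => hF0 j x), ?_, ?_, ?_⟩
    · exact (integrable_finsetSum _ fun j _ => hFi j).const_mul _
    · rw [integral_const_mul, integral_finsetSum _ fun j _ => hFi j]
      have : ∑ j, ∫ x in Ω, F j x ≤ ∑ _j : Fin d, C * M ^ 2 := Finset.sum_le_sum fun j _ => hFM j
      rw [Finset.sum_const, Finset.card_univ, Fintype.card_fin, nsmul_eq_mul] at this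
      nlinarith [mul_le_mul_of_nonneg_left this hC'.le, sq_nonneg M]
    · intro V hV hVΩ c r hr hVA
      choose q hq hqb using fun j => hFp j hV hVΩ hr hVA
      obtain ⟨p, hp, hpb⟩ := h' s hΩ hv hV hVΩ hr hVA hq
      refine ⟨p, hp, hpb.trans ?_⟩
      have hD : starKernel V c r ⊆ Ω := (starKernel_subset V c hr.le).trans hVΩ
      rw [integral_const_mul, integral_finsetSum _ fun j _ => (hFi j).mono_set hD]
      calc C' * r ^ 2 * ∑ j, ∫ x in starKernel V c r, (v j x - q j x) ^ 2
          ≤ C' * r ^ 2 * ∑ j, r ^ (2 * s) * ∫ x in starKernel V c r, F j x := by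
            gcongr with j
            exact hqb j
        _ = _ := by rw [← Finset.mul_sum]; ring

/-- A cut-off function at scale `r`. -/
theorem exists_cutoff (d : ℕ) : ∃ C : ℝ, 0 < C ∧ ∀ (c : E d) {r : ℝ}, 0 < r →
    ∃ χ : E d → ℝ, ContDiff ℝ ∞ χ ∧ tsupport χ ⊆ Metric.closedBall c r ∧
      (∀ x, 0 ≤ χ x) ∧ (∀ x, χ x ≤ 1) ∧ (∀ x ∈ Metric.closedBall c (1 / 2 * r), χ x = 1) ∧
      ∀ x j, |fderiv ℝ χ x (EuclideanSpace.single j 1)| ≤ C * r⁻¹ := by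
  let b : ContDiffBump (0 : E d) := ⟨1 / 2, 1, by norm_num, by norm_num⟩
  have hbs : ContDiff ℝ ∞ b := b.contDiff
  obtain ⟨C, hC⟩ := (hbs.continuous_fderiv (by simp)).bounded_above_of_compact_support
    (b.hasCompactSupport.fderiv ℝ)
  refine ⟨|C| + 1, by positivity, fun c r hr => ?_⟩
  have hφ (x : E d) : HasFDerivAt (fun x : E d => r⁻¹ • (x - c))
      (r⁻¹ • ContinuousLinearMap.id ℝ (E d)) x :=
    ((hasFDerivAt_id x).sub_const c).const_smul r⁻¹
  have hcd : ContDiff ℝ ∞ (fun x : E d => b (r⁻¹ • (x - c))) :=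
    hbs.comp ((contDiff_id.sub contDiff_const).const_smul r⁻¹)
  refine ⟨fun x => b (r⁻¹ • (x - c)), hcd, ?_, fun x => b.nonneg, fun x => b.le_one, ?_, ?_⟩
  · refine closure_minimal (fun x hx => ?_) Metric.isClosed_closedBall
    have h1 : r⁻¹ • (x - c) ∈ Function.support b := hx
    rw [b.support_eq, mem_ball_zero_iff, norm_smul, norm_inv, Real.norm_of_nonneg hr.le] at h1
    rw [Metric.mem_closedBall, dist_eq_norm]
    change r⁻¹ * _ < 1 at h1
    rw [inv_mul_lt_iff₀ hr, mul_one] at h1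
    exact h1.le
  · intro x hx
    refine b.one_of_mem_closedBall ?_
    rw [mem_closedBall_zero_iff, norm_smul, norm_inv, Real.norm_of_nonneg hr.le,
      inv_mul_le_iff₀ hr, mul_comm r, ← dist_eq_norm]
    exact hx
  · intro x j
    have h1 := ((hbs.differentiable (by simp) (r⁻¹ • (x - c))).hasFDerivAt.comp x (hφ x)).fderiv
    change |fderiv ℝ (b ∘ fun x => r⁻¹ • (x - c)) x _| ≤ _
    rw [h1]
    simp only [ContinuousLinearMap.comp_apply, smul_apply,
      ContinuousLinearMap.id_apply, map_smul, smul_eq_mul, abs_mul, abs_inv, abs_of_pos hr]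
    rw [mul_comm]
    gcongr
    have h2 := (fderiv ℝ b (r⁻¹ • (x - c))).le_opNorm (EuclideanSpace.single j 1)
    rw [PiLp.norm_single, norm_one, mul_one, Real.norm_eq_abs] at h2
    linarith [hC (r⁻¹ • (x - c)), le_abs_self C]

/-- The derivatives of a polynomial approximation of `u` are approximations of the derivatives of
`u`. -/
theorem exists_fderiv_sub_poly_le (d k : ℕ) {A : ℝ} (hA : 1 ≤ A) :
    ∃ C : ℝ, 0 < C ∧ ∀ {Ω : Set (E d)} (_ : MeasurableSet Ω) {u v : L2 Ω} {j : Fin d}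
      (_ : IsWeakPartial Ω j u v) {c : E d} {r : ℝ} (_ : 0 < r) (_ : Metric.closedBall c r ⊆ Ω)
      {p q : E d → ℝ} (_ : p ∈ polyLE d k) (_ : q ∈ polyLE d k) {D : Set (E d)}
      (_ : D ⊆ Metric.closedBall c (A * r)),
      ∫ x in D, (fderiv ℝ p x (EuclideanSpace.single j 1) - q x) ^ 2
        ≤ C * (r⁻¹ ^ 2 * (∫ x in Metric.closedBall c r, (u x - p x) ^ 2)
          + ∫ x in Metric.closedBall c r, (v x - q x) ^ 2) := by
  obtain ⟨C₁, hC₁, h₁⟩ := exists_poly_bounds d k (κ := 1 / 2) (by norm_num) A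
  obtain ⟨C₂, hC₂, h₂⟩ := exists_cutoff d
  set V₁ := volume.real (Metric.ball (0 : E d) 1) with hV₁
  have hV₁0 : 0 < V₁ := ENNReal.toReal_pos
    (Metric.measure_ball_pos volume (0 : E d) one_pos).ne' measure_ball_lt_top.ne
  set l := (2 * (C₂ ^ 2 + 1) * C₁ + C₁) * V₁ with hl
  have hl0 : 0 < l := by positivity
  refine ⟨A ^ d * V₁ * C₁ * l, by positivity, ?_⟩
  intro Ω hΩ u v j huv c r hr hB p q hp hq D hD
  obtain ⟨χ, hχ, hχs, hχ0, hχ1, hχe, hχd⟩ := h₂ c hr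
  set B := Metric.closedBall c r with hBdef
  set e : E d := EuclideanSpace.single j 1
  set φ : E d → ℝ := fun x => fderiv ℝ p x e - q x with hφdef
  have hφ : φ ∈ polyLE d k := Submodule.sub_mem _ (fderiv_mem_polyLE hp e) hq
  set I := ∫ x in Metric.closedBall c (1 / 2 * r), φ x ^ 2 with hI
  have hpb := h₁ φ hφ c r hr
  have hBA : B ⊆ Metric.closedBall c (A * r) :=
    Metric.closedBall_subset_closedBall (by nlinarith)
  have hφc : Continuous φ := continuous_of_mem_polyLE hφ
  have hφs : ContDiff ℝ ∞ φ := contDiff_of_mem_polyLE hφ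
  have hpc := continuous_of_mem_polyLE hp
  have hqc := continuous_of_mem_polyLE hq
  have hpdc : Continuous fun x => fderiv ℝ p x e :=
    continuous_of_mem_polyLE (fderiv_mem_polyLE hp e)
  have hψs : ContDiff ℝ ∞ fun x => χ x * φ x := hχ.mul hφs
  have hts : tsupport (fun x => χ x * φ x) ⊆ B := (tsupport_mul_subset_left).trans hχs
  have htest : IsTest Ω fun x => χ x * φ x :=
    ⟨hψs, HasCompactSupport.of_support_subset_isCompact (isCompact_closedBall c r)
      ((subset_tsupport _).trans hts), hts.trans hB⟩
  set ψ : E d → ℝ := fun x => fderiv ℝ (fun x => χ x * φ x) x e with hψ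
  have hψc : Continuous ψ := htest.continuous_fderiv_apply e
  have hχc := hχ.continuous
  have z1 : ∀ x ∉ B, χ x * φ x = 0 := fun x hx =>
    image_eq_zero_of_notMem_tsupport (f := fun x => χ x * φ x) fun h => hx (hts h)
  have z2 : ∀ x ∉ B, ψ x = 0 := fun x hx => by
    rw [hψ]
    simp only
    rw [image_eq_zero_of_notMem_tsupport (f := fderiv ℝ fun x => χ x * φ x)
      fun h => hx (hts (tsupport_fderiv_subset ℝ h))]
    rfl
  have i1 : ∫ x in B, u x * ψ x = -∫ x in B, v x * (χ x * φ x) := by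
    rw [← setIntegral_eq_of_subset_of_forall_sdiff_eq_zero hΩ hB
      (fun x hx => by rw [z2 x hx.2, mul_zero]),
      ← setIntegral_eq_of_subset_of_forall_sdiff_eq_zero hΩ hB
      (fun x hx => by rw [z1 x hx.2, mul_zero])]
    exact huv _ htest
  have i2 : ∫ x in B, p x * ψ x = -∫ x in B, fderiv ℝ p x e * (χ x * φ x) := by
    rw [setIntegral_eq_integral_of_forall_compl_eq_zero
      (fun x hx => by rw [z2 x hx, mul_zero]),
      setIntegral_eq_integral_of_forall_compl_eq_zero
      (fun x hx => by rw [z1 x hx, mul_zero])]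
    refine integral_mul_fderiv_eq_neg_fderiv_mul_of_integrable ?_ ?_ ?_
      (fun x _ => differentiable_of_mem_polyLE hp x) (fun x _ => hψs.differentiable (by simp) x)
    · exact (hpdc.mul hψs.continuous).integrable_of_hasCompactSupport htest.2.1.mul_left
    · exact (hpc.mul hψc).integrable_of_hasCompactSupport
        ((htest.2.1.fderiv_apply ℝ e).mul_left)
    · exact (hpc.mul hψs.continuous).integrable_of_hasCompactSupport htest.2.1.mul_left
  have hcm {g : E d → ℝ} (hg : Continuous g) : MemLp g 2 (volume.restrict B) :=
    hg.memLp_restrict_of_subset_closedBall (c := c) (r := r) Subset.rfl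
  have him {f g : E d → ℝ} (hf : MemLp f 2 (volume.restrict B))
      (hg : MemLp g 2 (volume.restrict B)) : Integrable (fun x => f x * g x) (volume.restrict B) :=
    hf.integrable_mul hg
  have hu := memLp_restrict_subset u hB
  have hv := memLp_restrict_subset v hB
  have hup : MemLp (fun x => u x - p x) 2 (volume.restrict B) := hu.sub (hcm hpc)
  have hvq : MemLp (fun x => v x - q x) 2 (volume.restrict B) := hv.sub (hcm hqc)
  have i3 : ∫ x in B, χ x * φ x ^ 2
      = (∫ x in B, (u x - p x) * ψ x) + ∫ x in B, (v x - q x) * (χ x * φ x) := by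
    have e1 : ∫ x in B, (u x - p x) * ψ x = (∫ x in B, u x * ψ x) - ∫ x in B, p x * ψ x := by
      rw [← integral_sub (him hu (hcm hψc)) (him (hcm hpc) (hcm hψc))]
      exact integral_congr_ae (.of_forall fun x => by simp only; ring)
    have hsub : Integrable (fun x => fderiv ℝ p x e * (χ x * φ x) - v x * (χ x * φ x))
        (volume.restrict B) := (him (hcm hpdc) (hcm hψs.continuous)).sub
      (him hv (hcm hψs.continuous))
    rw [e1, i1, i2, sub_neg_eq_add, neg_add_eq_sub,
      ← integral_sub (him (hcm hpdc) (hcm hψs.continuous))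
        (him hv (hcm hψs.continuous)),
      ← integral_add hsub (him hvq (hcm hψs.continuous))]
    refine integral_congr_ae (.of_forall fun x => ?_)
    simp only [hφdef]
    ring
  have hvolB : volume.real B = r ^ d * V₁ := by
    rw [hBdef, Measure.addHaar_real_closedBall _ _ hr.le, finrank_euclideanSpace_fin]
  have b1 : ∀ x ∈ B, φ x ^ 2 ≤ C₁ * (r ^ d)⁻¹ * I := fun x hx => (hpb x (hBA hx)).1
  have b2 : ∀ x ∈ B, r ^ 2 * ψ x ^ 2 ≤ 2 * (C₂ ^ 2 + 1) * (C₁ * (r ^ d)⁻¹ * I) := by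
    intro x hx
    have e1 : ψ x = χ x * fderiv ℝ φ x e + φ x * fderiv ℝ χ x e := by
      rw [hψ]
      simp only
      have := (hχ.differentiable (by simp) x).hasFDerivAt.mul
        (hφs.differentiable (by simp) x).hasFDerivAt
      rw [show (fun x => χ x * φ x) = χ * φ from rfl, this.fderiv]
      simp
    have e2 := b1 x hx
    have e3 := (hpb x (hBA hx)).2 j
    have e4 : (fderiv ℝ χ x e) ^ 2 ≤ (C₂ * r⁻¹) ^ 2 := by
      rw [← sq_abs]
      exact pow_le_pow_left₀ (abs_nonneg _) (hχd x j) 2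
    have e5 : χ x ^ 2 ≤ 1 := pow_le_one₀ (hχ0 x) (hχ1 x)
    set K := C₁ * (r ^ d)⁻¹ * I with hK
    have e6 : r ^ 2 * fderiv ℝ φ x e ^ 2 ≤ K := by
      calc r ^ 2 * fderiv ℝ φ x e ^ 2 ≤ r ^ 2 * (C₁ * (r ^ d)⁻¹ * (r ^ 2)⁻¹ * I) := by gcongr
        _ = K := by rw [hK]; field_simp
    have e7 : r ^ 2 * fderiv ℝ χ x e ^ 2 ≤ C₂ ^ 2 := by
      calc r ^ 2 * fderiv ℝ χ x e ^ 2 ≤ r ^ 2 * (C₂ * r⁻¹) ^ 2 := by gcongr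
        _ = C₂ ^ 2 := by field_simp
    rw [e1]
    calc r ^ 2 * (χ x * fderiv ℝ φ x e + φ x * fderiv ℝ χ x e) ^ 2
        ≤ r ^ 2 * (2 * (χ x * fderiv ℝ φ x e) ^ 2 + 2 * (φ x * fderiv ℝ χ x e) ^ 2) := by
          gcongr
          nlinarith [sq_nonneg (χ x * fderiv ℝ φ x e - φ x * fderiv ℝ χ x e)]
      _ = 2 * (χ x ^ 2 * (r ^ 2 * fderiv ℝ φ x e ^ 2))
          + 2 * (φ x ^ 2 * (r ^ 2 * fderiv ℝ χ x e ^ 2)) := by ring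
      _ ≤ 2 * (1 * K) + 2 * (K * C₂ ^ 2) := by gcongr
      _ = _ := by ring
  set U := ∫ x in B, (u x - p x) ^ 2 with hU
  set W := ∫ x in B, (v x - q x) ^ 2 with hW
  have hIle : I ≤ ∫ x in B, χ x * φ x ^ 2 := by
    have hi : IntegrableOn (fun x => χ x * φ x ^ 2) B :=
      (hχc.mul (hφc.pow 2)).continuousOn.integrableOn_compact (isCompact_closedBall c r)
    have hsub : Metric.closedBall c (1 / 2 * r) ⊆ B :=
      Metric.closedBall_subset_closedBall (by linarith)
    calc I = ∫ x in Metric.closedBall c (1 / 2 * r), χ x * φ x ^ 2 :=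
          setIntegral_congr_fun measurableSet_closedBall fun x hx => by
            simp only [hχe x hx, one_mul]
      _ ≤ _ := setIntegral_mono_set hi
          (.of_forall fun x => mul_nonneg (hχ0 x) (sq_nonneg _)) hsub.eventuallyLE
  have hψ2 : ∫ x in B, r ^ 2 * ψ x ^ 2 ≤ 2 * (C₂ ^ 2 + 1) * C₁ * V₁ * I := by
    have hi : IntegrableOn (fun x => r ^ 2 * ψ x ^ 2) B :=
      ((hψc.pow 2).const_mul (r ^ 2)).continuousOn.integrableOn_compact (isCompact_closedBall c r)
    have := setIntegral_mono_on hi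
      (integrableOn_const measure_closedBall_lt_top.ne) measurableSet_closedBall b2
    rw [setIntegral_const, smul_eq_mul, hvolB] at this
    refine this.trans_eq ?_
    field_simp
  have hφ2 : ∫ x in B, φ x ^ 2 ≤ C₁ * V₁ * I := by
    have hi : IntegrableOn (fun x => φ x ^ 2) B :=
      (hφc.pow 2).continuousOn.integrableOn_compact (isCompact_closedBall c r)
    have := setIntegral_mono_on hi
      (integrableOn_const measure_closedBall_lt_top.ne) measurableSet_closedBall b1
    rw [setIntegral_const, smul_eq_mul, hvolB] at this
    refine this.trans_eq ?_
    field_simp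
  have y1 : ∫ x in B, (u x - p x) * ψ x
      ≤ l / 2 * (r⁻¹ ^ 2 * U) + 1 / (2 * l) * ∫ x in B, r ^ 2 * ψ x ^ 2 := by
    rw [hU, ← integral_const_mul, ← integral_const_mul, ← integral_const_mul,
      ← integral_add ((hup.integrable_sq.const_mul _).const_mul _)
        (((hcm hψc).integrable_sq.const_mul _).const_mul _)]
    refine integral_mono (him hup (hcm hψc)) ((((hup.integrable_sq.const_mul _).const_mul _)).add
        (((hcm hψc).integrable_sq.const_mul _).const_mul _)) fun x => ?_
    have h0 := sq_nonneg (l * (r⁻¹ * (u x - p x)) - r * ψ x)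
    have h3 : (l * (r⁻¹ * (u x - p x)) - r * ψ x) ^ 2
      = 2 * l * (l / 2 * (r⁻¹ ^ 2 * (u x - p x) ^ 2) + 1 / (2 * l) * (r ^ 2 * ψ x ^ 2)
        - (u x - p x) * ψ x) := by
      field_simp
      ring
    rw [h3] at h0
    simp only
    linarith [nonneg_of_mul_nonneg_right h0 (by positivity)]
  have y2 : ∫ x in B, (v x - q x) * (χ x * φ x)
      ≤ l / 2 * W + 1 / (2 * l) * ∫ x in B, φ x ^ 2 := by
    rw [hW, ← integral_const_mul, ← integral_const_mul,
      ← integral_add (hvq.integrable_sq.const_mul _) ((hcm hφc).integrable_sq.const_mul _)]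
    refine integral_mono (him hvq (hcm hψs.continuous))
      ((hvq.integrable_sq.const_mul _).add ((hcm hφc).integrable_sq.const_mul _)) fun x => ?_
    have h0 := sq_nonneg (l * (v x - q x) - χ x * φ x)
    have h3 : (l * (v x - q x) - χ x * φ x) ^ 2
      = 2 * l * (l / 2 * (v x - q x) ^ 2 + 1 / (2 * l) * (χ x * φ x) ^ 2
        - (v x - q x) * (χ x * φ x)) := by
      field_simp
      ring
    rw [h3] at h0
    have h4 : (χ x * φ x) ^ 2 ≤ φ x ^ 2 := by
      rw [mul_pow]
      exact mul_le_of_le_one_left (sq_nonneg _) (pow_le_one₀ (hχ0 x) (hχ1 x))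
    have h5 : 1 / (2 * l) * (χ x * φ x) ^ 2 ≤ 1 / (2 * l) * φ x ^ 2 := by gcongr
    simp only
    linarith [nonneg_of_mul_nonneg_right h0 (by positivity)]
  have hfin : I ≤ l * (r⁻¹ ^ 2 * U + W) := by
    have h0 : 1 / (2 * l) * (∫ x in B, r ^ 2 * ψ x ^ 2) + 1 / (2 * l) * (∫ x in B, φ x ^ 2)
        ≤ I / 2 := by
      rw [← mul_add]
      calc _ ≤ 1 / (2 * l) * (2 * (C₂ ^ 2 + 1) * C₁ * V₁ * I + C₁ * V₁ * I) := by gcongr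
        _ = 1 / (2 * l) * (l * I) := by rw [hl]; ring
        _ = I / 2 := by field_simp
    linarith
  have hlast : ∫ x in D, φ x ^ 2 ≤ A ^ d * V₁ * C₁ * I := by
    have hi : IntegrableOn (fun x => φ x ^ 2) (Metric.closedBall c (A * r)) :=
      (hφc.pow 2).continuousOn.integrableOn_compact (isCompact_closedBall c _)
    calc ∫ x in D, φ x ^ 2 ≤ ∫ x in Metric.closedBall c (A * r), φ x ^ 2 :=
          setIntegral_mono_set hi (.of_forall fun x => sq_nonneg _) hD.eventuallyLE
      _ ≤ ∫ x in Metric.closedBall c (A * r), C₁ * (r ^ d)⁻¹ * I :=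
          setIntegral_mono_on hi (integrableOn_const measure_closedBall_lt_top.ne)
            measurableSet_closedBall fun x hx => (hpb x hx).1
      _ = _ := by
          rw [setIntegral_const, smul_eq_mul, Measure.addHaar_real_closedBall _ _ (by positivity),
            finrank_euclideanSpace_fin, mul_pow, ← hV₁]
          field_simp
  calc ∫ x in D, φ x ^ 2 ≤ A ^ d * V₁ * C₁ * I := hlast
    _ ≤ A ^ d * V₁ * C₁ * (l * (r⁻¹ ^ 2 * U + W)) := by gcongr
    _ = _ := by ring

/-- Local polynomial approximation of functions in `H^{k+1}(Ω)`, with the first derivatives. -/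
theorem exists_poly_approx_grad (d k : ℕ) {A : ℝ} (hA : 1 ≤ A) :
    ∃ C : ℝ, 0 < C ∧ ∀ {Ω : Set (E d)} (_ : IsOpen Ω) {u : L2 Ω} {M : ℝ}
      (_ : SobolevBound Ω (k + 1) u M) {v : Fin d → L2 Ω} (_ : ∀ j, IsWeakPartial Ω j u (v j)),
      ∃ F : E d → ℝ, (∀ x, 0 ≤ F x) ∧ IntegrableOn F Ω ∧
      ∫ x in Ω, F x ≤ C * M ^ 2 ∧ ∀ {V : Set (E d)} (_ : IsOpen V) (_ : V ⊆ Ω) {c : E d} {r : ℝ}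
      (_ : 0 < r) (_ : V ⊆ Metric.closedBall c (A * r)) (_ : Metric.closedBall c r ⊆ V),
        ∃ p ∈ polyLE d k,
          ∫ x in starKernel V c r, (u x - p x) ^ 2
            ≤ r ^ (2 * (k + 1)) * (∫ x in starKernel V c r, F x) ∧
          ∀ j, ∫ x in starKernel V c r, (v j x - fderiv ℝ p x (EuclideanSpace.single j 1)) ^ 2
            ≤ r ^ (2 * k) * ∫ x in starKernel V c r, F x := by
  have hA0 : 0 < A := one_pos.trans_le hA
  obtain ⟨C₁, hC₁, h₁⟩ := exists_poly_approx d k hA0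
  obtain ⟨C₂, hC₂, h₂⟩ := exists_poly_approx_step d hA0
  obtain ⟨C₃, hC₃, h₃⟩ := exists_fderiv_sub_poly_le d k hA
  set c₄ := C₂ + 2 + 2 * C₃ * (C₂ + 1) with hc₄
  refine ⟨c₄ * (d * C₁) + 1, by positivity, fun {Ω} hΩ {u M} hu {v} hv => ?_⟩
  have hvM (j : Fin d) : SobolevBound Ω k (v j) M := by
    obtain ⟨v', hv', hM⟩ := hu.2 j
    rwa [(hv j).unique hΩ hv']
  choose F hF0 hFi hFM hFp using fun j => h₁ hΩ (hvM j)
  refine ⟨fun x => c₄ * ∑ j, F j x, fun x => mul_nonneg (by positivity)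
      (Finset.sum_nonneg fun j _ => hF0 j x), ?_, ?_, ?_⟩
  · exact (integrable_finsetSum _ fun j _ => hFi j).const_mul _
  · rw [integral_const_mul, integral_finsetSum _ fun j _ => hFi j]
    have : ∑ j, ∫ x in Ω, F j x ≤ ∑ _j : Fin d, C₁ * M ^ 2 := Finset.sum_le_sum fun j _ => hFM j
    rw [Finset.sum_const, Finset.card_univ, Fintype.card_fin, nsmul_eq_mul] at this
    have hc0 : 0 ≤ c₄ := by positivity
    nlinarith [mul_le_mul_of_nonneg_left this hc0, sq_nonneg M]
  · intro V hV hVΩ c r hr hVA hBV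
    choose q hq hqb using fun j => hFp j hV hVΩ hr hVA
    obtain ⟨p, hp, hpb⟩ := h₂ k hΩ hv hV hVΩ hr hVA hq
    have hDV := starKernel_subset V c hr.le
    have hD : starKernel V c r ⊆ Ω := hDV.trans hVΩ
    have hBD := ball_subset_starKernel hBV
    have hqk (j : Fin d) : q j ∈ polyLE d k := polyLT_le d k (hq j)
    have hpk : p ∈ polyLE d k := hp
    have hpc := continuous_of_mem_polyLE hpk
    have hqc (j : Fin d) := continuous_of_mem_polyLE (hqk j)
    rw [integral_const_mul, integral_finsetSum _ fun j _ => (hFi j).mono_set hD]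
    set S := ∑ j, ∫ x in starKernel V c r, F j x with hS
    have hFS (j : Fin d) : ∫ x in starKernel V c r, F j x ≤ S :=
      Finset.single_le_sum (f := fun j => ∫ x in starKernel V c r, F j x)
        (fun j _ => integral_nonneg fun x => hF0 j x) (Finset.mem_univ j)
    have hS0 : 0 ≤ S := Finset.sum_nonneg fun j _ => integral_nonneg fun x => hF0 j x
    have hup : MemLp (fun x => u x - p x) 2 (volume.restrict (starKernel V c r)) :=
      (memLp_restrict_subset u hD).sub
        (hpc.memLp_restrict_of_subset_closedBall (hDV.trans hVA))
    have hvq (j : Fin d) : MemLp (fun x => v j x - q j x) 2 (volume.restrict (starKernel V c r)) :=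
      (memLp_restrict_subset (v j) hD).sub
        ((hqc j).memLp_restrict_of_subset_closedBall (hDV.trans hVA))
    have hU : ∫ x in starKernel V c r, (u x - p x) ^ 2 ≤ C₂ * (r ^ (2 * (k + 1)) * S) := by
      refine hpb.trans ?_
      calc C₂ * r ^ 2 * ∑ j, ∫ x in starKernel V c r, (v j x - q j x) ^ 2
          ≤ C₂ * r ^ 2 * ∑ j, r ^ (2 * k) * ∫ x in starKernel V c r, F j x := by
            gcongr with j
            exact hqb j
        _ = _ := by rw [← Finset.mul_sum]; ring
    have hW (j : Fin d) : ∫ x in starKernel V c r, (v j x - q j x) ^ 2 ≤ r ^ (2 * k) * S :=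
      (hqb j).trans (by gcongr; exact hFS j)
    refine ⟨p, hpk, hU.trans ?_, fun j => ?_⟩
    · have : C₂ ≤ c₄ := by rw [hc₄]; linarith [mul_pos hC₃ (by linarith : 0 < C₂ + 1)]
      calc C₂ * (r ^ (2 * (k + 1)) * S) ≤ c₄ * (r ^ (2 * (k + 1)) * S) := by gcongr
        _ = _ := by ring
    · have h4 := h₃ hΩ.measurableSet (hv j) hr (hBV.trans hVΩ) hpk (hqk j) (hDV.trans hVA)
      have hφc : Continuous fun x => fderiv ℝ p x (EuclideanSpace.single j 1) - q j x :=
        (continuous_of_mem_polyLE (fderiv_mem_polyLE hpk _)).sub (hqc j)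
      have hφm := hφc.memLp_restrict_of_subset_closedBall (hDV.trans hVA)
      have hUB : ∫ x in Metric.closedBall c r, (u x - p x) ^ 2 ≤ C₂ * (r ^ (2 * (k + 1)) * S) :=
        (setIntegral_mono_set hup.integrable_sq (.of_forall fun x => sq_nonneg _)
          hBD.eventuallyLE).trans hU
      have hWB : ∫ x in Metric.closedBall c r, (v j x - q j x) ^ 2 ≤ r ^ (2 * k) * S :=
        (setIntegral_mono_set (hvq j).integrable_sq (.of_forall fun x => sq_nonneg _)
          hBD.eventuallyLE).trans (hW j)
      have hm : MemLp (fun x => v j x - fderiv ℝ p x (EuclideanSpace.single j 1)) 2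
          (volume.restrict (starKernel V c r)) := by
        refine ((hvq j).sub hφm).ae_eq (.of_forall fun x => ?_)
        simp only [Pi.sub_apply]
        ring
      calc ∫ x in starKernel V c r, (v j x - fderiv ℝ p x (EuclideanSpace.single j 1)) ^ 2
          ≤ ∫ x in starKernel V c r, (2 * (v j x - q j x) ^ 2
            + 2 * (fderiv ℝ p x (EuclideanSpace.single j 1) - q j x) ^ 2) := by
            refine integral_mono hm.integrable_sq (((hvq j).integrable_sq.const_mul 2).add
              (hφm.integrable_sq.const_mul 2)) fun x => ?_
            simp only
            nlinarith [sq_nonneg (v j x - q j x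
              + (fderiv ℝ p x (EuclideanSpace.single j 1) - q j x))]
        _ = 2 * (∫ x in starKernel V c r, (v j x - q j x) ^ 2)
            + 2 * ∫ x in starKernel V c r,
              (fderiv ℝ p x (EuclideanSpace.single j 1) - q j x) ^ 2 := by
            rw [integral_add ((hvq j).integrable_sq.const_mul 2) (hφm.integrable_sq.const_mul 2),
              integral_const_mul, integral_const_mul]
        _ ≤ 2 * (r ^ (2 * k) * S)
            + 2 * (C₃ * (r⁻¹ ^ 2 * (C₂ * (r ^ (2 * (k + 1)) * S)) + r ^ (2 * k) * S)) := by
            gcongr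
            · exact hW j
            · exact h4.trans (by gcongr)
        _ = (2 + 2 * C₃ * (C₂ + 1)) * (r ^ (2 * k) * S) := by
            field_simp
            ring
        _ ≤ c₄ * (r ^ (2 * k) * S) := by
            gcongr
            rw [hc₄]; linarith
        _ = _ := by ring

end BrambleHilbert

section Triangulation

variable {d : ℕ} {Ω : Set (E d)} {κ h : ℝ} {𝒯 : Geometry.SimplicialComplex ℝ (E d)}

/-- The closed element with the given vertices. -/
abbrev hull (s : Finset (E d)) : Set (E d) := convexHull ℝ (s : Set (E d))

theorem volume_hull_eq_zero {s : Finset (E d)} (hs : s.card ≤ d) : volume (hull s) = 0 := by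
  classical
  rcases s.eq_empty_or_nonempty with rfl | hne
  · simp [hull]
  obtain ⟨n, hn⟩ := Nat.exists_eq_succ_of_ne_zero (Finset.card_pos.2 hne).ne'
  have h1 := finrank_vectorSpan_image_finset_le ℝ (id : E d → E d) s hn
  rw [Finset.image_id] at h1
  refine measure_mono_null (convexHull_subset_affineSpan _)
    (Measure.addHaar_affineSubspace volume _ fun htop => ?_)
  have h2 : vectorSpan ℝ (s : Set (E d)) = ⊤ := by
    rw [← direction_affineSpan, htop, AffineSubspace.direction_top]
  rw [h2, finrank_top, finrank_euclideanSpace_fin] at h1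
  omega

theorem isCompact_hull (s : Finset (E d)) : IsCompact (hull s) :=
  s.finite_toSet.isCompact_convexHull ℝ

theorem volume_hull_inter_hull {s t : Finset (E d)} (hs : s ∈ cells 𝒯) (ht : t ∈ cells 𝒯)
    (hst : s ≠ t) : volume (hull s ∩ hull t) = 0 := by
  classical
  have h1 := 𝒯.inter_subset_convexHull hs.1 ht.1
  rw [← Finset.coe_inter] at h1
  refine measure_mono_null h1 (volume_hull_eq_zero ?_)
  have h2 : s ∩ t ⊂ s := by
    refine (Finset.inter_subset_left).ssubset_of_ne fun he => hst ?_
    exact Finset.eq_of_subset_of_card_le (Finset.inter_eq_left.1 he) (by rw [hs.2, ht.2])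
  have := Finset.card_lt_card h2
  rw [hs.2] at this
  omega

namespace IsQuasiUniformTriangulation

theorem finite_cells (hT : IsQuasiUniformTriangulation Ω κ h 𝒯) : (cells 𝒯).Finite :=
  hT.finite.subset fun _ hs => hs.1

/-- The elements as a `Finset`. -/
def elements (hT : IsQuasiUniformTriangulation Ω κ h 𝒯) : Finset (Finset (E d)) :=
  hT.finite_cells.toFinset

theorem mem_elements (hT : IsQuasiUniformTriangulation Ω κ h 𝒯) {s : Finset (E d)} :
    s ∈ hT.elements ↔ s ∈ cells 𝒯 := hT.finite_cells.mem_toFinset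

theorem iUnion_hull (hT : IsQuasiUniformTriangulation Ω κ h 𝒯) (hΩ : IsOpen Ω) :
    ⋃ s ∈ cells 𝒯, hull s = closure Ω := by
  have hsub : ⋃ s ∈ cells 𝒯, hull s ⊆ closure Ω := by
    rw [← hT.space_eq]
    exact iUnion₂_subset fun s hs => Geometry.SimplicialComplex.convexHull_subset_space hs.1
  have hclosed : IsClosed (⋃ s ∈ cells 𝒯, hull s) :=
    hT.finite_cells.isClosed_biUnion fun s _ => (isCompact_hull s).isClosed
  refine hsub.antisymm (closure_minimal ?_ hclosed)
  by_contra hcon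
  obtain ⟨x, hx, hxn⟩ := not_subset.1 hcon
  have hU : IsOpen (Ω \ ⋃ s ∈ cells 𝒯, hull s) := hΩ.sdiff hclosed
  have hpos := hU.measure_pos volume ⟨x, hx, hxn⟩
  refine hpos.ne' ?_
  refine measure_mono_null (t := ⋃ s ∈ {s ∈ 𝒯.faces | s.card ≤ d}, hull s) ?_ ?_
  · intro y hy
    have hy1 : y ∈ 𝒯.space := by rw [hT.space_eq]; exact subset_closure hy.1
    obtain ⟨s, hs, hys⟩ := Geometry.SimplicialComplex.mem_space_iff.1 hy1
    refine mem_iUnion₂.2 ⟨s, ⟨hs, ?_⟩, hys⟩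
    by_contra hcard
    have h1 := (𝒯.indep hs).card_le_finrank_succ
    have h2 := Submodule.finrank_le (vectorSpan ℝ (range ((↑) : s → E d)))
    rw [finrank_euclideanSpace_fin] at h2
    rw [Fintype.card_coe] at h1
    exact hy.2 (mem_iUnion₂.2 ⟨s, ⟨hs, by omega⟩, hys⟩)
  · refine (measure_biUnion_null_iff (hT.finite.subset fun s hs => hs.1).countable).2 fun s hs => ?_
    exact volume_hull_eq_zero hs.2

theorem hull_subset (hT : IsQuasiUniformTriangulation Ω κ h 𝒯) {s : Finset (E d)}
    (hs : s ∈ cells 𝒯) : hull s ⊆ closure Ω := by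
  rw [← hT.space_eq]
  exact Geometry.SimplicialComplex.convexHull_subset_space hs.1

theorem exists_mem_hull (hT : IsQuasiUniformTriangulation Ω κ h 𝒯) (hΩ : IsOpen Ω) {x : E d}
    (hx : x ∈ closure Ω) : ∃ s ∈ cells 𝒯, x ∈ hull s := by
  rw [← hT.iUnion_hull hΩ] at hx
  simpa using hx

theorem restrict_eq_sum (hT : IsQuasiUniformTriangulation Ω κ h 𝒯) (hΩ : IsLipschitzDomain Ω)
    (hd : 1 ≤ d) : volume.restrict Ω = ∑ s ∈ hT.elements, volume.restrict (hull s) := by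
  have h1 : volume.restrict Ω = volume.restrict (closure Ω) := by
    refine Measure.restrict_congr_set ?_
    refine (subset_closure.eventuallyLE).antisymm ?_
    refine ae_le_set.2 (measure_mono_null ?_ (hΩ.volume_frontier hd))
    intro x hx
    rw [hΩ.isOpen.frontier_eq]
    exact hx
  rw [h1, ← hT.iUnion_hull hΩ.isOpen]
  have h2 : ⋃ s ∈ cells 𝒯, hull s = ⋃ s : hT.elements, hull (s : Finset (E d)) := by
    ext x; simp [hT.mem_elements]
  rw [h2, Measure.restrict_iUnion_ae, Measure.sum_fintype,
    Finset.sum_coe_sort hT.elements fun s => volume.restrict (hull s)]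
  · intro s t hst
    exact volume_hull_inter_hull (hT.mem_elements.1 s.2) (hT.mem_elements.1 t.2)
      fun he => hst (Subtype.ext he)
  · exact fun s => (isCompact_hull _).measurableSet.nullMeasurableSet

theorem restrict_hull_le (hT : IsQuasiUniformTriangulation Ω κ h 𝒯) (hΩ : IsLipschitzDomain Ω)
    (hd : 1 ≤ d) {s : Finset (E d)} (hs : s ∈ cells 𝒯) :
    volume.restrict (hull s) ≤ volume.restrict Ω := by
  rw [hT.restrict_eq_sum hΩ hd]
  exact Finset.single_le_sum (f := fun s => volume.restrict (hull s))
    (fun _ _ => Measure.zero_le _) (hT.mem_elements.2 hs)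

theorem ae_iff (hT : IsQuasiUniformTriangulation Ω κ h 𝒯) (hΩ : IsLipschitzDomain Ω)
    (hd : 1 ≤ d) {p : E d → Prop} : (∀ᵐ x ∂(volume.restrict Ω), p x) ↔
      ∀ s ∈ cells 𝒯, ∀ᵐ x ∂(volume.restrict (hull s)), p x := by
  refine ⟨fun hp s hs => ae_mono (hT.restrict_hull_le hΩ hd hs) hp, fun hp => ?_⟩
  rw [hT.restrict_eq_sum hΩ hd, MeasureTheory.ae_iff, Measure.finsetSum_apply]
  exact Finset.sum_eq_zero fun s hs => MeasureTheory.ae_iff.1 (hp s (hT.mem_elements.1 hs))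

theorem integral_eq_sum (hT : IsQuasiUniformTriangulation Ω κ h 𝒯) (hΩ : IsLipschitzDomain Ω)
    (hd : 1 ≤ d) {f : E d → ℝ} (hf : IntegrableOn f Ω) :
    ∫ x in Ω, f x = ∑ s ∈ hT.elements, ∫ x in hull s, f x := by
  rw [hT.restrict_eq_sum hΩ hd, integral_finsetSum_measure]
  exact fun s hs => Integrable.mono_measure hf (hT.restrict_hull_le hΩ hd (hT.mem_elements.1 hs))

theorem diam_le (hT : IsQuasiUniformTriangulation Ω κ h 𝒯) {s : Finset (E d)}
    (hs : s ∈ cells 𝒯) : Metric.diam (hull s) ≤ h :=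
  hT.mesh_size.2 ⟨s, hs, rfl⟩

theorem dist_le (hT : IsQuasiUniformTriangulation Ω κ h 𝒯) {s : Finset (E d)}
    (hs : s ∈ cells 𝒯) {x y : E d} (hx : x ∈ hull s) (hy : y ∈ hull s) : dist x y ≤ h :=
  (Metric.dist_le_diam_of_mem (isCompact_hull s).isBounded hx hy).trans (hT.diam_le hs)

theorem pos (hT : IsQuasiUniformTriangulation Ω κ h 𝒯) (hd : 1 ≤ d) : 0 < h := by
  obtain ⟨s, hs, hsh⟩ := hT.mesh_size.1
  have hcard : 1 < s.card := by rw [hs.2]; omega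
  obtain ⟨x, hx, y, hy, hxy⟩ := Finset.one_lt_card.1 hcard
  exact (dist_pos.2 hxy).trans_le (hT.dist_le hs (subset_convexHull ℝ _ hx)
    (subset_convexHull ℝ _ hy))

/-- The centre of a ball inside an element. -/
theorem exists_center (hT : IsQuasiUniformTriangulation Ω κ h 𝒯) (hd : 1 ≤ d) (hκ : 0 < κ)
    {s : Finset (E d)} (hs : s ∈ cells 𝒯) : ∃ c, Metric.closedBall c (κ * h) ⊆ hull s ∧
      hull s ⊆ Metric.closedBall c (1 * h) := by
  obtain ⟨c, hc⟩ := hT.quasi_uniform s hs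
  refine ⟨c, hc, fun x hx => ?_⟩
  rw [one_mul, Metric.mem_closedBall]
  exact hT.dist_le hs hx (hc (Metric.mem_closedBall_self (mul_pos hκ (hT.pos hd)).le))

theorem card_mul_le (hT : IsQuasiUniformTriangulation Ω κ h 𝒯) (hd : 1 ≤ d) (hκ : 0 < κ)
    {S : Finset (Finset (E d))} (hS : ∀ s ∈ S, s ∈ cells 𝒯) {z : E d} {R : ℝ} (hR : 0 ≤ R)
    (hSR : ∀ s ∈ S, hull s ⊆ Metric.closedBall z R) : S.card * (κ * h) ^ d ≤ R ^ d := by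
  have hh := hT.pos hd
  have h1 : volume (⋃ s ∈ S, hull s) = ∑ s ∈ S, volume (hull s) := by
    refine measure_biUnion_finset₀ ?_ fun s _ => (isCompact_hull s).measurableSet.nullMeasurableSet
    intro s hs t ht hst
    exact volume_hull_inter_hull (hS s hs) (hS t ht) hst
  set V₁ := volume (Metric.ball (0 : E d) 1) with hV₁
  have hV0 : V₁ ≠ 0 := (Metric.measure_ball_pos volume (0 : E d) one_pos).ne'
  have hVt : V₁ ≠ ⊤ := measure_ball_lt_top.ne
  have h2 : ∑ s ∈ S, ENNReal.ofReal ((κ * h) ^ d) * V₁ ≤ ENNReal.ofReal (R ^ d) * V₁ := by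
    calc _ ≤ ∑ s ∈ S, volume (hull s) := by
          refine Finset.sum_le_sum fun s hs => ?_
          obtain ⟨c, hc, -⟩ := hT.exists_center hd hκ (hS s hs)
          refine le_trans (le_of_eq ?_) (measure_mono hc)
          rw [Measure.addHaar_closedBall _ _ (by positivity), finrank_euclideanSpace_fin]
      _ = volume (⋃ s ∈ S, hull s) := h1.symm
      _ ≤ volume (Metric.closedBall z R) := measure_mono (iUnion₂_subset hSR)
      _ = _ := by rw [Measure.addHaar_closedBall _ _ hR, finrank_euclideanSpace_fin]
  rw [Finset.sum_const, nsmul_eq_mul, ← mul_assoc, ENNReal.mul_le_mul_iff_left hV0 hVt,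
    ← ENNReal.ofReal_natCast, ← ENNReal.ofReal_mul (by positivity),
    ENNReal.ofReal_le_ofReal_iff (by positivity)] at h2
  exact h2

/-- Functions given on the elements define a function on `Ω`. -/
theorem exists_glue (hT : IsQuasiUniformTriangulation Ω κ h 𝒯) (hΩ : IsLipschitzDomain Ω)
    (hd : 1 ≤ d) {F : Type*} [NormedAddCommGroup F] (f : Finset (E d) → E d → F)
    (hf : ∀ s ∈ cells 𝒯, Continuous (f s)) : ∃ z : Lp F 2 (volume.restrict Ω),
      ∀ s ∈ cells 𝒯, ∀ᵐ x ∂(volume.restrict (hull s)), z x = f s x := by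
  have hm : ∀ s ∈ hT.elements, MemLp ((hull s).indicator (f s)) 2 (volume.restrict Ω) := by
    intro s hs
    obtain ⟨M, hM⟩ := (isCompact_hull s).exists_bound_of_continuousOn
      (hf s (hT.mem_elements.1 hs)).continuousOn
    have : IsFiniteMeasure (volume.restrict Ω) :=
      ⟨by simpa using hΩ.isBounded.measure_lt_top⟩
    refine MemLp.of_bound (((hf s (hT.mem_elements.1 hs)).aestronglyMeasurable).indicator
      (isCompact_hull s).measurableSet) |M| (.of_forall fun x => ?_)
    by_cases hx : x ∈ hull s
    · rw [indicator_of_mem hx]; exact (hM x hx).trans (le_abs_self M)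
    · rw [indicator_of_notMem hx, norm_zero]; positivity
  have hsum : MemLp (∑ s ∈ hT.elements, (hull s).indicator (f s)) 2 (volume.restrict Ω) :=
    memLp_finsetSum' _ hm
  refine ⟨hsum.toLp _, fun s hs => ?_⟩
  have h1 : ∀ᵐ x ∂(volume.restrict (hull s)), ∀ t ∈ hT.elements, t ≠ s → x ∉ hull t := by
    rw [Finset.eventually_all]
    intro t ht
    by_cases hts : t = s
    · exact .of_forall fun x h => absurd hts h
    · rw [ae_restrict_iff' (isCompact_hull s).measurableSet]
      have := volume_hull_inter_hull (hT.mem_elements.1 ht) hs hts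
      filter_upwards [measure_eq_zero_iff_ae_notMem.1 this] with x hx hxs _ hxt
      exact hx ⟨hxt, hxs⟩
  filter_upwards [h1, ae_mono (hT.restrict_hull_le hΩ hd hs) hsum.coeFn_toLp,
    ae_restrict_mem (isCompact_hull s).measurableSet] with x hx1 hx2 hx3
  rw [hx2, Finset.sum_apply, Finset.sum_eq_single s]
  · rw [indicator_of_mem hx3]
  · intro t ht hts
    rw [indicator_of_notMem (hx1 t ht hts)]
  · exact fun hn => absurd (hT.mem_elements.2 hs) hn

end IsQuasiUniformTriangulation

end Triangulation

section PiecewisePolynomials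

variable {d k : ℕ} {Ω : Set (E d)} {κ h : ℝ} {𝒯 : Geometry.SimplicialComplex ℝ (E d)}

/-- `v` is continuous on `closure Ω` and is equal to the polynomial `p s` on each element `s`. -/
structure IsPiecewise (Ω : Set (E d)) (k : ℕ) (𝒯 : Geometry.SimplicialComplex ℝ (E d))
    (v : E d → ℝ) (p : Finset (E d) → E d → ℝ) : Prop where
  continuousOn : ContinuousOn v (closure Ω)
  mem : ∀ s ∈ cells 𝒯, p s ∈ polyLE d k
  eqOn : ∀ s ∈ cells 𝒯, EqOn v (p s) (hull s)

theorem mem_Rh_iff {u : L2 Ω} : u ∈ Rh Ω k 𝒯 ↔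
    ∃ v p, IsPiecewise Ω k 𝒯 v p ∧ u =ᵐ[volume.restrict Ω] v := by
  classical
  constructor
  · rintro ⟨v, hvc, hvp, huv⟩
    choose! p hp hpe using hvp
    exact ⟨v, fun s => pEval (p s), ⟨hvc, fun s hs => pEval_mem_polyLE (hp s hs), hpe⟩, huv⟩
  · rintro ⟨v, p, hv, huv⟩
    refine ⟨v, hv.continuousOn, fun s hs => ?_, huv⟩
    obtain ⟨q, hq, hqe⟩ := exists_pEval_of_mem_polyLE (hv.mem s hs)
    exact ⟨q, hq, fun x hx => by rw [hv.eqOn s hs hx, hqe]⟩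

/-- `R_h` as a subspace. -/
def RhSub (Ω : Set (E d)) (k : ℕ) (𝒯 : Geometry.SimplicialComplex ℝ (E d)) :
    Submodule ℝ (L2 Ω) where
  carrier := Rh Ω k 𝒯
  zero_mem' := mem_Rh_iff.2 ⟨0, fun _ => 0, ⟨continuousOn_const, fun _ _ => Submodule.zero_mem _,
    fun _ _ _ _ => rfl⟩, Lp.coeFn_zero _ _ _⟩
  add_mem' := by
    intro a b ha hb
    obtain ⟨v, p, hv, hva⟩ := mem_Rh_iff.1 ha
    obtain ⟨w, q, hw, hwb⟩ := mem_Rh_iff.1 hb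
    refine mem_Rh_iff.2 ⟨v + w, fun s => p s + q s, ⟨hv.continuousOn.add hw.continuousOn,
      fun s hs => Submodule.add_mem _ (hv.mem s hs) (hw.mem s hs), fun s hs x hx => ?_⟩, ?_⟩
    · simp [hv.eqOn s hs hx, hw.eqOn s hs hx]
    · exact (Lp.coeFn_add a b).trans (hva.add hwb)
  smul_mem' := by
    intro c a ha
    obtain ⟨v, p, hv, hva⟩ := mem_Rh_iff.1 ha
    refine mem_Rh_iff.2 ⟨c • v, fun s => c • p s, ⟨hv.continuousOn.const_smul c,
      fun s hs => Submodule.smul_mem _ c (hv.mem s hs), fun s hs x hx => ?_⟩, ?_⟩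
    · simp [hv.eqOn s hs hx]
    · exact (Lp.coeFn_smul c a).trans (hva.const_smul c)

theorem lipschitzWith_of_isClosed_cover {ι F V : Type*} [Finite ι] [NormedAddCommGroup V]
    [NormedSpace ℝ V] [PseudoMetricSpace F] {A : ι → Set V} (hA : ∀ i, IsClosed (A i))
    (hcov : ⋃ i, A i = univ) {K : ℝ≥0} {f : V → F} (hf : ∀ i, LipschitzOnWith K f (A i)) :
    LipschitzWith K f := by
  have hc : Continuous f :=
    (locallyFinite_of_finite A).continuous hcov hA fun i => (hf i).continuousOn
  refine LipschitzWith.of_dist_le_mul fun x y => ?_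
  set γ : ℝ → V := fun t => x + t • (y - x) with hγ
  have hγc : Continuous γ := by fun_prop
  have hγd (t t' : ℝ) : dist (γ t') (γ t) = |t' - t| * dist x y := by
    rw [hγ, dist_eq_norm, dist_eq_norm, ← Real.norm_eq_abs, ← norm_neg (x - y), ← norm_smul]
    congr 1
    module
  have h1 : (1 : ℝ) ∈ {t : ℝ | dist (f (γ t)) (f x) ≤ K * (t * dist x y)} := by
    refine IsClosed.mem_of_ge_of_forall_exists_gt (a := 0) ?_ (by simp [hγ]) zero_le_one ?_
    · refine IsClosed.inter (isClosed_le (by fun_prop) (by fun_prop)) isClosed_Icc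
    · rintro t ⟨ht, ht0, ht1⟩
      have hev : ∀ᶠ t' in 𝓝[>] t, ∀ i, γ t' ∈ A i → γ t ∈ A i := by
        rw [eventually_all]
        intro i
        by_cases hi : γ t ∈ A i
        · exact .of_forall fun _ _ => hi
        · refine nhdsWithin_le_nhds ?_
          filter_upwards [((hA i).isOpen_compl.preimage hγc).mem_nhds hi] with t' ht' h
          exact absurd h ht'
      obtain ⟨t', hev', ht'⟩ := (hev.and (Ioc_mem_nhdsGT ht1)).exists
      refine ⟨t', ?_, ht'⟩
      obtain ⟨i, hi⟩ := mem_iUnion.1 (hcov.symm ▸ mem_univ (γ t') : γ t' ∈ ⋃ i, A i)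
      have h2 := (hf i).dist_le_mul _ hi _ (hev' i hi)
      rw [hγd, abs_of_pos (sub_pos.2 ht'.1)] at h2
      calc dist (f (γ t')) (f x) ≤ dist (f (γ t')) (f (γ t)) + dist (f (γ t)) (f x) :=
            dist_triangle _ _ _
        _ ≤ K * ((t' - t) * dist x y) + K * (t * dist x y) := add_le_add h2 ht
        _ = _ := by ring
  have h2 : dist (f (γ 1)) (f x) ≤ K * (1 * dist x y) := h1
  rw [one_mul, dist_comm] at h2
  simpa [hγ] using h2

namespace IsPiecewise

variable {v : E d → ℝ} {p : Finset (E d) → E d → ℝ}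

/-- The gradient on the elements is the weak gradient. -/
theorem isWeakGradient (hv : IsPiecewise Ω k 𝒯 v p) (hT : IsQuasiUniformTriangulation Ω κ h 𝒯)
    (hΩ : IsLipschitzDomain Ω) (hd : 1 ≤ d) {u : L2 Ω} (huv : u =ᵐ[volume.restrict Ω] v)
    {G : L2v Ω} (hG : ∀ s ∈ cells 𝒯, ∀ᵐ x ∂(volume.restrict (hull s)),
      ∀ j, G x j = fderiv ℝ (p s) x (EuclideanSpace.single j 1)) : IsWeakGradient Ω u G := by
  classical
  intro j η hη
  set e : E d := EuclideanSpace.single j 1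
  set w : E d → ℝ := fun x => η x * (closure Ω).indicator v x with hw
  have hηΩ : ∀ x ∉ Ω, η x = 0 := fun x hx =>
    image_eq_zero_of_notMem_tsupport fun h => hx (hη.2.2 h)
  have hws : ∀ s ∈ cells 𝒯, EqOn w (fun x => η x * p s x) (hull s) := fun s hs x hx => by
    simp only [hw]
    rw [indicator_of_mem (hT.hull_subset hs hx), hv.eqOn s hs hx]
  have hwo : ∀ x ∉ Ω, w x = 0 := fun x hx => by simp only [hw]; rw [hηΩ x hx, zero_mul]
  have hlip : ∀ s ∈ hT.elements, ∃ K, LipschitzWith K (fun x => η x * p s x) := by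
    intro s hs
    have h1 : ContDiff ℝ ∞ (fun x => η x * p s x) :=
      hη.1.mul (contDiff_of_mem_polyLE (hv.mem s (hT.mem_elements.1 hs)))
    exact h1.lipschitzWith_of_hasCompactSupport hη.2.1.mul_right (by simp)
  choose! K hK using hlip
  set K₀ := ∑ s ∈ hT.elements, K s with hK₀
  have hwl : LipschitzWith K₀ w := by
    refine lipschitzWith_of_isClosed_cover (ι := Option hT.elements)
      (A := fun o => o.elim Ωᶜ fun s => hull s) ?_ ?_ ?_
    · rintro (_ | s)
      · exact hΩ.isOpen.isClosed_compl
      · exact (isCompact_hull _).isClosed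
    · refine eq_univ_of_forall fun x => mem_iUnion.2 ?_
      by_cases hx : x ∈ Ω
      · obtain ⟨s, hs, hxs⟩ := hT.exists_mem_hull hΩ.isOpen (subset_closure hx)
        exact ⟨some ⟨s, hT.mem_elements.2 hs⟩, hxs⟩
      · exact ⟨none, hx⟩
    · rintro (_ | ⟨s, hs⟩)
      · intro x hx y hy
        rw [hwo x hx, hwo y hy, edist_self]
        exact zero_le
      · have h1 : LipschitzOnWith (K s) w (hull s) := by
          intro x hx y hy
          rw [hws s (hT.mem_elements.1 hs) hx, hws s (hT.mem_elements.1 hs) hy]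
          exact hK s hs x y
        exact h1.weaken (Finset.single_le_sum (fun _ _ => zero_le) hs)
  have hwc : HasCompactSupport w := hη.2.1.mul_right
  have hint := (LipschitzWith.const (1 : ℝ)).integral_lineDeriv_mul_eq (μ := volume) hwl hwc (-e)
  simp only [neg_neg, mul_one] at hint
  have hl0 : ∀ x : E d, lineDeriv ℝ (fun _ : E d => (1 : ℝ)) x (-e) = 0 := fun x => by
    simp [lineDeriv]
  simp only [hl0, zero_mul, integral_zero] at hint
  have hout : ∀ x ∉ Ω, lineDeriv ℝ w x e = 0 := by
    intro x hx
    have h1 : w =ᶠ[𝓝 x] fun _ => 0 := by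
      have h2 : (tsupport η)ᶜ ∈ 𝓝 x :=
        (isClosed_tsupport η).isOpen_compl.mem_nhds fun h => hx (hη.2.2 h)
      filter_upwards [h2] with y hy
      simp only [hw]
      rw [image_eq_zero_of_notMem_tsupport hy, zero_mul]
    rw [h1.lineDeriv_eq]
    simp [lineDeriv]
  rw [← setIntegral_eq_integral_of_forall_compl_eq_zero hout] at hint
  have hae : ∀ᵐ x ∂(volume.restrict Ω),
      lineDeriv ℝ w x e = u x * fderiv ℝ η x e + comp Ω j G x * η x := by
    rw [hT.ae_iff hΩ hd]
    intro s hs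
    have h1 := (convex_convexHull ℝ (s : Set (E d))).addHaar_frontier volume
    filter_upwards [hG s hs, ae_mono (hT.restrict_hull_le hΩ hd hs) huv,
      ae_mono (hT.restrict_hull_le hΩ hd hs) (comp_ae_eq j G),
      ae_restrict_mem (isCompact_hull s).measurableSet,
      ae_restrict_of_ae (measure_eq_zero_iff_ae_notMem.1 h1)] with x hx1 hx2 hx3 hx4 hx5
    have hxi : x ∈ interior (hull s) := by
      by_contra hn
      exact hx5 ⟨subset_closure hx4, hn⟩
    have h2 : w =ᶠ[𝓝 x] fun x => η x * p s x := by
      filter_upwards [mem_interior_iff_mem_nhds.1 hxi] with y hy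
      exact hws s hs hy
    have hη' := (hη.1.differentiable (by simp) x).hasFDerivAt
    have hp' := (differentiable_of_mem_polyLE (hv.mem s hs) x).hasFDerivAt
    rw [h2.lineDeriv_eq, show (fun x => η x * p s x) = η * p s from rfl,
      (hη'.mul hp').differentiableAt.lineDeriv_eq_fderiv, (hη'.mul hp').fderiv, hx3, hx1 j, hx2,
      hv.eqOn s hs hx4]
    simp [e]
    ring
  rw [integral_congr_ae hae, integral_add] at hint
  · linarith
  · exact (Lp.memLp u).integrable_mul (hη.memLp_fderiv e)
  · exact (Lp.memLp (comp Ω j G)).integrable_mul hη.memLp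

theorem exists_isWeakGradient (hv : IsPiecewise Ω k 𝒯 v p)
    (hT : IsQuasiUniformTriangulation Ω κ h 𝒯)
    (hΩ : IsLipschitzDomain Ω) (hd : 1 ≤ d) {u : L2 Ω} (huv : u =ᵐ[volume.restrict Ω] v) :
    ∃ G : L2v Ω, IsWeakGradient Ω u G ∧ ∀ s ∈ cells 𝒯, ∀ᵐ x ∂(volume.restrict (hull s)),
      ∀ j, G x j = fderiv ℝ (p s) x (EuclideanSpace.single j 1) := by
  obtain ⟨G, hG⟩ := hT.exists_glue hΩ hd
    (fun s x => WithLp.toLp 2 fun j => fderiv ℝ (p s) x (EuclideanSpace.single j 1) :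
      Finset (E d) → E d → E d) fun s hs => by
      refine (PiLp.continuous_toLp 2 _).comp (continuous_pi fun j => ?_)
      exact continuous_of_mem_polyLE (fderiv_mem_polyLE (hv.mem s hs) _)
  have hG' : ∀ s ∈ cells 𝒯, ∀ᵐ x ∂(volume.restrict (hull s)),
      ∀ j, G x j = fderiv ℝ (p s) x (EuclideanSpace.single j 1) := by
    intro s hs
    filter_upwards [hG s hs] with x hx j
    rw [hx]
  exact ⟨G, hv.isWeakGradient hT hΩ hd huv hG', hG'⟩

/-- The trace of a continuous function. -/
theorem trace_eq (hv : ContinuousOn v (closure Ω)) {u : L2 Ω}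
    (huv : u =ᵐ[volume.restrict Ω] v) (hΩ : IsLipschitzDomain Ω) {x : E d}
    (hx : x ∈ frontier Ω) : trace Ω u x = v x := by
  refine Tendsto.limUnder_eq ?_
  rw [Metric.tendsto_nhds]
  intro ε hε
  have hxc : x ∈ closure Ω := frontier_subset_closure hx
  obtain ⟨δ, hδ, hδv⟩ := Metric.continuousOn_iff.1 hv x hxc (ε / 2) (half_pos hε)
  filter_upwards [Ioo_mem_nhdsGT hδ] with r hr
  have ho : IsOpen (Metric.ball x r ∩ Ω) := Metric.isOpen_ball.inter hΩ.isOpen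
  have hne : (Metric.ball x r ∩ Ω).Nonempty :=
    mem_closure_iff_nhds.1 hxc _ (Metric.ball_mem_nhds x hr.1)
  have hpos := ho.measure_pos volume hne
  have hfin : volume (Metric.ball x r ∩ Ω) < ⊤ :=
    (measure_mono inter_subset_left).trans_lt measure_ball_lt_top
  have hae : ∀ᵐ y ∂(volume.restrict (Metric.ball x r ∩ Ω)), ‖u y - v x‖ ≤ ε / 2 := by
    filter_upwards [ae_mono (Measure.restrict_mono inter_subset_right le_rfl) huv,
      ae_restrict_mem ho.measurableSet] with y hy1 hy2
    rw [hy1, ← dist_eq_norm]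
    exact (hδv y (subset_closure hy2.2) ((Metric.mem_ball.1 hy2.1).trans hr.2)).le
  have hui : IntegrableOn u (Metric.ball x r ∩ Ω) := by
    have : IsFiniteMeasure (volume.restrict (Metric.ball x r ∩ Ω)) := ⟨by simpa using hfin⟩
    exact (memLp_restrict_subset u inter_subset_right).integrable (by norm_num)
  have hreal : 0 < volume.real (Metric.ball x r ∩ Ω) := ENNReal.toReal_pos hpos.ne' hfin.ne
  have h1 : (⨍ y in Metric.ball x r ∩ Ω, u y) - v x
      = (volume.real (Metric.ball x r ∩ Ω))⁻¹ * ∫ y in Metric.ball x r ∩ Ω, (u y - v x) := by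
    rw [integral_sub hui (integrableOn_const hfin.ne), setIntegral_const, setAverage_eq,
      smul_eq_mul, smul_eq_mul]
    field_simp
  have h2 := norm_setIntegral_le_of_norm_le_const_ae' hfin
    ((ae_restrict_iff' ho.measurableSet).1 hae)
  rw [dist_eq_norm, h1, norm_mul, norm_inv, Real.norm_of_nonneg hreal.le,
    inv_mul_lt_iff₀ hreal]
  nlinarith

end IsPiecewise

theorem norm_sq_eq_integral (u : L2 Ω) : ‖u‖ ^ 2 = ∫ x in Ω, u x ^ 2 := by
  rw [← real_inner_self_eq_norm_sq, L2.inner_def]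
  refine integral_congr_ae (.of_forall fun x => ?_)
  simp [sq]

theorem norm_sq_eq_sum_comp (G : L2v Ω) : ‖G‖ ^ 2 = ∑ j, ‖comp Ω j G‖ ^ 2 := by
  simp only [norm_sq_eq_integral]
  rw [← integral_finsetSum _ fun j _ => (Lp.memLp (comp Ω j G)).integrable_sq,
    ← real_inner_self_eq_norm_sq, L2.inner_def]
  refine integral_congr_ae ?_
  filter_upwards [ae_all_iff.2 fun j => comp_ae_eq j G] with x hx
  rw [real_inner_self_eq_norm_sq, EuclideanSpace.real_norm_sq_eq]
  exact Finset.sum_congr rfl fun j _ => by rw [hx j]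

theorem exists_hull_poly_bounds (d k : ℕ) (hd : 1 ≤ d) {κ : ℝ} (hκ : 0 < κ) :
    ∃ C : ℝ, 0 < C ∧ ∀ {Ω : Set (E d)} {h : ℝ} {𝒯 : Geometry.SimplicialComplex ℝ (E d)}
      (_ : IsQuasiUniformTriangulation Ω κ h 𝒯) {s : Finset (E d)} (_ : s ∈ cells 𝒯)
      {p : E d → ℝ} (_ : p ∈ polyLE d k),
      (∀ x ∈ hull s, p x ^ 2 ≤ C * (h ^ d)⁻¹ * ∫ y in hull s, p y ^ 2) ∧
      ∀ j, ∫ x in hull s, (fderiv ℝ p x (EuclideanSpace.single j 1)) ^ 2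
        ≤ C * (h ^ 2)⁻¹ * ∫ y in hull s, p y ^ 2 := by
  obtain ⟨C, hC, hb⟩ := exists_poly_bounds d k hκ 1
  set V₁ := volume.real (Metric.ball (0 : E d) 1) with hV₁
  refine ⟨C + C * V₁, by positivity, fun {Ω h 𝒯} hT {s} hs {p} hp => ?_⟩
  have hh := hT.pos hd
  obtain ⟨c, hc, hc'⟩ := hT.exists_center hd hκ hs
  have hpc := continuous_of_mem_polyLE hp
  have hi : IntegrableOn (fun x => p x ^ 2) (hull s) :=
    (hpc.pow 2).continuousOn.integrableOn_compact (isCompact_hull s)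
  have hI : ∫ y in Metric.closedBall c (κ * h), p y ^ 2 ≤ ∫ y in hull s, p y ^ 2 :=
    setIntegral_mono_set hi (.of_forall fun x => sq_nonneg _) hc.eventuallyLE
  set I := ∫ y in hull s, p y ^ 2 with hIdef
  refine ⟨fun x hx => ?_, fun j => ?_⟩
  · calc p x ^ 2 ≤ C * (h ^ d)⁻¹ * ∫ y in Metric.closedBall c (κ * h), p y ^ 2 :=
          (hb p hp c h hh x (hc' hx)).1
      _ ≤ (C + C * V₁) * (h ^ d)⁻¹ * I := by
          gcongr
          exact le_add_of_nonneg_right (by positivity)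
  · have hdc : Continuous fun x => fderiv ℝ p x (EuclideanSpace.single j 1) :=
      continuous_of_mem_polyLE (fderiv_mem_polyLE hp _)
    have hvol : volume.real (hull s) ≤ h ^ d * V₁ := by
      refine (measureReal_mono hc' measure_closedBall_lt_top.ne).trans_eq ?_
      rw [Measure.addHaar_real_closedBall _ _ (by positivity), finrank_euclideanSpace_fin, one_mul]
    have hdi : IntegrableOn (fun x => (fderiv ℝ p x (EuclideanSpace.single j 1)) ^ 2) (hull s) :=
      (hdc.pow 2).continuousOn.integrableOn_compact (isCompact_hull s)
    calc ∫ x in hull s, (fderiv ℝ p x (EuclideanSpace.single j 1)) ^ 2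
        ≤ ∫ x in hull s, C * (h ^ d)⁻¹ * (h ^ 2)⁻¹ * I := by
          refine setIntegral_mono_on hdi (integrableOn_const (isCompact_hull s).measure_lt_top.ne)
            (isCompact_hull s).measurableSet fun x hx => ?_
          exact ((hb p hp c h hh x (hc' hx)).2 j).trans (by gcongr)
      _ = volume.real (hull s) * (C * (h ^ d)⁻¹ * (h ^ 2)⁻¹ * I) := by
          rw [setIntegral_const, smul_eq_mul]
      _ ≤ h ^ d * V₁ * (C * (h ^ d)⁻¹ * (h ^ 2)⁻¹ * I) := by gcongr
      _ = C * V₁ * (h ^ 2)⁻¹ * I := by field_simp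
      _ ≤ (C + C * V₁) * (h ^ 2)⁻¹ * I := by
          gcongr
          exact le_add_of_nonneg_left hC.le

namespace IsPiecewise

variable {v : E d → ℝ} {p : Finset (E d) → E d → ℝ}

theorem norm_sq_eq_sum (hv : IsPiecewise Ω k 𝒯 v p) (hT : IsQuasiUniformTriangulation Ω κ h 𝒯)
    (hΩ : IsLipschitzDomain Ω) (hd : 1 ≤ d) {u : L2 Ω} (huv : u =ᵐ[volume.restrict Ω] v) :
    ‖u‖ ^ 2 = ∑ s ∈ hT.elements, ∫ x in hull s, p s x ^ 2 := by
  rw [norm_sq_eq_integral, hT.integral_eq_sum hΩ hd (Lp.memLp u).integrable_sq]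
  refine Finset.sum_congr rfl fun s hs => integral_congr_ae ?_
  have hs' := hT.mem_elements.1 hs
  filter_upwards [ae_mono (hT.restrict_hull_le hΩ hd hs') huv,
    ae_restrict_mem (isCompact_hull s).measurableSet] with x hx1 hx2
  rw [hx1, hv.eqOn s hs' hx2]

end IsPiecewise

/-- The inverse inequality. -/
theorem exists_norm_gradient_le (d k : ℕ) (hd : 1 ≤ d) {κ : ℝ} (hκ : 0 < κ) :
    ∃ C : ℝ, 0 < C ∧ ∀ {Ω : Set (E d)} {h : ℝ} {𝒯 : Geometry.SimplicialComplex ℝ (E d)}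
      (_ : IsQuasiUniformTriangulation Ω κ h 𝒯) (_ : IsLipschitzDomain Ω) {u : L2 Ω} {G : L2v Ω},
      u ∈ Rh Ω k 𝒯 → IsWeakGradient Ω u G → ‖G‖ ≤ C * h⁻¹ * ‖u‖ := by
  obtain ⟨C, hC, hb⟩ := exists_hull_poly_bounds d k hd hκ
  refine ⟨√(d * C) + 1, by positivity, fun {Ω h 𝒯} hT hΩ {u G} hu hG => ?_⟩
  have hh := hT.pos hd
  obtain ⟨v, p, hv, huv⟩ := mem_Rh_iff.1 hu
  obtain ⟨G', hG', hGp⟩ := hv.exists_isWeakGradient hT hΩ hd huv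
  obtain rfl := hG.unique hΩ.isOpen hG'
  have h1 : ‖G‖ ^ 2 ≤ d * (C * (h ^ 2)⁻¹ * ‖u‖ ^ 2) := by
    rw [norm_sq_eq_sum_comp]
    have h2 : ∀ j : Fin d, ‖comp Ω j G‖ ^ 2 ≤ C * (h ^ 2)⁻¹ * ‖u‖ ^ 2 := by
      intro j
      rw [norm_sq_eq_integral,
        hT.integral_eq_sum hΩ hd (Lp.memLp (comp Ω j G)).integrable_sq,
        hv.norm_sq_eq_sum hT hΩ hd huv, Finset.mul_sum]
      refine Finset.sum_le_sum fun s hs => ?_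
      have hs' := hT.mem_elements.1 hs
      refine le_trans (le_of_eq ?_) ((hb hT hs' (hv.mem s hs')).2 j)
      refine integral_congr_ae ?_
      filter_upwards [hGp s hs', ae_mono (hT.restrict_hull_le hΩ hd hs') (comp_ae_eq j G)]
        with x hx1 hx2
      rw [hx2, hx1]
    calc ∑ j, ‖comp Ω j G‖ ^ 2 ≤ ∑ _j : Fin d, C * (h ^ 2)⁻¹ * ‖u‖ ^ 2 :=
          Finset.sum_le_sum fun j _ => h2 j
      _ = _ := by simp
  have h2 : ‖G‖ ^ 2 ≤ (√(d * C) * h⁻¹ * ‖u‖) ^ 2 := by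
    refine h1.trans_eq ?_
    rw [mul_pow, mul_pow, Real.sq_sqrt (by positivity), inv_pow]
    ring
  have h3 := (pow_le_pow_iff_left₀ (norm_nonneg _) (by positivity) two_ne_zero).1 h2
  refine h3.trans ?_
  gcongr
  linarith

/-- Comparison of boundary functionals on `R_h`. -/
theorem exists_bdryPair_sub_le {d : ℕ} (k : ℕ) (hd : 1 ≤ d) {Ω : Set (E d)}
    (hΩ : IsLipschitzDomain Ω) {κ : ℝ} (hκ : 0 < κ) :
    ∃ C : ℝ, 0 < C ∧ ∀ {h : ℝ} {𝒯 : Geometry.SimplicialComplex ℝ (E d)}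
      (_ : IsQuasiUniformTriangulation Ω κ h 𝒯) {u : L2 Ω} (_ : u ∈ Rh Ω k 𝒯) {ψ₁ ψ₂ : E d → ℝ}
      {M δ : ℝ} (_ : AEStronglyMeasurable ψ₁ (surface Ω)) (_ : AEStronglyMeasurable ψ₂ (surface Ω))
      (_ : ∀ᵐ x ∂(surface Ω), |ψ₁ x| ≤ M) (_ : ∀ᵐ x ∂(surface Ω), |ψ₂ x| ≤ M) (_ : 0 ≤ δ)
      (_ : ∀ᵐ x ∂(surface Ω), |ψ₁ x - ψ₂ x| ≤ δ),
      |bdryPair Ω ψ₁ u - bdryPair Ω ψ₂ u| ≤ C * δ * h⁻¹ * ‖u‖ := by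
  obtain ⟨Cp, hCp, hb⟩ := exists_hull_poly_bounds d k hd hκ
  obtain ⟨Cs, hCs, hsurf⟩ := hΩ.surface_closedBall_le hd
  obtain ⟨R, hR⟩ := hΩ.isBounded.subset_closedBall (0 : E d)
  have hsfin : IsFiniteMeasure (surface Ω) := ⟨hΩ.surface_lt_top hd⟩
  set A := (|R| / κ) ^ d with hA
  refine ⟨Cs * √(A * Cp) + 1, by positivity, ?_⟩
  intro h 𝒯 hT u hu ψ₁ ψ₂ M δ hm₁ hm₂ hb₁ hb₂ hδ hδb
  have hh := hT.pos hd
  obtain ⟨v, p, hv, huv⟩ := mem_Rh_iff.1 hu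
  have hcomp : IsCompact (closure Ω) := hΩ.isBounded.isCompact_closure
  have hmem : ∀ᵐ x ∂(surface Ω), x ∈ frontier Ω :=
    ae_restrict_mem isClosed_frontier.measurableSet
  have hvm : AEStronglyMeasurable v (surface Ω) :=
    (hv.continuousOn.mono frontier_subset_closure).aestronglyMeasurable
      isClosed_frontier.measurableSet
  obtain ⟨Mv, hMv⟩ := hcomp.exists_bound_of_continuousOn hv.continuousOn
  have hvb : ∀ᵐ x ∂(surface Ω), ‖v x‖ ≤ Mv := by
    filter_upwards [hmem] with x hx
    exact hMv x (frontier_subset_closure hx)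
  have hvi : Integrable v (surface Ω) := Integrable.of_bound hvm Mv hvb
  have hpair (ψ : E d → ℝ) : bdryPair Ω ψ u = ∫ x, ψ x * v x ∂(surface Ω) := by
    refine integral_congr_ae ?_
    filter_upwards [hmem] with x hx
    rw [IsPiecewise.trace_eq hv.continuousOn huv hΩ hx]
  have hint {ψ : E d → ℝ} (hm : AEStronglyMeasurable ψ (surface Ω))
      (hb : ∀ᵐ x ∂(surface Ω), |ψ x| ≤ M) : Integrable (fun x => ψ x * v x) (surface Ω) :=
    hvi.bdd_mul hm hb
  set I : Finset (E d) → ℝ := fun s => ∫ y in hull s, p s y ^ 2 with hI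
  have hI0 (s : Finset (E d)) : 0 ≤ I s := integral_nonneg fun x => sq_nonneg _
  set B : Finset (E d) → ℝ := fun s => √(Cp * (h ^ d)⁻¹ * I s) with hB
  have hvB : ∀ᵐ x ∂(surface Ω), ‖v x‖ ≤ ∑ s ∈ hT.elements, (hull s).indicator (fun _ => B s) x := by
    filter_upwards [hmem] with x hx
    obtain ⟨s, hs, hxs⟩ := hT.exists_mem_hull hΩ.isOpen (frontier_subset_closure hx)
    have h1 : ‖v x‖ ≤ (hull s).indicator (fun _ => B s) x := by
      rw [indicator_of_mem hxs, hv.eqOn s hs hxs]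
      exact Real.abs_le_sqrt ((hb hT hs (hv.mem s hs)).1 x hxs)
    exact h1.trans (Finset.single_le_sum (f := fun s => (hull s).indicator (fun _ => B s) x)
      (fun s _ => indicator_nonneg (fun _ _ => Real.sqrt_nonneg _) x) (hT.mem_elements.2 hs))
  have hσ : ∀ s ∈ hT.elements, (surface Ω).real (hull s) ≤ Cs * h ^ (d - 1) := by
    intro s hs
    obtain ⟨c, -, hc⟩ := hT.exists_center hd hκ (hT.mem_elements.1 hs)
    rw [one_mul] at hc
    exact ENNReal.toReal_le_of_le_ofReal (by positivity) ((measure_mono hc).trans (hsurf c h hh))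
  have hsum : ∑ s ∈ hT.elements, B s ≤ √(A * Cp) * (h ^ d)⁻¹ * ‖u‖ := by
    have h1 : (∑ s ∈ hT.elements, B s) ^ 2 ≤ (√(A * Cp) * (h ^ d)⁻¹ * ‖u‖) ^ 2 := by
      have hcard : (hT.elements.card : ℝ) ≤ A * (h ^ d)⁻¹ := by
        have hc := hT.card_mul_le hd hκ (S := hT.elements) (fun s hs => hT.mem_elements.1 hs)
          (z := 0) (abs_nonneg R) fun s hs => (hT.hull_subset (hT.mem_elements.1 hs)).trans
            (closure_minimal (hR.trans (Metric.closedBall_subset_closedBall (le_abs_self R)))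
              Metric.isClosed_closedBall)
        rw [hA, div_pow, div_mul_eq_mul_div, le_div_iff₀ (by positivity),
          le_mul_inv_iff₀ (by positivity)]
        rw [mul_pow] at hc
        linarith
      calc (∑ s ∈ hT.elements, B s) ^ 2 ≤ hT.elements.card * ∑ s ∈ hT.elements, B s ^ 2 :=
            sq_sum_le_card_mul_sum_sq
        _ = hT.elements.card * (Cp * (h ^ d)⁻¹ * ‖u‖ ^ 2) := by
            rw [hv.norm_sq_eq_sum hT hΩ hd huv, Finset.mul_sum (a := Cp * (h ^ d)⁻¹)]
            congr 1
            refine Finset.sum_congr rfl fun s _ => ?_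
            exact Real.sq_sqrt (mul_nonneg (by positivity) (hI0 s))
        _ ≤ A * (h ^ d)⁻¹ * (Cp * (h ^ d)⁻¹ * ‖u‖ ^ 2) := by gcongr
        _ = _ := by
            rw [mul_pow, mul_pow, Real.sq_sqrt (by positivity)]
            ring
    exact (pow_le_pow_iff_left₀ (Finset.sum_nonneg fun s _ => Real.sqrt_nonneg _)
      (by positivity) two_ne_zero).1 h1
  rw [hpair, hpair, ← integral_sub (hint hm₁ hb₁) (hint hm₂ hb₂), ← Real.norm_eq_abs]
  have hindi : ∀ s ∈ hT.elements, Integrable ((hull s).indicator fun _ => B s) (surface Ω) :=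
    fun s _ => (integrable_const _).indicator (isCompact_hull s).measurableSet
  calc ‖∫ x, (ψ₁ x * v x - ψ₂ x * v x) ∂(surface Ω)‖
      ≤ ∫ x, δ * ∑ s ∈ hT.elements, (hull s).indicator (fun _ => B s) x ∂(surface Ω) := by
        refine norm_integral_le_of_norm_le ((integrable_finsetSum _ hindi).const_mul δ) ?_
        filter_upwards [hδb, hvB] with x hx1 hx2
        rw [← sub_mul, norm_mul]
        exact mul_le_mul hx1 hx2 (norm_nonneg _) hδ
    _ = δ * ∑ s ∈ hT.elements, (surface Ω).real (hull s) * B s := by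
        rw [integral_const_mul, integral_finsetSum _ hindi]
        congr 1
        refine Finset.sum_congr rfl fun s _ => ?_
        rw [integral_indicator (isCompact_hull s).measurableSet, setIntegral_const, smul_eq_mul]
    _ ≤ δ * ∑ s ∈ hT.elements, Cs * h ^ (d - 1) * B s := by
        gcongr with s hs
        exact hσ s hs
    _ = δ * (Cs * h ^ (d - 1) * ∑ s ∈ hT.elements, B s) := by
        congr 1
        rw [Finset.mul_sum]
    _ ≤ δ * (Cs * h ^ (d - 1) * (√(A * Cp) * (h ^ d)⁻¹ * ‖u‖)) := by gcongr
    _ = Cs * √(A * Cp) * δ * h⁻¹ * ‖u‖ := by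
        have : h ^ d = h ^ (d - 1) * h := by rw [← pow_succ]; congr 1; omega
        rw [this]
        field_simp
    _ ≤ _ := by
        gcongr
        linarith

theorem finiteDimensional_RhSub (hT : IsQuasiUniformTriangulation Ω κ h 𝒯)
    (hΩ : IsLipschitzDomain Ω) (hd : 1 ≤ d) : FiniteDimensional ℝ (RhSub Ω k 𝒯) := by
  classical
  let f (P : hT.elements → polyLE d k) (s : Finset (E d)) : E d → ℝ :=
    if hs : s ∈ hT.elements then (P ⟨s, hs⟩ : E d → ℝ) else 0
  have hf (P : hT.elements → polyLE d k) (s) (hs : s ∈ hT.elements) : f P s = P ⟨s, hs⟩ := by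
    simp [f, hs]
  have hfc (P : hT.elements → polyLE d k) : ∀ s ∈ cells 𝒯, Continuous (f P s) := by
    intro s hs
    rw [hf P s (hT.mem_elements.2 hs)]
    exact continuous_of_mem_polyLE (P _).2
  choose z hz using fun P => hT.exists_glue hΩ hd (f P) (hfc P)
  have hext {a b : L2 Ω} (hab : ∀ s ∈ cells 𝒯, ∀ᵐ x ∂(volume.restrict (hull s)), a x = b x) :
      a = b := Lp.ext ((hT.ae_iff hΩ hd).2 hab)
  let Φ : (hT.elements → polyLE d k) →ₗ[ℝ] L2 Ω :=
    { toFun := z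
      map_add' := fun P Q => hext fun s hs => by
        filter_upwards [hz (P + Q) s hs, hz P s hs, hz Q s hs,
          ae_mono (hT.restrict_hull_le hΩ hd hs) (Lp.coeFn_add (z P) (z Q))] with x h1 h2 h3 h4
        rw [h1, h4, Pi.add_apply, h2, h3]
        simp only [hf _ s (hT.mem_elements.2 hs)]
        rfl
      map_smul' := fun c P => hext fun s hs => by
        filter_upwards [hz (c • P) s hs, hz P s hs,
          ae_mono (hT.restrict_hull_le hΩ hd hs) (Lp.coeFn_smul c (z P))] with x h1 h2 h4
        simp only [RingHom.id_apply]
        rw [h1, h4, Pi.smul_apply, h2]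
        simp only [hf _ s (hT.mem_elements.2 hs)]
        rfl }
  refine Submodule.finiteDimensional_of_le (S₂ := LinearMap.range Φ) ?_
  intro u hu
  obtain ⟨v, p, hv, huv⟩ := mem_Rh_iff.1 hu
  refine ⟨fun s => ⟨p s, hv.mem s (hT.mem_elements.1 s.2)⟩, hext fun s hs => ?_⟩
  filter_upwards [hz (fun s => ⟨p s, hv.mem s (hT.mem_elements.1 s.2)⟩) s hs,
    ae_mono (hT.restrict_hull_le hΩ hd hs) huv,
    ae_restrict_mem (isCompact_hull s).measurableSet] with x h1 h2 h3
  refine Eq.trans h1 ?_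
  rw [h2, hv.eqOn s hs h3]
  exact congrFun (hf (fun s => ⟨p s, hv.mem s (hT.mem_elements.1 s.2)⟩) s
    (hT.mem_elements.2 hs)) x

theorem mem_Mh_iff (hT : IsQuasiUniformTriangulation Ω κ h 𝒯) (hΩ : IsLipschitzDomain Ω)
    (hd : 1 ≤ d) {z : L2v Ω} : z ∈ Mh Ω k 𝒯 ↔ ∀ s ∈ cells 𝒯, ∃ q : Fin d → E d → ℝ,
      (∀ j, q j ∈ polyLE d k) ∧ ∀ᵐ x ∂(volume.restrict (hull s)), ∀ j, z x j = q j x := by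
  refine forall₂_congr fun s hs => ?_
  have hms := (isCompact_hull s).measurableSet
  constructor
  · rintro ⟨p, hp, hpe⟩
    refine ⟨fun j => pEval (p j), fun j => pEval_mem_polyLE (hp j), ?_⟩
    filter_upwards [ae_mono (hT.restrict_hull_le hΩ hd hs) hpe, ae_restrict_mem hms] with x h1 h2
    exact h1 h2
  · rintro ⟨q, hq, hqe⟩
    choose p hp hpe using fun j => exists_pEval_of_mem_polyLE (hq j)
    refine ⟨p, hp, ae_restrict_of_ae ?_⟩
    filter_upwards [(ae_restrict_iff' hms).1 hqe] with x hx hxs j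
    rw [hx hxs j, hpe j]

theorem sub_mem_Mh (hT : IsQuasiUniformTriangulation Ω κ h 𝒯) (hΩ : IsLipschitzDomain Ω)
    (hd : 1 ≤ d) {z w : L2v Ω} (hz : z ∈ Mh Ω k 𝒯) (hw : w ∈ Mh Ω k 𝒯) :
    z - w ∈ Mh Ω k 𝒯 := by
  rw [mem_Mh_iff hT hΩ hd] at *
  intro s hs
  obtain ⟨q, hq, hqe⟩ := hz s hs
  obtain ⟨q', hq', hqe'⟩ := hw s hs
  refine ⟨fun j => q j - q' j, fun j => Submodule.sub_mem _ (hq j) (hq' j), ?_⟩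
  filter_upwards [hqe, hqe', ae_mono (hT.restrict_hull_le hΩ hd hs) (Lp.coeFn_sub z w)]
    with x h1 h2 h3 j
  rw [h3, Pi.sub_apply, PiLp.sub_apply, h1, h2]
  rfl

theorem gradient_mem_Mh (hT : IsQuasiUniformTriangulation Ω κ h 𝒯) (hΩ : IsLipschitzDomain Ω)
    (hd : 1 ≤ d) {u : L2 Ω} {G : L2v Ω} (hu : u ∈ Rh Ω k 𝒯) (hG : IsWeakGradient Ω u G) :
    G ∈ Mh Ω k 𝒯 := by
  obtain ⟨v, p, hv, huv⟩ := mem_Rh_iff.1 hu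
  obtain ⟨G', hG', hGp⟩ := hv.exists_isWeakGradient hT hΩ hd huv
  obtain rfl := hG.unique hΩ.isOpen hG'
  rw [mem_Mh_iff hT hΩ hd]
  exact fun s hs => ⟨_, fun j => fderiv_mem_polyLE (hv.mem s hs) _, hGp s hs⟩

end PiecewisePolynomials

section QuasiInterpolation

variable {d k : ℕ} {Ω : Set (E d)} {κ h : ℝ} {𝒯 : Geometry.SimplicialComplex ℝ (E d)}

/-- `L v`, `v ∈ s`, are the barycentric coordinates with respect to the simplex `s`. -/
structure IsBarycentric (s : Finset (E d)) (L : E d → E d →ᵃ[ℝ] ℝ) : Prop where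
  eq_zero : ∀ v ∉ s, L v = 0
  sum_eq_one : ∀ x, ∑ v ∈ s, L v x = 1
  sum_smul : ∀ x, ∑ v ∈ s, L v x • v = x
  apply_sum : ∀ w : E d → ℝ, ∑ v ∈ s, w v = 1 → ∀ v ∈ s, L v (∑ u ∈ s, w u • u) = w v

theorem exists_isBarycentric {s : Finset (E d)}
    (hs : AffineIndependent ℝ ((↑) : s → E d)) (hcard : s.card = d + 1) :
    ∃ L, IsBarycentric s L := by
  classical
  have htop : affineSpan ℝ (range ((↑) : s → E d)) = ⊤ := by
    rw [hs.affineSpan_eq_top_iff_card_eq_finrank_add_one]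
    simp [hcard]
  let b : AffineBasis s ℝ (E d) := ⟨(↑), hs, htop⟩
  have hb (i : s) : b i = i := rfl
  refine ⟨fun v => if hv : v ∈ s then b.coord ⟨v, hv⟩ else 0, fun v hv => by simp [hv],
    fun x => ?_, fun x => ?_, fun w hw v hv => ?_⟩
  · rw [← b.sum_coord_apply_eq_one x, ← Finset.sum_coe_sort s]
    simp
  · conv_rhs => rw [← b.linear_combination_coord_eq_self x]
    rw [← Finset.sum_coe_sort s]
    simp [hb]
  · have hw' : ∑ u : s, w u = 1 := by rw [Finset.sum_coe_sort s w, hw]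
    have h1 := b.coord_apply_combination_of_mem (Finset.mem_univ (⟨v, hv⟩ : s)) hw'
    rw [Finset.affineCombination_eq_linear_combination _ _ _ hw'] at h1
    simp only [hv, dif_pos]
    rw [← Finset.sum_coe_sort s]
    exact h1

theorem IsBarycentric.eq_of_sum {s : Finset (E d)} {L : E d → E d →ᵃ[ℝ] ℝ}
    (hL : IsBarycentric s L) {t : Finset (E d)} (hts : t ⊆ s) {w : E d → ℝ} (hw0 : ∀ v ∉ t, w v = 0)
    (hw : ∑ v ∈ t, w v = 1) (v : E d) : L v (∑ u ∈ t, w u • u) = w v := by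
  by_cases hv : v ∈ s
  · have h1 : ∑ v ∈ s, w v = 1 := by
      rw [← hw]
      exact (Finset.sum_subset hts fun v _ hv => hw0 v hv).symm
    rw [← hL.apply_sum w h1 v hv]
    congr 1
    exact Finset.sum_subset hts fun v _ hv => by rw [hw0 v hv, zero_smul]
  · rw [hL.eq_zero v hv, hw0 v fun h => hv (hts h)]
    rfl

theorem exists_weights {t : Finset (E d)} {x : E d} (hx : x ∈ hull t) :
    ∃ w : E d → ℝ, (∀ v, 0 ≤ w v) ∧ (∀ v ∉ t, w v = 0) ∧ ∑ v ∈ t, w v = 1 ∧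
      ∑ v ∈ t, w v • v = x := by
  classical
  obtain ⟨w, hw0, hw1, hwx⟩ := Finset.mem_convexHull'.1 hx
  refine ⟨fun v => if v ∈ t then w v else 0, fun v => ?_, fun v hv => if_neg hv, ?_, ?_⟩
  · dsimp only
    split_ifs with h
    exacts [hw0 v h, le_rfl]
  · rw [← hw1]
    exact Finset.sum_congr rfl fun v hv => if_pos hv
  · rw [← hwx]
    exact Finset.sum_congr rfl fun v hv => by simp only [if_pos hv]

theorem IsBarycentric.nonneg {s : Finset (E d)} {L : E d → E d →ᵃ[ℝ] ℝ}
    (hL : IsBarycentric s L) {x : E d} (hx : x ∈ hull s) (v : E d) : 0 ≤ L v x := by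
  obtain ⟨w, hw, hw0, hw1, rfl⟩ := exists_weights hx
  rw [hL.eq_of_sum subset_rfl hw0 hw1]
  exact hw v

theorem IsBarycentric.eq_of_mem {s s' : Finset (E d)} {L L' : E d → E d →ᵃ[ℝ] ℝ}
    (hL : IsBarycentric s L) (hL' : IsBarycentric s' L') (hs : s ∈ 𝒯.faces) (hs' : s' ∈ 𝒯.faces)
    {x : E d} (hx : x ∈ hull s) (hx' : x ∈ hull s') (v : E d) : L v x = L' v x := by
  classical
  have h1 := 𝒯.inter_subset_convexHull hs hs' ⟨hx, hx'⟩
  rw [← Finset.coe_inter] at h1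
  obtain ⟨w, -, hw0, hw1, rfl⟩ := exists_weights h1
  rw [hL.eq_of_sum Finset.inter_subset_left hw0 hw1,
    hL'.eq_of_sum Finset.inter_subset_right hw0 hw1]

/-- The combination of the polynomials `q v`, one for each vertex `v ∈ W`, with Bernstein weights
built from the barycentric coordinates `L`. -/
def quasiInterpolant (k : ℕ) [NeZero k] (W : Finset (E d)) (q : E d → E d → ℝ)
    (L : E d → E d →ᵃ[ℝ] ℝ) (x : E d) : ℝ :=
  ∑ τ : Fin k → W, (∏ j, L (τ j) x) * polar k (q (τ 0)) fun j => τ j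

theorem quasiInterpolant_mem_polyLE [NeZero k] (W : Finset (E d)) (q : E d → E d → ℝ)
    (L : E d → E d →ᵃ[ℝ] ℝ) : quasiInterpolant k W q L ∈ polyLE d k := by
  have h1 : quasiInterpolant k W q L = ∑ τ : Fin k → W,
      polar k (q (τ 0)) (fun j => τ j) • fun x => ∏ j, L (τ j) x := by
    ext x
    simp [quasiInterpolant, Finset.sum_apply, mul_comm]
  rw [h1]
  exact Submodule.sum_mem _ fun τ _ => Submodule.smul_mem _ _ (prod_mem_polyLE fun j => L (τ j))

theorem abs_quasiInterpolant_sub_le [NeZero k] {s W : Finset (E d)} (hsW : s ⊆ W)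
    {q : E d → E d → ℝ} {L : E d → E d →ᵃ[ℝ] ℝ} (hL : IsBarycentric s L) {p : E d → ℝ}
    (hp : p ∈ polyLE d k) {M : ℝ} (hM : 0 ≤ M)
    (hqM : ∀ v ∈ s, ∀ y ∈ hull s, |q v y - p y| ≤ M) {x : E d} (hx : x ∈ hull s) :
    |quasiInterpolant k W q L x - p x| ≤ 2 ^ k * k ^ k * M := by
  classical
  have hsum {F : Type} [AddCommGroup F] (f : E d → F) (hf : ∀ v ∉ s, f v = 0) :
      ∑ v : W, f v = ∑ v ∈ s, f v := by
    rw [Finset.sum_coe_sort W f]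
    exact (Finset.sum_subset hsW fun v _ hv => hf v hv).symm
  have h1 : ∑ v : W, L v x = 1 := by
    rw [hsum (fun v => L v x) fun v hv => by simp [hL.eq_zero v hv], hL.sum_eq_one]
  have hpx := sum_prod_mul_polar (NeZero.ne k) hp (fun v : W => L v x) h1 fun v => v
  have h2 : ∑ v : W, L v x • (v : E d) = x := by
    rw [hsum (fun v => L v x • v) fun v hv => by simp [hL.eq_zero v hv], hL.sum_smul]
  rw [h2] at hpx
  have h3 : ∑ τ : Fin k → W, ∏ j, L (τ j) x = 1 := by
    have h4 := Fintype.sum_pow (fun v : W => L v x) k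
    rw [h1, one_pow] at h4
    exact h4.symm
  have hpolar (τ : Fin k → W) : polar k (q (τ 0)) (fun j => (τ j : E d)) - polar k p (fun j => τ j)
      = polar k (q (τ 0) - p) fun j => τ j := by
    rw [sub_eq_iff_eq_add, ← polar_add, sub_add_cancel]
  calc |quasiInterpolant k W q L x - p x|
      = |∑ τ : Fin k → W, (∏ j, L (τ j) x) * polar k (q (τ 0) - p) fun j => τ j| := by
        rw [quasiInterpolant, ← hpx, ← Finset.sum_sub_distrib]
        simp only [← mul_sub, hpolar]
    _ ≤ ∑ τ : Fin k → W, |(∏ j, L (τ j) x) * polar k (q (τ 0) - p) fun j => τ j| :=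
        Finset.abs_sum_le_sum_abs _ _
    _ ≤ ∑ τ : Fin k → W, (∏ j, L (τ j) x) * (2 ^ k * k ^ k * M) := by
        refine Finset.sum_le_sum fun τ _ => ?_
        have hprod : 0 ≤ ∏ j, L (τ j) x := Finset.prod_nonneg fun j _ => hL.nonneg hx _
        rw [abs_mul, abs_of_nonneg hprod]
        by_cases hτ : ∀ j, (τ j : E d) ∈ s
        · exact mul_le_mul_of_nonneg_left (abs_polar_le (NeZero.ne k)
            (convex_convexHull ℝ (s : Set (E d))) (fun j => subset_convexHull ℝ _ (hτ j)) hM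
            (hqM _ (hτ 0))) hprod
        · push Not at hτ
          obtain ⟨j, hj⟩ := hτ
          rw [Finset.prod_eq_zero (Finset.mem_univ j) (by rw [hL.eq_zero _ hj]; rfl)]
          simp
    _ = 2 ^ k * k ^ k * M := by rw [← Finset.sum_mul, h3, one_mul]

theorem IsQuasiUniformTriangulation.exists_isPiecewise_quasiInterpolant [NeZero k]
    (hT : IsQuasiUniformTriangulation Ω κ h 𝒯) (hΩ : IsOpen Ω) (q : E d → E d → ℝ) :
    ∃ (W : Finset (E d)) (L : Finset (E d) → E d → E d →ᵃ[ℝ] ℝ) (v : E d → ℝ),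
      (∀ s ∈ cells 𝒯, s ⊆ W) ∧ (∀ s ∈ cells 𝒯, IsBarycentric s (L s)) ∧
      IsPiecewise Ω k 𝒯 v fun s => quasiInterpolant k W q (L s) := by
  classical
  have hL (s : Finset (E d)) (hs : s ∈ cells 𝒯) : ∃ L, IsBarycentric s L :=
    exists_isBarycentric (𝒯.indep hs.1) hs.2
  choose! L hL using hL
  choose! σ hσ hxσ using fun (x : E d) (hx : x ∈ closure Ω) => hT.exists_mem_hull hΩ hx
  set W := hT.elements.biUnion id
  have heq (s) (hs : s ∈ cells 𝒯) :
      EqOn (fun x => quasiInterpolant k W q (L (σ x)) x) (quasiInterpolant k W q (L s)) (hull s) :=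
    fun x hx => by
      have hxΩ := hT.hull_subset hs hx
      simp only [quasiInterpolant]
      refine Finset.sum_congr rfl fun τ _ => ?_
      congr 1
      exact Finset.prod_congr rfl fun j _ => (hL _ (hσ x hxΩ)).eq_of_mem (hL s hs)
        (hσ x hxΩ).1 hs.1 (hxσ x hxΩ) hx _
  refine ⟨W, L, fun x => quasiInterpolant k W q (L (σ x)) x, fun s hs =>
    Finset.subset_biUnion_of_mem id (hT.mem_elements.2 hs), hL, ?_,
    fun s _ => quasiInterpolant_mem_polyLE _ _ _, heq⟩
  rw [← hT.iUnion_hull hΩ, biUnion_eq_iUnion]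
  have := hT.finite_cells.to_subtype
  exact (locallyFinite_of_finite _).continuousOn_iUnion (fun s => (isCompact_hull s.1).isClosed)
    fun s => (continuous_of_mem_polyLE (quasiInterpolant_mem_polyLE _ _ _)).continuousOn.congr
      (heq s.1 s.2)

end QuasiInterpolation

section Approximation

variable {d k : ℕ} {Ω : Set (E d)} {κ h : ℝ} {𝒯 : Geometry.SimplicialComplex ℝ (E d)}

/-- Near each point of `closure Ω` there are patches that are star-shaped with respect to a ball. -/
theorem IsLipschitzDomain.exists_patch (hΩ : IsLipschitzDomain Ω) :
    ∃ ε > 0, ∃ A : ℝ, 1 ≤ A ∧ ∀ z ∈ closure Ω, ∀ r : ℝ, 0 < r → r ≤ ε → ∃ V c, IsOpen V ∧ V ⊆ Ω ∧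
      V ⊆ Metric.closedBall z (A * r) ∧ V ⊆ Metric.closedBall c (A * r) ∧
      Metric.closedBall c r ⊆ V ∧ ∀ x ∈ Ω, dist x z ≤ r → x ∈ starKernel V c r := by
  obtain ⟨δ, hδ, a, ha, ha1, hcone⟩ := hΩ.uniform_cone
  refine ⟨a * δ / 2, by positivity, 4 / a + 2, by linarith [div_pos four_pos ha],
    fun z hz r hr hrε => ?_⟩
  obtain ⟨ν, hν, hcone⟩ := hcone z hz
  set t := 2 * r / a with ht
  have hat : a * t = 2 * r := by rw [ht]; field_simp
  have ht0 : 0 < t := by positivity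
  have htδ : t ≤ δ := by rw [ht, div_le_iff₀ ha]; linarith
  have hrt : r < δ := by nlinarith
  have htν : ‖t • ν‖ ≤ t := by
    rw [norm_smul, Real.norm_of_nonneg ht0.le]
    exact mul_le_of_le_one_right ht0.le hν
  have hA : (4 / a + 2) * r = 2 * t + 2 * r := by rw [ht]; ring
  have hcb {y : E d} (hy : y ∈ Metric.closedBall (z + t • ν) r) :
      ‖y - z - t • ν‖ ≤ r := by
    rw [sub_sub, ← dist_eq_norm]; exact hy
  have hyz {y : E d} (hy : y ∈ Metric.closedBall (z + t • ν) r) :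
      y ∈ Metric.ball z (t + 2 * r) := by
    rw [Metric.mem_ball, dist_eq_norm]
    calc ‖y - z‖ = ‖(y - z - t • ν) + t • ν‖ := by rw [sub_add_cancel]
      _ ≤ r + t := (norm_add_le _ _).trans (add_le_add (hcb hy) htν)
      _ < t + 2 * r := by linarith
  have hseg : ∀ x ∈ Ω, dist x z ≤ r → ∀ y ∈ Metric.closedBall (z + t • ν) r,
      segment ℝ x y ⊆ Ω ∩ Metric.ball z (t + 2 * r) := by
    intro x hx hxz y hy
    refine subset_inter ?_ ((convex_ball z _).segment_subset ?_ (hyz hy))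
    · rw [segment_eq_image']
      rintro _ ⟨θ, hθ, rfl⟩
      refine hcone x hx (hxz.trans_lt hrt) (θ * t)
        ⟨mul_nonneg hθ.1 ht0.le, (mul_le_of_le_one_left ht0.le hθ.2).trans htδ⟩ _ ?_
      rw [mul_smul, ← smul_sub, norm_smul, Real.norm_of_nonneg hθ.1]
      calc θ * ‖y - x - t • ν‖ = θ * ‖(y - z - t • ν) - (x - z)‖ := by congr 2; abel
        _ ≤ θ * (r + r) := by
          refine mul_le_mul_of_nonneg_left ((norm_sub_le _ _).trans (add_le_add (hcb hy) ?_)) hθ.1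
          rwa [← dist_eq_norm]
        _ = a * (θ * t) := by rw [mul_left_comm, hat, two_mul]
    · rw [Metric.mem_ball]; linarith
  refine ⟨Ω ∩ Metric.ball z (t + 2 * r), z + t • ν, hΩ.isOpen.inter Metric.isOpen_ball,
    inter_subset_left, ?_, ?_, fun y hy => ?_, fun x hx hxz y hy => hseg x hx hxz y hy⟩
  · rw [hA]
    exact inter_subset_right.trans (Metric.ball_subset_closedBall.trans
      (Metric.closedBall_subset_closedBall (by linarith)))
  · rw [hA]
    refine inter_subset_right.trans (Metric.ball_subset_closedBall.trans
      (Metric.closedBall_subset_closedBall' ?_))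
    rw [dist_self_add_right]
    linarith
  · obtain ⟨x, hx, hxz⟩ := Metric.mem_closure_iff.1 hz r hr
    rw [dist_comm] at hxz
    exact hseg x hx hxz.le y hy (right_mem_segment ℝ x y)

theorem integral_sub_sq_le {μ : Measure (E d)} {a b c : E d → ℝ} (ha : MemLp a 2 μ)
    (hb : MemLp b 2 μ) (hc : MemLp c 2 μ) :
    ∫ x, (a x - c x) ^ 2 ∂μ ≤ 2 * ∫ x, (a x - b x) ^ 2 ∂μ + 2 * ∫ x, (b x - c x) ^ 2 ∂μ := by
  have h1 : Integrable (fun x => 2 * (a x - b x) ^ 2) μ := ((ha.sub hb).integrable_sq).const_mul 2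
  have h2 : Integrable (fun x => 2 * (b x - c x) ^ 2) μ := ((hb.sub hc).integrable_sq).const_mul 2
  rw [← integral_const_mul, ← integral_const_mul, ← integral_add h1 h2]
  refine integral_mono_of_nonneg (.of_forall fun x => sq_nonneg _) (h1.add h2)
    (.of_forall fun x => ?_)
  change (a x - c x) ^ 2 ≤ 2 * (a x - b x) ^ 2 + 2 * (b x - c x) ^ 2
  nlinarith [sq_nonneg (a x - b x - (b x - c x))]

theorem exists_quasiInterpolant_error_le (d k : ℕ) [NeZero k] (hd : 1 ≤ d) {κ : ℝ} (hκ : 0 < κ) :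
    ∃ C : ℝ, 0 < C ∧ ∀ {Ω : Set (E d)} {h : ℝ} {𝒯 : Geometry.SimplicialComplex ℝ (E d)}
      (_ : IsQuasiUniformTriangulation Ω κ h 𝒯) {s : Finset (E d)} (_ : s ∈ cells 𝒯)
      {W : Finset (E d)} (_ : s ⊆ W) {L : E d → E d →ᵃ[ℝ] ℝ} (_ : IsBarycentric s L)
      {q : E d → E d → ℝ} (_ : ∀ v ∈ s, q v ∈ polyLE d k) {u : E d → ℝ} {g : Fin d → E d → ℝ}
      (_ : MemLp u 2 (volume.restrict (hull s))) (_ : ∀ j, MemLp (g j) 2 (volume.restrict (hull s)))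
      {e : E d → ℝ} (_ : ∀ v ∈ s, ∫ x in hull s, (u x - q v x) ^ 2 ≤ h ^ 2 * e v)
      (_ : ∀ v ∈ s, ∀ j,
        ∫ x in hull s, (g j x - fderiv ℝ (q v) x (EuclideanSpace.single j 1)) ^ 2 ≤ e v),
      ∫ x in hull s, (u x - quasiInterpolant k W q L x) ^ 2 ≤ C * (h ^ 2 * ∑ v ∈ s, e v) ∧
      ∀ j, ∫ x in hull s,
        (g j x - fderiv ℝ (quasiInterpolant k W q L) x (EuclideanSpace.single j 1)) ^ 2
        ≤ C * ∑ v ∈ s, e v := by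
  obtain ⟨Cp, hCp, hb⟩ := exists_hull_poly_bounds d k hd hκ
  set V₁ := volume.real (Metric.ball (0 : E d) 1) with hV₁
  set C₁ := (2 ^ k * k ^ k : ℝ) ^ 2 * V₁ * Cp * (4 * (d + 1)) with hC₁
  refine ⟨2 + 2 * C₁ + 2 * Cp * C₁, by positivity,
    fun {Ω h 𝒯} hT {s} hs {W} hsW {L} hL {q} hq {u g} hu hg {e} he heg => ?_⟩
  have hh := hT.pos hd
  have he0 : ∀ v ∈ s, 0 ≤ e v := by
    intro v hv
    have h1 : 0 ≤ h ^ 2 * e v := (integral_nonneg fun x => sq_nonneg _).trans (he v hv)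
    exact nonneg_of_mul_nonneg_right h1 (by positivity)
  set S := ∑ v ∈ s, e v with hS
  have hS0 : 0 ≤ S := Finset.sum_nonneg he0
  have heS : ∀ v ∈ s, e v ≤ S := fun v hv => Finset.single_le_sum he0 hv
  obtain ⟨v₀, hv₀⟩ : s.Nonempty := by rw [← Finset.card_pos, hs.2]; omega
  have hmem {f : E d → ℝ} (hf : Continuous f) : MemLp f 2 (volume.restrict (hull s)) := by
    obtain ⟨c, -, hc⟩ := hT.exists_center hd hκ hs
    exact hf.memLp_restrict_of_subset_closedBall hc
  have hqc {v : E d} (hv : v ∈ s) : MemLp (q v) 2 (volume.restrict (hull s)) :=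
    hmem (continuous_of_mem_polyLE (hq v hv))
  set I := quasiInterpolant k W q L
  have hI : I ∈ polyLE d k := quasiInterpolant_mem_polyLE _ _ _
  have hIc : MemLp I 2 (volume.restrict (hull s)) := hmem (continuous_of_mem_polyLE hI)
  have hsym (a b : E d → ℝ) :
      ∫ x in hull s, (a x - b x) ^ 2 = ∫ x in hull s, (b x - a x) ^ 2 := by
    congr 1; ext x; ring
  have hqq : ∀ v ∈ s, ∫ x in hull s, (q v x - q v₀ x) ^ 2 ≤ 4 * (h ^ 2 * S) := by
    intro v hv
    have h1 := integral_sub_sq_le (hqc hv) hu (hqc hv₀)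
    rw [hsym (q v) u] at h1
    have h2 := (he v hv).trans (mul_le_mul_of_nonneg_left (heS v hv) (sq_nonneg h))
    have h3 := (he v₀ hv₀).trans (mul_le_mul_of_nonneg_left (heS v₀ hv₀) (sq_nonneg h))
    linarith
  have hM0 : 0 ≤ Cp * (h ^ d)⁻¹ * (4 * (h ^ 2 * S)) := by positivity
  have hII : ∫ x in hull s, (q v₀ x - I x) ^ 2 ≤ C₁ * (h ^ 2 * S) := by
    have h1 : ∀ x ∈ hull s, (q v₀ x - I x) ^ 2
        ≤ (2 ^ k * k ^ k * √(Cp * (h ^ d)⁻¹ * (4 * (h ^ 2 * S)))) ^ 2 := by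
      intro x hx
      rw [← sq_abs, abs_sub_comm]
      refine pow_le_pow_left₀ (abs_nonneg _) ?_ 2
      refine abs_quasiInterpolant_sub_le hsW hL (hq v₀ hv₀) (Real.sqrt_nonneg _) ?_ hx
      intro v hv y hy
      refine Real.abs_le_sqrt (((hb hT hs (Submodule.sub_mem _ (hq v hv) (hq v₀ hv₀))).1 y hy).trans
        ?_)
      exact mul_le_mul_of_nonneg_left (hqq v hv) (by positivity)
    have hvol : volume.real (hull s) ≤ h ^ d * V₁ := by
      obtain ⟨c, -, hc⟩ := hT.exists_center hd hκ hs
      refine (measureReal_mono hc measure_closedBall_lt_top.ne).trans_eq ?_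
      rw [Measure.addHaar_real_closedBall _ _ (by positivity), finrank_euclideanSpace_fin, one_mul]
    calc ∫ x in hull s, (q v₀ x - I x) ^ 2
        ≤ ∫ x in hull s, (2 ^ k * k ^ k * √(Cp * (h ^ d)⁻¹ * (4 * (h ^ 2 * S)))) ^ 2 :=
          setIntegral_mono_on ((hqc hv₀).sub hIc).integrable_sq
            (integrableOn_const (isCompact_hull s).measure_lt_top.ne)
            (isCompact_hull s).measurableSet h1
      _ = volume.real (hull s) * ((2 ^ k * k ^ k) ^ 2 * (Cp * (h ^ d)⁻¹ * (4 * (h ^ 2 * S)))) := by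
          rw [setIntegral_const, smul_eq_mul, mul_pow _ (√_), Real.sq_sqrt hM0]
      _ ≤ h ^ d * V₁ * ((2 ^ k * k ^ k) ^ 2 * (Cp * (h ^ d)⁻¹ * (4 * (h ^ 2 * S)))) := by gcongr
      _ = (2 ^ k * k ^ k) ^ 2 * V₁ * Cp * 4 * (h ^ 2 * S) := by field_simp
      _ ≤ C₁ * (h ^ 2 * S) := by
          rw [hC₁, ← mul_assoc _ (4 : ℝ)]
          refine mul_le_mul_of_nonneg_right (le_mul_of_one_le_right (by positivity) ?_)
            (by positivity)
          linarith [(d.cast_nonneg : (0 : ℝ) ≤ d)]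
  have hP' : 0 ≤ Cp * C₁ * (h ^ 2 * S) := by positivity
  constructor
  · have h1 := integral_sub_sq_le hu (hqc hv₀) hIc
    have h2 := (he v₀ hv₀).trans (mul_le_mul_of_nonneg_left (heS v₀ hv₀) (sq_nonneg h))
    nlinarith
  · intro j
    have hdm {p : E d → ℝ} (hp : p ∈ polyLE d k) : MemLp
        (fun x => fderiv ℝ p x (EuclideanSpace.single j 1)) 2 (volume.restrict (hull s)) :=
      hmem (continuous_of_mem_polyLE (fderiv_mem_polyLE hp _))
    have h1 := integral_sub_sq_le (hg j) (hdm (hq v₀ hv₀)) (hdm hI)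
    have h2 : ∫ x in hull s, (fderiv ℝ (q v₀) x (EuclideanSpace.single j 1)
        - fderiv ℝ I x (EuclideanSpace.single j 1)) ^ 2 ≤ Cp * C₁ * S := by
      have h3 := (hb hT hs (Submodule.sub_mem _ (hq v₀ hv₀) hI)).2 j
      have h4 (x : E d) : fderiv ℝ (q v₀ - I) x = fderiv ℝ (q v₀) x - fderiv ℝ I x :=
        fderiv_sub (differentiable_of_mem_polyLE (hq v₀ hv₀) x) (differentiable_of_mem_polyLE hI x)
      simp only [h4, sub_apply, Pi.sub_apply] at h3
      refine h3.trans ((mul_le_mul_of_nonneg_left hII (by positivity)).trans_eq ?_)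
      field_simp
    have h5 := (heg v₀ hv₀ j).trans (heS v₀ hv₀)
    have h6 : 0 ≤ C₁ * S := by positivity
    linarith

end Approximation

section ApproximationTheorem

variable {d k : ℕ} {Ω : Set (E d)} {κ h : ℝ} {𝒯 : Geometry.SimplicialComplex ℝ (E d)}

theorem SobolevBound.norm_le {s : ℕ} {u : L2 Ω} {M : ℝ} (hu : SobolevBound Ω s u M) :
    ‖u‖ ≤ M := by
  cases s with
  | zero => exact hu
  | succ s => exact hu.1

theorem SobolevBound.norm_gradient_sq_le {s : ℕ} {u : L2 Ω} {M : ℝ}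
    (hu : SobolevBound Ω (s + 1) u M) (hΩ : IsOpen Ω) {G : L2v Ω} (hG : IsWeakGradient Ω u G) :
    ‖G‖ ^ 2 ≤ d * M ^ 2 := by
  rw [norm_sq_eq_sum_comp]
  calc ∑ j, ‖comp Ω j G‖ ^ 2 ≤ ∑ _j : Fin d, M ^ 2 := by
        refine Finset.sum_le_sum fun j _ => ?_
        obtain ⟨v, hv, hvM⟩ := hu.2 j
        rw [(hG j).unique hΩ hv]
        exact pow_le_pow_left₀ (norm_nonneg _) hvM.norm_le 2
    _ = d * M ^ 2 := by simp

/-- Sums over the elements and their vertices of integrals over patches. -/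
theorem IsQuasiUniformTriangulation.sum_setIntegral_patch_le
    (hT : IsQuasiUniformTriangulation Ω κ h 𝒯) (hd : 1 ≤ d) (hκ : 0 < κ) {A : ℝ} (hA : 0 ≤ A)
    {D : E d → Set (E d)} (hD : ∀ s ∈ cells 𝒯, ∀ v ∈ s, MeasurableSet (D v) ∧ D v ⊆ Ω ∧
      D v ⊆ Metric.closedBall v (A * h)) {F : E d → ℝ} (hF : ∀ x, 0 ≤ F x) (hFi : IntegrableOn F Ω) :
    ∑ s ∈ hT.elements, ∑ v ∈ s, ∫ x in D v, F x
      ≤ (d + 1) * ((A + 1) / κ) ^ d * ∫ x in Ω, F x := by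
  classical
  have hh := hT.pos hd
  have hmem {s} (hs : s ∈ hT.elements) := hT.mem_elements.1 hs
  have h1 : ∀ s ∈ hT.elements, ∀ v ∈ s,
      ∫ x in D v, F x = ∫ x in Ω, (D v).indicator F x := by
    intro s hs v hv
    obtain ⟨h1, h2, -⟩ := hD s (hmem hs) v hv
    rw [setIntegral_indicator h1, inter_eq_self_of_subset_right h2]
  have h2 : ∀ s ∈ hT.elements, ∀ v ∈ s, IntegrableOn ((D v).indicator F) Ω := fun s hs v hv =>
    hFi.indicator (hD s (hmem hs) v hv).1
  rw [Finset.sum_congr rfl fun s hs => Finset.sum_congr rfl (h1 s hs),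
    Finset.sum_congr rfl fun s hs => (integral_finsetSum _ (h2 s hs)).symm,
    ← integral_finsetSum _ fun s hs => integrable_finsetSum _ (h2 s hs), ← integral_const_mul]
  refine integral_mono (integrable_finsetSum _ fun s hs => integrable_finsetSum _ (h2 s hs))
    (hFi.const_mul _) fun x => ?_
  set S := hT.elements.filter fun s => ∃ v ∈ s, x ∈ D v with hS
  have hcard : (S.card : ℝ) ≤ ((A + 1) / κ) ^ d := by
    have h3 := hT.card_mul_le hd hκ (S := S) (fun s hs => hmem (Finset.mem_filter.1 hs).1)
      (z := x) (R := (A + 1) * h) (by positivity) fun s hs y hy => by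
        obtain ⟨hs, v, hv, hxv⟩ := Finset.mem_filter.1 hs
        have h4 := hT.dist_le (hmem hs) hy (subset_convexHull ℝ _ hv)
        have h5 : dist x v ≤ A * h := (hD s (hmem hs) v hv).2.2 hxv
        rw [Metric.mem_closedBall]
        calc dist y x ≤ dist y v + dist x v := dist_triangle_right y x v
          _ ≤ _ := by linarith
    rw [div_pow, le_div_iff₀ (by positivity)]
    rw [mul_pow, mul_pow, ← mul_assoc] at h3
    exact le_of_mul_le_mul_right h3 (by positivity)
  calc ∑ s ∈ hT.elements, ∑ v ∈ s, (D v).indicator F x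
      ≤ ∑ s ∈ hT.elements, if s ∈ S then (d + 1) * F x else 0 := by
        refine Finset.sum_le_sum fun s hs => ?_
        split_ifs with hsS
        · calc ∑ v ∈ s, (D v).indicator F x ≤ ∑ _v ∈ s, F x :=
                Finset.sum_le_sum fun v _ => indicator_le_self' (fun x _ => hF x) x
            _ = (d + 1) * F x := by rw [Finset.sum_const, (hmem hs).2]; simp
        · refine (Finset.sum_eq_zero fun v hv => indicator_of_notMem (fun hx => hsS ?_) F).le
          exact Finset.mem_filter.2 ⟨hs, v, hv, hx⟩
    _ = S.card * ((d + 1) * F x) := by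
        rw [← Finset.sum_filter, Finset.sum_const, nsmul_eq_mul]
        congr 3
        ext s
        simp [hS]
    _ ≤ ((A + 1) / κ) ^ d * ((d + 1) * F x) := by
        have := hF x
        gcongr
    _ = _ := by ring

theorem exists_approx_of_le (k : ℕ) [NeZero k] (hd : 1 ≤ d) (hΩ : IsLipschitzDomain Ω)
    (hκ : 0 < κ) : ∃ ε > 0, ∃ C > 0, ∀ {h : ℝ} {𝒯 : Geometry.SimplicialComplex ℝ (E d)}
      (_ : IsQuasiUniformTriangulation Ω κ h 𝒯) (_ : h ≤ ε) {u : L2 Ω} {M : ℝ} {G : L2v Ω}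
      (_ : SobolevBound Ω (k + 1) u M) (_ : IsWeakGradient Ω u G),
      ∃ r ∈ Rh Ω k 𝒯, ∃ Gr, IsWeakGradient Ω r Gr ∧
        ‖u - r‖ ^ 2 ≤ C * (M * h ^ (k + 1)) ^ 2 ∧ ‖G - Gr‖ ^ 2 ≤ C * (M * h ^ k) ^ 2 := by
  obtain ⟨ε, hε, A, hA, hpatch⟩ := hΩ.exists_patch
  obtain ⟨C₁, hC₁, hlocal⟩ := exists_poly_approx_grad d k hA
  obtain ⟨C₂, hC₂, hquasi⟩ := exists_quasiInterpolant_error_le d k hd hκ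
  set N : ℝ := (d + 1) * ((A + 1) / κ) ^ d with hN
  have hA0 : 0 ≤ A := zero_le_one.trans hA
  refine ⟨ε, hε, (d + 1) * (C₂ * (N * C₁)), by positivity,
    fun {h 𝒯} hT hhε {u M G} hu hG => ?_⟩
  have hh := hT.pos hd
  obtain ⟨F, hF, hFi, hFM, hloc⟩ := hlocal hΩ.isOpen hu hG
  have hD : ∀ z ∈ closure Ω, ∃ (D : Set (E d)) (q : E d → ℝ), q ∈ polyLE d k ∧ IsOpen D ∧ D ⊆ Ω ∧
      D ⊆ Metric.closedBall z (A * h) ∧ (∀ x ∈ Ω, dist x z ≤ h → x ∈ D) ∧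
      (∫ x in D, (u x - q x) ^ 2 ≤ h ^ 2 * (h ^ (2 * k) * ∫ x in D, F x)) ∧
      ∀ j, ∫ x in D, (comp Ω j G x - fderiv ℝ q x (EuclideanSpace.single j 1)) ^ 2
        ≤ h ^ (2 * k) * ∫ x in D, F x := by
    intro z hz
    obtain ⟨V, c, hV, hVΩ, hVz, hVc, hcV, hst⟩ := hpatch z hz h hh hhε
    obtain ⟨q, hq, hq1, hq2⟩ := hloc hV hVΩ hh hVc hcV
    refine ⟨starKernel V c h, q, hq, isOpen_starKernel hV c h, ?_, ?_, hst, hq1.trans_eq (by ring), hq2⟩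
    · exact (starKernel_subset V c hh.le).trans hVΩ
    · exact (starKernel_subset V c hh.le).trans hVz
  choose! D q hq hDo hDΩ hDz hDx hDu hDG using hD
  have hvert {s} (hs : s ∈ cells 𝒯) {v : E d} (hv : v ∈ s) : v ∈ closure Ω :=
    hT.hull_subset hs (subset_convexHull ℝ _ hv)
  obtain ⟨W, L, v, hW, hL, hv⟩ := hT.exists_isPiecewise_quasiInterpolant (k := k) hΩ.isOpen q
  obtain ⟨r, hr⟩ := hT.exists_glue hΩ hd (fun s => quasiInterpolant k W q (L s))
    fun s hs => continuous_of_mem_polyLE (hv.mem s hs)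
  have hrv : r =ᵐ[volume.restrict Ω] v := by
    refine (hT.ae_iff hΩ hd).2 fun s hs => ?_
    filter_upwards [hr s hs, ae_restrict_mem (isCompact_hull s).measurableSet] with x hx hxs
    rw [hx, hv.eqOn s hs hxs]
  obtain ⟨Gr, hGr, hGrs⟩ := hv.exists_isWeakGradient hT hΩ hd hrv
  have hle {s} (hs : s ∈ cells 𝒯) {z : E d} (hz : z ∈ s) :
      volume.restrict (hull s) ≤ volume.restrict (D z) := by
    rw [← Measure.restrict_inter_add_sdiff (hull s) hΩ.isOpen.measurableSet]
    have h0 : volume.restrict (hull s \ Ω) = 0 := by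
      rw [Measure.restrict_eq_zero]
      have h1 := (hT.restrict_hull_le hΩ hd hs) Ωᶜ
      rw [Measure.restrict_apply hΩ.isOpen.measurableSet.compl,
        Measure.restrict_apply hΩ.isOpen.measurableSet.compl, compl_inter_self, measure_empty,
        inter_comm] at h1
      exact le_antisymm h1 zero_le
    rw [h0, add_zero]
    refine Measure.restrict_mono (fun x hx => hDx z (hvert hs hz) x hx.2 ?_) le_rfl
    exact hT.dist_le hs hx.1 (subset_convexHull ℝ _ hz)
  have hmD {f : E d → ℝ} (hf : Continuous f) {s} (hs : s ∈ cells 𝒯) {z : E d} (hz : z ∈ s) :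
      MemLp f 2 (volume.restrict (D z)) :=
    hf.memLp_restrict_of_subset_closedBall (hDz z (hvert hs hz))
  have hcell : ∀ s ∈ cells 𝒯, _ := fun s hs => hquasi hT hs (hW s hs) (hL s hs)
    (fun z hz => hq z (hvert hs hz))
    ((Lp.memLp u).mono_measure (hT.restrict_hull_le hΩ hd hs))
    (fun j => (Lp.memLp (comp Ω j G)).mono_measure (hT.restrict_hull_le hΩ hd hs))
    (e := fun z => h ^ (2 * k) * ∫ x in D z, F x)
    (fun z hz => (integral_mono_measure (hle hs hz) (.of_forall fun x => sq_nonneg _)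
      (((memLp_restrict_subset u (hDΩ z (hvert hs hz))).sub
        (hmD (continuous_of_mem_polyLE (hq z (hvert hs hz))) hs hz)).integrable_sq)).trans
      (hDu z (hvert hs hz)))
    (fun z hz j => (integral_mono_measure (hle hs hz) (.of_forall fun x => sq_nonneg _)
      (((memLp_restrict_subset (comp Ω j G) (hDΩ z (hvert hs hz))).sub
        (hmD (continuous_of_mem_polyLE (fderiv_mem_polyLE (hq z (hvert hs hz)) _))
          hs hz)).integrable_sq)).trans (hDG z (hvert hs hz) j))
  have hsum : ∑ s ∈ hT.elements, ∑ z ∈ s, h ^ (2 * k) * ∫ x in D z, F x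
      ≤ N * C₁ * (M * h ^ k) ^ 2 := by
    simp only [← Finset.mul_sum]
    calc h ^ (2 * k) * ∑ s ∈ hT.elements, ∑ z ∈ s, ∫ x in D z, F x
        ≤ h ^ (2 * k) * (N * ∫ x in Ω, F x) := by
          refine mul_le_mul_of_nonneg_left (hT.sum_setIntegral_patch_le hd hκ hA0
            (fun s hs z hz => ⟨(hDo z (hvert hs hz)).measurableSet, hDΩ z (hvert hs hz),
              hDz z (hvert hs hz)⟩) hF hFi) (by positivity)
      _ ≤ h ^ (2 * k) * (N * (C₁ * M ^ 2)) := by gcongr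
      _ = _ := by ring
  have hbound (w r' : L2 Ω) (p : Finset (E d) → E d → ℝ)
      (hr' : ∀ s ∈ cells 𝒯, ∀ᵐ x ∂(volume.restrict (hull s)), r' x = p s x) :
      ‖w - r'‖ ^ 2 = ∑ s ∈ hT.elements, ∫ x in hull s, (w x - p s x) ^ 2 := by
    rw [norm_sq_eq_integral, hT.integral_eq_sum hΩ hd (Lp.memLp (w - r')).integrable_sq]
    refine Finset.sum_congr rfl fun s hs => integral_congr_ae ?_
    have hs' := hT.mem_elements.1 hs
    filter_upwards [hr' s hs', ae_mono (hT.restrict_hull_le hΩ hd hs') (Lp.coeFn_sub w r')]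
      with x h1 h2
    rw [h2, Pi.sub_apply, h1]
  refine ⟨r, mem_Rh_iff.2 ⟨v, _, hv, hrv⟩, Gr, hGr, ?_, ?_⟩
  · rw [hbound u r _ hr]
    calc _ ≤ ∑ s ∈ hT.elements, C₂ * (h ^ 2 * ∑ z ∈ s, h ^ (2 * k) * ∫ x in D z, F x) :=
          Finset.sum_le_sum fun s hs => (hcell s (hT.mem_elements.1 hs)).1
      _ = C₂ * h ^ 2 * ∑ s ∈ hT.elements, ∑ z ∈ s, h ^ (2 * k) * ∫ x in D z, F x := by
          rw [Finset.mul_sum]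
          exact Finset.sum_congr rfl fun s _ => by ring
      _ ≤ C₂ * h ^ 2 * (N * C₁ * (M * h ^ k) ^ 2) := by gcongr
      _ = 1 * (C₂ * (N * C₁)) * (M * h ^ (k + 1)) ^ 2 := by ring
      _ ≤ _ := by
          gcongr
          exact le_add_of_nonneg_left d.cast_nonneg
  · rw [norm_sq_eq_sum_comp]
    calc ∑ j, ‖comp Ω j (G - Gr)‖ ^ 2
        ≤ ∑ _j : Fin d, C₂ * (N * C₁ * (M * h ^ k) ^ 2) := by
          refine Finset.sum_le_sum fun j _ => ?_
          have h1 : comp Ω j (G - Gr) = comp Ω j G - comp Ω j Gr := map_sub (compL Ω j) G Gr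
          rw [h1, hbound (comp Ω j G) (comp Ω j Gr)
            (fun s x => fderiv ℝ (quasiInterpolant k W q (L s)) x (EuclideanSpace.single j 1))]
          · calc _ ≤ ∑ s ∈ hT.elements, C₂ * ∑ z ∈ s, h ^ (2 * k) * ∫ x in D z, F x :=
                  Finset.sum_le_sum fun s hs => (hcell s (hT.mem_elements.1 hs)).2 j
              _ = C₂ * ∑ s ∈ hT.elements, ∑ z ∈ s, h ^ (2 * k) * ∫ x in D z, F x := by
                  rw [Finset.mul_sum]
              _ ≤ _ := by gcongr
          · intro s hs
            filter_upwards [hGrs s hs, ae_mono (hT.restrict_hull_le hΩ hd hs) (comp_ae_eq j Gr)]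
              with x h1 h2
            rw [h2, h1]
      _ = d * (C₂ * (N * C₁)) * (M * h ^ k) ^ 2 := by
          rw [Finset.sum_const, Finset.card_univ, Fintype.card_fin, nsmul_eq_mul]
          ring
      _ ≤ _ := by
          gcongr
          exact le_add_of_nonneg_right zero_le_one

/-- Approximation of functions in `H^{k+1}(Ω)` by continuous piecewise polynomials. -/
theorem exists_approx (k : ℕ) [NeZero k] (hd : 1 ≤ d) (hΩ : IsLipschitzDomain Ω)
    (hκ : 0 < κ) : ∃ C > 0, ∀ {h : ℝ} {𝒯 : Geometry.SimplicialComplex ℝ (E d)}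
      (_ : IsQuasiUniformTriangulation Ω κ h 𝒯) {u : L2 Ω} {M : ℝ} {G : L2v Ω}
      (_ : SobolevBound Ω (k + 1) u M) (_ : IsWeakGradient Ω u G),
      ∃ r ∈ Rh Ω k 𝒯, ∃ Gr, IsWeakGradient Ω r Gr ∧
        ‖u - r‖ ≤ C * M * h ^ (k + 1) ∧ ‖G - Gr‖ ≤ C * M * h ^ k := by
  obtain ⟨ε, hε, C, hC, happ⟩ := exists_approx_of_le k hd hΩ hκ
  refine ⟨√C + (1 + √d) * ((ε ^ (k + 1))⁻¹ + (ε ^ k)⁻¹), by positivity,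
    fun {h 𝒯} hT {u M G} hu hG => ?_⟩
  have hh := hT.pos hd
  have hM : 0 ≤ M := (norm_nonneg u).trans hu.norm_le
  rcases le_or_gt h ε with hhε | hhε
  · obtain ⟨r, hr, Gr, hGr, h1, h2⟩ := happ hT hhε hu hG
    refine ⟨r, hr, Gr, hGr, ?_, ?_⟩
    · have h3 : ‖u - r‖ ≤ √C * (M * h ^ (k + 1)) := by
        rw [← abs_of_nonneg (norm_nonneg _), ← abs_of_nonneg (by positivity :
          0 ≤ √C * (M * h ^ (k + 1))), ← sq_le_sq, mul_pow, Real.sq_sqrt hC.le]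
        exact h1
      rw [mul_assoc]
      refine h3.trans (mul_le_mul_of_nonneg_right (le_add_of_nonneg_right ?_) (by positivity))
      positivity
    · have h3 : ‖G - Gr‖ ≤ √C * (M * h ^ k) := by
        rw [← abs_of_nonneg (norm_nonneg _), ← abs_of_nonneg (by positivity :
          0 ≤ √C * (M * h ^ k)), ← sq_le_sq, mul_pow, Real.sq_sqrt hC.le]
        exact h2
      rw [mul_assoc]
      refine h3.trans (mul_le_mul_of_nonneg_right (le_add_of_nonneg_right ?_) (by positivity))
      positivity
  · have hpow (n : ℕ) : 1 ≤ (ε ^ n)⁻¹ * h ^ n := by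
      rw [inv_mul_eq_div, one_le_div (by positivity)]
      exact pow_le_pow_left₀ hε.le hhε.le n
    have h0 : IsWeakGradient Ω (0 : L2 Ω) 0 := by
      have := hG.smul 0
      rwa [zero_smul, zero_smul] at this
    refine ⟨0, (RhSub Ω k 𝒯).zero_mem, 0, h0, ?_, ?_⟩
    · rw [sub_zero]
      refine hu.norm_le.trans ?_
      calc M ≤ M * ((ε ^ (k + 1))⁻¹ * h ^ (k + 1)) := le_mul_of_one_le_right hM (hpow _)
        _ = (ε ^ (k + 1))⁻¹ * M * h ^ (k + 1) := by ring
        _ ≤ _ := by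
          gcongr
          have : (ε ^ (k + 1))⁻¹ ≤ (1 + √d) * (ε ^ (k + 1))⁻¹ :=
            le_mul_of_one_le_left (by positivity) (by linarith [Real.sqrt_nonneg d])
          have h4 : 0 ≤ (1 + √d) * (ε ^ k)⁻¹ := by positivity
          linarith [Real.sqrt_nonneg C]
    · rw [sub_zero]
      have h1 : ‖G‖ ≤ √d * M := by
        rw [← abs_of_nonneg (norm_nonneg G), ← abs_of_nonneg (by positivity : 0 ≤ √d * M),
          ← sq_le_sq, mul_pow, Real.sq_sqrt d.cast_nonneg]
        exact hu.norm_gradient_sq_le hΩ.isOpen hG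
      refine h1.trans ?_
      calc √d * M ≤ √d * M * ((ε ^ k)⁻¹ * h ^ k) := le_mul_of_one_le_right (by positivity) (hpow _)
        _ = √d * (ε ^ k)⁻¹ * M * h ^ k := by ring
        _ ≤ _ := by
          gcongr
          have h4 : 0 ≤ (1 + √d) * (ε ^ (k + 1))⁻¹ := by positivity
          have h5 : 0 ≤ (ε ^ k)⁻¹ := by positivity
          linarith [Real.sqrt_nonneg C]

end ApproximationTheorem

section TimeDerivatives

variable {X : Type*} [NormedAddCommGroup X] [NormedSpace ℝ X] {T : ℝ} {u v w : ℝ → X}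

namespace HasTimeDeriv

theorem intervalIntegrable (h : HasTimeDeriv T u v) {s t : ℝ} (hs : s ∈ Icc 0 T)
    (ht : t ∈ Icc 0 T) : IntervalIntegrable v volume s t := by
  refine h.1.mono_set ?_
  rw [uIcc_of_le (hs.1.trans hs.2)]
  exact uIcc_subset_Icc hs ht

theorem sub_eq (h : HasTimeDeriv T u v) {s t : ℝ} (hs : s ∈ Icc 0 T) (ht : t ∈ Icc 0 T) :
    u t - u s = ∫ τ in s..t, v τ := by
  have h0 : (0 : ℝ) ∈ Icc 0 T := ⟨le_rfl, hs.1.trans hs.2⟩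
  rw [h.2 t ht, h.2 s hs, add_sub_add_left_eq_sub]
  exact intervalIntegral.integral_interval_sub_left (h.intervalIntegrable h0 ht)
    (h.intervalIntegrable h0 hs)

theorem norm_sub_le (h : HasTimeDeriv T u v) {s t : ℝ} (hs : s ∈ Icc 0 T) (ht : t ∈ Icc 0 T)
    (hst : s ≤ t) : ‖u t - u s‖ ≤ ∫ τ in s..t, ‖v τ‖ := by
  rw [h.sub_eq hs ht]
  exact intervalIntegral.norm_integral_le_integral_norm hst

theorem norm_le (h : HasTimeDeriv T u v) {t : ℝ} (ht : t ∈ Icc 0 T) :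
    ‖u t‖ ≤ ‖u 0‖ + ∫ τ in (0 : ℝ)..T, ‖v τ‖ := by
  have h0 : (0 : ℝ) ∈ Icc 0 T := ⟨le_rfl, ht.1.trans ht.2⟩
  have h1 : u t = u 0 + (u t - u 0) := by abel
  rw [h1]
  refine (norm_add_le _ _).trans (add_le_add le_rfl ((h.norm_sub_le h0 ht ht.1).trans ?_))
  exact intervalIntegral.integral_mono_interval le_rfl ht.1 ht.2
    (.of_forall fun _ => norm_nonneg _) h.1.norm

theorem norm_sub_le_of_norm_le (h : HasTimeDeriv T u v) {K : ℝ} (hK : ∀ t ∈ Icc 0 T, ‖v t‖ ≤ K)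
    {s t : ℝ} (hs : s ∈ Icc 0 T) (ht : t ∈ Icc 0 T) : ‖u t - u s‖ ≤ K * |t - s| := by
  rw [h.sub_eq hs ht]
  exact intervalIntegral.norm_integral_le_of_norm_le_const fun τ hτ =>
    hK τ (uIcc_subset_Icc hs ht (uIoc_subset_uIcc hτ))

/-- The truncation error of the backward Euler difference quotient. -/
theorem norm_sub_smul_sub_le [CompleteSpace X] (h : HasTimeDeriv T u v) (hv : HasTimeDeriv T v w)
    {s t : ℝ} (hs : s ∈ Icc 0 T) (ht : t ∈ Icc 0 T) (hst : s < t) :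
    ‖v t - (t - s)⁻¹ • (u t - u s)‖ ≤ ∫ τ in s..t, ‖w τ‖ := by
  have hts : 0 < t - s := sub_pos.2 hst
  have h1 : v t - (t - s)⁻¹ • (u t - u s) = (t - s)⁻¹ • ∫ τ in s..t, (v t - v τ) := by
    rw [h.sub_eq hs ht, intervalIntegral.integral_sub intervalIntegrable_const
      (h.intervalIntegrable hs ht), intervalIntegral.integral_const, smul_sub, smul_smul,
      inv_mul_cancel₀ hts.ne', one_smul]
  have h2 : ‖∫ τ in s..t, (v t - v τ)‖ ≤ (∫ τ in s..t, ‖w τ‖) * |t - s| := by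
    refine intervalIntegral.norm_integral_le_of_norm_le_const fun τ hτ => ?_
    rw [uIoc_of_le hst.le] at hτ
    have hτ' : τ ∈ Icc 0 T := ⟨hs.1.trans hτ.1.le, hτ.2.trans ht.2⟩
    refine (hv.norm_sub_le hτ' ht hτ.2).trans ?_
    exact intervalIntegral.integral_mono_interval hτ.1.le hτ.2 le_rfl
      (.of_forall fun _ => norm_nonneg _) (hv.intervalIntegrable hs ht).norm
  rw [h1, norm_smul, Real.norm_of_nonneg (inv_nonneg.2 hts.le), inv_mul_le_iff₀ hts, mul_comm]
  rwa [abs_of_pos hts] at h2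

theorem sum_truncation_le [CompleteSpace X] (h : HasTimeDeriv T u v) (hv : HasTimeDeriv T v w)
    {N : ℕ} {Δt : ℝ} (hΔt : 0 < Δt) (hN : N * Δt = T) :
    ∑ i ∈ Finset.range N, Δt * ‖v ((i + 1 : ℕ) * Δt)
      - Δt⁻¹ • (u ((i + 1 : ℕ) * Δt) - u (i * Δt))‖ ≤ (∫ τ in (0 : ℝ)..T, ‖w τ‖) * Δt := by
  have hmem {i : ℕ} (hi : i ≤ N) : (i : ℝ) * Δt ∈ Icc 0 T := by
    refine ⟨by positivity, ?_⟩
    rw [← hN]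
    gcongr
  have hsum : ∑ i ∈ Finset.range N, ∫ τ in ((i : ℕ) : ℝ) * Δt..((i + 1 : ℕ) : ℝ) * Δt, ‖w τ‖
      = ∫ τ in (0 : ℝ)..T, ‖w τ‖ := by
    have h1 := intervalIntegral.sum_integral_adjacent_intervals (f := fun τ => ‖w τ‖)
      (μ := volume) (a := fun i : ℕ => (i : ℝ) * Δt) (n := N) fun i hi =>
        (hv.intervalIntegrable (hmem hi.le) (hmem hi)).norm
    rw [h1, hN, Nat.cast_zero, zero_mul]
  rw [mul_comm, ← hsum, Finset.mul_sum]
  refine Finset.sum_le_sum fun i hi => mul_le_mul_of_nonneg_left ?_ hΔt.le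
  have hi' := Finset.mem_range.1 hi
  have h2 : ((i + 1 : ℕ) : ℝ) * Δt - i * Δt = Δt := by push_cast; ring
  have h3 := h.norm_sub_smul_sub_le hv (hmem hi'.le) (hmem hi') (by linarith)
  rwa [h2] at h3

theorem continuousOn (h : HasTimeDeriv T u v) {K : ℝ} (hK : ∀ t ∈ Icc 0 T, ‖v t‖ ≤ K) :
    ContinuousOn u (Icc 0 T) := by
  refine (LipschitzOnWith.of_dist_le_mul (K := K.toNNReal) fun t ht s hs => ?_).continuousOn
  rw [dist_eq_norm, Real.dist_eq]
  exact (h.norm_sub_le_of_norm_le hK hs ht).trans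
    (mul_le_mul_of_nonneg_right (Real.le_coe_toNNReal K) (abs_nonneg _))

end HasTimeDeriv

theorem mem_closure_of_ae {T : ℝ} (hT : 0 < T) {p : ℝ → Prop}
    (hp : ∀ᵐ t ∂(volume.restrict (Ioo 0 T)), p t) {t : ℝ} (ht : t ∈ Icc 0 T) :
    t ∈ closure {s | s ∈ Ioo 0 T ∧ p s} := by
  have h1 : Dense {s | s ∈ Ioo 0 T → p s} :=
    Measure.dense_of_ae ((ae_restrict_iff' measurableSet_Ioo).1 hp)
  have h2 := closure_mono (h1.open_subset_closure_inter (isOpen_Ioo (a := 0) (b := T)))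
  rw [closure_Ioo hT.ne, closure_closure] at h2
  refine closure_mono ?_ (h2 ht)
  exact fun s hs => ⟨hs.1, hs.2 hs.1⟩

end TimeDerivatives

section WeightedForm

variable {d : ℕ} {Ω : Set (E d)}

theorem exists_wForm_bilin {φ : E d → ℝ} {φlo φhi : ℝ} (hΩ : MeasurableSet Ω)
    (hφ : AEStronglyMeasurable φ (volume.restrict Ω)) (hlo : 0 < φlo)
    (hb : ∀ x ∈ Ω, φlo < φ x ∧ φ x < φhi) :
    ∃ a : L2 Ω →ₗ[ℝ] L2 Ω →ₗ[ℝ] ℝ, (∀ u r, a u r = wForm Ω φ u r) ∧ (∀ u v, a u v = a v u) ∧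
      (∀ u, φlo * ‖u‖ ^ 2 ≤ a u u) ∧ ∀ u v, |a u v| ≤ φhi * ‖u‖ * ‖v‖ := by
  have hbd : ∀ᵐ x ∂(volume.restrict Ω), ‖φ x‖ ≤ φhi := by
    filter_upwards [ae_restrict_mem hΩ] with x hx
    rw [Real.norm_of_nonneg (hlo.trans (hb x hx).1).le]
    exact (hb x hx).2.le
  have hi (u r : L2 Ω) : Integrable (fun x => φ x * u x * r x) (volume.restrict Ω) := by
    have h1 := (Lp.memLp u).integrable_mul (Lp.memLp r)
    have h2 := h1.bdd_mul hφ hbd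
    simpa only [Pi.mul_apply, mul_assoc] using h2
  have hcomm (u r : L2 Ω) : wForm Ω φ u r = wForm Ω φ r u := by
    simp only [wForm]
    exact integral_congr_ae (.of_forall fun x => by ring)
  have hadd (u v r : L2 Ω) : wForm Ω φ (u + v) r = wForm Ω φ u r + wForm Ω φ v r := by
    simp only [wForm]
    rw [← integral_add (hi u r) (hi v r)]
    refine integral_congr_ae ?_
    filter_upwards [Lp.coeFn_add u v] with x hx
    rw [hx, Pi.add_apply]; ring
  have hsmul (c : ℝ) (u r : L2 Ω) : wForm Ω φ (c • u) r = c • wForm Ω φ u r := by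
    simp only [wForm]
    rw [← integral_smul]
    refine integral_congr_ae ?_
    filter_upwards [Lp.coeFn_smul c u] with x hx
    rw [hx, Pi.smul_apply, smul_eq_mul, smul_eq_mul]; ring
  have habs (u v : L2 Ω) : |wForm Ω φ u v| ≤ φhi * ‖u‖ * ‖v‖ := by
    have h1 : ∫ x in Ω, ‖u x‖ * ‖v x‖ ≤ ‖u‖ * ‖v‖ := by
      have h2 : ∫ x in Ω, ‖u x‖ * ‖v x‖ = ⟪|u|, |v|⟫ := by
        rw [L2.inner_def]
        refine integral_congr_ae ?_
        filter_upwards [Lp.coeFn_abs u, Lp.coeFn_abs v] with x h3 h4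
        rw [h3, h4]
        simp [mul_comm]
      rw [h2]
      exact (real_inner_le_norm _ _).trans_eq (by rw [norm_abs_eq_norm, norm_abs_eq_norm])
    have h3 : Integrable (fun x => φhi * (‖u x‖ * ‖v x‖)) (volume.restrict Ω) :=
      ((Lp.memLp u).norm.integrable_mul (Lp.memLp v).norm).const_mul φhi
    rw [← Real.norm_eq_abs, wForm]
    calc _ ≤ ∫ x in Ω, φhi * (‖u x‖ * ‖v x‖) := by
          refine norm_integral_le_of_norm_le h3 ?_
          filter_upwards [hbd] with x hx
          rw [norm_mul, norm_mul, mul_assoc]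
          gcongr
      _ ≤ φhi * ‖u‖ * ‖v‖ := by
          rw [integral_const_mul, mul_assoc]
          rcases Ω.eq_empty_or_nonempty with rfl | ⟨x, hx⟩
          · have h0 (w : L2 (∅ : Set (E d))) : ‖w‖ = 0 := by
              rw [norm_eq_zero]
              exact Lp.ext (by simp [Filter.EventuallyEq])
            simp [h0]
          · exact mul_le_mul_of_nonneg_left h1
              (hlo.trans ((hb x hx).1.trans (hb x hx).2)).le
  refine ⟨LinearMap.mk₂ ℝ (wForm Ω φ) hadd hsmul (fun u v r => ?_) (fun c u r => ?_),
    fun u r => rfl, hcomm, fun u => ?_, habs⟩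
  · rw [hcomm, hadd, hcomm v, hcomm r]
  · rw [hcomm, hsmul, hcomm]
  · rw [LinearMap.mk₂_apply, norm_sq_eq_integral, ← integral_const_mul, wForm]
    refine integral_mono_ae ((Lp.memLp u).integrable_sq.const_mul _) (hi u u) ?_
    filter_upwards [ae_restrict_mem hΩ] with x hx
    have h1 := (hb x hx).1.le
    rw [mul_assoc, ← sq]
    exact mul_le_mul_of_nonneg_right h1 (sq_nonneg _)

end WeightedForm

section Projection

variable {H : Type*} [NormedAddCommGroup H] [InnerProductSpace ℝ H]

/-- The projection onto a finite-dimensional subspace with respect to a coercive form. -/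
theorem exists_form_projection (R : Submodule ℝ H) [FiniteDimensional ℝ R]
    (a : H →ₗ[ℝ] H →ₗ[ℝ] ℝ) {c : ℝ} (hc : 0 < c) (hcoer : ∀ u, c * ‖u‖ ^ 2 ≤ a u u) :
    ∃ Q : H →ₗ[ℝ] R, ∀ u (r : R), a (u - Q u) r = 0 := by
  let A : H →ₗ[ℝ] Module.Dual ℝ R := R.subtype.dualMap ∘ₗ a
  have hinj : Function.Injective (A ∘ₗ R.subtype) := by
    rw [injective_iff_map_eq_zero]
    intro r hr
    have h1 : a (r : H) (r : H) = 0 := LinearMap.congr_fun hr r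
    have h2 := hcoer (r : H)
    rw [h1] at h2
    have h3 : ‖(r : H)‖ ^ 2 ≤ 0 := by nlinarith [sq_nonneg ‖(r : H)‖]
    have h4 : ‖(r : H)‖ = 0 := by nlinarith [norm_nonneg (r : H), sq_nonneg ‖(r : H)‖]
    exact Subtype.ext (norm_eq_zero.1 h4)
  let e := LinearMap.linearEquivOfInjective (A ∘ₗ R.subtype) hinj
    (Subspace.dual_finrank_eq (K := ℝ) (V := R)).symm
  refine ⟨e.symm.toLinearMap ∘ₗ A, fun u r => ?_⟩
  have h1 : (A ∘ₗ R.subtype) (e.symm (A u)) = A u := e.apply_symm_apply (A u)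
  have h2 : a (e.symm (A u) : H) r = a u r := LinearMap.congr_fun h1 r
  rw [map_sub, LinearMap.sub_apply]
  exact sub_eq_zero.2 h2.symm

variable {R : Submodule ℝ H} {a : H →ₗ[ℝ] H →ₗ[ℝ] ℝ} {c C : ℝ}

theorem norm_sub_form_projection_le (hc : 0 < c) (hcoer : ∀ u, c * ‖u‖ ^ 2 ≤ a u u)
    (hbdd : ∀ u v, |a u v| ≤ C * ‖u‖ * ‖v‖) {u : H} {p : R} (hp : ∀ r : R, a (u - p) r = 0)
    (r : R) : ‖u - p‖ ≤ C / c * ‖u - r‖ := by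
  have h1 : a (u - p) (u - p) = a (u - p) (u - r) := by
    have h2 : u - (p : H) = (u - r) + ((r - p : R) : H) := by push_cast; abel
    conv_lhs => rw [h2, map_add, ← h2, hp, add_zero]
  have h3 := (hcoer (u - p)).trans (h1.le.trans ((le_abs_self _).trans (hbdd _ _)))
  rcases eq_or_lt_of_le (norm_nonneg (u - (p : H))) with h0 | h0
  · rw [← h0] at h3 ⊢
    rcases le_or_gt 0 C with hC | hC
    · positivity
    · have h4 := hbdd (u - r) (u - r)
      have h5 : ‖u - (r : H)‖ = 0 := by
        by_contra hne
        have h7 : C * ‖u - (r : H)‖ * ‖u - (r : H)‖ < 0 := by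
          rw [mul_assoc]; exact mul_neg_of_neg_of_pos hC (by positivity)
        linarith [abs_nonneg (a (u - r) (u - r))]
      rw [h5, mul_zero]
  · rw [div_mul_eq_mul_div, le_div_iff₀ hc]
    nlinarith

end Projection

section DiscreteSpaces

variable {d k : ℕ} {Ω : Set (E d)} {κ h : ℝ} {𝒯 : Geometry.SimplicialComplex ℝ (E d)}

theorem exists_gradient_map (k : ℕ) (hT : IsQuasiUniformTriangulation Ω κ h 𝒯)
    (hΩ : IsLipschitzDomain Ω) (hd : 1 ≤ d) :
    ∃ D : RhSub Ω k 𝒯 →ₗ[ℝ] L2v Ω, ∀ r : RhSub Ω k 𝒯, IsWeakGradient Ω (r : L2 Ω) (D r) := by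
  have h1 (r : RhSub Ω k 𝒯) : ∃ G, IsWeakGradient Ω (r : L2 Ω) G := by
    obtain ⟨v, p, hv, hrv⟩ := mem_Rh_iff.1 r.2
    obtain ⟨G, hG, -⟩ := hv.exists_isWeakGradient hT hΩ hd hrv
    exact ⟨G, hG⟩
  choose D hD using h1
  exact ⟨{ toFun := D
           map_add' := fun r s => (hD (r + s)).unique hΩ.isOpen ((hD r).add (hD s))
           map_smul' := fun c r => (hD (c • r)).unique hΩ.isOpen ((hD r).smul c) }, hD⟩

theorem eq_const_of_mem_polyLE_zero {p : E d → ℝ} (hp : p ∈ polyLE d 0) :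
    ∃ c : ℝ, p = fun _ => c := by
  refine polyLE_induction (p := fun p => ∃ c : ℝ, p = fun _ => c) ?_ ⟨0, rfl⟩ ?_ ?_ hp
  · exact fun L => ⟨1, by simp⟩
  · rintro f g - - ⟨a, rfl⟩ ⟨b, rfl⟩
    exact ⟨a + b, rfl⟩
  · rintro c f - ⟨a, rfl⟩
    exact ⟨c * a, rfl⟩

theorem gradient_eq_zero_of_mem_Rh_zero (hT : IsQuasiUniformTriangulation Ω κ h 𝒯)
    (hΩ : IsLipschitzDomain Ω) (hd : 1 ≤ d) {u : L2 Ω} {G : L2v Ω} (hu : u ∈ Rh Ω 0 𝒯)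
    (hG : IsWeakGradient Ω u G) : G = 0 := by
  obtain ⟨v, p, hv, huv⟩ := mem_Rh_iff.1 hu
  obtain ⟨G', hG', hGp⟩ := hv.exists_isWeakGradient hT hΩ hd huv
  obtain rfl := hG.unique hΩ.isOpen hG'
  refine Lp.ext ((hT.ae_iff hΩ hd).2 fun s hs => ?_)
  obtain ⟨c, hc⟩ := eq_const_of_mem_polyLE_zero (hv.mem s hs)
  filter_upwards [hGp s hs, ae_mono (hT.restrict_hull_le hΩ hd hs)
    (Lp.coeFn_zero (E d) 2 (volume.restrict Ω))] with x h1 h2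
  rw [h2]
  ext j
  rw [h1 j, hc]
  simp

/-- The flux of the gradient of a piecewise linear function is piecewise constant. -/
theorem fluxL_gradient_mem_Mh {n : ℕ} (P : ForchheimerPoly n)
    (hT : IsQuasiUniformTriangulation Ω κ h 𝒯)
    (hΩ : IsLipschitzDomain Ω) (hd : 1 ≤ d) {u : L2 Ω} {G : L2v Ω} (hu : u ∈ Rh Ω 1 𝒯)
    (hG : IsWeakGradient Ω u G) (k : ℕ) : P.fluxL G ∈ Mh Ω k 𝒯 := by
  obtain ⟨v, p, hv, huv⟩ := mem_Rh_iff.1 hu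
  obtain ⟨G', hG', hGp⟩ := hv.exists_isWeakGradient hT hΩ hd huv
  obtain rfl := hG.unique hΩ.isOpen hG'
  rw [mem_Mh_iff hT hΩ hd]
  intro s hs
  obtain ⟨L, hL⟩ := exists_const_fderiv_of_mem_polyLE_one (hv.mem s hs)
  refine ⟨fun j _ => P.flux (WithLp.toLp 2 fun i => L (EuclideanSpace.single i 1) : E d) j,
    fun j => const_mem_polyLE _ _, ?_⟩
  filter_upwards [hGp s hs, ae_mono (hT.restrict_hull_le hΩ hd hs) (P.coeFn_fluxL G)]
    with x h1 h2 j
  have h3 : G x = WithLp.toLp 2 fun i => L (EuclideanSpace.single i 1) := by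
    ext i
    rw [h1 i, hL x]
  rw [h2, h3]

/-- The vector field with the given components. -/
def ofComp (Ω : Set (E d)) (v : Fin d → L2 Ω) : L2v Ω :=
  ∑ j, (ContinuousLinearMap.toSpanSingleton ℝ (EuclideanSpace.single j 1 : E d)).compLp (v j)

theorem coeFn_ofComp (v : Fin d → L2 Ω) :
    ∀ᵐ x ∂(volume.restrict Ω), ∀ j, ofComp Ω v x j = v j x := by
  have h1 : ∀ᵐ x ∂(volume.restrict Ω), ∀ j,
      (ContinuousLinearMap.toSpanSingleton ℝ (EuclideanSpace.single j 1 : E d)).compLp (v j) x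
        = v j x • (EuclideanSpace.single j 1 : E d) :=
    ae_all_iff.2 fun j => ContinuousLinearMap.coeFn_compLp _ (v j)
  have h2 := Lp.coeFn_finsetSum (p := 2) (μ := volume.restrict Ω) Finset.univ fun j =>
    (ContinuousLinearMap.toSpanSingleton ℝ (EuclideanSpace.single j 1 : E d)).compLp (v j)
  filter_upwards [h1, h2] with x h1 h2 j
  rw [ofComp, h2, Finset.sum_apply]
  simp [h1, Finset.sum_apply, Pi.single_apply]

theorem comp_ofComp (v : Fin d → L2 Ω) (j : Fin d) : comp Ω j (ofComp Ω v) = v j := by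
  refine Lp.ext ?_
  filter_upwards [comp_ae_eq j (ofComp Ω v), coeFn_ofComp v] with x h1 h2
  rw [h1, h2 j]

theorem ofComp_mem_Mh (hT : IsQuasiUniformTriangulation Ω κ h 𝒯) (hΩ : IsLipschitzDomain Ω)
    (hd : 1 ≤ d) {l : ℕ} (hlk : l ≤ k) {v : Fin d → L2 Ω} (hv : ∀ j, v j ∈ Rh Ω l 𝒯) :
    ofComp Ω v ∈ Mh Ω k 𝒯 := by
  rw [mem_Mh_iff hT hΩ hd]
  intro s hs
  choose w p hw hvw using fun j => mem_Rh_iff.1 (hv j)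
  refine ⟨fun j => p j s, fun j => polyLE_mono hlk ((hw j).mem s hs), ?_⟩
  filter_upwards [ae_mono (hT.restrict_hull_le hΩ hd hs) (coeFn_ofComp v),
    ae_mono (hT.restrict_hull_le hΩ hd hs) (ae_all_iff.2 hvw),
    ae_restrict_mem (isCompact_hull s).measurableSet] with x h1 h2 h3 j
  rw [h1 j, h2 j, (hw j).eqOn s hs h3]

theorem SobolevBound.exists_isWeakGradient {s : ℕ} {u : L2 Ω} {M : ℝ}
    (hu : SobolevBound Ω (s + 1) u M) : ∃ G, IsWeakGradient Ω u G := by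
  choose v hv _ using hu.2
  exact ⟨ofComp Ω v, fun j => by rw [comp_ofComp]; exact hv j⟩

theorem SobolevBound.mono {s : ℕ} : ∀ {l : ℕ} {u : L2 Ω} {M : ℝ}, l ≤ s →
    SobolevBound Ω s u M → SobolevBound Ω l u M := by
  induction s with
  | zero =>
    intro l u M hl hu
    rwa [Nat.le_zero.1 hl]
  | succ s ih =>
    intro l u M hl hu
    cases l with
    | zero => exact hu.1
    | succ l =>
      refine ⟨hu.1, fun j => ?_⟩
      obtain ⟨v, hv, hvM⟩ := hu.2 j
      exact ⟨v, hv, ih (Nat.le_of_succ_le_succ hl) hvM⟩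

end DiscreteSpaces

section ErrorAnalysis

variable {d : ℕ} {Ω : Set (E d)}

/-- Bounds, with the constant `K`, for the data and the solution `ρ` with gradient `G`. -/
structure SolutionBounds {n : ℕ} (P : ForchheimerPoly n) (Ω : Set (E d)) (T : ℝ)
    (φ : E d → ℝ) (f : ℝ → L2 Ω) (ψ : ℝ → E d → ℝ) (ρ ρt : ℝ → L2 Ω) (m G : ℝ → L2v Ω)
    (K : ℝ) : Prop where
  nonneg : 0 ≤ K
  gradient : ∀ t ∈ Ioc 0 T, IsWeakGradient Ω (ρ t) (G t)
  m_eq : ∀ t ∈ Ioc 0 T, m t = -P.fluxL (G t)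
  mass : ∀ t ∈ Ioc 0 T, ∀ (r : L2 Ω) (Gr : L2v Ω), IsWeakGradient Ω r Gr →
    wForm Ω φ (ρt t) r + ⟪P.fluxL (G t), Gr⟫ = ⟪f t, r⟫ - bdryPair Ω (ψ t) r
  norm_le : ∀ t ∈ Icc 0 T, ‖ρ t‖ ≤ K
  norm_deriv_le : ∀ t ∈ Icc 0 T, ‖ρt t‖ ≤ K
  norm_sub_le : ∀ t ∈ Icc 0 T, ∀ s ∈ Icc 0 T, ‖ρ t - ρ s‖ ≤ K * |t - s|
  norm_gradient_le : ∀ t ∈ Ioc 0 T, ‖G t‖ ≤ K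
  norm_source_le : ∀ t ∈ Icc 0 T, ‖f t‖ ≤ K
  truncation : ∀ (N : ℕ) (Δt : ℝ), 0 < Δt → N * Δt = T →
    ∑ i ∈ Finset.range N, Δt * ‖ρt ((i + 1 : ℕ) * Δt)
      - Δt⁻¹ • (ρ ((i + 1 : ℕ) * Δt) - ρ (i * Δt))‖ ≤ K * Δt
  psi_measurable : ∀ t ∈ Icc 0 T, AEStronglyMeasurable (ψ t) (surface Ω)
  psi_le : ∀ t ∈ Icc 0 T, ∀ᵐ x ∂(surface Ω), |ψ t x| ≤ K
  psi_sub_le : ∀ s ∈ Icc 0 T, ∀ t ∈ Icc 0 T, ∀ᵐ x ∂(surface Ω), |ψ t x - ψ s x| ≤ K * |t - s|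

theorem IsWeakSolution.exists_solutionBounds {n : ℕ} {P : ForchheimerPoly n} {T : ℝ} (hT : 0 < T)
    (hΩ : IsOpen Ω) {φ : E d → ℝ} {f ft : ℝ → L2 Ω} {ψ : ℝ → E d → ℝ} {ρ ρt ρtt : ℝ → L2 Ω}
    {m : ℝ → L2v Ω} (hsol : IsWeakSolution P Ω T φ f ψ ρ ρt m) (hf : HasTimeDeriv T f ft)
    (hρt : HasTimeDeriv T ρt ρtt) {Mψ : ℝ}
    (hψm : ∀ t ∈ Icc 0 T, AEStronglyMeasurable (ψ t) (surface Ω))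
    (hψb : ∀ t ∈ Icc 0 T, ∀ᵐ x ∂(surface Ω), |ψ t x| ≤ Mψ)
    (hψt : ∀ s ∈ Icc 0 T, ∀ t ∈ Icc 0 T, ∀ᵐ x ∂(surface Ω), |ψ t x - ψ s x| ≤ Mψ * |t - s|)
    {k : ℕ} {M : ℝ} (hρ : ∀ᵐ t ∂(volume.restrict (Ioo 0 T)), SobolevBound Ω (k + 1) (ρ t) M) :
    ∃ G K, SolutionBounds P Ω T φ f ψ ρ ρt m G K := by
  have hmom (t) (ht : t ∈ Ioc 0 T) : ∃ G, IsWeakGradient Ω (ρ t) G ∧ m t = -P.fluxL G := by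
    obtain ⟨G, hG, hGz⟩ := hsol.momentum t ht
    refine ⟨G, hG, eq_of_inner_Hdiv_eq hΩ fun w hw => ?_⟩
    have h1 := hGz w hw
    rw [KForm_eq_inner] at h1
    rw [inner_neg_left]
    linarith
  choose! G hG hGm using hmom
  set K₁ := ‖ρt 0‖ + ∫ τ in (0 : ℝ)..T, ‖ρtt τ‖ with hK₁
  set K₂ := ‖f 0‖ + ∫ τ in (0 : ℝ)..T, ‖ft τ‖ with hK₂
  set K₃ := ‖ρ 0‖ + ∫ τ in (0 : ℝ)..T, ‖ρt τ‖ with hK₃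
  have hint (w : ℝ → L2 Ω) : 0 ≤ ∫ τ in (0 : ℝ)..T, ‖w τ‖ :=
    intervalIntegral.integral_nonneg hT.le fun _ _ => norm_nonneg _
  have hK₁0 : 0 ≤ K₁ := add_nonneg (norm_nonneg _) (hint _)
  have hK₂0 : 0 ≤ K₂ := add_nonneg (norm_nonneg _) (hint _)
  have hK₃0 : 0 ≤ K₃ := add_nonneg (norm_nonneg _) (hint _)
  have hMψ := abs_nonneg Mψ
  have hdM : 0 ≤ √d * |M| := by positivity
  have hb1 (t) (ht : t ∈ Icc 0 T) : ‖ρt t‖ ≤ K₁ := hρt.norm_le ht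
  have hGle (t) (ht : t ∈ Ioc 0 T) : ‖G t‖ ≤ √d * |M| := by
    have hne := mem_closure_iff_nhdsWithin_neBot.1 (mem_closure_of_ae hT hρ ⟨ht.1.le, ht.2⟩)
    have htend : Tendsto ρ (𝓝[{s | s ∈ Ioo 0 T ∧ SobolevBound Ω (k + 1) (ρ s) M}] t) (𝓝 (ρ t)) :=
      ((hsol.time_deriv.continuousOn hb1) t ⟨ht.1.le, ht.2⟩).mono_left
        (nhdsWithin_mono t fun s hs => Ioo_subset_Icc_self hs.1)
    refine IsWeakGradient.norm_le_of_tendsto hΩ (u := ρ) (G := G) htend ?_ ?_ (hG t ht)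
    · filter_upwards [self_mem_nhdsWithin] with s hs
      exact hG s (Ioo_subset_Ioc_self hs.1)
    · filter_upwards [self_mem_nhdsWithin] with s hs
      rw [← abs_of_nonneg (norm_nonneg (G s)), ← abs_of_nonneg hdM, ← sq_le_sq, mul_pow,
        Real.sq_sqrt d.cast_nonneg, sq_abs]
      exact hs.2.norm_gradient_sq_le hΩ (hG s (Ioo_subset_Ioc_self hs.1))
  refine ⟨G, K₁ + K₂ + K₃ + √d * |M| + |Mψ|,
    { nonneg := by positivity
      gradient := hG
      m_eq := hGm
      mass := fun t ht r Gr hGr => ?_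
      norm_le := fun t ht => (hsol.time_deriv.norm_le ht).trans (by linarith)
      norm_deriv_le := fun t ht => (hb1 t ht).trans (by linarith)
      norm_sub_le := fun t ht s hs =>
        (hsol.time_deriv.norm_sub_le_of_norm_le hb1 hs ht).trans ?_
      norm_gradient_le := fun t ht => (hGle t ht).trans (by linarith)
      norm_source_le := fun t ht => (hf.norm_le ht).trans (by linarith)
      truncation := fun N Δt hΔt hN => (hsol.time_deriv.sum_truncation_le hρt hΔt hN).trans ?_
      psi_measurable := hψm
      psi_le := fun t ht => (hψb t ht).mono fun x hx => hx.trans ?_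
      psi_sub_le := fun s hs t ht => (hψt s hs t ht).mono fun x hx => hx.trans ?_ }⟩
  · have h1 := hsol.mass t ht r Gr hGr
    rw [hGm t ht, inner_neg_left] at h1
    linarith
  · exact mul_le_mul_of_nonneg_right (by linarith) (abs_nonneg _)
  · exact mul_le_mul_of_nonneg_right (by linarith [norm_nonneg (ρt 0)]) hΔt.le
  · linarith [le_abs_self Mψ]
  · exact mul_le_mul_of_nonneg_right (by linarith [le_abs_self Mψ]) (abs_nonneg _)

variable {κ T : ℝ} {ρ : ℝ → L2 Ω} {G : ℝ → L2v Ω} {a : L2 Ω →ₗ[ℝ] L2 Ω →ₗ[ℝ] ℝ} {c C : ℝ}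

theorem continuous_form_projection {H : Type*} [NormedAddCommGroup H] [InnerProductSpace ℝ H]
    {R : Submodule ℝ H} {a : H →ₗ[ℝ] H →ₗ[ℝ] ℝ} (hc : 0 < c) (hcoer : ∀ u, c * ‖u‖ ^ 2 ≤ a u u)
    (hbdd : ∀ u v, |a u v| ≤ C * ‖u‖ * ‖v‖) {Q : H →ₗ[ℝ] R}
    (hQ : ∀ u (r : R), a (u - Q u) r = 0) : Continuous Q := by
  refine (Q.mkContinuous (1 + C / c) fun u => ?_).continuous
  have h1 := norm_sub_form_projection_le hc hcoer hbdd (hQ u) 0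
  rw [ZeroMemClass.coe_zero, sub_zero] at h1
  have h2 : ((Q u : R) : H) = u - (u - Q u) := by abel
  change ‖((Q u : R) : H)‖ ≤ _
  rw [h2]
  refine (norm_sub_le _ _).trans ?_
  linarith

/-- The errors of the weighted projection of the solution and of its gradient. -/
theorem exists_projection_error (k : ℕ) [NeZero k] (hd : 1 ≤ d) (hΩ : IsLipschitzDomain Ω)
    (hκ : 0 < κ) (hT : 0 < T) (hρc : ContinuousOn ρ (Icc 0 T))
    (hG : ∀ t ∈ Ioc 0 T, IsWeakGradient Ω (ρ t) (G t)) {M : ℝ}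
    (hρ : ∀ᵐ t ∂(volume.restrict (Ioo 0 T)), SobolevBound Ω (k + 1) (ρ t) M) (hc : 0 < c)
    (hC : 0 ≤ C) (hcoer : ∀ u, c * ‖u‖ ^ 2 ≤ a u u) (hbdd : ∀ u v, |a u v| ≤ C * ‖u‖ * ‖v‖) :
    ∃ K, 0 ≤ K ∧ ∀ {h : ℝ} {𝒯 : Geometry.SimplicialComplex ℝ (E d)}
      (_ : IsQuasiUniformTriangulation Ω κ h 𝒯) {D : RhSub Ω k 𝒯 →ₗ[ℝ] L2v Ω}
      (_ : ∀ r : RhSub Ω k 𝒯, IsWeakGradient Ω (r : L2 Ω) (D r)) {Q : L2 Ω →ₗ[ℝ] RhSub Ω k 𝒯}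
      (_ : ∀ u (r : RhSub Ω k 𝒯), a (u - Q u) r = 0),
      (∀ t ∈ Icc 0 T, ‖ρ t - Q (ρ t)‖ ≤ K * (h ^ k * h)) ∧
      ∀ t ∈ Ioc 0 T, ‖G t - D (Q (ρ t))‖ ≤ K * h ^ k := by
  obtain ⟨Ca, hCa, happ⟩ := exists_approx k hd hΩ hκ
  obtain ⟨Ci, hCi, hinv⟩ := exists_norm_gradient_le d k hd hκ
  have hM : 0 ≤ M := by
    obtain ⟨s, -, hs⟩ := closure_nonempty_iff.1 ⟨0, mem_closure_of_ae hT hρ ⟨le_rfl, hT.le⟩⟩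
    exact (norm_nonneg _).trans hs.norm_le
  refine ⟨C / c * (Ca * M) + Ca * M + Ci * ((1 + C / c) * (Ca * M)), by positivity,
    fun {h 𝒯} hTr {D} hD {Q} hQ => ?_⟩
  have hh := hTr.pos hd
  have hgood (s) (hs : s ∈ Ioo 0 T ∧ SobolevBound Ω (k + 1) (ρ s) M) :
      ‖ρ s - Q (ρ s)‖ ≤ C / c * (Ca * M) * (h ^ k * h) ∧
      ‖G s - D (Q (ρ s))‖ ≤ (Ca * M + Ci * ((1 + C / c) * (Ca * M))) * h ^ k := by
    obtain ⟨r, hr, Gr, hGr, h1, h2⟩ := happ hTr hs.2 (hG s (Ioo_subset_Ioc_self hs.1))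
    have hproj : ‖ρ s - Q (ρ s)‖ ≤ C / c * (Ca * M) * (h ^ k * h) :=
      calc ‖ρ s - Q (ρ s)‖ ≤ C / c * ‖ρ s - r‖ :=
            norm_sub_form_projection_le hc hcoer hbdd (hQ _) ⟨r, hr⟩
        _ ≤ C / c * (Ca * M * h ^ (k + 1)) := by gcongr
        _ = _ := by rw [pow_succ]; ring
    refine ⟨hproj, ?_⟩
    have h3 : ‖Gr - D (Q (ρ s))‖ ≤ Ci * h⁻¹ * ‖r - Q (ρ s)‖ :=
      hinv hTr hΩ ((RhSub Ω k 𝒯).sub_mem hr (Q (ρ s)).2) (hGr.sub (hD _))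
    have h4 : ‖r - Q (ρ s)‖ ≤ (1 + C / c) * (Ca * M) * (h ^ k * h) := by
      have h5 : r - Q (ρ s) = (ρ s - Q (ρ s)) - (ρ s - r) := by abel
      rw [h5]
      refine (norm_sub_le _ _).trans ?_
      rw [pow_succ] at h1
      linarith
    have h6 : G s - D (Q (ρ s)) = (G s - Gr) + (Gr - D (Q (ρ s))) := by abel
    rw [h6]
    calc _ ≤ ‖G s - Gr‖ + ‖Gr - D (Q (ρ s))‖ := norm_add_le _ _
      _ ≤ Ca * M * h ^ k + Ci * h⁻¹ * ((1 + C / c) * (Ca * M) * (h ^ k * h)) := by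
          refine add_le_add h2 (h3.trans ?_)
          gcongr
      _ = _ := by field_simp
  have hQc := continuous_form_projection hc hcoer hbdd hQ
  have htend (t) (ht : t ∈ Icc 0 T) : Tendsto (fun s => ρ s - (Q (ρ s) : L2 Ω))
      (𝓝[{s | s ∈ Ioo 0 T ∧ SobolevBound Ω (k + 1) (ρ s) M}] t) (𝓝 (ρ t - Q (ρ t))) := by
    have h1 := (hρc t ht).mono_left
      (nhdsWithin_mono t fun s (hs : s ∈ Ioo 0 T ∧ SobolevBound Ω (k + 1) (ρ s) M) =>
        Ioo_subset_Icc_self hs.1)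
    exact h1.sub (((continuous_subtype_val.comp hQc).tendsto _).comp h1)
  have hpos : 0 ≤ Ci * ((1 + C / c) * (Ca * M)) := by positivity
  have hpos' : 0 ≤ C / c * (Ca * M) := by positivity
  refine ⟨fun t ht => ?_, fun t ht => ?_⟩
  · have hne := mem_closure_iff_nhdsWithin_neBot.1 (mem_closure_of_ae hT hρ ht)
    refine le_of_tendsto (htend t ht).norm ?_
    filter_upwards [self_mem_nhdsWithin] with s hs
    refine (hgood s hs).1.trans (mul_le_mul_of_nonneg_right ?_ (by positivity))
    have : 0 ≤ Ca * M := by positivity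
    linarith
  · have ht' : t ∈ Icc 0 T := Ioc_subset_Icc_self ht
    have hne := mem_closure_iff_nhdsWithin_neBot.1 (mem_closure_of_ae hT hρ ht')
    refine IsWeakGradient.norm_le_of_tendsto hΩ.isOpen (G := fun s => G s - D (Q (ρ s)))
      (htend t ht') ?_ ?_ ((hG t ht).sub (hD _))
    · filter_upwards [self_mem_nhdsWithin] with s hs
      exact (hG s (Ioo_subset_Ioc_self hs.1)).sub (hD _)
    · filter_upwards [self_mem_nhdsWithin] with s hs
      refine (hgood s hs).2.trans (mul_le_mul_of_nonneg_right ?_ (by positivity))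
      linarith

theorem IsLipschitzDomain.exists_mesh_le (hΩ : IsLipschitzDomain Ω) :
    ∃ H > 0, ∀ {h : ℝ} {𝒯 : Geometry.SimplicialComplex ℝ (E d)}
      (_ : IsQuasiUniformTriangulation Ω κ h 𝒯), h ≤ H := by
  refine ⟨Metric.diam (closure Ω) + 1, by positivity, fun {h 𝒯} hTr => ?_⟩
  obtain ⟨s, hs, rfl⟩ := hTr.mesh_size.1
  exact (Metric.diam_mono (hTr.hull_subset hs) hΩ.isBounded.closure).trans (by linarith)

end ErrorAnalysis

section Scheme

variable {d : ℕ} {Ω : Set (E d)} {κ T : ℝ} {n : ℕ} {P : ForchheimerPoly n} {φ : E d → ℝ}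
  {f : ℝ → L2 Ω} {ψ : ℝ → E d → ℝ} {ρ ρt : ℝ → L2 Ω} {m G : ℝ → L2v Ω}
  {a : L2 Ω →ₗ[ℝ] L2 Ω →ₗ[ℝ] ℝ} {φlo φhi : ℝ}

/-- The mixed finite element scheme as an abstract Euler scheme, with mesh-independent bounds. -/
structure IsMixedScheme (P : ForchheimerPoly n) (Ω : Set (E d)) (T : ℝ) (f : ℝ → L2 Ω)
    (ψ : ℝ → E d → ℝ) (ρ ρt : ℝ → L2 Ω) (G : ℝ → L2v Ω) (a : L2 Ω →ₗ[ℝ] L2 Ω →ₗ[ℝ] ℝ)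
    (φlo φhi K : ℝ) (k : ℕ) (h : ℝ) (𝒯 : Geometry.SimplicialComplex ℝ (E d)) (N : ℕ)
    (D : RhSub Ω k 𝒯 →ₗ[ℝ] L2v Ω) (Q : L2 Ω →ₗ[ℝ] RhSub Ω k 𝒯) (x : ℕ → RhSub Ω k 𝒯) : Prop where
  scheme : IsEulerScheme (P.a 0) φlo φhi K T P.fluxL P.energyL a (RhSub Ω k 𝒯) D (h ^ k) (T / N) N
    ρ ρt G (fun t => Q (ρ t)) x fun t r => ⟪f t, (r : L2 Ω)⟫ - bdryPair Ω (ψ t) r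
  gradient : ∀ r : RhSub Ω k 𝒯, IsWeakGradient Ω (r : L2 Ω) (D r)
  projection_err : ∀ t ∈ Icc 0 T, ‖ρ t - Q (ρ t)‖ ≤ K * h ^ k
  projection_err' : k ≠ 0 → ∀ t ∈ Icc 0 T, ‖ρ t - Q (ρ t)‖ ≤ K * (h ^ k * h)
  init_err : k ≠ 0 → ‖(x 0 : L2 Ω) - ρ 0‖ ≤ K * (h ^ k * h)
  pow_le : h ^ k ≤ K
  pow_le_mul : k ≠ 0 → h ^ k ≤ K * h
  inverse : ∀ r : RhSub Ω k 𝒯, ‖D r‖ ≤ K * h⁻¹ * ‖r‖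
  rhs_sub_le : ∀ t ∈ Ioc 0 T, ∀ s ∈ Ioc 0 T, ∀ r : RhSub Ω k 𝒯,
    |(⟪f t, (r : L2 Ω)⟫ - bdryPair Ω (ψ t) r) - (⟪f s, (r : L2 Ω)⟫ - bdryPair Ω (ψ s) r)|
      ≤ K * (1 + |t - s| / h) * ‖r‖
  norm_deriv_le : ∀ t ∈ Icc 0 T, ‖ρt t‖ ≤ K
  norm_sub_le : ∀ t ∈ Icc 0 T, ∀ s ∈ Icc 0 T, ‖ρ t - ρ s‖ ≤ K * |t - s|
  norm_gradient_le : ∀ t ∈ Ioc 0 T, ‖G t‖ ≤ K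

theorem SolutionBounds.exists_projection_bounds {K₀ : ℝ}
    (hB : SolutionBounds P Ω T φ f ψ ρ ρt m G K₀) (k : ℕ) (hd : 1 ≤ d) (hΩ : IsLipschitzDomain Ω)
    (hκ : 0 < κ) (hT : 0 < T) {M : ℝ}
    (hρ : ∀ᵐ t ∂(volume.restrict (Ioo 0 T)), SobolevBound Ω (k + 1) (ρ t) M) (hlo : 0 < φlo)
    (hhi : 0 < φhi) (hcoer : ∀ u, φlo * ‖u‖ ^ 2 ≤ a u u)
    (hbdd : ∀ u v, |a u v| ≤ φhi * ‖u‖ * ‖v‖) :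
    ∃ K, 0 ≤ K ∧ ∀ {h : ℝ} {𝒯 : Geometry.SimplicialComplex ℝ (E d)}
      (_ : IsQuasiUniformTriangulation Ω κ h 𝒯) {D : RhSub Ω k 𝒯 →ₗ[ℝ] L2v Ω}
      (_ : ∀ r : RhSub Ω k 𝒯, IsWeakGradient Ω (r : L2 Ω) (D r)) {Q : L2 Ω →ₗ[ℝ] RhSub Ω k 𝒯}
      (_ : ∀ u (r : RhSub Ω k 𝒯), a (u - Q u) r = 0),
      (∀ t ∈ Icc 0 T, ‖ρ t - Q (ρ t)‖ ≤ K * h ^ k) ∧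
      (∀ t ∈ Ioc 0 T, ‖G t - D (Q (ρ t))‖ ≤ K * h ^ k) ∧
      (k ≠ 0 → ∀ t ∈ Icc 0 T, ‖ρ t - Q (ρ t)‖ ≤ K * (h ^ k * h)) := by
  have hK₀ := hB.nonneg
  rcases eq_or_ne k 0 with rfl | hk
  · refine ⟨φhi / φlo * K₀ + K₀, by positivity, fun {h 𝒯} hTr {D} hD {Q} hQ =>
      ⟨fun t ht => ?_, fun t ht => ?_, fun h0 => absurd rfl h0⟩⟩
    · have h1 := norm_sub_form_projection_le hlo hcoer hbdd (hQ (ρ t)) 0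
      rw [ZeroMemClass.coe_zero, sub_zero] at h1
      rw [pow_zero, mul_one]
      have h2 : φhi / φlo * ‖ρ t‖ ≤ φhi / φlo * K₀ :=
        mul_le_mul_of_nonneg_left (hB.norm_le t ht) (by positivity)
      linarith
    · rw [gradient_eq_zero_of_mem_Rh_zero hTr hΩ hd (Q (ρ t)).2 (hD _), sub_zero, pow_zero, mul_one]
      have h2 : 0 ≤ φhi / φlo * K₀ := by positivity
      linarith [hB.norm_gradient_le t ht]
  · have : NeZero k := ⟨hk⟩
    have hρc : ContinuousOn ρ (Icc 0 T) := by
      refine (LipschitzOnWith.of_dist_le_mul (K := K₀.toNNReal) fun t ht s hs => ?_).continuousOn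
      rw [dist_eq_norm, Real.dist_eq]
      exact (hB.norm_sub_le t ht s hs).trans
        (mul_le_mul_of_nonneg_right (Real.le_coe_toNNReal K₀) (abs_nonneg _))
    obtain ⟨K, hK, hp⟩ := exists_projection_error k hd hΩ hκ hT hρc hB.gradient hρ hlo hhi.le
      hcoer hbdd
    obtain ⟨H, hH, hmesh⟩ := hΩ.exists_mesh_le (κ := κ)
    refine ⟨K + K * H, by positivity, fun {h 𝒯} hTr {D} hD {Q} hQ => ?_⟩
    have hh := hTr.pos hd
    obtain ⟨h1, h2⟩ := hp hTr hD hQ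
    have hKH : 0 ≤ K * H := by positivity
    refine ⟨fun t ht => (h1 t ht).trans ?_, fun t ht => (h2 t ht).trans ?_,
      fun _ t ht => (h1 t ht).trans ?_⟩
    · calc K * (h ^ k * h) ≤ K * (h ^ k * H) := by gcongr; exact hmesh hTr
        _ = K * H * h ^ k := by ring
        _ ≤ _ := by gcongr; linarith
    · gcongr; linarith
    · gcongr; linarith

theorem SolutionBounds.exists_rhs_sub_le {K₀ : ℝ} (hB : SolutionBounds P Ω T φ f ψ ρ ρt m G K₀)
    (k : ℕ) (hd : 1 ≤ d) (hΩ : IsLipschitzDomain Ω) (hκ : 0 < κ) :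
    ∃ K, 0 ≤ K ∧ ∀ {h : ℝ} {𝒯 : Geometry.SimplicialComplex ℝ (E d)}
      (_ : IsQuasiUniformTriangulation Ω κ h 𝒯), ∀ t ∈ Ioc 0 T, ∀ s ∈ Ioc 0 T,
      ∀ r : RhSub Ω k 𝒯, |(⟪f t, (r : L2 Ω)⟫ - bdryPair Ω (ψ t) r)
        - (⟪f s, (r : L2 Ω)⟫ - bdryPair Ω (ψ s) r)| ≤ K * (1 + |t - s| / h) * ‖r‖ := by
  have hK₀ := hB.nonneg
  obtain ⟨Cb, hCb, hbd⟩ := exists_bdryPair_sub_le k hd hΩ hκ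
  refine ⟨2 * K₀ + Cb * K₀, by positivity, fun {h 𝒯} hTr t ht s hs r => ?_⟩
  have hh := hTr.pos hd
  have ht' := Ioc_subset_Icc_self ht
  have hs' := Ioc_subset_Icc_self hs
  have h1 := hbd hTr r.2 (hB.psi_measurable t ht') (hB.psi_measurable s hs') (hB.psi_le t ht')
    (hB.psi_le s hs') (mul_nonneg hK₀ (abs_nonneg (t - s))) (hB.psi_sub_le s hs' t ht')
  have h2 : |⟪f t, (r : L2 Ω)⟫ - ⟪f s, (r : L2 Ω)⟫| ≤ 2 * K₀ * ‖r‖ := by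
    rw [← inner_sub_left]
    refine (abs_real_inner_le_norm _ _).trans (mul_le_mul_of_nonneg_right ?_ (norm_nonneg _))
    refine (_root_.norm_sub_le _ _).trans ?_
    linarith [hB.norm_source_le t ht', hB.norm_source_le s hs']
  have h3 : Cb * (K₀ * |t - s|) * h⁻¹ * ‖(r : L2 Ω)‖ = Cb * K₀ * (|t - s| / h) * ‖r‖ := by
    rw [Submodule.coe_norm]; ring
  calc _ = |(⟪f t, (r : L2 Ω)⟫ - ⟪f s, (r : L2 Ω)⟫)
        - (bdryPair Ω (ψ t) r - bdryPair Ω (ψ s) r)| := by congr 1; ring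
    _ ≤ 2 * K₀ * ‖r‖ + Cb * K₀ * (|t - s| / h) * ‖r‖ :=
        (abs_sub _ _).trans (add_le_add h2 (h1.trans_eq h3))
    _ ≤ _ := by
        have h5 : 0 ≤ Cb * K₀ * ‖r‖ := by positivity
        have h6 : 0 ≤ 2 * K₀ * (|t - s| / h) * ‖r‖ := by positivity
        linarith

theorem SolutionBounds.exists_isMixedScheme {K₀ : ℝ}
    (hB : SolutionBounds P Ω T φ f ψ ρ ρt m G K₀) (k : ℕ) (hd : 1 ≤ d) (hΩ : IsLipschitzDomain Ω)
    (hκ : 0 < κ) (hT : 0 < T) {M : ℝ}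
    (hρ : ∀ᵐ t ∂(volume.restrict (Ioo 0 T)), SobolevBound Ω (k + 1) (ρ t) M) (hlo : 0 < φlo)
    (hhi : 0 < φhi) (ha : ∀ u r, a u r = wForm Ω φ u r) (hsymm : ∀ u v, a u v = a v u)
    (hcoer : ∀ u, φlo * ‖u‖ ^ 2 ≤ a u u) (hbdd : ∀ u v, |a u v| ≤ φhi * ‖u‖ * ‖v‖) :
    ∃ K, 0 < K ∧ ∀ {h : ℝ} {𝒯 : Geometry.SimplicialComplex ℝ (E d)}
      (_ : IsQuasiUniformTriangulation Ω κ h 𝒯) {N : ℕ} (_ : 0 < N) {ρh : ℕ → L2 Ω}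
      {mh : ℕ → L2v Ω} (_ : IsDiscreteSolution P Ω T φ f ψ (ρ 0) k 𝒯 N ρh mh),
      ∃ D Q x, IsMixedScheme P Ω T f ψ ρ ρt G a φlo φhi K k h 𝒯 N D Q x ∧
        ∀ i ≤ N, (x i : L2 Ω) = ρh i := by
  have hK₀ := hB.nonneg
  obtain ⟨Kp, hKp, hproj⟩ := hB.exists_projection_bounds k hd hΩ hκ hT hρ hlo hhi hcoer hbdd
  obtain ⟨Kb, hKb, hrhs⟩ := hB.exists_rhs_sub_le k hd hΩ hκ
  obtain ⟨Ci, hCi, hinv⟩ := exists_norm_gradient_le d k hd hκ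
  obtain ⟨H, hH, hmesh⟩ := hΩ.exists_mesh_le (κ := κ)
  have hHk : 0 ≤ H ^ k := by positivity
  have hHk' : 0 ≤ H ^ (k - 1) := by positivity
  set K := K₀ + 2 * Kp + Kb + Ci + H + H ^ k + H ^ (k - 1) with hK
  refine ⟨K, by positivity, fun {h 𝒯} hTr {N} hN {ρh mh} hsol => ?_⟩
  have hh := hTr.pos hd
  have hhH := hmesh hTr
  have hε : 0 < h ^ k := by positivity
  have hfin := finiteDimensional_RhSub (k := k) hTr hΩ hd
  obtain ⟨D, hD⟩ := exists_gradient_map k hTr hΩ hd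
  obtain ⟨Q, hQ⟩ := exists_form_projection (RhSub Ω k 𝒯) a hlo hcoer
  obtain ⟨hp1, hp2, hp3⟩ := hproj hTr hD hQ
  have hmem (i) (hi : i ≤ N) : ρh i ∈ RhSub Ω k 𝒯 := by
    rcases Nat.eq_zero_or_pos i with rfl | hi0
    · exact hsol.init_mem
    · exact hsol.ρh_mem i (Finset.mem_Icc.2 ⟨hi0, hi⟩)
  classical
  let x (i : ℕ) : RhSub Ω k 𝒯 := if hi : i ≤ N then ⟨ρh i, hmem i hi⟩ else 0
  have hx (i) (hi : i ≤ N) : (x i : L2 Ω) = ρh i := by simp [x, hi]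
  have hx0 : ‖ρ 0 - x 0‖ ≤ ‖ρ 0 - Q (ρ 0)‖ := by
    have h1 := norm_sub_form_projection_le (a := innerₗ (L2 Ω)) (c := 1) (C := 1) one_pos
      (fun u => by rw [one_mul, innerₗ_apply_apply, real_inner_self_eq_norm_sq])
      (fun u v => by rw [one_mul]; exact abs_real_inner_le_norm u v) (u := ρ 0) (p := x 0)
      (fun r => by
        have h2 := hsol.init_proj r r.2
        rw [innerₗ_apply_apply, hx 0 (Nat.zero_le N), ← neg_sub, inner_neg_left, h2, neg_zero])
      (Q (ρ 0))
    rwa [div_one, one_mul] at h1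
  have h0T : (0 : ℝ) ∈ Icc 0 T := ⟨le_rfl, hT.le⟩
  have hKp1 : Kp ≤ K := by linarith
  refine ⟨D, Q, x,
    { scheme :=
        { a₀_pos := P.a_zero_pos
          φlo_pos := hlo
          φhi_pos := hhi
          K_pos := by positivity
          isEnergy := fun u v => P.energyL_bregman u v
          symm := hsymm
          coercive := hcoer
          bounded := hbdd
          step_pos := by positivity
          final_time := by field_simp
          eps_pos := hε
          continuous_eq := fun t ht r => by
            rw [ha]
            exact hB.mass t ht r (D r) (hD r)
          discrete_eq := fun i hi r => ?_
          proj := fun t _ r => hQ (ρ t) r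
          grad_err := fun t ht => (hp2 t ht).trans (by gcongr)
          init_err := ?_
          trunc := (hB.truncation N (T / N) (by positivity) (by field_simp)).trans
            (mul_le_mul_of_nonneg_right (by linarith) (by positivity)) }
      gradient := hD
      projection_err := fun t ht => (hp1 t ht).trans (by gcongr)
      projection_err' := fun hk t ht => (hp3 hk t ht).trans (by gcongr)
      init_err := fun hk => by
        rw [norm_sub_rev]
        exact hx0.trans ((hp3 hk 0 h0T).trans (by gcongr))
      pow_le := (pow_le_pow_left₀ hh.le hhH k).trans (by linarith)
      pow_le_mul := fun hk => ?_
      inverse := fun r => (hinv hTr hΩ r.2 (hD r)).trans ?_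
      rhs_sub_le := fun t ht s hs r => (hrhs hTr t ht s hs r).trans ?_
      norm_deriv_le := fun t ht => (hB.norm_deriv_le t ht).trans (by linarith)
      norm_sub_le := fun t ht s hs => (hB.norm_sub_le t ht s hs).trans
        (mul_le_mul_of_nonneg_right (by linarith) (abs_nonneg _))
      norm_gradient_le := fun t ht => (hB.norm_gradient_le t ht).trans (by linarith) }, hx⟩
  · have hi' : i + 1 ∈ Finset.Icc 1 N := Finset.mem_Icc.2 ⟨by omega, hi⟩
    obtain ⟨Gh, hGh, hGz⟩ := hsol.momentum (i + 1) hi'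
    have h1 := hsol.mass (i + 1) hi' r r.2 (D r) (hD r)
    have h2 := hGz (D r) (gradient_mem_Mh hTr hΩ hd r.2 (hD r))
    have h3 : D (x (i + 1)) = Gh :=
      (hD (x (i + 1))).unique hΩ.isOpen (by rwa [hx (i + 1) hi])
    rw [KForm_eq_inner] at h2
    rw [Nat.add_sub_cancel] at h1
    rw [ha, h3, hx (i + 1) hi, hx i hi.le]
    linarith
  · have h1 : (Q (ρ 0) : L2 Ω) - x 0 = (ρ 0 - x 0) - (ρ 0 - Q (ρ 0)) := by abel
    rw [h1]
    refine (_root_.norm_sub_le _ _).trans ?_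
    have h2 := hp1 0 h0T
    have h3 : 2 * Kp * h ^ k ≤ K * h ^ k := by
      gcongr
      linarith
    linarith
  · rw [← pow_sub_one_mul hk h]
    exact mul_le_mul_of_nonneg_right
      ((pow_le_pow_left₀ hh.le hhH (k - 1)).trans (by linarith)) hh.le
  · refine mul_le_mul_of_nonneg_right (mul_le_mul_of_nonneg_right ?_ (by positivity))
      (norm_nonneg _)
    linarith
  · refine mul_le_mul_of_nonneg_right (mul_le_mul_of_nonneg_right ?_ (by positivity))
      (norm_nonneg _)
    linarith

end Scheme

section Convergence

variable {d : ℕ} {Ω : Set (E d)} {κ T : ℝ} {n : ℕ} {P : ForchheimerPoly n} {φ : E d → ℝ}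
  {f : ℝ → L2 Ω} {ψ : ℝ → E d → ℝ} {ρ ρt : ℝ → L2 Ω} {m G : ℝ → L2v Ω}
  {a : L2 Ω →ₗ[ℝ] L2 Ω →ₗ[ℝ] ℝ} {φlo φhi K : ℝ}

theorem norm_fluxL_sub_le (P : ForchheimerPoly n) (u v : L2v Ω) :
    ‖P.fluxL u - P.fluxL v‖ ≤ (P.a 0)⁻¹ * ‖u - v‖ :=
  IsEnergy.norm_sub_le (F := P.fluxL) (En := P.energyL) (fun u v => P.energyL_bregman u v)
    P.a_zero_pos u v

/-- The error of the flux of the discrete gradients. -/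
theorem exists_flux_error_le (P : ForchheimerPoly n) (T : ℝ) (f : ℝ → L2 Ω) (ψ : ℝ → E d → ℝ)
    (ρ ρt : ℝ → L2 Ω) (G : ℝ → L2v Ω) (a : L2 Ω →ₗ[ℝ] L2 Ω →ₗ[ℝ] ℝ) (φlo φhi K : ℝ) (k : ℕ)
    (hd : 1 ≤ d) (hΩ : IsLipschitzDomain Ω) (κ : ℝ) :
    ∃ C, 0 ≤ C ∧ ∀ {h : ℝ} {𝒯 : Geometry.SimplicialComplex ℝ (E d)}
      (_ : IsQuasiUniformTriangulation Ω κ h 𝒯) {N : ℕ} {D : RhSub Ω k 𝒯 →ₗ[ℝ] L2v Ω}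
      {Q : L2 Ω →ₗ[ℝ] RhSub Ω k 𝒯} {x : ℕ → RhSub Ω k 𝒯}
      (_ : IsMixedScheme P Ω T f ψ ρ ρt G a φlo φhi K k h 𝒯 N D Q x), ∀ i < N,
      ‖P.fluxL (G ((i + 1 : ℕ) * (T / N))) - P.fluxL (D (x (i + 1)))‖ ^ 2
        ≤ C * (h ^ k + T / N) := by
  have ha := P.a_zero_pos
  set K₁ := IsEulerScheme.solVarConst (P.a 0) φlo φhi K + (IsEulerScheme.varConst φhi K) ^ 2 / (4 * φlo)
    + (P.a 0)⁻¹ * (((3 * K ^ 2 + K) * K + 2 * K) * (3 * K ^ 2 + K))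
    + 4 * φlo * IsEulerScheme.errConst (P.a 0) φlo φhi K T
    + IsEulerScheme.varConst φhi K * √(2 * IsEulerScheme.errConst (P.a 0) φlo φhi K T) + 2 * K ^ 2 / P.a 0
  set K₂ := φlo * IsEulerScheme.errConst (P.a 0) φlo φhi K T
  refine ⟨2 / P.a 0 * |K₁| + 2 / P.a 0 * |K₂| + ((P.a 0)⁻¹ * K) ^ 2, by positivity,
    fun {h 𝒯} hTr {N D Q x} S i hi => ?_⟩
  have hh := hTr.pos hd
  have hε := S.scheme.eps_pos
  have hΔ := S.scheme.step_pos
  have hp1 : 0 ≤ 2 / P.a 0 * |K₁| := by positivity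
  have hp2 : 0 ≤ 2 / P.a 0 * |K₂| := by positivity
  have hp3 : 0 ≤ ((P.a 0)⁻¹ * K) ^ 2 := by positivity
  have ht : ((i + 1 : ℕ) : ℝ) * (T / N) ∈ Ioc 0 T := S.scheme.time_mem hi
  set X := ‖P.fluxL (G ((i + 1 : ℕ) * (T / N))) - P.fluxL (D (x (i + 1)))‖ ^ 2 with hX
  rcases eq_or_ne k 0 with rfl | hk
  · have h1 : X ≤ ((P.a 0)⁻¹ * K) ^ 2 := by
      refine pow_le_pow_left₀ (norm_nonneg _) ((norm_fluxL_sub_le P _ _).trans ?_) 2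
      rw [gradient_eq_zero_of_mem_Rh_zero hTr hΩ hd (x (i + 1)).2 (S.gradient _), sub_zero]
      exact mul_le_mul_of_nonneg_left (S.norm_gradient_le _ ht) (by positivity)
    calc X ≤ (2 / P.a 0 * |K₁| + 2 / P.a 0 * |K₂| + ((P.a 0)⁻¹ * K) ^ 2) * 1 := by linarith
      _ ≤ _ := by
        gcongr
        rw [pow_zero]
        linarith
  rcases le_or_gt (T / N) (h ^ k) with hle | hlt
  · have h1 := S.scheme.flux_error_of_step_le S.norm_deriv_le S.norm_sub_le S.norm_gradient_le
      S.rhs_sub_le S.inverse (S.projection_err' hk) (S.init_err hk) hh (S.pow_le_mul hk) S.pow_le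
      hle hi
    have h2 : X ≤ 2 / P.a 0 * |K₁| * h ^ k := by
      have h3 : P.a 0 / 2 * X ≤ |K₁| * h ^ k :=
        h1.trans (mul_le_mul_of_nonneg_right (le_abs_self K₁) hε.le)
      rw [div_mul_eq_mul_div, div_mul_eq_mul_div, le_div_iff₀ ha]
      linarith
    calc X ≤ 2 / P.a 0 * |K₁| * h ^ k := h2
      _ ≤ _ := by
        gcongr
        · linarith
        · linarith
  · have h1 := S.scheme.flux_error_of_le_step hi
    have h2 : X ≤ 2 / P.a 0 * |K₂| * (T / N) := by
      have h3 : T / N * (P.a 0 * X) ≤ |K₂| * (h ^ k * h ^ k + (T / N) * (T / N)) := by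
        refine (h1.trans (mul_le_mul_of_nonneg_right (le_abs_self K₂) (by positivity))).trans_eq ?_
        ring
      have h4 : |K₂| * (h ^ k * h ^ k + (T / N) * (T / N)) ≤ T / N * (2 * |K₂| * (T / N)) := by
        have h5 : h ^ k * h ^ k ≤ (T / N) * (T / N) :=
          mul_le_mul hlt.le hlt.le hε.le hΔ.le
        nlinarith [abs_nonneg K₂]
      have h6 := le_of_mul_le_mul_left (h3.trans h4) hΔ
      rw [div_mul_eq_mul_div, div_mul_eq_mul_div, le_div_iff₀ ha]
      linarith
    calc X ≤ 2 / P.a 0 * |K₂| * (T / N) := h2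
      _ ≤ _ := by
        gcongr
        · linarith
        · linarith

/-- From almost every time to all times. -/
theorem exists_mem_Mh_near_of_ae {k : ℕ} {h : ℝ} {𝒯 : Geometry.SimplicialComplex ℝ (E d)} {N : ℕ}
    {D : RhSub Ω k 𝒯 →ₗ[ℝ] L2v Ω} {Q : L2 Ω →ₗ[ℝ] RhSub Ω k 𝒯} {x : ℕ → RhSub Ω k 𝒯}
    (S : IsMixedScheme P Ω T f ψ ρ ρt G a φlo φhi K k h 𝒯 N D Q x) (hk : k ≠ 0) (hh : 0 < h)
    (hT : 0 < T) (hm : ∀ t ∈ Ioc 0 T, m t = -P.fluxL (G t)) {p : ℝ → Prop}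
    (hp : ∀ᵐ t ∂(volume.restrict (Ioo 0 T)), p t) {C : ℝ}
    (hpC : ∀ t ∈ Ioc 0 T, p t → ∃ w ∈ Mh Ω k 𝒯, ‖m t - w‖ ^ 2 ≤ C * h ^ k) {t : ℝ}
    (ht : t ∈ Ioc 0 T) : ∃ w ∈ Mh Ω k 𝒯, ‖m t - w‖ ^ 2 ≤
      2 * (C + |IsEulerScheme.solVarConst (P.a 0) φlo φhi K| / P.a 0) * h ^ k := by
  have ha := P.a_zero_pos
  have hε := S.scheme.eps_pos
  obtain ⟨s, ⟨hs, hps⟩, hts⟩ := Metric.mem_closure_iff.1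
    (mem_closure_of_ae hT hp (Ioc_subset_Icc_self ht)) _ hε
  have hs' := Ioo_subset_Ioc_self hs
  obtain ⟨w, hw, hwC⟩ := hpC s hs' hps
  refine ⟨w, hw, ?_⟩
  have h1 := S.scheme.sol_var S.norm_deriv_le S.norm_sub_le S.norm_gradient_le S.rhs_sub_le hh
    (S.pow_le_mul hk) hs' ht hts.le
  have h2 : ‖m t - m s‖ ^ 2 ≤ |IsEulerScheme.solVarConst (P.a 0) φlo φhi K| / P.a 0 * h ^ k := by
    have h3 : m t - m s = -(P.fluxL (G t) - P.fluxL (G s)) := by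
      rw [hm t ht, hm s hs']; abel
    rw [h3, norm_neg, div_mul_eq_mul_div, le_div_iff₀ ha, mul_comm]
    exact (S.scheme.isEnergy.cocoercive _ _).trans
      (h1.trans (mul_le_mul_of_nonneg_right (le_abs_self _) hε.le))
  have h3 : ‖m t - w‖ ≤ ‖m t - m s‖ + ‖m s - w‖ := norm_sub_le_norm_sub_add_norm_sub _ _ _
  calc ‖m t - w‖ ^ 2 ≤ (‖m t - m s‖ + ‖m s - w‖) ^ 2 := pow_le_pow_left₀ (norm_nonneg _) h3 2
    _ ≤ 2 * (‖m t - m s‖ ^ 2 + ‖m s - w‖ ^ 2) := add_sq_le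
    _ ≤ _ := by linarith

theorem neg_mem_Mh {k : ℕ} {h : ℝ} {𝒯 : Geometry.SimplicialComplex ℝ (E d)}
    (hTr : IsQuasiUniformTriangulation Ω κ h 𝒯) (hΩ : IsLipschitzDomain Ω)
    (hd : 1 ≤ d) {z : L2v Ω} (hz : z ∈ Mh Ω k 𝒯) : -z ∈ Mh Ω k 𝒯 := by
  have h1 : -z = z - z - z := by abel
  rw [h1]
  exact sub_mem_Mh hTr hΩ hd (sub_mem_Mh hTr hΩ hd hz hz) hz

theorem zero_mem_Mh (Ω : Set (E d)) (k : ℕ) (𝒯 : Geometry.SimplicialComplex ℝ (E d)) :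
    (0 : L2v Ω) ∈ Mh Ω k 𝒯 := by
  intro s _
  refine ⟨0, fun j => by simp, ?_⟩
  filter_upwards [Lp.coeFn_zero (E d) 2 (volume.restrict Ω)] with x hx _ j
  rw [hx]
  simp [pEval]

/-- The momentum is approximated by the momentum space. -/
theorem SolutionBounds.exists_mem_Mh_near {K₀ : ℝ}
    (hB : SolutionBounds P Ω T φ f ψ ρ ρt m G K₀) (k : ℕ) (hd : 1 ≤ d) (hΩ : IsLipschitzDomain Ω)
    (hκ : 0 < κ) (hT : 0 < T) {M : ℝ}
    (hρ : ∀ᵐ t ∂(volume.restrict (Ioo 0 T)), SobolevBound Ω (k + 1) (ρ t) M)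
    (hm : 3 ≤ k → ∃ M, ∀ᵐ t ∂(volume.restrict (Ioo 0 T)),
      ∀ j, SobolevBound Ω ((k + 1) / 2) (comp Ω j (m t)) M)
    (a : L2 Ω →ₗ[ℝ] L2 Ω →ₗ[ℝ] ℝ) (φlo φhi K : ℝ) :
    ∃ C, 0 ≤ C ∧ ∀ {h : ℝ} {𝒯 : Geometry.SimplicialComplex ℝ (E d)}
      (_ : IsQuasiUniformTriangulation Ω κ h 𝒯) {N : ℕ} {D : RhSub Ω k 𝒯 →ₗ[ℝ] L2v Ω}
      {Q : L2 Ω →ₗ[ℝ] RhSub Ω k 𝒯} {x : ℕ → RhSub Ω k 𝒯}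
      (_ : IsMixedScheme P Ω T f ψ ρ ρt G a φlo φhi K k h 𝒯 N D Q x),
      ∀ t ∈ Ioc 0 T, ∃ w ∈ Mh Ω k 𝒯, ‖m t - w‖ ^ 2 ≤ C * h ^ k := by
  have ha := P.a_zero_pos
  obtain ⟨H, hH, hmesh⟩ := hΩ.exists_mesh_le (κ := κ)
  have hpow {h : ℝ} (hh : 0 < h) (hhH : h ≤ H) {l : ℕ} (hl : k ≤ l) :
      h ^ l ≤ H ^ (l - k) * h ^ k := by
    rw [← pow_sub_mul_pow h hl]
    exact mul_le_mul_of_nonneg_right (pow_le_pow_left₀ hh.le hhH _) (by positivity)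
  rcases eq_or_ne k 0 with rfl | hk
  · refine ⟨((P.a 0)⁻¹ * K₀) ^ 2, sq_nonneg _, fun {h 𝒯} hTr {N D Q x} S t ht =>
      ⟨0, zero_mem_Mh Ω 0 𝒯, ?_⟩⟩
    rw [pow_zero, mul_one, sub_zero]
    refine pow_le_pow_left₀ (norm_nonneg _) ?_ 2
    rw [hB.m_eq t ht, norm_neg]
    have h1 := norm_fluxL_sub_le P (G t) 0
    rw [P.fluxL_zero, sub_zero, sub_zero] at h1
    exact h1.trans (mul_le_mul_of_nonneg_left (hB.norm_gradient_le t ht) (by positivity))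
  rcases le_or_gt k 2 with hk2 | hk2
  · obtain ⟨Ca, hCa, happ⟩ := exists_approx 1 hd hΩ hκ
    refine ⟨2 * (((P.a 0)⁻¹ * (Ca * M)) ^ 2 * H ^ (2 - k)
      + |IsEulerScheme.solVarConst (P.a 0) φlo φhi K| / P.a 0), by positivity,
      fun {h 𝒯} hTr {N D Q x} S t ht => ?_⟩
    have hh := hTr.pos hd
    refine exists_mem_Mh_near_of_ae S hk hh hT hB.m_eq hρ (fun s hs hsM => ?_) ht
    obtain ⟨r, hr, Gr, hGr, -, h2⟩ :=
      happ hTr (SobolevBound.mono (by omega) hsM) (hB.gradient s hs)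
    refine ⟨-P.fluxL Gr, neg_mem_Mh hTr hΩ hd (fluxL_gradient_mem_Mh P hTr hΩ hd hr hGr k), ?_⟩
    have h3 : m s - -P.fluxL Gr = -(P.fluxL (G s) - P.fluxL Gr) := by rw [hB.m_eq s hs]; abel
    rw [pow_one] at h2
    rw [h3, norm_neg]
    calc ‖P.fluxL (G s) - P.fluxL Gr‖ ^ 2 ≤ ((P.a 0)⁻¹ * (Ca * M * h)) ^ 2 := by
          refine pow_le_pow_left₀ (norm_nonneg _) ((norm_fluxL_sub_le P _ _).trans ?_) 2
          exact mul_le_mul_of_nonneg_left h2 (by positivity)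
      _ = ((P.a 0)⁻¹ * (Ca * M)) ^ 2 * h ^ 2 := by ring
      _ ≤ ((P.a 0)⁻¹ * (Ca * M)) ^ 2 * (H ^ (2 - k) * h ^ k) :=
          mul_le_mul_of_nonneg_left (hpow hh (hmesh hTr) hk2) (sq_nonneg _)
      _ = _ := by ring
  · obtain ⟨M', hM'⟩ := hm hk2
    obtain ⟨l, hl⟩ : ∃ l, (k + 1) / 2 = l + 1 := ⟨(k + 1) / 2 - 1, by omega⟩
    rw [hl] at hM'
    have : NeZero l := ⟨by omega⟩
    obtain ⟨Ca, hCa, happ⟩ := exists_approx l hd hΩ hκ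
    refine ⟨2 * (d * (Ca * M') ^ 2 * H ^ (2 * (l + 1) - k)
      + |IsEulerScheme.solVarConst (P.a 0) φlo φhi K| / P.a 0), by positivity,
      fun {h 𝒯} hTr {N D Q x} S t ht => ?_⟩
    have hh := hTr.pos hd
    refine exists_mem_Mh_near_of_ae S hk hh hT hB.m_eq hM' (fun s hs hsM => ?_) ht
    have hr (j) : ∃ r ∈ Rh Ω l 𝒯, ‖comp Ω j (m s) - r‖ ≤ Ca * M' * h ^ (l + 1) := by
      obtain ⟨g, hg⟩ := (hsM j).exists_isWeakGradient
      obtain ⟨r, hr, Gr, -, h1, -⟩ := happ hTr (hsM j) hg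
      exact ⟨r, hr, h1⟩
    choose r hr hrM using hr
    refine ⟨ofComp Ω r, ofComp_mem_Mh hTr hΩ hd (by omega) hr, ?_⟩
    rw [norm_sq_eq_sum_comp]
    calc ∑ j, ‖comp Ω j (m s - ofComp Ω r)‖ ^ 2
        ≤ ∑ _j : Fin d, (Ca * M' * h ^ (l + 1)) ^ 2 := by
          refine Finset.sum_le_sum fun j _ => pow_le_pow_left₀ (norm_nonneg _) ?_ 2
          rw [← compL_apply, map_sub, compL_apply, compL_apply, comp_ofComp]
          exact hrM j
      _ = d * (Ca * M') ^ 2 * h ^ (2 * (l + 1)) := by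
          rw [Finset.sum_const, Finset.card_univ, Fintype.card_fin, nsmul_eq_mul]
          ring
      _ ≤ d * (Ca * M') ^ 2 * (H ^ (2 * (l + 1) - k) * h ^ k) :=
          mul_le_mul_of_nonneg_left (hpow hh (hmesh hTr) (by omega)) (by positivity)
      _ = _ := by ring

/-- The error of the momentum is controlled by its distance to the momentum space and the error of
the flux. -/
theorem norm_sub_le_of_momentum {M : Set (L2v Ω)} (hM : ∀ z ∈ M, ∀ w ∈ M, z - w ∈ M)
    {μ μh w F Fh : L2v Ω} (hμ : μ = -F) (hμh : μh ∈ M) (hw : w ∈ M)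
    (hz : ∀ z ∈ M, ⟪μh, z⟫ + ⟪Fh, z⟫ = 0) : ‖μ - μh‖ ≤ 2 * ‖μ - w‖ + ‖F - Fh‖ := by
  have h1 := hz _ (hM _ hμh _ hw)
  have h2 : ⟪μh - w, μh - w⟫ = ⟪(μ - w) + (F - Fh), μh - w⟫ := by
    have h3 : (μ - w) + (F - Fh) = (μh - w) - (μh + Fh) := by rw [hμ]; abel
    rw [h3, inner_sub_left _ (μh + Fh), inner_add_left, h1, sub_zero]
  have h4 : ‖μh - w‖ ≤ ‖(μ - w) + (F - Fh)‖ := by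
    rw [real_inner_self_eq_norm_sq] at h2
    have h5 := real_inner_le_norm ((μ - w) + (F - Fh)) (μh - w)
    rcases eq_or_lt_of_le (norm_nonneg (μh - w)) with h0 | h0
    · rw [← h0]; exact norm_nonneg _
    · rw [← h2, sq] at h5
      exact le_of_mul_le_mul_right h5 h0
  have h6 : μ - μh = (μ - w) - (μh - w) := by abel
  rw [h6]
  have h7 := norm_sub_le (μ - w) (μh - w)
  have h8 := norm_add_le (μ - w) (F - Fh)
  linarith

end Convergence

end MixedFEM

end

open MixedFEM
theorem theorem7p2 {d : ℕ} (hd : 2 ≤ d) (Ω : Set (E d)) (hΩ : IsLipschitzDomain Ω)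
    (T : ℝ) (hT : 0 < T)
    -- the Forchheimer polynomial and the porosity
    {n : ℕ} (P : ForchheimerPoly n)
    (φ : E d → ℝ) (φlo φhi : ℝ) (hφ : ContDiffOn ℝ 1 φ Ω) (hφlo : 0 < φlo)
    (hφb : ∀ x ∈ Ω, φlo < φ x ∧ φ x < φhi)
    -- the data: `f, f_t ∈ L²(I; L²(Ω))` and `ψ, ψ_t ∈ L^∞(I; L^∞(Γ))`
    (f ft : ℝ → L2 Ω) (hf : HasTimeDeriv T f ft) (hft : MemLp ft 2 (volume.restrict (Ioo 0 T)))
    (ψ : ℝ → E d → ℝ) (Mψ : ℝ)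
    (hψm : ∀ t ∈ Icc 0 T, AEStronglyMeasurable (ψ t) (surface Ω))
    (hψb : ∀ t ∈ Icc 0 T, ∀ᵐ x ∂(surface Ω), |ψ t x| ≤ Mψ)
    (hψt : ∀ s ∈ Icc 0 T, ∀ t ∈ Icc 0 T, ∀ᵐ x ∂(surface Ω), |ψ t x - ψ s x| ≤ Mψ * |t - s|)
    -- the solution
    (ρ ρt ρtt : ℝ → L2 Ω) (m : ℝ → L2v Ω)
    (hsol : IsWeakSolution P Ω T φ f ψ ρ ρt m)
    -- its regularity; `k` is the polynomial degree of the finite elements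
    (k : ℕ)
    (hρ : ∃ M, ∀ᵐ t ∂(volume.restrict (Ioo 0 T)), SobolevBound Ω (k + 1) (ρ t) M)
    (hm : MemLp m ∞ (volume.restrict (Ioo 0 T)))
    (hm' : 3 ≤ k → ∃ M, ∀ᵐ t ∂(volume.restrict (Ioo 0 T)),
      ∀ j, SobolevBound Ω ((k + 1) / 2) (comp Ω j (m t)) M)
    (hρt : HasTimeDeriv T ρt ρtt) (hρtt : MemLp ρtt 2 (volume.restrict (Ioo 0 T)))
    -- the quasi-uniformity constant of the family of triangulations
    (κ : ℝ) (hκ : 0 < κ) :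
    ∃ C > 0, ∃ τ > 0, ∀ (h : ℝ) (𝒯 : Geometry.SimplicialComplex ℝ (E d)),
      IsQuasiUniformTriangulation Ω κ h 𝒯 →
      ∀ N : ℕ, 0 < N → T / N ≤ τ →
      ∀ (ρh : ℕ → L2 Ω) (mh : ℕ → L2v Ω),
        IsDiscreteSolution P Ω T φ f ψ (ρ 0) k 𝒯 N ρh mh →
        ∀ i ∈ Finset.Icc 1 N,
          ‖ρ (i * (T / N)) - ρh i‖ + ‖m (i * (T / N)) - mh i‖ ^ 2
            ≤ C * (h ^ k + √(T / N)) := by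
  have hd1 : 1 ≤ d := by omega
  obtain ⟨x₀, hx₀⟩ := hΩ.isConnected.nonempty
  have hφhi : 0 < φhi := hφlo.trans ((hφb x₀ hx₀).1.trans (hφb x₀ hx₀).2)
  obtain ⟨M, hρM⟩ := hρ
  obtain ⟨G, K₀, hB⟩ := hsol.exists_solutionBounds hT hΩ.isOpen hf hρt hψm hψb hψt hρM
  obtain ⟨a, ha, hsymm, hcoer, hbdd⟩ := exists_wForm_bilin hΩ.isOpen.measurableSet
    (hφ.continuousOn.aestronglyMeasurable hΩ.isOpen.measurableSet) hφlo hφb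
  obtain ⟨K, hK, hscheme⟩ := hB.exists_isMixedScheme k hd1 hΩ hκ hT hρM hφlo hφhi ha hsymm hcoer
    hbdd
  obtain ⟨Kf, hKf, hflux⟩ :=
    exists_flux_error_le P T f ψ ρ ρt G a φlo φhi K k hd1 hΩ κ
  obtain ⟨Kd, hKd, hdist⟩ := hB.exists_mem_Mh_near k hd1 hΩ hκ hT hρM hm' a φlo φhi K
  set e := IsEulerScheme.errConst (P.a 0) φlo φhi K T with he
  have hse := Real.sqrt_nonneg e
  refine ⟨K + √e + 8 * Kd + 2 * Kf, by positivity, 1, one_pos, ?_⟩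
  intro h 𝒯 hTr N hN hτ ρh mh hdis i hi
  obtain ⟨j, rfl⟩ : ∃ j, i = j + 1 := ⟨i - 1, by have := (Finset.mem_Icc.1 hi).1; omega⟩
  have hj : j < N := (Finset.mem_Icc.1 hi).2
  obtain ⟨D, Q, x, S, hx⟩ := hscheme hTr hN hdis
  have hε := S.scheme.eps_pos
  have hΔ := S.scheme.step_pos
  have hsq : T / N ≤ √(T / N) := by
    rw [Real.le_sqrt hΔ.le hΔ.le, sq]
    exact mul_le_of_le_one_left hΔ.le hτ
  set t : ℝ := ((j + 1 : ℕ) : ℝ) * (T / N) with ht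
  have htm : t ∈ Ioc 0 T := S.scheme.time_mem hj
  have h1 : ‖ρ t - ρh (j + 1)‖ ≤ K * h ^ k + √e * (h ^ k + T / N) := by
    have h2 := S.scheme.error_le.1 (j + 1) hj
    have he0 : 0 ≤ e := S.scheme.errConst_nonneg
    have h3 : ‖(Q (ρ t) : L2 Ω) - ρh (j + 1)‖ ≤ √e * (h ^ k + T / N) := by
      rw [← hx (j + 1) hj, ← Submodule.coe_sub, ← Submodule.coe_norm]
      refine le_of_sq_le_sq (h2.trans ?_) (by positivity)
      rw [mul_pow, Real.sq_sqrt he0]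
      refine mul_le_mul_of_nonneg_left ?_ he0
      nlinarith
    exact (norm_sub_le_norm_sub_add_norm_sub _ (Q (ρ t) : L2 Ω) _).trans
      (add_le_add (S.projection_err t (Ioc_subset_Icc_self htm)) h3)
  have h4 : ‖m t - mh (j + 1)‖ ^ 2 ≤ 8 * (Kd * h ^ k) + 2 * (Kf * (h ^ k + T / N)) := by
    obtain ⟨w, hw, hwt⟩ := hdist hTr S t htm
    obtain ⟨Gh, hGh, hGz⟩ := hdis.momentum (j + 1) hi
    have h5 : D (x (j + 1)) = Gh :=
      (S.gradient (x (j + 1))).unique hΩ.isOpen (by rwa [hx (j + 1) hj])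
    have h6 := hflux hTr S j hj
    rw [h5] at h6
    have h7 := norm_sub_le_of_momentum (fun z hz w hw => sub_mem_Mh hTr hΩ hd1 hz hw)
      (hB.m_eq t htm) (hdis.mh_mem (j + 1) hi) hw (Fh := P.fluxL Gh) fun z hz => by
        rw [← KForm_eq_inner]
        exact hGz z hz
    have h8 : ‖m t - mh (j + 1)‖ ^ 2 ≤ (2 * ‖m t - w‖ + ‖P.fluxL (G t) - P.fluxL Gh‖) ^ 2 :=
      pow_le_pow_left₀ (norm_nonneg _) h7 2
    have h9 : (2 * ‖m t - w‖ + ‖P.fluxL (G t) - P.fluxL Gh‖) ^ 2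
        ≤ 2 * ((2 * ‖m t - w‖) ^ 2 + ‖P.fluxL (G t) - P.fluxL Gh‖ ^ 2) := add_sq_le
    rw [mul_pow] at h9
    linarith
  have h10 : K * h ^ k + √e * (h ^ k + T / N) ≤ (K + √e) * (h ^ k + √(T / N)) := by
    have h11 : √e * (T / N) ≤ √e * √(T / N) := mul_le_mul_of_nonneg_left hsq hse
    have h12 : 0 ≤ K * √(T / N) := by positivity
    linarith
  have h13 : 8 * (Kd * h ^ k) + 2 * (Kf * (h ^ k + T / N))
      ≤ (8 * Kd + 2 * Kf) * (h ^ k + √(T / N)) := by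
    have h11 : Kf * (T / N) ≤ Kf * √(T / N) := mul_le_mul_of_nonneg_left hsq hKf
    have h12 : 0 ≤ Kd * √(T / N) := by positivity
    linarith
  linarith
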